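/- Let $q$ be a power of $2$, let $\operatorname{Tr}$ be the trace map $\mathbb F_q\to\mathbb F_2$, and identify the points of $\mathrm{PG}(5,q)$ with the nonzero symmetric $3\times 3$ matrices over $\mathbb F_q$ up to scalars, so that solids and hyperplanes are the subspaces of vector-space dimension $4$ and $5$. Let $K\cong\mathrm{PGL}(3,q)$ be the group of collineations of $\mathrm{PG}(5,q)$ induced by $M\mapsto AMA^{T}$, $A\in\mathrm{GL}(3,q)$. The *point-orbit distribution* of a solid $S$ is $[r_1,r_{2n},r_{2s},r_3]$, where $r_1,r_3$ are the numbers of points of $S$ of rank $1$, $3$, and $r_{2n}$ (resp. $r_{2s}$) is the number of rank-$2$ points of $S$ with zero diagonal (resp. nonzero diagonal). A conic $\sum_{0\le i\le j\le 2}a_{ij}X_iX_j=0$ of $\mathrm{PG}(2,q)$ corresponds to the hyperplane $\{M:\sum_{i\le j}a_{ij}M_{ij}=0\}$. The *hyperplane-orbit distribution* of $S$ is $[a_1,a_{2r},a_{2i},a_3]$, the numbers of hyperplanes containing $S$ that correspond to double lines, to pairs of distinct lines over $\mathbb F_q$, to pairs of distinct lines over $\mathbb F_{q^2}$ that are conjugate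 under $x\mapsto x^q$, and to nonsingular conics, respectively. For $i=1,\dots,15$ let $\Omega_i$ be the $K$-orbit of the solid consisting of the following matrices, $x,y,z,t\in\mathbb F_q$ (not all $0$): $$\Omega_1:\begin{bmatrix}x&y&z\\y&t&0\\z&0&t\end{bmatrix},\quad \Omega_2:\begin{bmatrix}x&y&z\\y&t&0\\z&0&0\end{bmatrix},\quad \Omega_3:\begin{bmatrix}x&y&z\\y&0&t\\z&t&0\end{bmatrix},\quad \Omega_4:\begin{bmatrix}x&0&y\\0&z&0\\y&0&t\end{bmatrix},\quad \Omega_5:\begin{bmatrix}0&x&y\\x&z&t\\y&t&x\end{bmatrix},$$ $$\Omega_6:\begin{bmatrix}x&0&y\\0&z&t\\y&t&0\end{bmatrix},\quad \Omega_7:\begin{bmatrix}x&y&z\\y&x+\gamma y&t\\z&t&y\end{bmatrix},\quad \Omega_8:\begin{bmatrix}x&y&z\\y&t&z\\z&z&y\end{bmatrix},\quad \Omega_9:\begin{bmatrix}x&x&y\\x&z&t\\y&t&t\end{bmatrix},\quad \Omega_{10}:\begin{bmatrix}x&y&z\\y&y+\gamma t&t\\z&t&y\end{bmatrix},$$ $$\Omega_{11}:\begin{bmatrix}x&y&z\\y&t&0\\z&0&y\end{bmatrix},\quad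 \Omega_{12}:\begin{bmatrix}x&y&z\\y&t&\gamma y+z\\z&\gamma y+z&y\end{bmatrix},\quad \Omega_{13}:\begin{bmatrix}x&y&z\\y&\gamma x+y&t\\z&t&\gamma x+z\end{bmatrix},$$ $$\Omega_{14}:\begin{bmatrix}x&y&\gamma x+y+\gamma t\\y&\gamma x+y&z\\\gamma x+y+\gamma t&z&t\end{bmatrix},\quad \Omega_{15}:\begin{bmatrix}x&y&bz+cy\\y&z&t\\bz+cy&t&y\end{bmatrix},$$ where $\gamma\in\mathbb F_q$ satisfies $\operatorname{Tr}(\gamma^{-1})=1$ for $i=7,10,12$ and $\operatorname{Tr}(\gamma)=1$ for $i=13,14$, and for $i=15$ the elements $b\ne 0$ and $c$ of $\mathbb F_q$ are such that $b\lambda^3+c\lambda+1$ is irreducible over $\mathbb F_q$. Such parameters exist, $\Omega_i$ does not depend on their choice, and $\Omega_1,\dots,\Omega_{15}$ are pairwise distinct orbits of solids. For each $i$, every solid $S\in\Omega_i$ has the point-orbit distribution, the hyperplane-orbit distribution and (up to isomorphism) the stabiliser $K_S$ in the following table, and $|\Omega_i|$ is as listed. | $i$ | Point OD | Hyperplane OD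 | $K_S$ | $\lvert\Omega_i\rvert$ | |---|---|---|---|---| | 1 | $[1,q+1,2q^2-1,q^3-q^2]$ | $[1,\frac q2,\frac q2,0]$ | $E_q^2:(E_q\times C_{q-1})$ | $(q^3-1)(q+1)$ | | 2 | $[q+1,q+1,2q^2-q-1,q^3-q^2]$ | $[1,q,0,0]$ | $E_q^{1+2}:C_{q-1}^2$ | $(q^2+q+1)(q+1)$ | | 3 | $[1,q^2+q+1,q^2-1,q^3-q^2]$ | $[q+1,0,0,0]$ | $E_q^2:\mathrm{GL}(2,q)$ | $q^2+q+1$ | | 4 | $[q+2,1,2q^2-2,q^3-q^2]$ | $[0,q+1,0,0]$ | $\mathrm{GL}(2,q)$ | $q^2(q^2+q+1)$ | | 5 | $[1,q+1,q^2-1,q^3]$ | $[1,0,0,q]$ | $E_q^2:C_{q-1}$ | $q(q^3-1)(q+1)$ | | 6 | $[2,q+1,q^2+q-2,q^3-q]$ | $[1,1,0,q-1]$ | $C_{q-1}^2:C_2$ | $\frac12q^3(q^2+q+1)(q+1)$ | | 7 | $[0,q+1,q^2+q,q^3-q]$ | $[1,0,1,q-1]$ | $D_{2(q+1)}\times C_{q-1}$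 | $\frac12q^3(q^3-1)$ | | 8 | $[3,1,q^2+2q-3,q^3-q]$ | $[0,2,0,q-1]$ | $C_{q-1}\times C_2$ | $\frac12q^3(q^3-1)(q+1)$ | | 9 | $[4,1,q^2+3q-4,q^3-2q]$ | $[0,3,0,q-2]$ | $\mathrm{Sym}_4$ | $\frac1{24}q^3(q^3-1)(q^2-1)$ | | 10 | $[1,1,q^2+2q-1,q^3-q]$ | $[0,1,1,q-1]$ | $C_{q-1}\times C_2$ | $\frac12q^3(q^3-1)(q+1)$ | | 11 | $[2,1,q^2+q-2,q^3]$ | $[0,1,0,q]$ | $E_q:C_{q-1}$ | $q^2(q^3-1)(q+1)$ | | 12 | $[2,1,q^2+q-2,q^3]$ | $[0,1,0,q]$ | $C_2^2$ | $\frac14q^3(q^3-1)(q^2-1)$ | | 13 | $[0,1,q^2+3q,q^3-2q]$ | $[0,1,2,q-2]$ | $C_2^2:C_2$ | $\frac18q^3(q^3-1)(q^2-1)$ | | 14 | $[0,1,q^2+q,q^3]$ | $[0,0,1,q]$ | $C_4$ | $\frac14q^3(q^3-1)(q^2-1)$ | | 15 | $[1,1,q^2-1,q^3+q]$ | $[0,0,0,q+1]$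 | $C_3$ | $\frac13q^3(q^3-1)(q^2-1)$ | Here $C_n$ is cyclic of order $n$, $D_{2n}$ is dihedral of order $2n$, $E_q$ is the additive group of $\mathbb F_q$, $E_q^{1+2}$ is the group of upper unitriangular $3\times3$ matrices over $\mathbb F_q$ (whose centre is isomorphic to $E_q$, with quotient by the centre isomorphic to $E_q^2$), and $A:B$ is a semidirect product with normal subgroup $A$, for the following actions, with $C_{q-1}=\mathbb F_q^\times$. Row 1: $(c,a)\in\mathbb F_q\times\mathbb F_q^\times$ acts on $\mathbb F_q^2$ by $(u,v)\mapsto(a(u+cv),av)$. Row 2: conjugation by diagonal matrices, i.e. $(a,b)$ multiplies the $(1,2)$, $(2,3)$, $(1,3)$ entries by $a$, $b$, $ab$. Row 3: natural action on $\mathbb F_q^2$. Rows 5 and 11: scalar multiplication on $\mathbb F_q^2$ and on $\mathbb F_q$. Rows 6 and 13: $C_2$ swaps the two factors. -/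

import Mathlib

open scoped LinearAlgebra.Projectivization
open Matrix

namespace VeroneseSolids

section Geometry

variable (F : Type*) [Field F]

/-- The six-dimensional space of symmetric `3 × 3` matrices over `F`. The point
`(y₀, …, y₅)` of `PG(5,q)` corresponds to the matrix with rows
`(y₀,y₁,y₂)`, `(y₁,y₃,y₄)`, `(y₂,y₄,y₅)`, so subspaces of `PG(5,q)` are identified with
`Submodule F (Sym F)`; solids have rank 4 and hyperplanes have rank 5. -/
def symmetricMatrices : Submodule F (Matrix (Fin 3) (Fin 3) F) where
  carrier := {M | M.IsSymm}
  add_mem' hM hN := hM.add hN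
  zero_mem' := Matrix.isSymm_zero
  smul_mem' c _ hM := hM.smul c

abbrev Sym : Type _ := ↥(symmetricMatrices F)

variable {F}

/-- The linear map `M ↦ A M Aᵀ` on symmetric matrices. -/
def congrMap (A : Matrix (Fin 3) (Fin 3) F) : Sym F →ₗ[F] Sym F where
  toFun M := ⟨A * M.1 * Aᵀ, by
    have h : (M.1)ᵀ = M.1 := M.2
    change (A * M.1 * Aᵀ)ᵀ = A * M.1 * Aᵀ
    simp [Matrix.transpose_mul, h, Matrix.mul_assoc]⟩
  map_add' M N := by
    apply Subtype.ext
    simp [Matrix.mul_add, Matrix.add_mul]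
  map_smul' c M := by
    apply Subtype.ext
    simp

theorem congrMap_mul (A B : Matrix (Fin 3) (Fin 3) F) (M : Sym F) :
    congrMap (A * B) M = congrMap A (congrMap B M) := by
  apply Subtype.ext
  simp [congrMap, Matrix.transpose_mul, Matrix.mul_assoc]

theorem congrMap_one (M : Sym F) : congrMap (1 : Matrix (Fin 3) (Fin 3) F) M = M := by
  apply Subtype.ext
  simp [congrMap]

/-- The linear automorphism `M ↦ A M Aᵀ` of the space of symmetric matrices, `A ∈ GL(3,q)`. -/
def congrEquiv (A : GL (Fin 3) F) : Sym F ≃ₗ[F] Sym F :=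
  LinearEquiv.ofLinearMap (congrMap A.1) (congrMap A⁻¹.1)
    (by
      ext1 M
      rw [LinearMap.comp_apply, ← congrMap_mul, ← Units.val_mul, mul_inv_cancel]
      exact congrMap_one M)
    (by
      ext1 M
      rw [LinearMap.comp_apply, ← congrMap_mul, ← Units.val_mul, inv_mul_cancel]
      exact congrMap_one M)

theorem congrEquiv_apply (A : GL (Fin 3) F) (M : Sym F) :
    (congrEquiv A M : Matrix (Fin 3) (Fin 3) F) = A.1 * M.1 * A.1ᵀ := rfl

variable (F)

/-- The homomorphism taking `A ∈ GL(3,q)` to the collineation of `PG(5,q)` (an automorphism of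
the lattice of subspaces) induced by `M ↦ A M Aᵀ`. -/
def alpha : GL (Fin 3) F →* (Submodule F (Sym F) ≃o Submodule F (Sym F)) where
  toFun A := Submodule.orderIsoMapComap (congrEquiv A)
  map_one' := by
    apply RelIso.ext
    intro U
    change U.map (congrEquiv (1 : GL (Fin 3) F) : Sym F →ₗ[F] Sym F) = U
    have h : (congrEquiv (1 : GL (Fin 3) F) : Sym F →ₗ[F] Sym F) = LinearMap.id := by
      ext1 M
      exact congrMap_one M
    rw [h, Submodule.map_id]
  map_mul' A B := by
    apply RelIso.ext
    intro U
    change U.map (congrEquiv (A * B) : Sym F →ₗ[F] Sym F) =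
      (U.map (congrEquiv B : Sym F →ₗ[F] Sym F)).map (congrEquiv A : Sym F →ₗ[F] Sym F)
    rw [← Submodule.map_comp]
    congr 1
    ext1 M
    exact congrMap_mul A.1 B.1 M

/-- The group `K`: the group of collineations of `PG(5,q)` induced by `PGL(3,q)`. Scalar
matrices act trivially, so this is the image of `PGL(3,q) = GL(3,q)/scalars`. It acts on the
subspaces of `PG(5,q)`. -/
def K : Subgroup (Submodule F (Sym F) ≃o Submodule F (Sym F)) := (alpha F).range

variable {F}

/-! ### Point-orbit distributions -/

/-- The points of `PG(5,q)` lying in the subspace `U` with matrix of rank `r`. -/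
def rankPoints (U : Submodule F (Sym F)) (r : ℕ) : Set (ℙ F (Sym F)) :=
  {P | P.submodule ≤ U ∧ P.rep.1.rank = r}

/-- The points of the nucleus plane: matrices with zero diagonal. -/
def nucleusPlane (F : Type*) [Field F] : Set (ℙ F (Sym F)) :=
  {P | ∀ i, P.rep.1 i i = 0}

/-- The point-orbit distribution `[r₁, r₂ₙ, r₂ₛ, r₃]` of a subspace. -/
noncomputable def pointOD (U : Submodule F (Sym F)) : Fin 4 → ℕ :=
  ![(rankPoints U 1).ncard,
    (rankPoints U 2 ∩ nucleusPlane F).ncard,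
    (rankPoints U 2 \ nucleusPlane F).ncard,
    (rankPoints U 3).ncard]

/-! ### Conics and hyperplane-orbit distributions -/

/-- The ternary quadratic form
`a₀₀X₀² + a₀₁X₀X₁ + a₀₂X₀X₂ + a₁₁X₁² + a₁₂X₁X₂ + a₂₂X₂²`. -/
@[ext] structure TernaryForm (R : Type*) where
  a00 : R
  a01 : R
  a02 : R
  a11 : R
  a12 : R
  a22 : R

namespace TernaryForm

def eval {R : Type*} [CommRing R] (f : TernaryForm R) (v : Fin 3 → R) : R :=
  f.a00 * v 0 ^ 2 + f.a01 * v 0 * v 1 + f.a02 * v 0 * v 2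
    + f.a11 * v 1 ^ 2 + f.a12 * v 1 * v 2 + f.a22 * v 2 ^ 2

/-- The three formal partial derivatives of the form, evaluated at `v`. -/
def grad {R : Type*} [CommRing R] (f : TernaryForm R) (v : Fin 3 → R) : Fin 3 → R :=
  ![2 * f.a00 * v 0 + f.a01 * v 1 + f.a02 * v 2,
    f.a01 * v 0 + 2 * f.a11 * v 1 + f.a12 * v 2,
    f.a02 * v 0 + f.a12 * v 1 + 2 * f.a22 * v 2]

def map {R S : Type*} [CommRing R] [CommRing S] (φ : R →+* S) (f : TernaryForm R) :
    TernaryForm S :=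
  ⟨φ f.a00, φ f.a01, φ f.a02, φ f.a11, φ f.a12, φ f.a22⟩

/-- The form `c · (l₀X₀ + l₁X₁ + l₂X₂) · (m₀X₀ + m₁X₁ + m₂X₂)`. -/
def prodLin {R : Type*} [CommRing R] (c : R) (l m : Fin 3 → R) : TernaryForm R :=
  ⟨c * (l 0 * m 0), c * (l 0 * m 1 + l 1 * m 0), c * (l 0 * m 2 + l 2 * m 0),
    c * (l 1 * m 1), c * (l 1 * m 2 + l 2 * m 1), c * (l 2 * m 2)⟩

theorem eval_prodLin {R : Type*} [CommRing R] (c : R) (l m v : Fin 3 → R) :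
    (prodLin c l m).eval v =
      c * (l 0 * v 0 + l 1 * v 1 + l 2 * v 2) * (m 0 * v 0 + m 1 * v 1 + m 2 * v 2) := by
  simp only [eval, prodLin]
  ring

/-- The conic is a double line. -/
def IsDoubleLine (f : TernaryForm F) : Prop :=
  ∃ c : F, c ≠ 0 ∧ ∃ l : Fin 3 → F, l ≠ 0 ∧ f = prodLin c l l

/-- The conic is a pair of distinct real lines. -/
def IsRealLinePair (f : TernaryForm F) : Prop :=
  ∃ c : F, c ≠ 0 ∧ ∃ l m : Fin 3 → F, LinearIndependent F ![l, m] ∧ f = prodLin c l m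

/-- The conic is a pair of conjugate imaginary lines: it is the product of a linear form with
coefficients in `𝔽_{q²}` (the elements `x` of an algebraic closure with `x ^ q² = x`) and its
image under `x ↦ x ^ q`, and these define distinct lines. -/
def IsImaginaryLinePair [Fintype F] (f : TernaryForm F) : Prop :=
  ∃ c : F, c ≠ 0 ∧ ∃ l : Fin 3 → AlgebraicClosure F,
    (∀ i, l i ^ (Fintype.card F ^ 2) = l i) ∧
    LinearIndependent (AlgebraicClosure F) ![l, fun i => l i ^ Fintype.card F] ∧
    f.map (algebraMap F (AlgebraicClosure F)) =
      prodLin (algebraMap F (AlgebraicClosure F) c) l (fun i => l i ^ Fintype.card F)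

/-- The conic is nonsingular: it has no singular point over an algebraic closure. -/
def IsNonsingular (f : TernaryForm F) : Prop :=
  ∀ v : Fin 3 → AlgebraicClosure F, v ≠ 0 →
    ¬ ((f.map (algebraMap F (AlgebraicClosure F))).eval v = 0 ∧
      (f.map (algebraMap F (AlgebraicClosure F))).grad v = 0)

/-- The hyperplane `δ(f)` with equation
`a₀₀Y₀ + a₀₁Y₁ + a₀₂Y₂ + a₁₁Y₃ + a₁₂Y₄ + a₂₂Y₅ = 0` corresponding to the conic `f = 0`. -/
def delta (f : TernaryForm F) : Submodule F (Sym F) where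
  carrier := {M | f.a00 * M.1 0 0 + f.a01 * M.1 0 1 + f.a02 * M.1 0 2
    + f.a11 * M.1 1 1 + f.a12 * M.1 1 2 + f.a22 * M.1 2 2 = 0}
  zero_mem' := by simp
  add_mem' {M N} hM hN := by
    simp only [Set.mem_ofPred_eq] at hM hN ⊢
    simp only [Submodule.coe_add, Matrix.add_apply]
    linear_combination hM + hN
  smul_mem' c M hM := by
    simp only [Set.mem_ofPred_eq] at hM ⊢
    simp only [Submodule.coe_smul, Matrix.smul_apply, smul_eq_mul]
    linear_combination c * hM

end TernaryForm

/-- The hyperplanes containing the subspace `U` that correspond to conics with property `T`. -/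
def hyperplanesThrough (U : Submodule F (Sym F)) (T : TernaryForm F → Prop) :
    Set (Submodule F (Sym F)) :=
  {H | Module.finrank F H = 5 ∧ U ≤ H ∧ ∃ f, T f ∧ H = f.delta}

/-- The hyperplane-orbit distribution `[a₁, a₂ᵣ, a₂ᵢ, a₃]` of a subspace. -/
noncomputable def hyperplaneOD [Fintype F] (U : Submodule F (Sym F)) : Fin 4 → ℕ :=
  ![(hyperplanesThrough U TernaryForm.IsDoubleLine).ncard,
    (hyperplanesThrough U TernaryForm.IsRealLinePair).ncard,
    (hyperplanesThrough U TernaryForm.IsImaginaryLinePair).ncard,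
    (hyperplanesThrough U TernaryForm.IsNonsingular).ncard]

/-! ### The fifteen orbits -/

/-- The subspace represented by a symmetric matrix whose entries are linear forms in
`x, y, z, t`. -/
def solid (m : F → F → F → F → Matrix (Fin 3) (Fin 3) F) : Submodule F (Sym F) :=
  Submodule.span F {M | ∃ x y z t, M.1 = m x y z t}

/-- The trace from `F` to its prime field `𝔽₂`. -/
noncomputable def Tr [CharP F 2] (a : F) : ZMod 2 :=
  letI := ZMod.algebra F 2
  Algebra.trace (ZMod 2) F a

/-- `IsRepresentative i S` means that `S` is a representative of the `i`-th orbit. -/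
inductive IsRepresentative [CharP F 2] : ℕ → Submodule F (Sym F) → Prop
  | rep1 : IsRepresentative 1 (solid fun x y z t => !![x, y, z; y, t, 0; z, 0, t])
  | rep2 : IsRepresentative 2 (solid fun x y z t => !![x, y, z; y, t, 0; z, 0, 0])
  | rep3 : IsRepresentative 3 (solid fun x y z t => !![x, y, z; y, 0, t; z, t, 0])
  | rep4 : IsRepresentative 4 (solid fun x y z t => !![x, 0, y; 0, z, 0; y, 0, t])
  | rep5 : IsRepresentative 5 (solid fun x y z t => !![0, x, y; x, z, t; y, t, x])
  | rep6 : IsRepresentative 6 (solid fun x y z t => !![x, 0, y; 0, z, t; y, t, 0])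
  | rep7 (γ : F) (h : Tr γ⁻¹ = 1) : IsRepresentative 7
      (solid fun x y z t => !![x, y, z; y, x + γ * y, t; z, t, y])
  | rep8 : IsRepresentative 8 (solid fun x y z t => !![x, y, z; y, t, z; z, z, y])
  | rep9 : IsRepresentative 9 (solid fun x y z t => !![x, x, y; x, z, t; y, t, t])
  | rep10 (γ : F) (h : Tr γ⁻¹ = 1) : IsRepresentative 10
      (solid fun x y z t => !![x, y, z; y, y + γ * t, t; z, t, y])
  | rep11 : IsRepresentative 11 (solid fun x y z t => !![x, y, z; y, t, 0; z, 0, y])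
  | rep12 (γ : F) (h : Tr γ⁻¹ = 1) : IsRepresentative 12
      (solid fun x y z t => !![x, y, z; y, t, γ * y + z; z, γ * y + z, y])
  | rep13 (γ : F) (h : Tr γ = 1) : IsRepresentative 13
      (solid fun x y z t => !![x, y, z; y, γ * x + y, t; z, t, γ * x + z])
  | rep14 (γ : F) (h : Tr γ = 1) : IsRepresentative 14
      (solid fun x y z t =>
        !![x, y, γ * x + y + γ * t; y, γ * x + y, z; γ * x + y + γ * t, z, t])
  | rep15 (b c : F) (hb : b ≠ 0)
      (h : Irreducible (Polynomial.C b * Polynomial.X ^ 3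
        + Polynomial.C c * Polynomial.X + 1)) : IsRepresentative 15
      (solid fun x y z t => !![x, y, b * z + c * y; y, z, t; b * z + c * y, t, y])

variable (F) in
/-- The set `Ω_i` of all solids in the `K`-orbit of an `i`-th representative. -/
def Omega [CharP F 2] (i : ℕ) : Set (Submodule F (Sym F)) :=
  {S | ∃ R, IsRepresentative i R ∧ S ∈ MulAction.orbit (K F) R}

variable (F) in
/-- A row of the table: every solid in `Ω_i` has point-orbit distribution `p`,
hyperplane-orbit distribution `h` and stabiliser in `K` isomorphic to `G`, and `|Ω_i| = N`. -/
def OrbitRow [Fintype F] [CharP F 2] (i : ℕ) (p h : Fin 4 → ℚ) (G : Type*) [Group G] (N : ℚ) :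
    Prop :=
  (∀ S ∈ Omega F i,
    (∀ j, (pointOD S j : ℚ) = p j) ∧
    (∀ j, (hyperplaneOD S j : ℚ) = h j) ∧
    Nonempty (MulAction.stabilizer (K F) S ≃* G)) ∧
  ((Omega F i).ncard : ℚ) = N

end Geometry

/-! ### The groups -/

section Groups

/-- The cyclic group of order `n` (for `n > 0`). -/
abbrev Cyc (n : ℕ) : Type := Multiplicative (ZMod n)

variable (F : Type*) [Field F]

/-- The elementary abelian group of order `q`: the additive group of `F`. -/
abbrev E : Type _ := Multiplicative F

/-- The elementary abelian group of order `q²`. -/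
abbrev E2 : Type _ := Multiplicative (F × F)

/-- The action of `𝔽_q × 𝔽_qˣ` on `𝔽_q²` by `(c, a) · (u, v) = (a (u + c v), a v)`. -/
def unipotentScalarAction : E F × Fˣ →* MulAut (E2 F) where
  toFun g := AddEquiv.toMultiplicative
    { toFun := fun w => (g.2 * (w.1 + g.1.toAdd * w.2), g.2 * w.2)
      invFun := fun w => (g.2⁻¹ * (w.1 - g.1.toAdd * w.2), g.2⁻¹ * w.2)
      left_inv := fun w => by
        ext <;> simp <;> field_simp <;> ring
      right_inv := fun w => by
        ext <;> simp <;> field_simp <;> ring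
      map_add' := fun v w => by
        ext <;> simp <;> ring }
  map_one' := by
    ext w : 1
    apply Multiplicative.toAdd.injective
    ext <;> simp
  map_mul' g h := by
    ext w : 1
    apply Multiplicative.toAdd.injective
    ext <;> simp <;> ring

/-- The natural action of `GL(2,q)` on `𝔽_q²` (column vectors). -/
def naturalAction : GL (Fin 2) F →* MulAut (Multiplicative (Fin 2 → F)) :=
  ((MulAutMultiplicative (Fin 2 → F)).symm.toMonoidHom.comp
    (DistribMulAction.toAddAut (LinearMap.GeneralLinearGroup F (Fin 2 → F)) (Fin 2 → F))).comp
    Matrix.GeneralLinearGroup.toLin.toMonoidHom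

theorem naturalAction_apply (A : GL (Fin 2) F) (v : Fin 2 → F) :
    naturalAction F A (Multiplicative.ofAdd v) = Multiplicative.ofAdd (A.1 *ᵥ v) := rfl

/-- The action of `𝔽_qˣ` by scalar multiplication on an `𝔽_q`-vector space `V`. -/
def scalarAction (V : Type*) [AddCommGroup V] [Module F V] :
    Fˣ →* MulAut (Multiplicative V) :=
  (MulAutMultiplicative V).symm.toMonoidHom.comp (DistribMulAction.toAddAut Fˣ V)

theorem scalarAction_apply (V : Type*) [AddCommGroup V] [Module F V] (a : Fˣ) (v : V) :
    scalarAction F V a (Multiplicative.ofAdd v) = Multiplicative.ofAdd ((a : F) • v) := rfl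

/-- The group of order 2 acting on `G × G` by swapping the two factors. -/
def swapAction (G : Type*) [Group G] : Cyc 2 →* MulAut (G × G) where
  toFun e := if e = 1 then 1 else MulEquiv.prodComm
  map_one' := by simp
  map_mul' := by
    have hs : (MulEquiv.prodComm : MulAut (G × G)) * MulEquiv.prodComm = 1 := by
      ext x <;> rfl
    have key : ∀ a b : Cyc 2, (a = 1 ∨ b = 1) ∨ (a ≠ 1 ∧ b ≠ 1 ∧ a * b = 1) := by decide
    intro a b
    rcases key a b with (h | h) | ⟨h1, h2, h3⟩
    · simp [h]
    · simp [h]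
    · simp [h1, h2, h3, hs]

/-- The group `E_q^{1+2}` of upper unitriangular `3 × 3` matrices; the triple `(x, y, z)` is the
matrix with rows `(1, x, z)`, `(0, 1, y)`, `(0, 0, 1)`. -/
@[ext] structure Unitri where
  x : F
  y : F
  z : F

namespace Unitri

variable {F}

def toMatrix (g : Unitri F) : Matrix (Fin 3) (Fin 3) F :=
  !![1, g.x, g.z; 0, 1, g.y; 0, 0, 1]

instance : One (Unitri F) := ⟨⟨0, 0, 0⟩⟩
instance : Mul (Unitri F) := ⟨fun g h => ⟨g.x + h.x, g.y + h.y, g.z + h.z + g.x * h.y⟩⟩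
instance : Inv (Unitri F) := ⟨fun g => ⟨-g.x, -g.y, -g.z + g.x * g.y⟩⟩

theorem one_def : (1 : Unitri F) = ⟨0, 0, 0⟩ := rfl
theorem mul_def (g h : Unitri F) :
    g * h = ⟨g.x + h.x, g.y + h.y, g.z + h.z + g.x * h.y⟩ := rfl
theorem inv_def (g : Unitri F) : g⁻¹ = ⟨-g.x, -g.y, -g.z + g.x * g.y⟩ := rfl

instance : Group (Unitri F) :=
  Group.ofLeftAxioms
    (fun a b c => by ext <;> simp only [mul_def] <;> ring)
    (fun a => by ext <;> simp [mul_def, one_def])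
    (fun a => by ext <;> simp [mul_def, one_def, inv_def])

theorem toMatrix_mul (g h : Unitri F) : (g * h).toMatrix = g.toMatrix * h.toMatrix := by
  ext i j
  fin_cases i <;> fin_cases j <;>
    simp [toMatrix, mul_def, Matrix.mul_apply, Fin.sum_univ_three] <;> ring

end Unitri

/-- The action of `𝔽_qˣ × 𝔽_qˣ` on unitriangular matrices by conjugation with diagonal
matrices: `(a, b)` sends `(x, y, z)` to `(a x, b y, a b z)`. -/
def torusAction : Fˣ × Fˣ →* MulAut (Unitri F) where
  toFun s :=
    { toFun := fun g => ⟨s.1 * g.x, s.2 * g.y, s.1 * s.2 * g.z⟩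
      invFun := fun g => ⟨s.1⁻¹ * g.x, s.2⁻¹ * g.y, s.1⁻¹ * s.2⁻¹ * g.z⟩
      left_inv := fun g => by
        ext <;> simp <;> field_simp
      right_inv := fun g => by
        ext <;> simp <;> field_simp
      map_mul' := fun g h => by
        ext <;> simp only [Unitri.mul_def] <;> ring }
  map_one' := by
    ext g <;> simp
  map_mul' s t := by
    ext g <;> simp <;> ring

end Groups

end VeroneseSolids

/-! The argument dualises. A solid is the common annihilator of two independent ternary quadratic
forms, that is, of a pencil of conics, and since pairing `f` with `A M Aᵀ` equals pairing `f ∘ A`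
with `M` (`pair_congr`), the group acts on solids as linear substitutions act on pencils.
Hyperplanes through the solid are the q + 1 members f₁ + βf₂ and f₂ of the pencil
(`pencil_le_delta`, `ncard_hyperplanesThrough`).

Point distributions. In characteristic two over a finite field every symmetric matrix of rank one is
some v vᵀ, because square roots exist; it lies in the solid exactly when v is a common zero of the
pencil, so r₁ counts rational base points. Nonzero matrices with zero diagonal have rank 2 and form
an invariant subspace. The determinant of a generic member can be arranged as a(w)φ(x) + b(w) with φ
the identity or squaring, so its zeros are counted from the loci a = 0 and a = b = 0
(`ncard_linear_zeros`). The remaining number r₂ₛ follows by subtraction.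

Hyperplane distributions. Three invariants separate the four types of conic: the vanishing of `disc`
(the value of the form at its nucleus), the vanishing of the mixed coefficients, and whether all
rational zeros are singular (`HasType.unique`). A binary form a l² + l m + b m² splits over F or
over the quadratic extension according to `Tr (a * b)`, since s² + s = a is solvable exactly when a
has trace zero (`tr_eq_zero_iff`).

Stabilisers. Modulo scalars these are the invertible matrices whose substitution preserves the
pencil (`stabilizer_pencil`). In rows 9, 12, 13, 14 and 15 the pencil has four base points over the
algebraic closure, no three collinear, permuted by Frobenius through a permutation σ of cycle type
1, 2, 2+2, 4 and 3 respectively. A projective frame determines its pencil and the matrix carrying it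
to another frame, and such a matrix is rational when it respects Frobenius. Hence σ alone determines
the orbit, whatever the parameters, and the stabiliser is the centraliser of σ in the symmetric
group on four letters (`IsBaseFrame.pencil_mem_orbit`, `IsBaseFrame.stabilizer`). The other pencils
are degenerate enough for the equations on the matrix entries to be solved directly, in rows 1, 7, 8
and 10 after a change to simpler coordinates. Row 7 is the similitude group of the norm form of the
quadratic extension, where the dihedral group comes from the elements of norm one and conjugation.

Sizes follow from orbit–stabiliser and |K| = q³(q³ − 1)(q² − 1). The hyperplane distributions
separate the orbits except rows 11 and 12, and rows 4 and 9 when q = 2; there the orbit sizes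
differ. -/

namespace VeroneseSolids

/-! ### Ternary quadratic forms under linear substitution -/

namespace TernaryForm

section Ring

variable {R S : Type*} [CommRing R] [CommRing S]

/-- The linear combination `a f + b g` of two forms. -/
def comb (a b : R) (f g : TernaryForm R) : TernaryForm R :=
  ⟨a * f.a00 + b * g.a00, a * f.a01 + b * g.a01, a * f.a02 + b * g.a02,
    a * f.a11 + b * g.a11, a * f.a12 + b * g.a12, a * f.a22 + b * g.a22⟩

/-- The zero form. -/
def zeroForm (R : Type*) [CommRing R] : TernaryForm R := ⟨0, 0, 0, 0, 0, 0⟩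

/-- The polar form. -/
def polar (f : TernaryForm R) (u v : Fin 3 → R) : R :=
  2 * f.a00 * u 0 * v 0 + f.a01 * (u 0 * v 1 + u 1 * v 0) + f.a02 * (u 0 * v 2 + u 2 * v 0)
    + 2 * f.a11 * u 1 * v 1 + f.a12 * (u 1 * v 2 + u 2 * v 1) + 2 * f.a22 * u 2 * v 2

/-- The form `f ∘ A`. -/
def subst (f : TernaryForm R) (A : Matrix (Fin 3) (Fin 3) R) : TernaryForm R :=
  ⟨f.eval (Aᵀ 0), f.polar (Aᵀ 0) (Aᵀ 1), f.polar (Aᵀ 0) (Aᵀ 2),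
    f.eval (Aᵀ 1), f.polar (Aᵀ 1) (Aᵀ 2), f.eval (Aᵀ 2)⟩

theorem mulVec_three (A : Matrix (Fin 3) (Fin 3) R) (v : Fin 3 → R) (i : Fin 3) :
    (A *ᵥ v) i = A i 0 * v 0 + A i 1 * v 1 + A i 2 * v 2 := by
  simp [Matrix.mulVec, dotProduct, Fin.sum_univ_three]

theorem eval_subst (f : TernaryForm R) (A : Matrix (Fin 3) (Fin 3) R) (v : Fin 3 → R) :
    (f.subst A).eval v = f.eval (A *ᵥ v) := by
  simp only [eval, subst, polar, mulVec_three, transpose_apply]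
  ring

theorem polar_subst (f : TernaryForm R) (A : Matrix (Fin 3) (Fin 3) R) (u v : Fin 3 → R) :
    (f.subst A).polar u v = f.polar (A *ᵥ u) (A *ᵥ v) := by
  simp only [eval, subst, polar, mulVec_three, transpose_apply]
  ring

theorem col_mul (A B : Matrix (Fin 3) (Fin 3) R) (j : Fin 3) :
    (A * B)ᵀ j = A *ᵥ (Bᵀ j) := by
  ext i
  simp [Matrix.mul_apply, Matrix.mulVec, dotProduct]

theorem subst_mul (f : TernaryForm R) (A B : Matrix (Fin 3) (Fin 3) R) :
    f.subst (A * B) = (f.subst A).subst B := by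
  conv_lhs => rw [subst]
  conv_rhs => rw [subst]
  simp only [col_mul, eval_subst, polar_subst]

theorem subst_one (f : TernaryForm R) : f.subst 1 = f := by
  ext <;> simp [subst, eval, polar]

theorem grad_subst (f : TernaryForm R) (A : Matrix (Fin 3) (Fin 3) R) (v : Fin 3 → R) :
    (f.subst A).grad v = Aᵀ *ᵥ (f.grad (A *ᵥ v)) := by
  ext i
  fin_cases i <;>
  simp [grad, subst, eval, polar, mulVec_three] <;>
  ring

theorem map_subst (φ : R →+* S) (f : TernaryForm R) (A : Matrix (Fin 3) (Fin 3) R) :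
    (f.subst A).map φ = (f.map φ).subst (A.map φ) := by
  ext <;> simp [subst, eval, polar, map, map_ofNat]

theorem map_comb (φ : R →+* S) (a b : R) (f g : TernaryForm R) :
    (comb a b f g).map φ = comb (φ a) (φ b) (f.map φ) (g.map φ) := by
  ext <;> simp [comb, map]

theorem eval_map (φ : R →+* S) (f : TernaryForm R) (v : Fin 3 → R) :
    (f.map φ).eval (fun i => φ (v i)) = φ (f.eval v) := by
  simp [eval, map]

theorem subst_comb (a b : R) (f g : TernaryForm R) (A : Matrix (Fin 3) (Fin 3) R) :
    (comb a b f g).subst A = comb a b (f.subst A) (g.subst A) := by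
  ext <;> simp only [subst, eval, polar, comb] <;> ring

theorem eval_comb (a b : R) (f g : TernaryForm R) (v : Fin 3 → R) :
    (comb a b f g).eval v = a * f.eval v + b * g.eval v := by
  simp only [eval, comb]
  ring

theorem subst_prodLin (c : R) (l m : Fin 3 → R) (A : Matrix (Fin 3) (Fin 3) R) :
    (prodLin c l m).subst A = prodLin c (Aᵀ *ᵥ l) (Aᵀ *ᵥ m) := by
  ext <;> simp only [subst, eval, polar, prodLin, mulVec_three, transpose_apply] <;> ring

theorem comb_comb (a b c d e g : R) (f₁ f₂ : TernaryForm R) :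
    comb a b (comb c d f₁ f₂) (comb e g f₁ f₂) =
      comb (a * c + b * e) (a * d + b * g) f₁ f₂ := by
  ext <;> simp only [comb] <;> ring

/-- The pairing of a form with a symmetric matrix. -/
def pair (f : TernaryForm R) (M : Matrix (Fin 3) (Fin 3) R) : R :=
  f.a00 * M 0 0 + f.a01 * M 0 1 + f.a02 * M 0 2
    + f.a11 * M 1 1 + f.a12 * M 1 2 + f.a22 * M 2 2

/-- Congruence on matrices is adjoint to substitution in forms; this moves every question about
solids to pencils. Symmetry of `M` is needed because `pair` reads only the upper triangle. -/
theorem pair_congr (f : TernaryForm R) (A M : Matrix (Fin 3) (Fin 3) R) (hM : M.IsSymm) :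
    f.pair (A * M * Aᵀ) = (f.subst A).pair M := by
  have h1 : M 1 0 = M 0 1 := hM.apply 0 1
  have h2 : M 2 0 = M 0 2 := hM.apply 0 2
  have h3 : M 2 1 = M 1 2 := hM.apply 1 2
  simp only [pair, subst, eval, polar, Matrix.mul_apply, Fin.sum_univ_three, transpose_apply,
    h1, h2, h3]
  ring

/-- `f` is a linear combination of `f₁` and `f₂`. -/
def InSpan (f₁ f₂ f : TernaryForm R) : Prop := ∃ a b : R, f = comb a b f₁ f₂

/-- Linear independence of two forms. -/
def Indep (f₁ f₂ : TernaryForm R) : Prop :=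
  ∀ a b : R, comb a b f₁ f₂ = zeroForm R → a = 0 ∧ b = 0

end Ring

variable {F : Type*} [Field F]

/-- The linear functional on symmetric matrices given by a form. -/
def toDual (f : TernaryForm F) : Sym F →ₗ[F] F where
  toFun M := f.pair M.1
  map_add' M N := by simp [pair]; ring
  map_smul' c M := by simp [pair]; ring

theorem delta_eq_ker (f : TernaryForm F) : f.delta = LinearMap.ker f.toDual := rfl

theorem mem_delta {f : TernaryForm F} {M : Sym F} : M ∈ f.delta ↔ f.pair M.1 = 0 := Iff.rfl

end TernaryForm

/-! ### Solids as annihilators of pencils of conics -/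

open TernaryForm

variable {F : Type*} [Field F]

/-- The symmetric matrix with given upper triangle. -/
def symMk (y : Fin 6 → F) : Sym F :=
  ⟨!![y 0, y 1, y 2; y 1, y 3, y 4; y 2, y 4, y 5], by
    change Matrix.IsSymm _
    ext i j
    fin_cases i <;> fin_cases j <;> rfl⟩

theorem sym_apply (M : Sym F) (i j : Fin 3) : M.1 i j = M.1 j i :=
  (Matrix.IsSymm.apply (show M.1.IsSymm from M.2) i j).symm

theorem sym_ext {M N : Sym F} (h0 : M.1 0 0 = N.1 0 0) (h1 : M.1 0 1 = N.1 0 1)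
    (h2 : M.1 0 2 = N.1 0 2) (h3 : M.1 1 1 = N.1 1 1) (h4 : M.1 1 2 = N.1 1 2)
    (h5 : M.1 2 2 = N.1 2 2) : M = N := by
  apply Subtype.ext
  have a1 := sym_apply M 1 0
  have a2 := sym_apply M 2 0
  have a3 := sym_apply M 2 1
  have b1 := sym_apply N 1 0
  have b2 := sym_apply N 2 0
  have b3 := sym_apply N 2 1
  ext i j
  fin_cases i <;> fin_cases j <;> simp_all

variable (F) in
/-- Coordinates of symmetric matrices. -/
def symEquiv : Sym F ≃ₗ[F] (Fin 6 → F) where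
  toFun M := ![M.1 0 0, M.1 0 1, M.1 0 2, M.1 1 1, M.1 1 2, M.1 2 2]
  map_add' M N := by
    ext i
    fin_cases i <;> rfl
  map_smul' c M := by
    ext i
    fin_cases i <;> rfl
  invFun := symMk
  left_inv M := sym_ext rfl rfl rfl rfl rfl rfl
  right_inv y := by
    ext i
    fin_cases i <;> rfl

instance : Module.Finite F (Sym F) := Module.Finite.equiv (symEquiv F).symm

theorem finrank_sym : Module.finrank F (Sym F) = 6 := by
  rw [(symEquiv F).finrank_eq]
  simp

theorem toDual_injective : Function.Injective (toDual (F := F)) := by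
  intro f g h
  have key : ∀ y : Fin 6 → F, f.pair (symMk y).1 = g.pair (symMk y).1 :=
    fun y => LinearMap.congr_fun h (symMk y)
  ext
  · simpa [pair, symMk] using key ![1, 0, 0, 0, 0, 0]
  · simpa [pair, symMk] using key ![0, 1, 0, 0, 0, 0]
  · simpa [pair, symMk] using key ![0, 0, 1, 0, 0, 0]
  · simpa [pair, symMk] using key ![0, 0, 0, 1, 0, 0]
  · simpa [pair, symMk] using key ![0, 0, 0, 0, 1, 0]
  · simpa [pair, symMk] using key ![0, 0, 0, 0, 0, 1]

theorem toDual_comb (a b : F) (f g : TernaryForm F) :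
    (comb a b f g).toDual = a • f.toDual + b • g.toDual := by
  ext M
  simp [toDual, comb, pair]
  ring

/-- The subspace of all symmetric matrices annihilated by `f₁` and `f₂`. -/
def pencil (f₁ f₂ : TernaryForm F) : Submodule F (Sym F) := f₁.delta ⊓ f₂.delta

theorem mem_pencil {f₁ f₂ : TernaryForm F} {M : Sym F} :
    M ∈ pencil f₁ f₂ ↔ f₁.pair M.1 = 0 ∧ f₂.pair M.1 = 0 := Iff.rfl

/-- A functional vanishing on the common kernel of two functionals is a combination of them. Thus
the hyperplanes through the solid are the members of the pencil. -/
theorem pencil_le_delta {f₁ f₂ f : TernaryForm F} :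
    pencil f₁ f₂ ≤ f.delta ↔ InSpan f₁ f₂ f := by
  constructor
  · intro h
    have := mem_span_of_iInf_ker_le_ker (L := ![f₁.toDual, f₂.toDual]) (K := f.toDual) (by
      refine le_trans ?_ h
      refine le_inf (iInf_le _ 0) (iInf_le _ 1))
    rw [Matrix.range_cons, Matrix.range_cons, Matrix.range_empty, Set.union_empty,
      Set.singleton_union, Submodule.mem_span_pair] at this
    obtain ⟨a, b, hab⟩ := this
    exact ⟨a, b, toDual_injective (by rw [toDual_comb, hab])⟩
  · rintro ⟨a, b, rfl⟩ M ⟨h1, h2⟩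
    have h1 : f₁.toDual M = 0 := h1
    have h2 : f₂.toDual M = 0 := h2
    rw [delta_eq_ker, LinearMap.mem_ker, toDual_comb]
    simp [h1, h2]

theorem pencil_le_pencil {f₁ f₂ g₁ g₂ : TernaryForm F} (h₁ : InSpan f₁ f₂ g₁)
    (h₂ : InSpan f₁ f₂ g₂) : pencil f₁ f₂ ≤ pencil g₁ g₂ :=
  le_inf (pencil_le_delta.2 h₁) (pencil_le_delta.2 h₂)

theorem pencil_eq_pencil {f₁ f₂ g₁ g₂ : TernaryForm F} (h₁ : InSpan f₁ f₂ g₁)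
    (h₂ : InSpan f₁ f₂ g₂) (h₃ : InSpan g₁ g₂ f₁) (h₄ : InSpan g₁ g₂ f₂) :
    pencil f₁ f₂ = pencil g₁ g₂ :=
  le_antisymm (pencil_le_pencil h₁ h₂) (pencil_le_pencil h₃ h₄)

theorem finrank_delta {f : TernaryForm F} (hf : f ≠ zeroForm F) : Module.finrank F f.delta = 5 := by
  have h : f.toDual ≠ 0 := by
    intro h
    apply hf
    apply toDual_injective
    rw [h]
    ext M
    simp [toDual, pair, zeroForm]
  have := Module.Dual.finrank_ker_add_one_of_ne_zero (f := f.toDual) h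
  rw [finrank_sym] at this
  rw [delta_eq_ker]
  omega

/-- The case of a pencil with both generators equal. Here, as in `IsConicType.scale`, `comb c 0 f f`
stands for the multiple c f. -/
theorem delta_le_delta {f g : TernaryForm F} (h : f.delta ≤ g.delta) :
    ∃ c, g = comb c 0 f f := by
  have : InSpan f f g := pencil_le_delta.1 (by simpa [pencil] using h)
  obtain ⟨a, b, rfl⟩ := this
  exact ⟨a + b, by ext <;> simp [comb] <;> ring⟩

/-! ### The collineation group acting on pencils -/

theorem alpha_apply (A : GL (Fin 3) F) (U : Submodule F (Sym F)) :
    alpha F A U = U.map (congrEquiv A : Sym F →ₗ[F] Sym F) := rfl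

/-- The inverse appears because M lies in the image of the hyperplane exactly when A⁻¹ M A⁻ᵀ lies in
the hyperplane. -/
theorem alpha_delta (A : GL (Fin 3) F) (f : TernaryForm F) :
    alpha F A f.delta = (f.subst (A⁻¹ : GL (Fin 3) F).1).delta := by
  rw [alpha_apply]
  ext M
  rw [Submodule.map_equiv_eq_comap_symm]
  change f.pair (A⁻¹.1 * M.1 * A⁻¹.1ᵀ) = 0 ↔ _
  rw [pair_congr _ _ _ M.2, mem_delta]

theorem alpha_pencil (A : GL (Fin 3) F) (f g : TernaryForm F) :
    alpha F A (pencil f g) =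
      pencil (f.subst (A⁻¹ : GL (Fin 3) F).1) (g.subst (A⁻¹ : GL (Fin 3) F).1) := by
  rw [pencil, map_inf, alpha_delta, alpha_delta, pencil]

theorem finrank_alpha (A : GL (Fin 3) F) (U : Submodule F (Sym F)) :
    Module.finrank F (alpha F A U : Submodule F (Sym F)) = Module.finrank F U :=
  LinearEquiv.finrank_map_eq _ _

theorem smul_mem_orbit (A : GL (Fin 3) F) (U : Submodule F (Sym F)) :
    alpha F A U ∈ MulAction.orbit (K F) U :=
  ⟨⟨alpha F A, A, rfl⟩, rfl⟩

theorem mem_orbit_iff {U V : Submodule F (Sym F)} :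
    V ∈ MulAction.orbit (K F) U ↔ ∃ A : GL (Fin 3) F, V = alpha F A U := by
  constructor
  · rintro ⟨⟨_, A, rfl⟩, rfl⟩
    exact ⟨A, rfl⟩
  · rintro ⟨A, rfl⟩
    exact smul_mem_orbit A U

theorem pencil_subst_mem_orbit (f g : TernaryForm F) {A : Matrix (Fin 3) (Fin 3) F}
    (hA : A.det ≠ 0) : pencil (f.subst A) (g.subst A) ∈ MulAction.orbit (K F) (pencil f g) := by
  have h := smul_mem_orbit (Matrix.GeneralLinearGroup.mkOfDetNeZero A hA)⁻¹ (pencil f g)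
  rw [alpha_pencil, inv_inv] at h
  exact h

/-- Membership of the two substituted forms gives one inclusion of subspaces; equality of dimensions
gives the other. -/
theorem alpha_pencil_eq_of_inSpan {f g : TernaryForm F} (A : GL (Fin 3) F)
    (h₁ : InSpan f g (f.subst A.1)) (h₂ : InSpan f g (g.subst A.1)) :
    alpha F A (pencil f g) = pencil f g := by
  have h : pencil f g ≤ alpha F A⁻¹ (pencil f g) := by
    rw [alpha_pencil, inv_inv]
    exact pencil_le_pencil h₁ h₂
  have h' := Submodule.eq_of_le_of_finrank_eq h (finrank_alpha _ _).symm
  rw [map_inv] at h'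
  conv_lhs => rw [h']
  exact (alpha F A).apply_symm_apply _

theorem inSpan_of_alpha_pencil_eq {f g : TernaryForm F} (A : GL (Fin 3) F)
    (h : alpha F A (pencil f g) = pencil f g) :
    InSpan f g (f.subst A.1) ∧ InSpan f g (g.subst A.1) := by
  have h' : alpha F A⁻¹ (pencil f g) = pencil f g := by
    rw [map_inv]
    conv_lhs => rw [← h]
    exact (alpha F A).symm_apply_apply _
  rw [alpha_pencil, inv_inv] at h'
  exact ⟨pencil_le_delta.1 (h'.symm.le.trans inf_le_left),
    pencil_le_delta.1 (h'.symm.le.trans inf_le_right)⟩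

/-- The symmetric matrix `v vᵀ`. -/
def outer (v : Fin 3 → F) : Sym F :=
  ⟨vecMulVec v v, by
    change Matrix.IsSymm _
    ext i j
    simp [vecMulVec_apply, mul_comm]⟩

theorem pair_outer (f : TernaryForm F) (v : Fin 3 → F) : f.pair (outer v).1 = f.eval v := by
  simp only [pair, outer, vecMulVec_apply, eval]
  ring

theorem congrMap_outer (A : Matrix (Fin 3) (Fin 3) F) (v : Fin 3 → F) :
    congrMap A (outer v) = outer (A *ᵥ v) := by
  apply Subtype.ext
  change A * vecMulVec v v * Aᵀ = vecMulVec (A *ᵥ v) (A *ᵥ v)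
  rw [Matrix.mul_vecMulVec, Matrix.vecMulVec_mul, Matrix.vecMul_transpose]

/-- A collineation acting trivially fixes all points v vᵀ. Taking v = eⱼ kills the off-diagonal
entries of A, and v = eᵢ + eⱼ equates its diagonal entries. Conversely the scalar c acts on matrices
as c². -/
theorem alpha_eq_one_iff (A : GL (Fin 3) F) : alpha F A = 1 ↔ ∃ c : F, A.1 = c • 1 := by
  constructor
  · intro h
    have key : ∀ v : Fin 3 → F, ∃ a : F, a • outer v = outer (A.1 *ᵥ v) := by
      intro v
      have h1 : alpha F A (Submodule.span F {outer v}) = Submodule.span F {outer v} := by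
        rw [h]
        rfl
      have h2 : congrMap A.1 (outer v) ∈ Submodule.span F {outer v} := by
        rw [← h1, alpha_apply]
        exact Submodule.mem_map_of_mem (Submodule.mem_span_singleton_self _)
      rw [congrMap_outer] at h2
      exact Submodule.mem_span_singleton.1 h2
    have ent : ∀ v : Fin 3 → F, ∃ a : F, ∀ i j, a * (v i * v j) = (A.1 *ᵥ v) i * (A.1 *ᵥ v) j := by
      intro v
      obtain ⟨a, ha⟩ := key v
      refine ⟨a, fun i j => ?_⟩
      have := congrArg (fun M : Sym F => M.1 i j) ha
      simpa [outer, vecMulVec_apply] using this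
    have off : ∀ i j, i ≠ j → A.1 i j = 0 := by
      intro i j hij
      obtain ⟨a, ha⟩ := ent (Pi.single j 1)
      have := ha i i
      simpa [hij] using this
    have dg : ∀ i j, A.1 i i = A.1 j j := by
      intro i j
      rcases eq_or_ne i j with rfl | hij
      · rfl
      obtain ⟨a, ha⟩ := ent (Pi.single i 1 + Pi.single j 1)
      have h1 := ha i i
      have h2 := ha i j
      have hi : A.1 i i ≠ 0 := by
        intro h0
        have hrow : ∀ k, A.1 i k = 0 := by
          intro k
          rcases eq_or_ne i k with rfl | hk
          · exact h0
          · exact off i k hk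
        have hdet : A.1.det = 0 := Matrix.det_eq_zero_of_row_eq_zero i hrow
        exact (Matrix.isUnits_det_units A).ne_zero hdet
      simp [Matrix.mulVec_add, off _ _ hij, off _ _ hij.symm, hij, hij.symm] at h1 h2
      rw [h1] at h2
      exact mul_left_cancel₀ hi h2
    refine ⟨A.1 0 0, ?_⟩
    ext i j
    rcases eq_or_ne i j with rfl | hij
    · simp [dg i 0]
    · simp [off _ _ hij, hij]
  · rintro ⟨c, hc⟩
    have hc0 : c ≠ 0 := by
      rintro rfl
      have := (Matrix.isUnits_det_units A).ne_zero
      rw [hc] at this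
      simp at this
    apply RelIso.ext
    intro U
    rw [alpha_apply]
    have hM : ∀ M : Sym F, congrEquiv A M = (c * c) • M := by
      intro M
      apply Subtype.ext
      rw [congrEquiv_apply, hc]
      simp [smul_smul]
    change _ = U
    ext M
    constructor
    · rintro ⟨N, hN, rfl⟩
      change congrEquiv A N ∈ U
      rw [hM]
      exact U.smul_mem _ hN
    · intro h
      refine ⟨(c * c)⁻¹ • M, U.smul_mem _ h, ?_⟩
      change congrEquiv A _ = M
      rw [hM, smul_smul, mul_inv_cancel₀ (mul_ne_zero hc0 hc0), one_smul]

/-- If `ψ` is a representation of `G` preserving the pencil, injective modulo scalars, such that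
every linear substitution preserving the pencil is proportional to some `ψ g`, then the
stabiliser of the pencil is isomorphic to `G`. -/
theorem stabilizer_pencil {G : Type*} [Group G] {f₁ f₂ : TernaryForm F}
    (ψ : G →* Matrix (Fin 3) (Fin 3) F)
    (h₁ : ∀ g, InSpan f₁ f₂ (f₁.subst (ψ g)) ∧ InSpan f₁ f₂ (f₂.subst (ψ g)))
    (h₂ : ∀ (g : G) (c : F), ψ g = c • (1 : Matrix (Fin 3) (Fin 3) F) → g = 1)
    (h₃ : ∀ A : Matrix (Fin 3) (Fin 3) F, A.det ≠ 0 → InSpan f₁ f₂ (f₁.subst A) →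
      InSpan f₁ f₂ (f₂.subst A) → ∃ (g : G) (c : F), A = c • ψ g) :
    Nonempty (MulAction.stabilizer (K F) (pencil f₁ f₂) ≃* G) := by
  let φ : G →* GL (Fin 3) F := ψ.toHomUnits
  have hφ : ∀ g, (φ g).1 = ψ g := fun g => rfl
  let Φ : G →* MulAction.stabilizer (K F) (pencil f₁ f₂) :=
    { toFun := fun g => ⟨⟨alpha F (φ g), φ g, rfl⟩,
        alpha_pencil_eq_of_inSpan (φ g) (h₁ g).1 (h₁ g).2⟩
      map_one' := by
        apply Subtype.ext
        apply Subtype.ext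
        simp
      map_mul' := fun a b => by
        apply Subtype.ext
        apply Subtype.ext
        simp }
  refine ⟨(MulEquiv.ofBijective Φ ⟨?_, ?_⟩).symm⟩
  · rw [injective_iff_map_eq_one]
    intro g hg
    have : alpha F (φ g) = 1 := congrArg (fun x => x.1.1) hg
    obtain ⟨c, hc⟩ := (alpha_eq_one_iff _).1 this
    exact h₂ g c hc
  · rintro ⟨⟨_, A, rfl⟩, hA⟩
    have hA' : alpha F A (pencil f₁ f₂) = pencil f₁ f₂ := hA
    obtain ⟨s₁, s₂⟩ := inSpan_of_alpha_pencil_eq A hA'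
    obtain ⟨g, c, hc⟩ := h₃ A.1 (Matrix.isUnits_det_units A).ne_zero s₁ s₂
    refine ⟨g, ?_⟩
    apply Subtype.ext
    apply Subtype.ext
    change alpha F (φ g) = alpha F A
    -- A and ψ g differ by the scalar c, so their quotient acts trivially.
    have : alpha F (A * (φ g)⁻¹) = 1 := by
      rw [alpha_eq_one_iff]
      refine ⟨c, ?_⟩
      rw [Units.val_mul, hc, ← hφ, smul_mul_assoc, ← Units.val_mul, mul_inv_cancel, Units.val_one]
    rw [map_mul, map_inv, mul_inv_eq_one] at this
    exact this.symm

theorem card_alpha_ker : Nat.card (alpha F).ker = Nat.card Fˣ := by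
  let σ : Fˣ →* (alpha F).ker :=
    { toFun := fun c => ⟨Units.map (Matrix.scalar (Fin 3) : F →+* _).toMonoidHom c, by
        rw [MonoidHom.mem_ker, alpha_eq_one_iff]
        exact ⟨c, by ext i j; simp [Matrix.scalar, Matrix.diagonal, Matrix.one_apply]⟩⟩
      map_one' := by
        apply Subtype.ext
        simp
      map_mul' := fun a b => by
        apply Subtype.ext
        simp }
  refine (Nat.card_congr (Equiv.ofBijective σ ⟨?_, ?_⟩)).symm
  · intro a b h
    have h : (Matrix.scalar (Fin 3) (a : F)) 0 0 = (Matrix.scalar (Fin 3) (b : F)) 0 0 :=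
      congrArg (fun x => x.1.1 0 0) h
    apply Units.ext
    simpa using h
  · rintro ⟨A, hA⟩
    obtain ⟨c, hc⟩ := (alpha_eq_one_iff A).1 hA
    have hc0 : c ≠ 0 := by
      rintro rfl
      have := (Matrix.isUnits_det_units A).ne_zero
      rw [hc] at this
      simp at this
    refine ⟨Units.mk0 c hc0, ?_⟩
    apply Subtype.ext
    apply Units.ext
    change Matrix.scalar (Fin 3) c = A.1
    rw [hc]
    ext i j
    simp [Matrix.scalar, Matrix.diagonal, Matrix.one_apply]

/-- The kernel of `alpha` consists of the q − 1 scalars, which cancel one factor of |GL(3,q)|. -/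
theorem card_K [Fintype F] : (Nat.card (K F) : ℚ) =
    (Fintype.card F : ℚ) ^ 3 * ((Fintype.card F : ℚ) ^ 3 - 1) * ((Fintype.card F : ℚ) ^ 2 - 1) := by
  have h1 : Nat.card (alpha F).ker * Nat.card (K F) = Nat.card (GL (Fin 3) F) := by
    rw [← Subgroup.card_mul_index (alpha F).ker, Subgroup.index_ker]
    rfl
  have hq : 1 < Fintype.card F := Fintype.one_lt_card
  have h2 : Nat.card Fˣ = Fintype.card F - 1 := by
    classical rw [Nat.card_eq_fintype_card, Fintype.card_units]
  rw [card_alpha_ker, h2, Matrix.card_GL_field, Fin.prod_univ_three, Fin.val_zero, Fin.val_one,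
    Fin.val_two] at h1
  set q := Fintype.card F
  have hp : ∀ a b : ℕ, a ≤ b → q ^ a ≤ q ^ b := fun a b h => Nat.pow_le_pow_right hq.le h
  have h3 := congrArg (Nat.cast : ℕ → ℚ) h1
  push_cast [Nat.cast_sub hq.le, Nat.cast_sub (hp 0 3 (by norm_num)),
    Nat.cast_sub (hp 1 3 (by norm_num)), Nat.cast_sub (hp 2 3 (by norm_num))] at h3
  have hq' : (q : ℚ) - 1 ≠ 0 := by
    have : (1 : ℚ) < q := by exact_mod_cast hq
    linarith
  apply mul_left_cancel₀ hq'
  linear_combination h3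

theorem ncard_orbit_mul_card_stabilizer (U : Submodule F (Sym F)) :
    (MulAction.orbit (K F) U).ncard * Nat.card (MulAction.stabilizer (K F) U) =
      Nat.card (K F) := by
  rw [← MulAction.index_stabilizer, mul_comm, Subgroup.card_mul_index]

end VeroneseSolids

namespace VeroneseSolids

/-! ### Trace, Artin–Schreier equations and Frobenius in characteristic two -/

section CharTwo

variable {F : Type*} [Field F] [Fintype F] [CharP F 2]

theorem exists_sq_eq (a : F) : ∃ s : F, s ^ 2 = a := by
  obtain ⟨s, hs⟩ := FiniteField.isSquare_of_char_two (CharP.ringChar_of_prime_eq_zero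
    Nat.prime_two (CharP.cast_eq_zero F 2)) a
  exact ⟨s, by rw [hs, sq]⟩

theorem sq_inj {R : Type*} [Field R] [CharP R 2] {a b : R} (h : a ^ 2 = b ^ 2) : a = b := by
  have : (a - b) ^ 2 = 0 := by
    rw [sub_pow_char, h, sub_self]
  exact sub_eq_zero.1 (pow_eq_zero_iff (by norm_num) |>.1 this)

omit [Fintype F] in
theorem tr_add (a b : F) : Tr (a + b) = Tr a + Tr b := by
  let _ := ZMod.algebra F 2
  exact map_add (Algebra.trace (ZMod 2) F) a b

/-- Squaring is an automorphism over the prime field, and the trace is invariant under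
automorphisms. -/
theorem tr_sq (a : F) : Tr (a ^ 2) = Tr a := by
  let _ := ZMod.algebra F 2
  have h := Algebra.trace_eq_of_algEquiv
    (FiniteField.frobeniusAlgEquivOfAlgebraic (ZMod 2) F) a
  rwa [FiniteField.coe_frobeniusAlgEquivOfAlgebraic, ZMod.card] at h

theorem tr_surjective : Function.Surjective (Tr : F → ZMod 2) := by
  let _ := ZMod.algebra F 2
  exact Algebra.trace_surjective (ZMod 2) F

omit [Fintype F] in
theorem tr_zero : Tr (0 : F) = 0 := by
  let _ := ZMod.algebra F 2
  exact map_zero (Algebra.trace (ZMod 2) F)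

omit [Fintype F] in
theorem tr_eq_zero_or_one (a : F) : Tr a = 0 ∨ Tr a = 1 := by
  generalize Tr a = t
  revert t
  decide

variable (F) in
/-- The trace as an additive homomorphism. -/
noncomputable def trHom : F →+ ZMod 2 where
  toFun := Tr
  map_zero' := tr_zero
  map_add' := tr_add

variable (F) in
/-- The additive map `s ↦ s² + s`. -/
def artinSchreier : F →+ F where
  toFun s := s ^ 2 + s
  map_zero' := by ring
  map_add' a b := by
    rw [add_pow_char]
    ring

theorem card_ker_trHom : Nat.card (trHom F).ker * 2 = Fintype.card F := by
  have h := AddSubgroup.card_mul_index (trHom F).ker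
  rw [AddSubgroup.index_ker, AddMonoidHom.range_eq_top.2 tr_surjective] at h
  rw [← Nat.card_eq_fintype_card, ← h]
  simp

omit [Fintype F] in
theorem card_ker_artinSchreier : Nat.card (artinSchreier F).ker = 2 := by
  have h : ((artinSchreier F).ker : Set F) = {0, 1} := by
    ext s
    change s ^ 2 + s = 0 ↔ s = 0 ∨ s = 1
    rw [show s ^ 2 + s = s * (s + 1) by ring, mul_eq_zero, CharTwo.add_eq_zero]
  change Nat.card ((artinSchreier F).ker : Set F) = 2
  rw [h, Nat.card_coe_set_eq, Set.ncard_pair zero_ne_one]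

/-- An element has trace zero if and only if it is of the form `s² + s`. -/
theorem tr_eq_zero_iff {a : F} : Tr a = 0 ↔ ∃ s, s ^ 2 + s = a := by
  have hle : (artinSchreier F).range ≤ (trHom F).ker := by
    rintro _ ⟨s, rfl⟩
    change Tr (s ^ 2 + s) = 0
    rw [tr_add, tr_sq]
    exact CharTwo.add_self_eq_zero _
  -- The inclusion becomes an equality by counting: both groups have q/2 elements, as s² + s has
  -- kernel {0, 1} and the trace is onto a group of order 2.
  have hcard : Nat.card (trHom F).ker ≤ Nat.card (artinSchreier F).range := by
    have h1 := AddSubgroup.card_mul_index (artinSchreier F).ker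
    rw [AddSubgroup.index_ker, card_ker_artinSchreier, Nat.card_eq_fintype_card (α := F)] at h1
    have h2 := card_ker_trHom (F := F)
    omega
  have heq : ((artinSchreier F).range : Set F) = ((trHom F).ker : Set F) :=
    Set.eq_of_subset_of_ncard_le hle hcard
  exact (Set.ext_iff.1 heq a).symm

theorem ncard_tr_eq_zero : {a : F | Tr a = 0}.ncard * 2 = Fintype.card F :=
  card_ker_trHom

theorem ncard_tr_eq_one : {a : F | Tr a = 1}.ncard * 2 = Fintype.card F := by
  have h := Set.ncard_add_ncard_compl {a : F | Tr a = 0}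
  have hc : {a : F | Tr a = 0}ᶜ = {a : F | Tr a = 1} := by
    ext a
    rcases tr_eq_zero_or_one a with h | h <;> simp [h]
  rw [hc, Nat.card_eq_fintype_card] at h
  have := ncard_tr_eq_zero (F := F)
  omega

theorem sq_add_self_ne {γ : F} (h : Tr γ = 1) (s : F) : s ^ 2 + s ≠ γ := by
  intro hs
  have := tr_eq_zero_iff.2 ⟨s, hs⟩
  rw [h] at this
  exact one_ne_zero this

/-- A binary quadratic form `x² + xy + δy²` with `Tr δ = 1` is anisotropic. -/
theorem norm_form_eq_zero {δ : F} (h : Tr δ = 1) {x y : F} (hxy : x ^ 2 + x * y + δ * y ^ 2 = 0) :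
    x = 0 ∧ y = 0 := by
  by_cases hy : y = 0
  · subst hy
    simpa using hxy
  · exfalso
    -- With y nonzero, division by y² would exhibit δ as s² + s for s = x/y.
    apply sq_add_self_ne h (x / y)
    have : (x / y) ^ 2 + x / y = (x ^ 2 + x * y) / y ^ 2 := by
      field_simp
    rw [this, CharTwo.add_eq_zero.1 hxy]
    field_simp

omit [CharP F 2] in
theorem add_pow_card {k : Type*} [Field k] [Algebra F k] (x y : k) :
    (x + y) ^ Fintype.card F = x ^ Fintype.card F + y ^ Fintype.card F :=
  map_add (FiniteField.frobeniusAlgHom F k) x y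

omit [CharP F 2] in
theorem algebraMap_pow_card {k : Type*} [Field k] [Algebra F k] (x : F) :
    algebraMap F k x ^ Fintype.card F = algebraMap F k x := by
  rw [← map_pow, FiniteField.pow_card]

omit [CharP F 2] in
-- Over F the polynomial X^q − X is the product of all X − a, so a root of it in an extension is one
-- of the a.
theorem exists_algebraMap_eq_of_pow_card {k : Type*} [Field k] [Algebra F k] {x : k}
    (hx : x ^ Fintype.card F = x) : ∃ a : F, algebraMap F k a = x := by
  open Polynomial in
  have hq : 1 < Fintype.card F := Fintype.one_lt_card
  have hs : (X ^ Fintype.card F - X : F[X]) = (Finset.univ.val.map fun a : F => X - C a).prod := by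
    rw [← FiniteField.roots_X_pow_card_sub_X]
    refine (Polynomial.prod_multiset_X_sub_C_of_monic_of_roots_card_eq ?_ ?_).symm
    · exact monic_X_pow_sub (by rw [degree_X]; exact_mod_cast hq)
    · rw [FiniteField.roots_X_pow_card_sub_X, FiniteField.X_pow_card_sub_X_natDegree_eq F hq]
      rfl
  have h0 : Polynomial.aeval x (X ^ Fintype.card F - X : F[X]) = 0 := by
    simp [hx]
  rw [hs, map_multiset_prod, Multiset.prod_eq_zero_iff] at h0
  simp only [Multiset.map_map, Multiset.mem_map, Function.comp_apply] at h0
  obtain ⟨a, -, ha⟩ := h0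
  refine ⟨a, ?_⟩
  rw [map_sub, Polynomial.aeval_X, Polynomial.aeval_C, sub_eq_zero] at ha
  exact ha.symm

/-- The roots of `X² + X + a` are conjugate when `Tr a = 1`. -/
theorem pow_card_of_tr_eq_one {k : Type*} [Field k] [Algebra F k] {a : F} (ha : Tr a = 1) {x : k}
    (hx : x ^ 2 + x = algebraMap F k a) : x ^ Fintype.card F = x + 1 := by
  have : CharP k 2 := charP_of_injective_algebraMap (algebraMap F k).injective 2
  have h1 : (x ^ Fintype.card F) ^ 2 + x ^ Fintype.card F = algebraMap F k a := by
    rw [← algebraMap_pow_card, ← hx, add_pow_card, ← pow_mul, ← pow_mul, mul_comm]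
  -- Both x and x^q solve X² + X = a, so their sum is 0 or 1. The sum 0 would make x rational,
  -- against the trace condition.
  have h2 : (x ^ Fintype.card F + x) * (x ^ Fintype.card F + x + 1) = 0 := by
    linear_combination h1 - hx + (x ^ 2 + x ^ Fintype.card F * x + x) * CharTwo.two_eq_zero (R := k)
  rcases mul_eq_zero.1 h2 with h | h
  · exfalso
    obtain ⟨s, hs⟩ := exists_algebraMap_eq_of_pow_card (F := F) (CharTwo.add_eq_zero.1 h)
    apply sq_add_self_ne ha s
    apply (algebraMap F k).injective
    rw [← hx, ← hs]
    simp
  · linear_combination h - (x + 1) * CharTwo.two_eq_zero (R := k)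

theorem exists_sq_add_self {k : Type*} [Field k] [IsAlgClosed k] (a : k) :
    ∃ x : k, x ^ 2 + x = a := by
  open Polynomial in
  obtain ⟨x, hx⟩ := IsAlgClosed.exists_root (X ^ 2 + X - C a : k[X]) (by
    have : (X ^ 2 + X - C a : k[X]).degree = 2 := by compute_degree!
    rw [this]
    decide)
  refine ⟨x, ?_⟩
  rw [Polynomial.IsRoot.def] at hx
  simpa [sub_eq_zero] using hx

end CharTwo

/-! ### Counting by parametrisation -/

section Counting

variable {F : Type*} [Field F] [Fintype F]

theorem ncard_eq_card_of_param {X W : Type*} {S : Set W} (e : X → W) (he : Function.Injective e)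
    (hS : ∀ w, w ∈ S ↔ ∃ x, e x = w) : S.ncard = Nat.card X := by
  have : S = Set.range e := Set.ext hS
  rw [this, ← Set.image_univ, Set.ncard_image_of_injective _ he, Set.ncard_univ]

/-- Counting the zeros of `a(w) φ(x) + b(w)` for a permutation `φ` of `F`. -/
theorem ncard_linear_zeros {W : Type*} [Finite W] (φ : F → F) (hφ : Function.Bijective φ)
    (a b : W → F) :
    {p : W × F | a p.1 * φ p.2 + b p.1 = 0}.ncard + {w | a w = 0}.ncard =
      Nat.card W + Fintype.card F * {w | a w = 0 ∧ b w = 0}.ncard := by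
  classical
  -- Over a point w with a(w) ≠ 0 there is exactly one zero x; over one with a(w) = 0 there are q
  -- zeros or none, according to b(w).
  have hsplit : {p : W × F | a p.1 * φ p.2 + b p.1 = 0} =
      {p : W × F | a p.1 ≠ 0 ∧ a p.1 * φ p.2 + b p.1 = 0} ∪
      {w | a w = 0 ∧ b w = 0} ×ˢ (Set.univ : Set F) := by
    ext ⟨w, x⟩
    by_cases h : a w = 0 <;> simp [h]
  have hdisj : Disjoint {p : W × F | a p.1 ≠ 0 ∧ a p.1 * φ p.2 + b p.1 = 0}
      ({w | a w = 0 ∧ b w = 0} ×ˢ (Set.univ : Set F)) := by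
    rw [Set.disjoint_left]
    rintro ⟨w, x⟩ h1 h2
    exact h1.1 h2.1.1
  have h1 : {p : W × F | a p.1 ≠ 0 ∧ a p.1 * φ p.2 + b p.1 = 0}.ncard =
      {w | a w = 0}ᶜ.ncard := by
    rw [← Nat.card_coe_set_eq {w | a w = 0}ᶜ]
    obtain ⟨ψ, hψ₁, hψ₂⟩ := Function.bijective_iff_has_inverse.1 hφ
    apply ncard_eq_card_of_param
      (fun w : ({w | a w = 0}ᶜ : Set W) => ((w : W), ψ (-(b w) / a w)))
    · intro u v huv
      exact Subtype.ext (congrArg Prod.fst huv)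
    · rintro ⟨w, x⟩
      constructor
      · rintro ⟨hw, hx⟩
        have hw : a w ≠ 0 := hw
        refine ⟨⟨w, hw⟩, Prod.ext rfl ?_⟩
        change ψ (-(b w) / a w) = x
        rw [← hψ₁ x]
        congr 1
        have hx : a w * φ x + b w = 0 := hx
        field_simp
        linear_combination -hx
      · rintro ⟨⟨u, hu⟩, huv⟩
        have h2 : u = w := congrArg Prod.fst huv
        have h3 : ψ (-(b u) / a u) = x := congrArg Prod.snd huv
        subst h2
        refine ⟨hu, ?_⟩
        change a u * φ x + b u = 0
        have hu : a u ≠ 0 := hu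
        rw [← h3, hψ₂]
        field_simp
        ring
  rw [hsplit, Set.ncard_union_eq hdisj (Set.toFinite _) (Set.toFinite _), h1, Set.ncard_prod,
    Set.ncard_univ, Nat.card_eq_fintype_card (α := F)]
  have := Set.ncard_add_ncard_compl {w | a w = 0}
  linarith

theorem sq_bijective [CharP F 2] : Function.Bijective (fun x : F => x ^ 2) :=
  ⟨fun _ _ h => sq_inj h, exists_sq_eq⟩

end Counting

end VeroneseSolids

namespace VeroneseSolids

open TernaryForm

/-! ### Point-orbit distributions as counts of vectors -/

section PointCounts

variable {F : Type*} [Field F] [Fintype F]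

/-- Each projective point accounts for `q - 1` nonzero vectors. -/
theorem ncard_points_mul (U : Submodule F (Sym F)) (Q : Sym F → Prop)
    (hQ : ∀ (c : F) (M : Sym F), c ≠ 0 → Q M → Q (c • M)) :
    {P : ℙ F (Sym F) | P.submodule ≤ U ∧ Q P.rep}.ncard * (Fintype.card F - 1) =
      {M : Sym F | M ∈ U ∧ M ≠ 0 ∧ Q M}.ncard := by
  classical
  symm
  rw [← Fintype.card_units, ← Nat.card_coe_set_eq {P : ℙ F (Sym F) | P.submodule ≤ U ∧ Q P.rep},
    ← Nat.card_eq_fintype_card, ← Nat.card_prod]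
  apply ncard_eq_card_of_param (fun x : {P : ℙ F (Sym F) | P.submodule ≤ U ∧ Q P.rep} × Fˣ =>
    (x.2 : F) • x.1.1.rep)
  · rintro ⟨⟨P, hP⟩, c⟩ ⟨⟨P', hP'⟩, c'⟩ h
    have h : (c : F) • P.rep = (c' : F) • P'.rep := h
    have hPP : P = P' := by
      rw [← P.mk_rep, ← P'.mk_rep, Projectivization.mk_eq_mk_iff']
      refine ⟨(c : F)⁻¹ * c', ?_⟩
      rw [mul_smul, ← h, smul_smul, inv_mul_cancel₀ c.ne_zero, one_smul]
    subst hPP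
    have hc := smul_left_injective F P.rep_nonzero h
    exact Prod.ext rfl (Units.ext hc)
  · intro M
    constructor
    · rintro ⟨hM, h0, hQM⟩
      obtain ⟨a, ha⟩ := Projectivization.exists_smul_eq_mk_rep F M h0
      have ha : (a : F) • M = (Projectivization.mk F M h0).rep := ha
      refine ⟨⟨⟨Projectivization.mk F M h0, ?_, ?_⟩, a⁻¹⟩, ?_⟩
      · rw [Projectivization.submodule_mk, Submodule.span_singleton_le_iff_mem]
        exact hM
      · rw [← ha]
        exact hQ _ _ a.ne_zero hQM
      · change ((a⁻¹ : Fˣ) : F) • (Projectivization.mk F M h0).rep = M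
        rw [← ha, smul_smul, Units.inv_mul, one_smul]
    · rintro ⟨⟨⟨P, hPU, hPQ⟩, c⟩, rfl⟩
      refine ⟨U.smul_mem _ ?_, smul_ne_zero c.ne_zero P.rep_nonzero, hQ _ _ c.ne_zero hPQ⟩
      apply hPU
      change P.rep ∈ P.submodule
      rw [Projectivization.submodule_eq]
      exact Submodule.mem_span_singleton_self _

omit [Fintype F] in
theorem rank_smul_eq {c : F} (hc : c ≠ 0) (M : Matrix (Fin 3) (Fin 3) F) :
    (c • M).rank = M.rank :=
  Matrix.rank_smul_of_mem_nonZeroDivisors M (mem_nonZeroDivisors_of_ne_zero hc)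

/-- A matrix is alternating if its diagonal vanishes. -/
def ZeroDiag (M : Sym F) : Prop := ∀ i, M.1 i i = 0

theorem pointOD_mul (U : Submodule F (Sym F)) :
    pointOD U 0 * (Fintype.card F - 1) = {M : Sym F | M ∈ U ∧ M ≠ 0 ∧ M.1.rank = 1}.ncard ∧
    pointOD U 1 * (Fintype.card F - 1) =
      {M : Sym F | M ∈ U ∧ M ≠ 0 ∧ (M.1.rank = 2 ∧ ZeroDiag M)}.ncard ∧
    pointOD U 2 * (Fintype.card F - 1) =
      {M : Sym F | M ∈ U ∧ M ≠ 0 ∧ (M.1.rank = 2 ∧ ¬ ZeroDiag M)}.ncard ∧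
    pointOD U 3 * (Fintype.card F - 1) = {M : Sym F | M ∈ U ∧ M ≠ 0 ∧ M.1.rank = 3}.ncard := by
  have hr : ∀ (c : F) (M : Sym F), c ≠ 0 → (c • M).1.rank = M.1.rank :=
    fun c M hc => rank_smul_eq hc M.1
  have hz : ∀ (c : F) (M : Sym F), c ≠ 0 → (ZeroDiag (c • M) ↔ ZeroDiag M) := by
    intro c M hc
    simp [ZeroDiag, hc]
  refine ⟨?_, ?_, ?_, ?_⟩
  · rw [← ncard_points_mul U (fun M => M.1.rank = 1) (fun c M hc h => (hr c M hc).trans h)]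
    rfl
  · rw [← ncard_points_mul U (fun M => M.1.rank = 2 ∧ ZeroDiag M)
      (fun c M hc h => ⟨(hr c M hc).trans h.1, (hz c M hc).2 h.2⟩)]
    refine congrArg (fun s : Set (ℙ F (Sym F)) => s.ncard * (Fintype.card F - 1)) ?_
    ext P
    exact and_assoc
  · rw [← ncard_points_mul U (fun M => M.1.rank = 2 ∧ ¬ ZeroDiag M)
      (fun c M hc h => ⟨(hr c M hc).trans h.1, fun h' => h.2 ((hz c M hc).1 h')⟩)]
    refine congrArg (fun s : Set (ℙ F (Sym F)) => s.ncard * (Fintype.card F - 1)) ?_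
    ext P
    exact and_assoc
  · rw [← ncard_points_mul U (fun M => M.1.rank = 3) (fun c M hc h => (hr c M hc).trans h)]
    rfl

theorem card_sub_one_pos : 0 < Fintype.card F - 1 := by
  have : 1 < Fintype.card F := Fintype.one_lt_card
  omega

omit [Fintype F] in
theorem congrEquiv_inv_apply (A : GL (Fin 3) F) (M : Sym F) :
    congrEquiv A⁻¹ (congrEquiv A M) = M :=
  (congrEquiv A).symm_apply_apply M

omit [Fintype F] in
theorem rank_congrEquiv (A : GL (Fin 3) F) (M : Sym F) : (congrEquiv A M).1.rank = M.1.rank := by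
  rw [congrEquiv_apply]
  have hA : IsUnit A.1.det := Matrix.isUnits_det_units A
  rw [Matrix.rank_mul_eq_left_of_isUnit_det _ _ (by rwa [det_transpose]),
    Matrix.rank_mul_eq_right_of_isUnit_det _ _ hA]

omit [Fintype F] in
-- When the diagonal of M vanishes, each diagonal entry of A M Aᵀ is twice a sum of products. This
-- is the invariance of the nucleus plane.
theorem ZeroDiag.congrEquiv [CharP F 2] (A : GL (Fin 3) F) {M : Sym F} (h : ZeroDiag M) :
    ZeroDiag (congrEquiv A M) := by
  intro i
  have h1 := sym_apply M 1 0
  have h2 := sym_apply M 2 0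
  have h3 := sym_apply M 2 1
  rw [congrEquiv_apply]
  simp only [Matrix.mul_apply, Fin.sum_univ_three, transpose_apply, h 0, h 1, h 2, h1, h2, h3]
  linear_combination (A.1 i 0 * A.1 i 1 * M.1 0 1 + A.1 i 0 * A.1 i 2 * M.1 0 2 +
    A.1 i 1 * A.1 i 2 * M.1 1 2) * CharTwo.two_eq_zero (R := F)

omit [Fintype F] in
theorem ncard_alpha (A : GL (Fin 3) F) (U : Submodule F (Sym F)) (Q : Sym F → Prop)
    (hQ : ∀ (A : GL (Fin 3) F) (M : Sym F), Q M → Q (congrEquiv A M)) :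
    {M : Sym F | M ∈ alpha F A U ∧ M ≠ 0 ∧ Q M}.ncard =
      {M : Sym F | M ∈ U ∧ M ≠ 0 ∧ Q M}.ncard := by
  rw [← Set.ncard_image_of_injective {M : Sym F | M ∈ U ∧ M ≠ 0 ∧ Q M} (congrEquiv A).injective]
  congr 1
  ext M
  rw [alpha_apply]
  constructor
  · rintro ⟨⟨N, hN, rfl⟩, h0, hq⟩
    refine ⟨N, ⟨hN, ?_, ?_⟩, rfl⟩
    · rintro rfl
      exact h0 (map_zero _)
    · have := hQ A⁻¹ _ hq
      rwa [show ((congrEquiv A : Sym F →ₗ[F] Sym F) N) = congrEquiv A N from rfl,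
        congrEquiv_inv_apply] at this
  · rintro ⟨N, ⟨hN, h0, hq⟩, rfl⟩
    exact ⟨⟨N, hN, rfl⟩, (congrEquiv A).map_ne_zero_iff.2 h0, hQ _ _ hq⟩

theorem pointOD_alpha [CharP F 2] (A : GL (Fin 3) F) (U : Submodule F (Sym F)) (j : Fin 4) :
    pointOD (alpha F A U) j = pointOD U j := by
  obtain ⟨h0, h1, h2, h3⟩ := pointOD_mul U
  obtain ⟨h0', h1', h2', h3'⟩ := pointOD_mul (alpha F A U)
  have hr : ∀ n, ∀ (A : GL (Fin 3) F) (M : Sym F), M.1.rank = n → (congrEquiv A M).1.rank = n :=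
    fun n A M h => (rank_congrEquiv A M).trans h
  have hz : ∀ (A : GL (Fin 3) F) (M : Sym F), ¬ ZeroDiag M → ¬ ZeroDiag (congrEquiv A M) := by
    intro A M h h'
    apply h
    have := h'.congrEquiv A⁻¹
    rwa [congrEquiv_inv_apply] at this
  rw [ncard_alpha A U _ (hr 1), ← h0] at h0'
  rw [ncard_alpha A U _ (fun A M h => ⟨hr 2 A M h.1, h.2.congrEquiv A⟩), ← h1] at h1'
  rw [ncard_alpha A U _ (fun A M h => ⟨hr 2 A M h.1, hz A M h.2⟩), ← h2] at h2'
  rw [ncard_alpha A U _ (hr 3), ← h3] at h3'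
  fin_cases j
  · exact Nat.eq_of_mul_eq_mul_right card_sub_one_pos h0'
  · exact Nat.eq_of_mul_eq_mul_right card_sub_one_pos h1'
  · exact Nat.eq_of_mul_eq_mul_right card_sub_one_pos h2'
  · exact Nat.eq_of_mul_eq_mul_right card_sub_one_pos h3'

variable [CharP F 2]

/-- All columns are multiples of one vector, so by symmetry mᵢⱼ² = mᵢᵢmⱼⱼ. The vector v of square
roots of the diagonal then works, because squaring is injective. -/
theorem exists_outer_of_rank_le_one {M : Sym F} (h : M.1.rank ≤ 1) : ∃ v, M = outer v := by
  rw [Matrix.rank_eq_finrank_span_cols, finrank_le_one_iff] at h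
  obtain ⟨⟨u, hu⟩, h⟩ := h
  have hcol : ∀ j, ∃ c : F, ∀ i, M.1 i j = c * u i := by
    intro j
    obtain ⟨c, hc⟩ := h ⟨M.1.col j, Submodule.subset_span ⟨j, rfl⟩⟩
    refine ⟨c, fun i => ?_⟩
    have := congrFun (congrArg Subtype.val hc) i
    exact this.symm
  choose c hc using hcol
  choose s hs using fun a : F => exists_sq_eq a
  refine ⟨fun i => s (M.1 i i), ?_⟩
  apply Subtype.ext
  ext i j
  simp only [outer, vecMulVec_apply]
  apply sq_inj
  rw [mul_pow, hs, hs]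
  have := sym_apply M i j
  calc M.1 i j ^ 2 = M.1 i j * M.1 j i := by rw [← this, sq]
    _ = M.1 i i * M.1 j j := by
      rw [hc, hc, hc, hc]
      ring

omit [Fintype F] in
theorem outer_injective : Function.Injective (outer : (Fin 3 → F) → Sym F) := by
  intro u v h
  ext i
  have := congrArg (fun M : Sym F => M.1 i i) h
  simp only [outer, vecMulVec_apply, ← sq] at this
  exact sq_inj this

omit [Fintype F] [CharP F 2] in
theorem outer_zero : outer (0 : Fin 3 → F) = 0 := by
  apply Subtype.ext
  simp [outer]

omit [Fintype F] in
theorem outer_ne_zero {v : Fin 3 → F} (hv : v ≠ 0) : outer v ≠ 0 := by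
  rw [← outer_zero]
  exact outer_injective.ne hv

omit [Fintype F] [CharP F 2] in
theorem rank_eq_zero_imp {M : Sym F} (h : M.1.rank = 0) : M = 0 := by
  apply Subtype.ext
  rw [Matrix.rank_eq_finrank_span_cols, Submodule.finrank_eq_zero, Submodule.span_eq_bot] at h
  ext i j
  exact congrFun (h _ ⟨j, rfl⟩) i

theorem rank_eq_one_iff {M : Sym F} : M.1.rank = 1 ↔ ∃ v, v ≠ 0 ∧ M = outer v := by
  constructor
  · intro h
    obtain ⟨v, rfl⟩ := exists_outer_of_rank_le_one h.le
    refine ⟨v, ?_, rfl⟩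
    rintro rfl
    rw [outer_zero] at h
    simp at h
  · rintro ⟨v, hv, rfl⟩
    refine le_antisymm (Matrix.rank_vecMulVec_le v v) (Nat.one_le_iff_ne_zero.2 fun h => ?_)
    exact outer_ne_zero hv (rank_eq_zero_imp h)

omit [Fintype F] [CharP F 2] in
theorem rank_eq_three_iff {M : Sym F} : M.1.rank = 3 ↔ M.1.det ≠ 0 := by
  constructor
  · intro h h0
    obtain ⟨v, hv, hMv⟩ := Matrix.exists_mulVec_eq_zero_iff.2 h0
    have h1 := LinearMap.finrank_range_add_finrank_ker (Matrix.mulVecLin M.1)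
    have h2 : Module.finrank F (LinearMap.range (Matrix.mulVecLin M.1)) = 3 := h
    rw [h2, Module.finrank_fin_fun, Nat.add_eq_left, Submodule.finrank_eq_zero] at h1
    exact hv ((Submodule.eq_bot_iff _).1 h1 v hMv)
  · intro h
    simpa using Matrix.rank_of_det_ne_zero h

/-- The determinant is 2m₀₁m₀₂m₁₂ = 0, and rank one would mean M = v vᵀ with every vᵢ² = 0. -/
theorem rank_of_zeroDiag {M : Sym F} (h : ZeroDiag M) (h0 : M ≠ 0) : M.1.rank = 2 := by
  have h1 : M.1.rank ≤ 3 := by simpa using M.1.rank_le_card_width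
  have h2 : M.1.rank ≠ 3 := by
    rw [Ne, rank_eq_three_iff, not_not, Matrix.det_fin_three, h 0, h 1, h 2, sym_apply M 1 0,
      sym_apply M 2 0, sym_apply M 2 1]
    linear_combination (M.1 0 1 * M.1 0 2 * M.1 1 2) * CharTwo.two_eq_zero (R := F)
  have h3 : M.1.rank ≠ 1 := by
    intro h3
    obtain ⟨v, hv, rfl⟩ := rank_eq_one_iff.1 h3
    apply hv
    ext i
    have := h i
    simpa [outer, vecMulVec_apply] using this
  have h4 : M.1.rank ≠ 0 := fun h4 => h0 (rank_eq_zero_imp h4)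
  omega

/-- The point-orbit distribution of a pencil in terms of numbers of vectors: common zeros of the
two forms, alternating matrices, and nonsingular matrices. -/
theorem pointOD_pencil (f₁ f₂ : TernaryForm F) :
    pointOD (pencil f₁ f₂) 0 * (Fintype.card F - 1) =
      {v : Fin 3 → F | v ≠ 0 ∧ f₁.eval v = 0 ∧ f₂.eval v = 0}.ncard ∧
    pointOD (pencil f₁ f₂) 1 * (Fintype.card F - 1) + 1 =
      {M : Sym F | M ∈ pencil f₁ f₂ ∧ ZeroDiag M}.ncard ∧
    pointOD (pencil f₁ f₂) 3 * (Fintype.card F - 1) =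
      {M : Sym F | M ∈ pencil f₁ f₂ ∧ M.1.det ≠ 0}.ncard ∧
    (pointOD (pencil f₁ f₂) 0 + pointOD (pencil f₁ f₂) 1 + pointOD (pencil f₁ f₂) 2 +
      pointOD (pencil f₁ f₂) 3) * (Fintype.card F - 1) + 1 = Nat.card (pencil f₁ f₂) := by
  obtain ⟨h0, h1, h2, h3⟩ := pointOD_mul (pencil f₁ f₂)
  have e0 : {M : Sym F | M ∈ pencil f₁ f₂ ∧ M ≠ 0 ∧ M.1.rank = 1} =
      outer '' {v : Fin 3 → F | v ≠ 0 ∧ f₁.eval v = 0 ∧ f₂.eval v = 0} := by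
    ext M
    constructor
    · rintro ⟨hM, -, hr⟩
      obtain ⟨v, hv, rfl⟩ := rank_eq_one_iff.1 hr
      rw [mem_pencil, pair_outer, pair_outer] at hM
      exact ⟨v, ⟨hv, hM.1, hM.2⟩, rfl⟩
    · rintro ⟨v, ⟨hv, h1, h2⟩, rfl⟩
      refine ⟨?_, outer_ne_zero hv, rank_eq_one_iff.2 ⟨v, hv, rfl⟩⟩
      rw [mem_pencil, pair_outer, pair_outer]
      exact ⟨h1, h2⟩
  -- The zero matrix is alternating but is not a point; it accounts for the added 1.
  have e1 : {M : Sym F | M ∈ pencil f₁ f₂ ∧ ZeroDiag M} = insert 0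
      {M : Sym F | M ∈ pencil f₁ f₂ ∧ M ≠ 0 ∧ (M.1.rank = 2 ∧ ZeroDiag M)} := by
    ext M
    by_cases hM : M = 0
    · subst hM
      simp [ZeroDiag]
    · constructor
      · rintro ⟨a, b⟩
        exact Or.inr ⟨a, hM, rank_of_zeroDiag b hM, b⟩
      · rintro (h | ⟨a, -, -, b⟩)
        · exact absurd h hM
        · exact ⟨a, b⟩
  have e3 : {M : Sym F | M ∈ pencil f₁ f₂ ∧ M.1.det ≠ 0} =
      {M : Sym F | M ∈ pencil f₁ f₂ ∧ M ≠ 0 ∧ M.1.rank = 3} := by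
    ext M
    constructor
    · rintro ⟨a, b⟩
      refine ⟨a, ?_, rank_eq_three_iff.2 b⟩
      rintro rfl
      simp at b
    · rintro ⟨a, -, b⟩
      exact ⟨a, rank_eq_three_iff.1 b⟩
  have eall : (pencil f₁ f₂ : Set (Sym F)) = insert 0
      ({M : Sym F | M ∈ pencil f₁ f₂ ∧ M ≠ 0 ∧ M.1.rank = 1} ∪
      {M : Sym F | M ∈ pencil f₁ f₂ ∧ M ≠ 0 ∧ (M.1.rank = 2 ∧ ZeroDiag M)} ∪
      {M : Sym F | M ∈ pencil f₁ f₂ ∧ M ≠ 0 ∧ (M.1.rank = 2 ∧ ¬ ZeroDiag M)} ∪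
      {M : Sym F | M ∈ pencil f₁ f₂ ∧ M ≠ 0 ∧ M.1.rank = 3}) := by
    ext M
    by_cases hM : M = 0
    · subst hM
      simp
    · have hr1 : M.1.rank ≤ 3 := by simpa using M.1.rank_le_card_width
      have hr0 : M.1.rank ≠ 0 := fun h4 => hM (rank_eq_zero_imp h4)
      have hr : M.1.rank = 1 ∨ M.1.rank = 2 ∨ M.1.rank = 3 := by omega
      by_cases hz : ZeroDiag M <;> rcases hr with h | h | h <;> simp [hM, hz, h]
  have hfin : ∀ S : Set (Sym F), S.Finite := fun S => Set.toFinite S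
  refine ⟨?_, ?_, ?_, ?_⟩
  · rw [h0, e0, Set.ncard_image_of_injective _ outer_injective]
  · rw [h1, e1, Set.ncard_insert_of_notMem (fun h => h.2.1 rfl) (hfin _)]
  · rw [h3, e3]
  · rw [add_mul, add_mul, add_mul, h0, h1, h2, h3]
    change _ = Nat.card (pencil f₁ f₂ : Set (Sym F))
    rw [Nat.card_coe_set_eq, eall, Set.ncard_insert_of_notMem ?_ (hfin _),
      Set.ncard_union_eq ?_ (hfin _) (hfin _), Set.ncard_union_eq ?_ (hfin _) (hfin _),
      Set.ncard_union_eq ?_ (hfin _) (hfin _)]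
    · rw [Set.disjoint_left]
      rintro M ⟨-, -, a⟩ ⟨-, -, b, -⟩
      omega
    · rw [Set.disjoint_left]
      rintro M (⟨-, -, a⟩ | ⟨-, -, a, a'⟩) ⟨-, -, b, b'⟩
      · omega
      · exact b' a'
    · rw [Set.disjoint_left]
      rintro M ((⟨-, -, a⟩ | ⟨-, -, a, -⟩) | ⟨-, -, a, -⟩) ⟨-, -, b⟩ <;> omega
    · rintro (((h | h) | h) | h) <;> exact h.2.1 rfl

end PointCounts

end VeroneseSolids

namespace VeroneseSolids

open TernaryForm

/-! ### Invariance of the conic types and of the hyperplane distribution -/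

section ConicTypes

variable {F : Type*} [Field F]

/-- A property of conics: it is invariant under scaling and linear substitutions, and the zero
form does not have it. -/
structure IsConicType (T : TernaryForm F → Prop) : Prop where
  ne_zero : ∀ {f}, T f → f ≠ zeroForm F
  scale : ∀ {f} (c : F), c ≠ 0 → T f → T (comb c 0 f f)
  subst : ∀ {f} (A : Matrix (Fin 3) (Fin 3) F), A.det ≠ 0 → T f → T (f.subst A)

theorem comb_prodLin (a c : F) (l m : Fin 3 → F) :
    comb a 0 (prodLin c l m) (prodLin c l m) = prodLin (a * c) l m := by
  ext <;> simp only [comb, prodLin] <;> ring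

theorem transpose_mulVec_injective {R : Type*} [Field R] {A : Matrix (Fin 3) (Fin 3) R}
    (hA : A.det ≠ 0) : Function.Injective (fun v => Aᵀ *ᵥ v) :=
  Matrix.mulVec_injective_of_isUnit ((Matrix.isUnit_iff_isUnit_det _).2
    (by rw [det_transpose]; exact hA.isUnit))

theorem linearIndependent_mulVec {R : Type*} [Field R] {A : Matrix (Fin 3) (Fin 3) R}
    (hA : A.det ≠ 0) {l m : Fin 3 → R} (h : LinearIndependent R ![l, m]) :
    LinearIndependent R ![Aᵀ *ᵥ l, Aᵀ *ᵥ m] := by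
  rw [LinearIndependent.pair_iff] at h ⊢
  intro s t hst
  apply h
  apply transpose_mulVec_injective hA
  simpa [Matrix.mulVec_add, Matrix.mulVec_smul] using hst

/-- The product rule at a point where the first factor vanishes. -/
theorem prodLin_grad_of_zero {R : Type*} [CommRing R] (c : R) (l m v : Fin 3 → R)
    (hv : l 0 * v 0 + l 1 * v 1 + l 2 * v 2 = 0) (i : Fin 3) :
    (prodLin c l m).grad v i = c * (m 0 * v 0 + m 1 * v 1 + m 2 * v 2) * l i := by
  fin_cases i <;> simp [grad, prodLin]
  · linear_combination c * m 0 * hv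
  · linear_combination c * m 1 * hv
  · linear_combination c * m 2 * hv

theorem isConicType_doubleLine : IsConicType (IsDoubleLine (F := F)) where
  ne_zero := by
    rintro _ ⟨c, hc, l, hl, rfl⟩ h
    apply hl
    have h0 : c * (l 0 * l 0) = 0 := congrArg TernaryForm.a00 h
    have h1 : c * (l 1 * l 1) = 0 := congrArg TernaryForm.a11 h
    have h2 : c * (l 2 * l 2) = 0 := congrArg TernaryForm.a22 h
    ext i
    fin_cases i
    · simpa [hc] using h0
    · simpa [hc] using h1
    · simpa [hc] using h2
  scale := by
    rintro _ a ha ⟨c, hc, l, hl, rfl⟩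
    exact ⟨a * c, mul_ne_zero ha hc, l, hl, comb_prodLin ..⟩
  subst := by
    rintro _ A hA ⟨c, hc, l, hl, rfl⟩
    refine ⟨c, hc, Aᵀ *ᵥ l, ?_, subst_prodLin ..⟩
    intro h
    apply hl
    apply transpose_mulVec_injective hA
    simpa using h

theorem linearIndependent_iff_minors {R : Type*} [Field R] {l m : Fin 3 → R} :
    LinearIndependent R ![l, m] ↔
      ¬ (l 1 * m 2 - l 2 * m 1 = 0 ∧ l 2 * m 0 - l 0 * m 2 = 0 ∧ l 0 * m 1 - l 1 * m 0 = 0) := by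
  rw [← crossProduct_ne_zero_iff_linearIndependent, cross_apply]
  simp

/-- For independent linear forms there is a zero of the first which is not one of the second. -/
theorem exists_zero_of_linearIndependent {R : Type*} [Field R] {l m : Fin 3 → R}
    (h : LinearIndependent R ![l, m]) : ∃ v : Fin 3 → R,
      l 0 * v 0 + l 1 * v 1 + l 2 * v 2 = 0 ∧ m 0 * v 0 + m 1 * v 1 + m 2 * v 2 ≠ 0 := by
  by_contra! hcon
  -- The three test vectors are zeros of l, and on them m takes the 2 × 2 minors of the pair up to
  -- sign. If all vanish, l and m are dependent.
  have h0 := hcon ![l 1, -l 0, 0] (by simp; ring)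
  have h1 := hcon ![l 2, 0, -l 0] (by simp; ring)
  have h2 := hcon ![0, l 2, -l 1] (by simp; ring)
  simp at h0 h1 h2
  refine linearIndependent_iff_minors.1 h ⟨?_, ?_, ?_⟩
  · linear_combination -h2
  · linear_combination h1
  · linear_combination -h0

/-- For nonvanishing, at a zero of l outside the other line the gradient of c l m is a nonzero
multiple of l, whereas the zero form has zero gradient. -/
theorem isConicType_realLinePair : IsConicType (IsRealLinePair (F := F)) where
  ne_zero := by
    rintro _ ⟨c, hc, l, m, hlm, rfl⟩ h
    obtain ⟨v, hv, hm⟩ := exists_zero_of_linearIndependent hlm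
    have hl : l = 0 := by
      ext i
      have h1 := prodLin_grad_of_zero c l m v hv i
      rw [h] at h1
      have h2 : (zeroForm F).grad v i = 0 := by
        fin_cases i <;> simp [grad, zeroForm]
      rw [h2] at h1
      simpa [hc, hm] using h1.symm
    rw [LinearIndependent.pair_iff] at hlm
    exact one_ne_zero (hlm 1 0 (by simp [hl])).1
  scale := by
    rintro _ a ha ⟨c, hc, l, m, hlm, rfl⟩
    exact ⟨a * c, mul_ne_zero ha hc, l, m, hlm, comb_prodLin ..⟩
  subst := by
    rintro _ A hA ⟨c, hc, l, m, hlm, rfl⟩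
    exact ⟨c, hc, Aᵀ *ᵥ l, Aᵀ *ᵥ m, linearIndependent_mulVec hA hlm, subst_prodLin ..⟩

theorem isConicType_nonsingular : IsConicType (IsNonsingular (F := F)) where
  ne_zero := by
    rintro _ h rfl
    refine h ![1, 0, 0] (fun h => one_ne_zero (congrFun h 0)) ⟨?_, ?_⟩
    · simp [eval, TernaryForm.map, zeroForm]
    · ext i
      fin_cases i <;> simp [grad, TernaryForm.map, zeroForm]
  scale := by
    rintro f c hc h v hv ⟨h1, h2⟩
    have hc' : algebraMap F (AlgebraicClosure F) c ≠ 0 := by simpa using hc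
    refine h v hv ⟨?_, ?_⟩
    · rw [map_comb, eval_comb] at h1
      simpa [hc'] using h1
    · ext i
      have h3 := congrFun h2 i
      apply mul_left_cancel₀ hc'
      rw [Pi.zero_apply, mul_zero, ← Pi.zero_apply (M := fun _ : Fin 3 => AlgebraicClosure F) i,
        ← h3]
      rw [map_comb]
      fin_cases i <;> simp [grad, comb] <;> ring
  subst := by
    rintro f A hA h v hv ⟨h1, h2⟩
    have hA' : (A.map (algebraMap F (AlgebraicClosure F))).det ≠ 0 := by
      have : (A.map (algebraMap F (AlgebraicClosure F))).det =
        algebraMap F (AlgebraicClosure F) A.det := (RingHom.map_det _ A).symm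
      rw [this]
      simpa using hA
    rw [map_subst] at h1 h2
    refine h (A.map (algebraMap F (AlgebraicClosure F)) *ᵥ v) ?_ ⟨?_, ?_⟩
    · intro h0
      exact hv (Matrix.eq_zero_of_mulVec_eq_zero hA' h0)
    · rw [← eval_subst, h1]
    · rw [grad_subst] at h2
      apply transpose_mulVec_injective hA'
      simpa using h2

variable [Fintype F]

theorem isConicType_imaginaryLinePair : IsConicType (IsImaginaryLinePair (F := F)) where
  ne_zero := by
    rintro _ ⟨c, hc, l, hl, hli, h⟩ rfl
    have hc' : algebraMap F (AlgebraicClosure F) c ≠ 0 := by simpa using hc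
    have h' := (isConicType_realLinePair (F := AlgebraicClosure F)).ne_zero
      ⟨_, hc', l, _, hli, rfl⟩
    rw [← h] at h'
    apply h'
    ext <;> simp [TernaryForm.map, zeroForm]
  scale := by
    rintro f a ha ⟨c, hc, l, hl, hli, h⟩
    refine ⟨a * c, mul_ne_zero ha hc, l, hl, hli, ?_⟩
    rw [map_comb, h, map_zero, comb_prodLin, map_mul]
  subst := by
    rintro f A hA ⟨c, hc, l, hl, hli, h⟩
    have hA' : (A.map (algebraMap F (AlgebraicClosure F))).det ≠ 0 := by
      have : (A.map (algebraMap F (AlgebraicClosure F))).det =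
        algebraMap F (AlgebraicClosure F) A.det := (RingHom.map_det _ A).symm
      rw [this]
      simpa using hA
    -- A has entries in F, so it commutes with the q-power map and sends conjugate linear forms to
    -- conjugate ones.
    have key : (fun i => ((A.map (algebraMap F (AlgebraicClosure F)))ᵀ *ᵥ l) i ^ Fintype.card F) =
        (A.map (algebraMap F (AlgebraicClosure F)))ᵀ *ᵥ fun i => l i ^ Fintype.card F := by
      ext i
      simp only [mulVec_three, transpose_apply, map_apply]
      rw [add_pow_card, add_pow_card, mul_pow, mul_pow, mul_pow, algebraMap_pow_card,
        algebraMap_pow_card, algebraMap_pow_card]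
    refine ⟨c, hc, (A.map (algebraMap F (AlgebraicClosure F)))ᵀ *ᵥ l, ?_, ?_, ?_⟩
    · intro i
      have h1 := congrFun key i
      have h2 : ∀ x : AlgebraicClosure F, x ^ Fintype.card F ^ 2 =
        (x ^ Fintype.card F) ^ Fintype.card F := fun x => by rw [← pow_mul, sq]
      rw [h2]
      rw [h1]
      simp only [mulVec_three, transpose_apply, map_apply]
      rw [add_pow_card, add_pow_card, mul_pow, mul_pow, mul_pow, algebraMap_pow_card,
        algebraMap_pow_card, algebraMap_pow_card, ← h2, ← h2, ← h2, hl, hl, hl]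
    · rw [key]
      exact linearIndependent_mulVec hA' hli
    · rw [key, map_subst, h, subst_prodLin]

omit [Fintype F] in
theorem ncard_hyperplanesThrough_alpha {T : TernaryForm F → Prop} (hT : IsConicType T)
    (A : GL (Fin 3) F) (U : Submodule F (Sym F)) :
    (hyperplanesThrough (alpha F A U) T).ncard = (hyperplanesThrough U T).ncard := by
  rw [← Set.ncard_image_of_injective (hyperplanesThrough U T) (alpha F A).injective]
  congr 1
  have hdet : ∀ B : GL (Fin 3) F, B.1.det ≠ 0 := fun B => (Matrix.isUnits_det_units B).ne_zero
  ext H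
  constructor
  · rintro ⟨h5, hU, f, hf, rfl⟩
    refine ⟨(f.subst A.1).delta, ⟨?_, ?_, f.subst A.1, hT.subst _ (hdet A) hf, rfl⟩, ?_⟩
    · exact finrank_delta (hT.ne_zero (hT.subst _ (hdet A) hf))
    · have h : (f.subst A.1).delta = alpha F A⁻¹ f.delta := by rw [alpha_delta, inv_inv]
      rw [h, map_inv]
      exact (alpha F A).le_symm_apply.2 hU
    · rw [alpha_delta, ← subst_mul, ← Units.val_mul, mul_inv_cancel, Units.val_one, subst_one]
  · rintro ⟨_, ⟨h5, hU, f, hf, rfl⟩, rfl⟩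
    refine ⟨(finrank_alpha A _).trans h5, (alpha F A).monotone hU, f.subst (A⁻¹ : GL (Fin 3) F).1,
      hT.subst _ (hdet A⁻¹) hf, alpha_delta A f⟩

theorem hyperplaneOD_alpha (A : GL (Fin 3) F) (U : Submodule F (Sym F)) (j : Fin 4) :
    hyperplaneOD (alpha F A U) j = hyperplaneOD U j := by
  fin_cases j
  · exact ncard_hyperplanesThrough_alpha isConicType_doubleLine A U
  · exact ncard_hyperplanesThrough_alpha isConicType_realLinePair A U
  · exact ncard_hyperplanesThrough_alpha isConicType_imaginaryLinePair A U
  · exact ncard_hyperplanesThrough_alpha isConicType_nonsingular A U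

omit [Fintype F] in
theorem delta_scale {c : F} (hc : c ≠ 0) (f : TernaryForm F) :
    (comb c 0 f f).delta = f.delta := by
  ext M
  simp only [mem_delta, pair, comb]
  constructor
  · intro h
    apply mul_left_cancel₀ hc
    linear_combination h
  · intro h
    linear_combination c * h

open Classical in
/-- The hyperplanes through a pencil `f₁, f₂` correspond to `f₁ + β f₂` and `f₂`. -/
theorem ncard_hyperplanesThrough {T : TernaryForm F → Prop} (hT : IsConicType T)
    {f₁ f₂ : TernaryForm F} (hI : Indep f₁ f₂) :
    (hyperplanesThrough (pencil f₁ f₂) T).ncard =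
      {β : F | T (comb 1 β f₁ f₂)}.ncard + if T f₂ then 1 else 0 := by
  have hcoef : ∀ a b c d : F, comb a b f₁ f₂ = comb c d f₁ f₂ → a = c ∧ b = d := by
    intro a b c d h
    obtain ⟨h1, h2⟩ := hI (a - c) (b - d) (by
      rw [TernaryForm.ext_iff] at h ⊢
      simp only [comb, zeroForm] at h ⊢
      obtain ⟨h1, h2, h3, h4, h5, h6⟩ := h
      exact ⟨by linear_combination h1, by linear_combination h2, by linear_combination h3,
        by linear_combination h4, by linear_combination h5, by linear_combination h6⟩)
    exact ⟨sub_eq_zero.1 h1, sub_eq_zero.1 h2⟩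
  have hsc : ∀ c a b : F, comb c 0 (comb a b f₁ f₂) (comb a b f₁ f₂) =
      comb (c * a) (c * b) f₁ f₂ := by
    intro c a b
    rw [comb_comb]
    simp
  have hone : f₂ = comb 0 1 f₁ f₂ := by
    ext <;> simp [comb]
  have hset : hyperplanesThrough (pencil f₁ f₂) T =
      ((fun β => (comb 1 β f₁ f₂).delta) '' {β : F | T (comb 1 β f₁ f₂)}) ∪
        {H | T f₂ ∧ H = f₂.delta} := by
    ext H
    constructor
    · rintro ⟨-, hU, f, hf, rfl⟩
      -- Up to a scalar, a member a f₁ + b f₂ is f₂ when a = 0 and f₁ + (b/a) f₂ otherwise.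
      obtain ⟨a, b, rfl⟩ := pencil_le_delta.1 hU
      by_cases ha : a = 0
      · right
        subst ha
        have hb : b ≠ 0 := by
          rintro rfl
          apply hT.ne_zero hf
          ext <;> simp [comb, zeroForm]
        have h2 : f₂ = comb b⁻¹ 0 (comb 0 b f₁ f₂) (comb 0 b f₁ f₂) := by
          rw [hsc, mul_zero, inv_mul_cancel₀ hb]
          exact hone
        refine ⟨?_, ?_⟩
        · rw [h2]
          exact hT.scale _ (inv_ne_zero hb) hf
        · conv_rhs => rw [h2, delta_scale (inv_ne_zero hb)]
      · left
        have h2 : comb 1 (a⁻¹ * b) f₁ f₂ = comb a⁻¹ 0 (comb a b f₁ f₂) (comb a b f₁ f₂) := by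
          rw [hsc, inv_mul_cancel₀ ha]
        refine ⟨a⁻¹ * b, ?_, ?_⟩
        · change T _
          rw [h2]
          exact hT.scale _ (inv_ne_zero ha) hf
        · change (comb 1 (a⁻¹ * b) f₁ f₂).delta = _
          rw [h2, delta_scale (inv_ne_zero ha)]
    · rintro (⟨β, hβ, rfl⟩ | ⟨h2, rfl⟩)
      · exact ⟨finrank_delta (hT.ne_zero hβ), pencil_le_delta.2 ⟨1, β, rfl⟩, _, hβ, rfl⟩
      · exact ⟨finrank_delta (hT.ne_zero h2), pencil_le_delta.2 ⟨0, 1, hone⟩, _, h2, rfl⟩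
  have hinj : Function.Injective (fun β => (comb 1 β f₁ f₂).delta) := by
    intro β β' h
    obtain ⟨c, hc⟩ := delta_le_delta (le_of_eq h)
    rw [hsc] at hc
    obtain ⟨h1, h2⟩ := hcoef _ _ _ _ hc
    rw [mul_one] at h1
    rw [h2, ← h1, one_mul]
  have hfin : (hyperplanesThrough (pencil f₁ f₂) T).Finite := by
    rw [hset]
    apply Set.Finite.union (Set.toFinite _)
    exact (Set.finite_singleton f₂.delta).subset fun H h => h.2
  rw [hset] at hfin ⊢
  rw [Set.ncard_union_eq ?_ (hfin.subset Set.subset_union_left)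
    (hfin.subset Set.subset_union_right), Set.ncard_image_of_injective _ hinj]
  · congr 1
    by_cases h : T f₂ <;> simp [h]
  · rw [Set.disjoint_left]
    rintro _ ⟨β, -, rfl⟩ ⟨-, h⟩
    obtain ⟨c, hc⟩ := delta_le_delta (le_of_eq h.symm)
    have hone' : comb c 0 f₂ f₂ = comb 0 c f₁ f₂ := by
      ext <;> simp [comb]
    rw [hone'] at hc
    exact one_ne_zero (hcoef _ _ _ _ hc).1

end ConicTypes

/-! ### Recognising conic types in characteristic two -/

section Classification

variable {F : Type*} [Field F]

/-- In characteristic two, four times the discriminant of a ternary form. -/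
def disc (f : TernaryForm F) : F :=
  f.a00 * f.a12 ^ 2 + f.a11 * f.a02 ^ 2 + f.a22 * f.a01 ^ 2 + f.a01 * f.a02 * f.a12

/-- The coefficients of mixed monomials vanish. -/
def Unmixed (f : TernaryForm F) : Prop := f.a01 = 0 ∧ f.a02 = 0 ∧ f.a12 = 0

/-- Every zero over `F` is singular. -/
def ZerosSingular (f : TernaryForm F) : Prop := ∀ v, f.eval v = 0 → f.grad v = 0

variable [CharP F 2]

/-- In characteristic two the gradient at v is the cross product of v with the nucleus n = (a₁₂,
a₀₂, a₀₁), and `disc` is the value of the form at n. A point with zero gradient is proportional to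
n, so disc · vᵢ² = nᵢ² f(v), which vanishes at a singular point. -/
theorem isNonsingular_of_disc_ne_zero {f : TernaryForm F} (h : disc f ≠ 0) : IsNonsingular f := by
  have : CharP (AlgebraicClosure F) 2 :=
    charP_of_injective_algebraMap (algebraMap F (AlgebraicClosure F)).injective 2
  have h2 : (2 : AlgebraicClosure F) = 0 := CharTwo.two_eq_zero
  rintro v hv ⟨h0, hg⟩
  have e0 := congrFun hg 0
  have e1 := congrFun hg 1
  have e2 := congrFun hg 2
  simp only [grad, h2, zero_mul, TernaryForm.map, zero_add, add_zero, Matrix.cons_val, Pi.zero_apply,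
    eval] at h0 e0 e1 e2
  have hd : ∀ i, algebraMap F (AlgebraicClosure F) (disc f) * v i ^ 2 = 0 := by
    intro i
    simp only [disc, map_add, map_mul, map_pow]
    generalize algebraMap F (AlgebraicClosure F) f.a00 = a at *
    generalize algebraMap F (AlgebraicClosure F) f.a01 = b at *
    generalize algebraMap F (AlgebraicClosure F) f.a02 = c at *
    generalize algebraMap F (AlgebraicClosure F) f.a11 = d at *
    generalize algebraMap F (AlgebraicClosure F) f.a12 = e at *
    generalize algebraMap F (AlgebraicClosure F) f.a22 = g at *
    fin_cases i <;> simp <;> grind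
  apply hv
  ext i
  have := hd i
  simpa [h] using this

/-- If the mixed coefficients vanish, the gradient is identically zero and every zero over the
closure is singular; one exists because the form is a square there. Otherwise the nucleus is a
nonzero vector with zero gradient, and it is a zero of the form when `disc` vanishes. -/
theorem disc_eq_zero_of_isNonsingular {f : TernaryForm F} (h : IsNonsingular f) :
    disc f ≠ 0 ∧ ¬ Unmixed f := by
  have : CharP (AlgebraicClosure F) 2 :=
    charP_of_injective_algebraMap (algebraMap F (AlgebraicClosure F)).injective 2
  have h2 : (2 : AlgebraicClosure F) = 0 := CharTwo.two_eq_zero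
  have hU : ¬ Unmixed f := by
    rintro ⟨h01, h02, h12⟩
    choose s hs using fun a : AlgebraicClosure F => IsAlgClosed.exists_pow_nat_eq a
      (show 0 < 2 by norm_num)
    set φ := algebraMap F (AlgebraicClosure F)
    -- A point with X₂ = 0 on the line whose square is the form, that is, on √a₀₀X₀ + √a₁₁X₁ +
    -- √a₂₂X₂ = 0.
    obtain ⟨v, hv, hvz⟩ : ∃ v : Fin 3 → AlgebraicClosure F, v ≠ 0 ∧
        s (φ f.a00) * v 0 + s (φ f.a11) * v 1 = 0 ∧ v 2 = 0 := by
      by_cases h0 : s (φ f.a00) = 0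
      · exact ⟨![1, 0, 0], fun h => one_ne_zero (congrFun h 0), by simp [h0], by simp⟩
      · refine ⟨![s (φ f.a11), -s (φ f.a00), 0], fun h => h0 ?_, by simp; ring, by simp⟩
        simpa using congrFun h 1
    refine h v hv ⟨?_, ?_⟩
    · simp only [eval, TernaryForm.map, h01, h02, h12, hvz.2]
      have e := congrArg (· ^ 2) hvz.1
      simp only [add_pow_char, mul_pow, hs] at e
      simp
      simpa using e
    · ext i
      fin_cases i <;> simp [grad, TernaryForm.map, h01, h02, h12, h2]
  refine ⟨fun hd => ?_, hU⟩
  set φ := algebraMap F (AlgebraicClosure F)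
  refine h ![φ f.a12, φ f.a02, φ f.a01] (fun h0 => hU ⟨?_, ?_, ?_⟩) ⟨?_, ?_⟩
  · simpa [φ] using congrFun h0 2
  · simpa [φ] using congrFun h0 1
  · simpa [φ] using congrFun h0 0
  · have e := congrArg φ hd
    simp only [disc, map_add, map_mul, map_pow, map_zero] at e
    simp [eval, TernaryForm.map]
    linear_combination e + φ f.a01 * φ f.a02 * φ f.a12 * h2
  · ext i
    fin_cases i <;> simp [grad, TernaryForm.map, h2]
    · linear_combination φ f.a01 * φ f.a02 * h2
    · linear_combination φ f.a01 * φ f.a12 * h2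
    · linear_combination φ f.a02 * φ f.a12 * h2

theorem unmixed_of_isDoubleLine {f : TernaryForm F} (h : IsDoubleLine f) : Unmixed f := by
  obtain ⟨c, hc, l, hl, rfl⟩ := h
  refine ⟨?_, ?_, ?_⟩ <;> simp only [prodLin]
  · linear_combination c * l 0 * l 1 * CharTwo.two_eq_zero (R := F)
  · linear_combination c * l 0 * l 2 * CharTwo.two_eq_zero (R := F)
  · linear_combination c * l 1 * l 2 * CharTwo.two_eq_zero (R := F)

/-- The nucleus of a product of two linear forms is, up to the scalar, their cross product, on which
both factors vanish. -/
theorem disc_prodLin (c : F) (l m : Fin 3 → F) : disc (prodLin c l m) = 0 := by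
  simp only [disc, prodLin]
  linear_combination c ^ 3 * (l 0 * m 0 * (l 1 * m 2 + l 2 * m 1) ^ 2 +
    l 1 * m 1 * (l 0 * m 2 + l 2 * m 0) ^ 2 + l 2 * m 2 * (l 0 * m 1 + l 1 * m 0) ^ 2
    - 2 * l 0 * m 0 * l 1 * m 1 * l 2 * m 2) * CharTwo.two_eq_zero (R := F)

theorem not_unmixed_of_linearIndependent {c : F} (hc : c ≠ 0) {l m : Fin 3 → F}
    (h : LinearIndependent F ![l, m]) : ¬ Unmixed (prodLin c l m) := by
  rintro ⟨h01, h02, h12⟩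
  simp only [prodLin, mul_eq_zero, hc, false_or] at h01 h02 h12
  refine linearIndependent_iff_minors.1 h ⟨?_, ?_, ?_⟩
  · linear_combination h12 - l 2 * m 1 * CharTwo.two_eq_zero (R := F)
  · linear_combination h02 - l 0 * m 2 * CharTwo.two_eq_zero (R := F)
  · linear_combination h01 - l 1 * m 0 * CharTwo.two_eq_zero (R := F)

/-- A rational point on one line and off the other is a nonsingular zero. -/
theorem not_zerosSingular_of_isRealLinePair {f : TernaryForm F} (h : IsRealLinePair f) :
    disc f = 0 ∧ ¬ Unmixed f ∧ ¬ ZerosSingular f := by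
  obtain ⟨c, hc, l, m, hlm, rfl⟩ := h
  refine ⟨disc_prodLin .., not_unmixed_of_linearIndependent hc hlm, fun hz => ?_⟩
  obtain ⟨v, hv, hm⟩ := exists_zero_of_linearIndependent hlm
  have hg := hz v (by rw [eval_prodLin, hv]; ring)
  have hl : l = 0 := by
    ext i
    have h1 := prodLin_grad_of_zero c l m v hv i
    rw [hg] at h1
    simpa [hc, hm] using h1.symm
  rw [LinearIndependent.pair_iff] at hlm
  exact one_ne_zero (hlm 1 0 (by simp [hl])).1

/-- Square roots of the diagonal coefficients turn the form into the square of one linear form. -/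
theorem isDoubleLine_of_unmixed [Fintype F] {f : TernaryForm F} (h : Unmixed f)
    (h0 : f ≠ zeroForm F) : IsDoubleLine f := by
  choose s hs using fun a : F => exists_sq_eq a
  obtain ⟨h01, h02, h12⟩ := h
  have key : f = prodLin 1 ![s f.a00, s f.a11, s f.a22] ![s f.a00, s f.a11, s f.a22] := by
    ext <;> simp [prodLin, ← sq, hs, h01, h02, h12]
    · linear_combination -(s f.a00 * s f.a11) * CharTwo.two_eq_zero (R := F)
    · linear_combination -(s f.a00 * s f.a22) * CharTwo.two_eq_zero (R := F)
    · linear_combination -(s f.a11 * s f.a22) * CharTwo.two_eq_zero (R := F)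
  refine ⟨1, one_ne_zero, _, fun hl => h0 ?_, key⟩
  rw [hl] at key
  rw [key]
  ext <;> simp [prodLin, zeroForm]

/-- At a rational point the values of l and of its conjugate are conjugate, so if one vanishes both
do, and the product rule gives zero gradient. This distinguishes conjugate lines from real ones. -/
theorem zerosSingular_of_isImaginaryLinePair [Fintype F] {f : TernaryForm F}
    (h : IsImaginaryLinePair f) : disc f = 0 ∧ ¬ Unmixed f ∧ ZerosSingular f := by
  have : CharP (AlgebraicClosure F) 2 :=
    charP_of_injective_algebraMap (algebraMap F (AlgebraicClosure F)).injective 2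
  obtain ⟨c, hc, l, hl, hli, h⟩ := h
  set φ := algebraMap F (AlgebraicClosure F)
  have hc' : φ c ≠ 0 := by simpa [φ] using hc
  refine ⟨?_, ?_, ?_⟩
  · apply φ.injective
    rw [map_zero, ← disc_prodLin (φ c) l (fun i => l i ^ Fintype.card F), ← h]
    simp [disc, TernaryForm.map]
  · rintro ⟨h1, h2, h3⟩
    apply not_unmixed_of_linearIndependent hc' hli
    rw [← h]
    exact ⟨by simp [TernaryForm.map, h1], by simp [TernaryForm.map, h2], by simp [TernaryForm.map, h3]⟩
  · intro v hv
    have h1 : (f.map φ).eval (fun i => φ (v i)) = 0 := by rw [eval_map, hv, map_zero]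
    rw [h, eval_prodLin] at h1
    have hz : l 0 * φ (v 0) + l 1 * φ (v 1) + l 2 * φ (v 2) = 0 := by
      rcases mul_eq_zero.1 h1 with h1 | h1
      · simpa [hc'] using h1
      · have : (l 0 * φ (v 0) + l 1 * φ (v 1) + l 2 * φ (v 2)) ^ Fintype.card F = 0 := by
          rw [add_pow_card, add_pow_card, mul_pow, mul_pow, mul_pow, algebraMap_pow_card,
            algebraMap_pow_card, algebraMap_pow_card]
          exact h1
        exact pow_eq_zero_iff Fintype.card_ne_zero |>.1 this
    have hz' : l 0 ^ Fintype.card F * φ (v 0) + l 1 ^ Fintype.card F * φ (v 1) +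
        l 2 ^ Fintype.card F * φ (v 2) = 0 := by
      have : (l 0 * φ (v 0) + l 1 * φ (v 1) + l 2 * φ (v 2)) ^ Fintype.card F = 0 := by
        rw [hz, zero_pow Fintype.card_ne_zero]
      rwa [add_pow_card, add_pow_card, mul_pow, mul_pow, mul_pow, algebraMap_pow_card,
        algebraMap_pow_card, algebraMap_pow_card] at this
    have hg : ∀ i, (f.map φ).grad (fun i => φ (v i)) i = φ (f.grad v i) := by
      intro i
      fin_cases i <;> simp [grad, TernaryForm.map, map_ofNat]
    ext i
    apply φ.injective
    rw [← hg, h, prodLin_grad_of_zero _ _ _ _ hz, hz']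
    simp

/-- The form `a l² + l m + b m²`. -/
def binaryForm {R : Type*} [CommRing R] (a b : R) (l m : Fin 3 → R) : TernaryForm R :=
  ⟨a * l 0 ^ 2 + l 0 * m 0 + b * m 0 ^ 2,
    2 * a * l 0 * l 1 + (l 0 * m 1 + l 1 * m 0) + 2 * b * m 0 * m 1,
    2 * a * l 0 * l 2 + (l 0 * m 2 + l 2 * m 0) + 2 * b * m 0 * m 2,
    a * l 1 ^ 2 + l 1 * m 1 + b * m 1 ^ 2,
    2 * a * l 1 * l 2 + (l 1 * m 2 + l 2 * m 1) + 2 * b * m 1 * m 2,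
    a * l 2 ^ 2 + l 2 * m 2 + b * m 2 ^ 2⟩

omit [CharP F 2] in
-- Expanding a⁻¹(a l + θm)(a l + (θ + 1)m) gives a l² + (2θ + 1)l m + a⁻¹(θ² + θ)m². It is applied
-- both over F and over its algebraic closure.
theorem binaryForm_eq_prodLin {a b θ : F} (h2 : (2 : F) = 0) (ha : a ≠ 0)
    (hθ : θ ^ 2 + θ = a * b) {l m : Fin 3 → F} (hlm : LinearIndependent F ![l, m]) :
    LinearIndependent F ![fun i => a * l i + θ * m i, fun i => a * l i + (θ + 1) * m i] ∧
    binaryForm a b l m =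
      prodLin a⁻¹ (fun i => a * l i + θ * m i) (fun i => a * l i + (θ + 1) * m i) := by
  constructor
  · rw [LinearIndependent.pair_iff] at hlm ⊢
    intro x y hxy
    obtain ⟨h3, h4⟩ := hlm (a * (x + y)) (x * θ + y * (θ + 1)) (by
      rw [← hxy]
      ext i
      simp
      ring)
    have h5 : x + y = 0 := by simpa [ha] using h3
    have h6 : y = 0 := by linear_combination h4 - θ * h5
    subst h6
    simpa using h5
  · ext <;> simp only [prodLin, binaryForm] <;> field_simp
    · linear_combination -(m 0 ^ 2) * hθ - θ * a * l 0 * m 0 * h2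
    · linear_combination -(2 * m 0 * m 1) * hθ - θ * a * (l 0 * m 1 + l 1 * m 0) * h2
    · linear_combination -(2 * m 0 * m 2) * hθ - θ * a * (l 0 * m 2 + l 2 * m 0) * h2
    · linear_combination -(m 1 ^ 2) * hθ - θ * a * l 1 * m 1 * h2
    · linear_combination -(2 * m 1 * m 2) * hθ - θ * a * (l 1 * m 2 + l 2 * m 1) * h2
    · linear_combination -(m 2 ^ 2) * hθ - θ * a * l 2 * m 2 * h2

/-- A form `a l² + l m + b m²` with `Tr (a b) = 0` is a pair of lines over `F`. -/
theorem isRealLinePair_binaryForm [Fintype F] {a b : F} {l m : Fin 3 → F}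
    (hlm : LinearIndependent F ![l, m]) (hab : Tr (a * b) = 0) :
    IsRealLinePair (binaryForm a b l m) := by
  have h2 : (2 : F) = 0 := CharTwo.two_eq_zero
  -- For a = 0 no root θ is needed: the form is m(l + b m).
  by_cases ha : a = 0
  · subst ha
    refine ⟨1, one_ne_zero, m, fun i => l i + b * m i, ?_, ?_⟩
    · rw [LinearIndependent.pair_iff] at hlm ⊢
      intro s t hst
      obtain ⟨h3, h4⟩ := hlm t (s + t * b) (by
        rw [← hst]
        ext i
        simp
        ring)
      subst h3
      simpa using h4
    · ext <;> simp only [prodLin, binaryForm] <;> ring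
  · obtain ⟨s, hs⟩ := tr_eq_zero_iff.1 hab
    obtain ⟨h3, h4⟩ := binaryForm_eq_prodLin h2 ha hs hlm
    exact ⟨a⁻¹, inv_ne_zero ha, _, _, h3, h4⟩

/-- A form `a l² + l m + b m²` with `Tr (a b) = 1` is a pair of conjugate lines. -/
theorem isImaginaryLinePair_binaryForm [Fintype F] {a b : F} {l m : Fin 3 → F}
    (hlm : LinearIndependent F ![l, m]) (hab : Tr (a * b) = 1) :
    IsImaginaryLinePair (binaryForm a b l m) := by
  have : CharP (AlgebraicClosure F) 2 :=
    charP_of_injective_algebraMap (algebraMap F (AlgebraicClosure F)).injective 2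
  have h2 : (2 : AlgebraicClosure F) = 0 := CharTwo.two_eq_zero
  have ha : a ≠ 0 := by
    rintro rfl
    rw [zero_mul, tr_zero] at hab
    exact zero_ne_one hab
  set φ := algebraMap F (AlgebraicClosure F) with hφ
  obtain ⟨θ, hθ⟩ := exists_sq_add_self (φ (a * b))
  -- The q-power map takes θ to θ + 1 and so interchanges the two linear factors.
  have hθq : θ ^ Fintype.card F = θ + 1 := pow_card_of_tr_eq_one hab hθ
  have hθqq : (θ ^ Fintype.card F) ^ Fintype.card F = θ := by
    rw [hθq, add_pow_card (F := F), hθq, one_pow]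
    linear_combination h2
  have ha' : φ a ≠ 0 := by simpa [φ] using ha
  have hc : (fun i => (φ a * φ (l i) + θ * φ (m i)) ^ Fintype.card F) =
      fun i => φ a * φ (l i) + (θ + 1) * φ (m i) := by
    ext i
    rw [add_pow_card, mul_pow, mul_pow, algebraMap_pow_card, algebraMap_pow_card,
      algebraMap_pow_card, hθq]
  have hlm' : LinearIndependent (AlgebraicClosure F) ![fun i => φ (l i), fun i => φ (m i)] := by
    rw [linearIndependent_iff_minors] at hlm ⊢
    simpa only [← map_mul, ← map_sub, map_eq_zero] using hlm
  obtain ⟨h3, h4⟩ := binaryForm_eq_prodLin h2 ha' (hθ.trans (map_mul φ a b)) hlm'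
  refine ⟨a⁻¹, inv_ne_zero ha, fun i => φ a * φ (l i) + θ * φ (m i), ?_, ?_, ?_⟩
  · intro i
    rw [sq, pow_mul]
    simp only [add_pow_card, mul_pow, hφ, algebraMap_pow_card, hθqq]
  · rw [hc]
    exact h3
  · rw [hc, map_inv₀, ← h4]
    ext <;> simp [binaryForm, TernaryForm.map, map_ofNat, φ]

end Classification

end VeroneseSolids

namespace VeroneseSolids

open TernaryForm

/-! ### Counting the members of a pencil by type -/

section HyperplaneCounts

variable {F : Type*} [Field F] [Fintype F] [CharP F 2]

/-- The four types of conics: double lines, real line pairs, imaginary line pairs, nonsingular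
conics. -/
def HasType : Fin 4 → TernaryForm F → Prop :=
  ![IsDoubleLine, IsRealLinePair, IsImaginaryLinePair, IsNonsingular]

/-- Double lines are the unmixed forms. Among the mixed ones, nonvanishing of `disc` singles out the
nonsingular conics, and `ZerosSingular` separates conjugate from real line pairs. -/
theorem HasType.unique {i j : Fin 4} {f : TernaryForm F} (hi : HasType i f) (hj : HasType j f) :
    i = j := by
  have h0 : HasType 0 f → Unmixed f := unmixed_of_isDoubleLine
  have h1 : HasType 1 f → disc f = 0 ∧ ¬ Unmixed f ∧ ¬ ZerosSingular f :=
    not_zerosSingular_of_isRealLinePair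
  have h2 : HasType 2 f → disc f = 0 ∧ ¬ Unmixed f ∧ ZerosSingular f :=
    zerosSingular_of_isImaginaryLinePair
  have h3 : HasType 3 f → disc f ≠ 0 ∧ ¬ Unmixed f := disc_eq_zero_of_isNonsingular
  fin_cases i <;> fin_cases j <;> simp only [Fin.zero_eta, Fin.mk_one, Fin.reduceFinMk] at * <;>
    tauto

omit [CharP F 2] in
theorem isConicType_hasType (j : Fin 4) : IsConicType (HasType (F := F) j) := by
  fin_cases j
  · exact isConicType_doubleLine
  · exact isConicType_realLinePair
  · exact isConicType_imaginaryLinePair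
  · exact isConicType_nonsingular

/-- The hyperplane-orbit distribution of a pencil all of whose members have known type. -/
theorem hyperplaneOD_pencil {f₁ f₂ : TernaryForm F} (hI : Indep f₁ f₂) (kind : F → Fin 4)
    (k : Fin 4) (hkind : ∀ β, HasType (kind β) (comb 1 β f₁ f₂)) (hk : HasType k f₂) (j : Fin 4) :
    hyperplaneOD (pencil f₁ f₂) j = {β | kind β = j}.ncard + if k = j then 1 else 0 := by
  have h1 : hyperplaneOD (pencil f₁ f₂) j =
      (hyperplanesThrough (pencil f₁ f₂) (HasType j)).ncard := by
    fin_cases j <;> rfl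
  rw [h1, ncard_hyperplanesThrough (isConicType_hasType j) hI]
  congr 1
  · congr 1
    ext β
    exact ⟨fun h => (hkind β).unique h, fun h => h ▸ hkind β⟩
  · by_cases h : k = j
    · subst h
      simp [hk]
    · have : ¬ HasType j f₂ := fun h' => h (hk.unique h')
      simp [h, this]

/-- The variants with no, one or two exceptional values of β serve every row but the first, where
the type varies with `Tr β`. -/
theorem hyperplaneOD_pencil_const {f₁ f₂ : TernaryForm F} (hI : Indep f₁ f₂) (k₀ k : Fin 4)
    (hkind : ∀ β, HasType k₀ (comb 1 β f₁ f₂)) (hk : HasType k f₂) (j : Fin 4) :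
    (hyperplaneOD (pencil f₁ f₂) j : ℚ) =
      (if k₀ = j then (Fintype.card F : ℚ) else 0) + if k = j then 1 else 0 := by
  rw [hyperplaneOD_pencil hI (fun _ => k₀) k hkind hk]
  by_cases h : k₀ = j <;> simp [h, Set.ncard_univ, Nat.card_eq_fintype_card]

theorem hyperplaneOD_pencil_one {f₁ f₂ : TernaryForm F} (hI : Indep f₁ f₂) (b : F)
    (k₀ k₁ k : Fin 4) (h₀ : HasType k₀ (comb 1 b f₁ f₂))
    (h₁ : ∀ β, β ≠ b → HasType k₁ (comb 1 β f₁ f₂)) (hk : HasType k f₂) (j : Fin 4) :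
    (hyperplaneOD (pencil f₁ f₂) j : ℚ) =
      (if k₀ = j then 1 else 0) + (if k₁ = j then (Fintype.card F : ℚ) - 1 else 0) +
        if k = j then 1 else 0 := by
  classical
  rw [hyperplaneOD_pencil hI (fun β => if β = b then k₀ else k₁) k (fun β => by
    by_cases h : β = b
    · subst h
      simpa using h₀
    · simpa [h] using h₁ β h) hk]
  have key : {β : F | (if β = b then k₀ else k₁) = j} =
      (if k₀ = j then {b} else ∅) ∪ (if k₁ = j then {b}ᶜ else ∅) := by
    ext β
    by_cases h : β = b <;> by_cases h0 : k₀ = j <;> by_cases h1 : k₁ = j <;> simp [h, h0, h1]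
  have hc : (({b}ᶜ : Set F).ncard : ℚ) = (Fintype.card F : ℚ) - 1 := by
    have := Set.ncard_add_ncard_compl {b}
    rw [Set.ncard_singleton, Nat.card_eq_fintype_card] at this
    rw [← this]
    push_cast
    ring
  have hd : Disjoint (if k₀ = j then ({b} : Set F) else ∅) (if k₁ = j then {b}ᶜ else ∅) := by
    by_cases h0 : k₀ = j <;> by_cases h1 : k₁ = j <;> simp [h0, h1]
  rw [key, Set.ncard_union_eq hd (Set.toFinite _) (Set.toFinite _)]
  push_cast
  by_cases h0 : k₀ = j <;> by_cases h1 : k₁ = j <;> simp only [h0, h1, if_true, if_false, hc,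
    Set.ncard_singleton, Set.ncard_empty] <;> norm_num

theorem hyperplaneOD_pencil_two {f₁ f₂ : TernaryForm F} (hI : Indep f₁ f₂) {b b' : F}
    (hbb : b ≠ b') (k₀ k₁ k₂ k : Fin 4) (h₀ : HasType k₀ (comb 1 b f₁ f₂))
    (h₁ : HasType k₁ (comb 1 b' f₁ f₂))
    (h₂ : ∀ β, β ≠ b → β ≠ b' → HasType k₂ (comb 1 β f₁ f₂)) (hk : HasType k f₂) (j : Fin 4) :
    (hyperplaneOD (pencil f₁ f₂) j : ℚ) =
      (if k₀ = j then 1 else 0) + (if k₁ = j then 1 else 0) +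
        (if k₂ = j then (Fintype.card F : ℚ) - 2 else 0) + if k = j then 1 else 0 := by
  classical
  rw [hyperplaneOD_pencil hI (fun β => if β = b then k₀ else if β = b' then k₁ else k₂) k
    (fun β => by
      by_cases h : β = b
      · subst h
        simpa using h₀
      · by_cases h' : β = b'
        · subst h'
          simpa [h] using h₁
        · simpa [h, h'] using h₂ β h h') hk]
  have key : {β : F | (if β = b then k₀ else if β = b' then k₁ else k₂) = j} =
      ((if k₀ = j then {b} else ∅) ∪ (if k₁ = j then {b'} else ∅)) ∪
        (if k₂ = j then {b, b'}ᶜ else ∅) := by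
    ext β
    by_cases h : β = b
    · subst h
      by_cases h0 : k₀ = j <;> by_cases h1 : k₁ = j <;> by_cases h2 : k₂ = j <;>
        simp [h0, h1, h2, hbb]
    · by_cases h' : β = b'
      · subst h'
        by_cases h0 : k₀ = j <;> by_cases h1 : k₁ = j <;> by_cases h2 : k₂ = j <;>
          simp [h0, h1, h2, hbb.symm]
      · by_cases h0 : k₀ = j <;> by_cases h1 : k₁ = j <;> by_cases h2 : k₂ = j <;>
          simp [h0, h1, h2, h, h']
  have hc : (({b, b'}ᶜ : Set F).ncard : ℚ) = (Fintype.card F : ℚ) - 2 := by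
    have := Set.ncard_add_ncard_compl {b, b'}
    rw [Set.ncard_pair hbb, Nat.card_eq_fintype_card] at this
    rw [← this]
    push_cast
    ring
  have hd : Disjoint (if k₀ = j then ({b} : Set F) else ∅) (if k₁ = j then {b'} else ∅) := by
    by_cases h0 : k₀ = j <;> by_cases h1 : k₁ = j <;> simp [h0, h1, hbb]
  have hd' : Disjoint ((if k₀ = j then ({b} : Set F) else ∅) ∪ (if k₁ = j then {b'} else ∅))
      (if k₂ = j then {b, b'}ᶜ else ∅) := by
    by_cases h0 : k₀ = j <;> by_cases h1 : k₁ = j <;> by_cases h2 : k₂ = j <;> simp [h0, h1, h2]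
  rw [key, Set.ncard_union_eq hd' (Set.toFinite _) (Set.toFinite _),
    Set.ncard_union_eq hd (Set.toFinite _) (Set.toFinite _)]
  push_cast
  by_cases h0 : k₀ = j <;> by_cases h1 : k₁ = j <;> by_cases h2 : k₂ = j <;>
    simp only [h0, h1, h2, if_true, if_false, hc, Set.ncard_singleton, Set.ncard_empty] <;>
    norm_num

end HyperplaneCounts

/-! ### Point distributions from a parametrised solid -/

section PointCounts

variable {F : Type*} [Field F]

theorem solid_eq_pencil {m : F → F → F → F → Matrix (Fin 3) (Fin 3) F} {f₁ f₂ : TernaryForm F}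
    (c : F → F → F → F → Fin 6 → F) (hm : ∀ x y z t, m x y z t = (symMk (c x y z t)).1)
    (h₁ : ∀ x y z t, symMk (c x y z t) ∈ pencil f₁ f₂)
    (h₂ : ∀ M : Sym F, f₁.pair M.1 = 0 → f₂.pair M.1 = 0 → ∃ x y z t, symMk (c x y z t) = M) :
    solid m = pencil f₁ f₂ := by
  apply le_antisymm
  · rw [solid, Submodule.span_le]
    rintro M ⟨x, y, z, t, hM⟩
    have : M = symMk (c x y z t) := Subtype.ext (hM.trans (hm x y z t))
    rw [this]
    exact h₁ x y z t
  · rintro M hM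
    obtain ⟨x, y, z, t, rfl⟩ := h₂ M hM.1 hM.2
    exact Submodule.subset_span ⟨x, y, z, t, (hm x y z t).symm⟩

variable [Fintype F]

theorem card_pencil {f₁ f₂ : TernaryForm F} (e : (F × F × F) × F → Sym F)
    (he : Function.Injective e) (hmem : ∀ M, M ∈ pencil f₁ f₂ ↔ ∃ p, e p = M) :
    Nat.card (pencil f₁ f₂) = Fintype.card F ^ 4 := by
  change Nat.card (pencil f₁ f₂ : Set (Sym F)) = _
  rw [Nat.card_coe_set_eq, ncard_eq_card_of_param e he hmem]
  simp only [Nat.card_eq_fintype_card, Fintype.card_prod]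
  ring

theorem finrank_of_card {U : Submodule F (Sym F)} (h : Nat.card U = Fintype.card F ^ 4) :
    Module.finrank F U = 4 := by
  have h1 := Module.natCard_eq_pow_finrank (K := F) (V := U)
  rw [h, Nat.card_eq_fintype_card] at h1
  exact (Nat.pow_right_injective Fintype.one_lt_card h1).symm

/-- Counting nonsingular matrices when the determinant has the form `a(w) φ(x) + b(w)`. -/
theorem ncard_det_ne_zero {f₁ f₂ : TernaryForm F} (e : (F × F × F) × F → Sym F)
    (he : Function.Injective e) (hmem : ∀ M, M ∈ pencil f₁ f₂ ↔ ∃ p, e p = M)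
    (φ : F → F) (hφ : Function.Bijective φ) (a b : F × F × F → F)
    (hdet : ∀ p, (e p).1.det = a p.1 * φ p.2 + b p.1)
    (ha : {w | a w = 0}.ncard = Fintype.card F ^ 2) :
    {M : Sym F | M ∈ pencil f₁ f₂ ∧ M.1.det ≠ 0}.ncard + Fintype.card F ^ 3 +
      Fintype.card F * {w | a w = 0 ∧ b w = 0}.ncard = Fintype.card F ^ 4 + Fintype.card F ^ 2 := by
  have h1 : {M : Sym F | M ∈ pencil f₁ f₂ ∧ M.1.det ≠ 0}.ncard =
      {p : (F × F × F) × F | a p.1 * φ p.2 + b p.1 = 0}ᶜ.ncard := by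
    rw [← Set.ncard_image_of_injective _ he]
    congr 1
    ext M
    constructor
    · rintro ⟨hM, hd⟩
      obtain ⟨p, rfl⟩ := (hmem M).1 hM
      refine ⟨p, ?_, rfl⟩
      rw [hdet] at hd
      exact hd
    · rintro ⟨p, hp, rfl⟩
      refine ⟨(hmem _).2 ⟨p, rfl⟩, ?_⟩
      rw [hdet]
      exact hp
  have h2 := Set.ncard_add_ncard_compl {p : (F × F × F) × F | a p.1 * φ p.2 + b p.1 = 0}
  have h3 := ncard_linear_zeros φ hφ a b
  rw [ha] at h3
  rw [h1]
  simp only [Nat.card_eq_fintype_card, Fintype.card_prod] at h2 h3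
  have h4 : Fintype.card F * (Fintype.card F * Fintype.card F) * Fintype.card F =
    Fintype.card F ^ 4 := by ring
  have h5 : Fintype.card F * (Fintype.card F * Fintype.card F) = Fintype.card F ^ 3 := by ring
  rw [h4] at h2
  rw [h5] at h3
  omega

/-- The point-orbit distribution in terms of the number `n₁` of common zeros, `n₂` of alternating
matrices, and `n₃` governing the number of singular matrices. -/
theorem pointOD_eq [CharP F 2] {f₁ f₂ : TernaryForm F} {n₁ n₂ n₃ : ℕ} {p : Fin 4 → ℚ}
    (hc : Nat.card (pencil f₁ f₂) = Fintype.card F ^ 4)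
    (h₁ : {v : Fin 3 → F | v ≠ 0 ∧ f₁.eval v = 0 ∧ f₂.eval v = 0}.ncard = n₁)
    (h₂ : {M : Sym F | M ∈ pencil f₁ f₂ ∧ ZeroDiag M}.ncard = n₂)
    (h₃ : {M : Sym F | M ∈ pencil f₁ f₂ ∧ M.1.det ≠ 0}.ncard + Fintype.card F ^ 3 +
      Fintype.card F * n₃ = Fintype.card F ^ 4 + Fintype.card F ^ 2)
    (e₀ : p 0 * ((Fintype.card F : ℚ) - 1) = n₁)
    (e₁ : p 1 * ((Fintype.card F : ℚ) - 1) + 1 = n₂)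
    (e₃ : p 3 * ((Fintype.card F : ℚ) - 1) + (Fintype.card F : ℚ) ^ 3 + Fintype.card F * n₃ =
      (Fintype.card F : ℚ) ^ 4 + (Fintype.card F : ℚ) ^ 2)
    (e : p 0 + p 1 + p 2 + p 3 = (Fintype.card F : ℚ) ^ 3 + (Fintype.card F : ℚ) ^ 2 +
      Fintype.card F + 1) (j : Fin 4) :
    (pointOD (pencil f₁ f₂) j : ℚ) = p j := by
  have hq : 1 < Fintype.card F := Fintype.one_lt_card
  have hq1 : ((Fintype.card F - 1 : ℕ) : ℚ) = (Fintype.card F : ℚ) - 1 := by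
    rw [Nat.cast_sub hq.le, Nat.cast_one]
  have hq0 : (Fintype.card F : ℚ) - 1 ≠ 0 := by
    have : (1 : ℚ) < Fintype.card F := by exact_mod_cast hq
    linarith
  obtain ⟨g0, g1, g3, g⟩ := pointOD_pencil f₁ f₂
  rw [h₁] at g0
  rw [h₂] at g1
  rw [← g3] at h₃
  rw [hc] at g
  have g0 := congrArg (Nat.cast : ℕ → ℚ) g0
  have g1 := congrArg (Nat.cast : ℕ → ℚ) g1
  have g3 := congrArg (Nat.cast : ℕ → ℚ) h₃
  have g := congrArg (Nat.cast : ℕ → ℚ) g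
  push_cast [hq1] at g0 g1 g3 g
  have k0 : (pointOD (pencil f₁ f₂) 0 : ℚ) = p 0 :=
    mul_right_cancel₀ hq0 (by linear_combination g0 - e₀)
  have k1 : (pointOD (pencil f₁ f₂) 1 : ℚ) = p 1 :=
    mul_right_cancel₀ hq0 (by linear_combination g1 - e₁)
  have k3 : (pointOD (pencil f₁ f₂) 3 : ℚ) = p 3 :=
    mul_right_cancel₀ hq0 (by linear_combination g3 - e₃)
  -- The number of rank-2 points off the nucleus plane is what remains of the q³ + q² + q + 1 points
  -- of the solid.
  have k2 : (pointOD (pencil f₁ f₂) 2 : ℚ) = p 2 := by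
    apply mul_right_cancel₀ hq0
    rw [k0, k1, k3] at g
    linear_combination g - ((Fintype.card F : ℚ) - 1) * e
  fin_cases j <;> assumption

/-- Counting the nonzero vectors on a union of lines through the origin. -/
theorem ncard_lines {n : ℕ} {P : (Fin 3 → F) → Prop} (w : Fin n → Fin 3 → F)
    (hw : ∀ i, w i ≠ 0) (hind : ∀ i j (c : F), w i = c • w j → i = j)
    (hP : ∀ i (c : F), P (c • w i)) (h : ∀ v, v ≠ 0 → P v → ∃ i, ∃ c : F, v = c • w i) :
    {v | v ≠ 0 ∧ P v}.ncard = n * (Fintype.card F - 1) := by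
  classical
  rw [← Fintype.card_units, ← Nat.card_eq_fintype_card]
  conv_rhs => rw [← Fintype.card_fin n, ← Nat.card_eq_fintype_card, ← Nat.card_prod]
  apply ncard_eq_card_of_param (fun x : Fin n × Fˣ => (x.2 : F) • w x.1)
  · rintro ⟨i, c⟩ ⟨j, d⟩ hij
    have hij : (c : F) • w i = (d : F) • w j := hij
    have h1 : i = j := by
      apply hind i j ((c : F)⁻¹ * d)
      rw [mul_smul, ← hij, smul_smul, inv_mul_cancel₀ c.ne_zero, one_smul]
    subst h1
    exact Prod.ext rfl (Units.ext (smul_left_injective F (hw i) hij))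
  · intro v
    constructor
    · rintro ⟨h0, hv⟩
      obtain ⟨i, c, rfl⟩ := h v h0 hv
      have hc : c ≠ 0 := by
        rintro rfl
        simp at h0
      exact ⟨(i, Units.mk0 c hc), rfl⟩
    · rintro ⟨⟨i, c⟩, rfl⟩
      exact ⟨smul_ne_zero c.ne_zero (hw i), hP i c⟩

end PointCounts

/-! ### Determinants, square roots and criteria for the individual rows -/

section Parametrisation

variable {F : Type*} [Field F]

/-- The term 2y₁y₂y₄ disappears. Diagonal entries then occur linearly and off-diagonal entries only
through their squares, which is what makes the counting by `ncard_linear_zeros` possible. -/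
theorem det_symMk [CharP F 2] (y : Fin 6 → F) : (symMk y).1.det =
    y 0 * y 3 * y 5 + y 0 * y 4 ^ 2 + y 3 * y 2 ^ 2 + y 5 * y 1 ^ 2 := by
  simp only [symMk, det_fin_three, Matrix.of_apply, Matrix.cons_val]
  linear_combination (y 1 * y 2 * y 4 - y 0 * y 4 ^ 2 - y 3 * y 2 ^ 2 - y 5 * y 1 ^ 2) *
    CharTwo.two_eq_zero (R := F)

theorem pair_symMk (f : TernaryForm F) (y : Fin 6 → F) : f.pair (symMk y).1 =
    f.a00 * y 0 + f.a01 * y 1 + f.a02 * y 2 + f.a11 * y 3 + f.a12 * y 4 + f.a22 * y 5 := rfl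

theorem zeroDiag_symMk (y : Fin 6 → F) : ZeroDiag (symMk y) ↔ y 0 = 0 ∧ y 3 = 0 ∧ y 5 = 0 := by
  simp [ZeroDiag, symMk, Fin.forall_fin_succ]

theorem symMk_injective : Function.Injective (symMk (F := F)) := (symEquiv F).symm.injective

variable [Fintype F]

theorem card_units_cast : (Nat.card Fˣ : ℚ) = Fintype.card F - 1 := by
  classical
  have hq : 1 < Fintype.card F := Fintype.one_lt_card
  rw [Nat.card_eq_fintype_card, Fintype.card_units]
  push_cast [Nat.cast_sub hq.le]
  ring

/-- The square root in a finite field of characteristic two. -/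
noncomputable def sqrtTwo [CharP F 2] (a : F) : F := (exists_sq_eq a).choose

theorem sqrtTwo_sq [CharP F 2] (a : F) : sqrtTwo a ^ 2 = a := (exists_sq_eq a).choose_spec

/-- The point-orbit distribution of a pencil from a parametrisation of its matrices, of the
alternating ones, and of the loci in which the determinant degenerates. -/
theorem pointOD_of_param [CharP F 2] {f₁ f₂ : TernaryForm F} (e : (F × F × F) × F → Sym F)
    (he : Function.Injective e) (hmem : ∀ M, M ∈ pencil f₁ f₂ ↔ ∃ p, e p = M) {n₁ : ℕ}
    (h₁ : {v : Fin 3 → F | v ≠ 0 ∧ f₁.eval v = 0 ∧ f₂.eval v = 0}.ncard = n₁)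
    {Z : Type*} (eZ : Z → (F × F × F) × F) (heZ : Function.Injective eZ)
    (hZ : ∀ p, ZeroDiag (e p) ↔ ∃ x, eZ x = p)
    (φ : F → F) (hφ : Function.Bijective φ) (a b : F × F × F → F)
    (hdet : ∀ p, (e p).1.det = a p.1 * φ p.2 + b p.1)
    (eA : F × F → F × F × F) (heA : Function.Injective eA) (hA : ∀ w, a w = 0 ↔ ∃ x, eA x = w)
    {B : Type*} (eB : B → F × F × F) (heB : Function.Injective eB)
    (hB : ∀ w, a w = 0 ∧ b w = 0 ↔ ∃ x, eB x = w) {p : Fin 4 → ℚ}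
    (e₀ : p 0 * ((Fintype.card F : ℚ) - 1) = n₁)
    (e₁ : p 1 * ((Fintype.card F : ℚ) - 1) + 1 = Nat.card Z)
    (e₃ : p 3 * ((Fintype.card F : ℚ) - 1) + (Fintype.card F : ℚ) ^ 3 +
      Fintype.card F * Nat.card B = (Fintype.card F : ℚ) ^ 4 + (Fintype.card F : ℚ) ^ 2)
    (e₂ : p 0 + p 1 + p 2 + p 3 = (Fintype.card F : ℚ) ^ 3 + (Fintype.card F : ℚ) ^ 2 +
      Fintype.card F + 1) (j : Fin 4) :
    (pointOD (pencil f₁ f₂) j : ℚ) = p j := by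
  refine pointOD_eq (card_pencil e he hmem) h₁ (n₂ := Nat.card Z) (n₃ := Nat.card B) ?_ ?_
    e₀ e₁ e₃ e₂ j
  · apply ncard_eq_card_of_param (fun x => e (eZ x)) (he.comp heZ)
    intro M
    constructor
    · rintro ⟨hM, hz⟩
      obtain ⟨p, rfl⟩ := (hmem M).1 hM
      obtain ⟨x, rfl⟩ := (hZ p).1 hz
      exact ⟨x, rfl⟩
    · rintro ⟨x, rfl⟩
      exact ⟨(hmem _).2 ⟨_, rfl⟩, (hZ _).2 ⟨x, rfl⟩⟩
  · have h := ncard_det_ne_zero e he hmem φ hφ a b hdet (by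
      rw [ncard_eq_card_of_param (S := {w | a w = 0}) eA heA hA, Nat.card_prod, Nat.card_eq_fintype_card, sq])
    rwa [ncard_eq_card_of_param (S := {w | a w = 0 ∧ b w = 0}) eB heB hB] at h

variable [CharP F 2]

theorem hasType_double {f : TernaryForm F} (h : Unmixed f) (h0 : f ≠ zeroForm F) :
    HasType 0 f := isDoubleLine_of_unmixed h h0

omit [CharP F 2] in
theorem hasType_real {f : TernaryForm F} (l m : Fin 3 → F)
    (hlm : ¬ (l 1 * m 2 - l 2 * m 1 = 0 ∧ l 2 * m 0 - l 0 * m 2 = 0 ∧ l 0 * m 1 - l 1 * m 0 = 0))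
    (h : f = prodLin 1 l m) : HasType 1 f :=
  ⟨1, one_ne_zero, l, m, linearIndependent_iff_minors.2 hlm, h⟩

theorem hasType_imaginary {f : TernaryForm F} (a b : F) (l m : Fin 3 → F)
    (hlm : ¬ (l 1 * m 2 - l 2 * m 1 = 0 ∧ l 2 * m 0 - l 0 * m 2 = 0 ∧ l 0 * m 1 - l 1 * m 0 = 0))
    (hab : Tr (a * b) = 1) (h : f = binaryForm a b l m) : HasType 2 f := by
  subst h
  exact isImaginaryLinePair_binaryForm (linearIndependent_iff_minors.2 hlm) hab

theorem hasType_nonsingular {f : TernaryForm F} (h : disc f ≠ 0) : HasType 3 f :=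
  isNonsingular_of_disc_ne_zero h

theorem ne_zero_of_tr_inv {γ : F} (h : Tr γ⁻¹ = 1) : γ ≠ 0 := by
  rintro rfl
  -- The inverse of 0 is 0 by convention, and its trace is 0 rather than 1.
  rw [_root_.inv_zero, tr_zero] at h
  exact zero_ne_one h

theorem tr_inv_sq {γ : F} (h : Tr γ⁻¹ = 1) : Tr (γ⁻¹ ^ 2) = 1 := by
  rw [tr_sq, h]

omit [Fintype F] in
theorem ne_zero_of_tr {γ : F} (h : Tr γ = 1) : γ ≠ 0 := by
  rintro rfl
  rw [tr_zero] at h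
  exact zero_ne_one h

omit [CharP F 2] in
theorem card_cast : (Nat.card F : ℚ) = Fintype.card F := by
  rw [Nat.card_eq_fintype_card]

omit [CharP F 2] in
theorem card_ne_zero_cast :
    (Nat.card {w : F × F // w ≠ 0} : ℚ) = (Fintype.card F : ℚ) ^ 2 - 1 := by
  have h := Set.ncard_add_ncard_compl {(0 : F × F)}
  rw [Set.ncard_singleton, Nat.card_prod, Nat.card_eq_fintype_card, ← Nat.card_coe_set_eq] at h
  have h := congrArg (Nat.cast : ℕ → ℚ) h
  push_cast at h
  change 1 + (Nat.card {w : F × F // w ≠ 0} : ℚ) = _ at h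
  linear_combination h

omit [CharP F 2] in
theorem card_sub_one_cast (n : ℕ) :
    ((n * (Fintype.card F - 1) : ℕ) : ℚ) = n * ((Fintype.card F : ℚ) - 1) := by
  rw [Nat.cast_mul, Nat.cast_sub Fintype.one_lt_card.le, Nat.cast_one]

/-- The form `x² + γ x y + y²` is anisotropic when `Tr γ⁻¹ = 1`. -/
theorem norm_form_eq_zero' {γ : F} (h : Tr γ⁻¹ = 1) {x y : F}
    (hxy : x ^ 2 + γ * x * y + y ^ 2 = 0) : x = 0 ∧ y = 0 := by
  have hγ := ne_zero_of_tr_inv h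
  -- Replacing y by γy turns x² + γxy + y² into x² + xy + γ⁻²y², and γ⁻² has the trace of γ⁻¹.
  obtain ⟨h1, h2⟩ := norm_form_eq_zero (tr_inv_sq h) (x := x) (y := γ * y) (by
    field_simp
    linear_combination hxy)
  exact ⟨h1, by simpa [hγ] using h2⟩

end Parametrisation

/-! ### Assembling a row of the table -/

section Rows

variable {F : Type*} [Field F] [Fintype F] [CharP F 2]

omit [Fintype F] in
theorem Omega_eq_orbit {i : ℕ} {U : Submodule F (Sym F)}
    (h₁ : ∃ R, IsRepresentative i R ∧ R ∈ MulAction.orbit (K F) U)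
    (h₂ : ∀ R, IsRepresentative i R → R ∈ MulAction.orbit (K F) U) :
    Omega F i = MulAction.orbit (K F) U := by
  ext S
  constructor
  · rintro ⟨R, hR, hS⟩
    rwa [← MulAction.orbit_eq_iff.2 (h₂ R hR)]
  · intro hS
    obtain ⟨R, hR, hRU⟩ := h₁
    refine ⟨R, hR, ?_⟩
    rwa [MulAction.orbit_eq_iff.2 hRU]

/-- Both distributions and the isomorphism type of the stabiliser are constant on an orbit, and the
size is |K| divided by the order of G. The second solid V allows the stabiliser to be computed at a
more convenient point of the orbit. -/
theorem orbitRow_of {i : ℕ} {p h : Fin 4 → ℚ} {G : Type*} [Group G] {N : ℚ}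
    (U V : Submodule F (Sym F)) (hΩ : Omega F i = MulAction.orbit (K F) U)
    (hV : V ∈ MulAction.orbit (K F) U) (hp : ∀ j, (pointOD U j : ℚ) = p j)
    (hh : ∀ j, (hyperplaneOD U j : ℚ) = h j)
    (hG : Nonempty (MulAction.stabilizer (K F) V ≃* G))
    (hN : N * Nat.card G = (Fintype.card F : ℚ) ^ 3 * ((Fintype.card F : ℚ) ^ 3 - 1) *
      ((Fintype.card F : ℚ) ^ 2 - 1)) :
    OrbitRow F i p h G N := by
  obtain ⟨g⟩ := hG
  have hstab : ∀ S ∈ MulAction.orbit (K F) U, Nonempty (MulAction.stabilizer (K F) S ≃* G) := by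
    intro S hS
    have : MulAction.orbitRel (K F) _ S V := by
      rw [MulAction.orbitRel_apply, MulAction.orbit_eq_iff.2 hV]
      exact hS
    exact ⟨(MulAction.stabilizerEquivStabilizerOfOrbitRel this).trans g⟩
  refine ⟨?_, ?_⟩
  · intro S hS
    rw [hΩ] at hS
    refine ⟨?_, ?_, hstab S hS⟩
    · obtain ⟨A, rfl⟩ := mem_orbit_iff.1 hS
      intro j
      rw [pointOD_alpha, hp]
    · obtain ⟨A, rfl⟩ := mem_orbit_iff.1 hS
      intro j
      rw [hyperplaneOD_alpha, hh]
  · obtain ⟨g'⟩ := hstab U (MulAction.mem_orbit_self U)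
    have h1 := ncard_orbit_mul_card_stabilizer U
    rw [Nat.card_congr g'.toEquiv, ← hΩ] at h1
    have h2 := congrArg (Nat.cast : ℕ → ℚ) h1
    push_cast at h2
    rw [card_K, ← hN] at h2
    have hq : (1 : ℚ) < Fintype.card F := by exact_mod_cast (Fintype.one_lt_card (α := F))
    -- An infinite G would have `Nat.card` zero; this is excluded because its product with N is |K|,
    -- which is positive.
    have hne : (Nat.card G : ℚ) ≠ 0 := by
      intro h0
      rw [h0, mul_zero] at hN
      have e1 : 0 < (Fintype.card F : ℚ) ^ 3 := by positivity
      have e2 : 0 < (Fintype.card F : ℚ) ^ 3 - 1 := by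
        have : (1 : ℚ) < (Fintype.card F : ℚ) ^ 3 := one_lt_pow₀ hq (by norm_num)
        linarith
      have e3 : 0 < (Fintype.card F : ℚ) ^ 2 - 1 := by
        have : (1 : ℚ) < (Fintype.card F : ℚ) ^ 2 := one_lt_pow₀ hq (by norm_num)
        linarith
      have := mul_pos (mul_pos e1 e2) e3
      linarith
    exact mul_right_cancel₀ hne h2

omit [Fintype F] [CharP F 2] in
/-- If the pencil of `g₁, g₂` is obtained from that of `f₁, f₂` by an invertible linear
substitution, the solids lie in the same orbit. -/
theorem pencil_mem_orbit {f₁ f₂ g₁ g₂ : TernaryForm F} (A : Matrix (Fin 3) (Fin 3) F)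
    (hA : A.det ≠ 0) (h₁ : InSpan g₁ g₂ (f₁.subst A)) (h₂ : InSpan g₁ g₂ (f₂.subst A))
    (h₃ : InSpan (f₁.subst A) (f₂.subst A) g₁) (h₄ : InSpan (f₁.subst A) (f₂.subst A) g₂) :
    pencil g₁ g₂ ∈ MulAction.orbit (K F) (pencil f₁ f₂) := by
  rw [pencil_eq_pencil h₁ h₂ h₃ h₄]
  exact pencil_subst_mem_orbit f₁ f₂ hA

end Rows

end VeroneseSolids

namespace VeroneseSolids
open TernaryForm

/-! ### Point-orbit distributions of the fifteen representatives -/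

section RepresentativeData

variable {F : Type*} [Field F]

def rep1Form₁ (F : Type*) [Field F] : TernaryForm F := ⟨0, 0, 0, 0, 1, 0⟩

def rep1Form₂ (F : Type*) [Field F] : TernaryForm F := ⟨0, 0, 0, 1, 0, 1⟩

/-- The parameters are grouped as a triple and a distinguished fourth, the one in which the
determinant is affine, possibly after squaring it. The same convention serves all fifteen solids. -/
def rep1Param (p : (F × F × F) × F) : Sym F :=
  symMk ![p.2, p.1.1, p.1.2.1, p.1.2.2, 0, p.1.2.2]

theorem rep1Param_injective : Function.Injective (rep1Param (F := F)) := by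
  rintro ⟨⟨y, z, t⟩, x⟩ ⟨⟨y', z', t'⟩, x'⟩ h
  have h := symMk_injective h
  simp at h ⊢
  grind

theorem mem_rep1 [CharP F 2] (M : Sym F) :
    M ∈ pencil (rep1Form₁ F) (rep1Form₂ F) ↔ ∃ p, rep1Param p = M := by
  have h2 : (2 : F) = 0 := CharTwo.two_eq_zero
  constructor
  · intro hM
    obtain ⟨h₁, h₂⟩ := mem_pencil.1 hM
    simp only [pair, rep1Form₁, rep1Form₂] at h₁ h₂
    refine ⟨((M.1 0 1, M.1 0 2, M.1 1 1), M.1 0 0), sym_ext ?_ ?_ ?_ ?_ ?_ ?_⟩ <;>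
      simp [rep1Param, symMk] <;> grind
  · rintro ⟨p, rfl⟩
    simp only [mem_pencil, rep1Param, pair_symMk, rep1Form₁, rep1Form₂, Matrix.cons_val]
    constructor <;> grind

theorem solid_rep1 [CharP F 2] : (solid fun x y z t : F =>
    !![x, y, z; y, t, 0; z, 0, t]) = pencil (rep1Form₁ F) (rep1Form₂ F) :=
  solid_eq_pencil (fun x y z t => ![x, y, z, t, 0, t]) (fun _ _ _ _ => rfl)
    (fun x y z t => (mem_rep1 _).2 ⟨((y, z, t), x), rfl⟩)
    (fun M h₁ h₂ => by
      obtain ⟨⟨⟨y, z, t⟩, x⟩, rfl⟩ := (mem_rep1 M).1 ⟨h₁, h₂⟩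
      exact ⟨x, y, z, t, rfl⟩)

theorem finrank_rep1 [CharP F 2] [Fintype F] : Module.finrank F (pencil (rep1Form₁ F) (rep1Form₂ F)) = 4 :=
  finrank_of_card (card_pencil _ rep1Param_injective mem_rep1)

theorem indep_rep1 : Indep (rep1Form₁ F) (rep1Form₂ F) := by
  intro a b h
  have h := TernaryForm.ext_iff.1 h
  simp [comb, zeroForm, rep1Form₁, rep1Form₂] at h
  grind

/-- X₁X₂ = 0 and (X₁ + X₂)² = 0 leave only the point (1, 0, 0). -/
theorem zeros_rep1 [CharP F 2] [Fintype F] :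
    {v : Fin 3 → F | v ≠ 0 ∧ (rep1Form₁ F).eval v = 0 ∧ (rep1Form₂ F).eval v = 0}.ncard =
      1 * (Fintype.card F - 1) := by
  have h2 : (2 : F) = 0 := CharTwo.two_eq_zero
  refine ncard_lines ![![1, 0, 0]] ?_ ?_ ?_ ?_
  · intro i h
    fin_cases i <;> simp at h
  · intro i j c h
    fin_cases i <;> fin_cases j <;> simp at h ⊢ <;> grind
  · intro i c
    fin_cases i <;> simp [eval, rep1Form₁, rep1Form₂] <;> grind
  · rintro v - ⟨h₁, h₂⟩
    simp only [eval, rep1Form₁, rep1Form₂] at h₁ h₂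
    refine ⟨0, v 0, ?_⟩
    funext j
    fin_cases j <;> simp <;> grind

theorem pointOD_rep1 [CharP F 2] [Fintype F] (j : Fin 4) :
    (pointOD (pencil (rep1Form₁ F) (rep1Form₂ F)) j : ℚ) =
      (![1, Fintype.card F + 1, 2 * Fintype.card F ^ 2 - 1, Fintype.card F ^ 3 - Fintype.card F ^ 2] : Fin 4 → ℚ) j := by
  have h2 : (2 : F) = 0 := CharTwo.two_eq_zero
  -- The determinant is t²x + t(y² + z²); coefficient and constant term vanish together on t = 0.
  refine pointOD_of_param (rep1Param) rep1Param_injective mem_rep1 (zeros_rep1)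
    (Z := F × F) (fun yz => ((yz.1, yz.2, 0), 0)) ?_ ?_ id Function.bijective_id
    (fun w => w.2.2 ^ 2) (fun w => w.2.2 * (w.1 ^ 2 + w.2.1 ^ 2)) ?_
    (fun v => (v.1, v.2, 0)) ?_ ?_ (B := F × F) (fun yz => (yz.1, yz.2, 0)) ?_ ?_ ?_ ?_ ?_ ?_ j
  · intro u v h
    simp at h ⊢
    grind
  · rintro ⟨⟨y, z, t⟩, x⟩
    simp only [rep1Param, zeroDiag_symMk, Matrix.cons_val, Prod.exists, Prod.mk.injEq]
    grind
  · intro p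
    simp only [rep1Param, det_symMk, Matrix.cons_val, id]
    grind
  · intro u v h
    simp at h ⊢
    grind
  · rintro ⟨y, z, t⟩
    simp only [Prod.exists, Prod.mk.injEq]
    grind
  · intro u v h
    simp at h ⊢
    try grind
  · rintro ⟨y, z, t⟩
    simp only [Sum.exists, Prod.exists, Sum.elim_inl, Sum.elim_inr, Prod.mk.injEq]
    grind [sqrtTwo_sq, sq_inj]
  · simp only [card_sub_one_cast, Matrix.cons_val]
    norm_num
  · simp only [Nat.card_sum, Nat.card_prod, Nat.cast_add, Nat.cast_mul, card_units_cast, card_cast, Matrix.cons_val]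
    ring
  · simp only [Nat.card_sum, Nat.card_prod, Nat.cast_add, Nat.cast_mul, card_units_cast, card_cast, Matrix.cons_val]
    ring
  · simp only [Matrix.cons_val]
    ring


def rep2Form₁ (F : Type*) [Field F] : TernaryForm F := ⟨0, 0, 0, 0, 1, 0⟩

def rep2Form₂ (F : Type*) [Field F] : TernaryForm F := ⟨0, 0, 0, 0, 0, 1⟩

def rep2Param (p : (F × F × F) × F) : Sym F :=
  symMk ![p.1.1, p.1.2.1, p.2, p.1.2.2, 0, 0]

theorem rep2Param_injective : Function.Injective (rep2Param (F := F)) := by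
  rintro ⟨⟨x, y, t⟩, z⟩ ⟨⟨x', y', t'⟩, z'⟩ h
  have h := symMk_injective h
  simp at h ⊢
  grind

theorem mem_rep2 [CharP F 2] (M : Sym F) :
    M ∈ pencil (rep2Form₁ F) (rep2Form₂ F) ↔ ∃ p, rep2Param p = M := by
  have h2 : (2 : F) = 0 := CharTwo.two_eq_zero
  constructor
  · intro hM
    obtain ⟨h₁, h₂⟩ := mem_pencil.1 hM
    simp only [pair, rep2Form₁, rep2Form₂] at h₁ h₂
    refine ⟨((M.1 0 0, M.1 0 1, M.1 1 1), M.1 0 2), sym_ext ?_ ?_ ?_ ?_ ?_ ?_⟩ <;>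
      simp [rep2Param, symMk] <;> grind
  · rintro ⟨p, rfl⟩
    simp only [mem_pencil, rep2Param, pair_symMk, rep2Form₁, rep2Form₂, Matrix.cons_val]
    constructor <;> grind

theorem solid_rep2 [CharP F 2] : (solid fun x y z t : F =>
    !![x, y, z; y, t, 0; z, 0, 0]) = pencil (rep2Form₁ F) (rep2Form₂ F) :=
  solid_eq_pencil (fun x y z t => ![x, y, z, t, 0, 0]) (fun _ _ _ _ => rfl)
    (fun x y z t => (mem_rep2 _).2 ⟨((x, y, t), z), rfl⟩)
    (fun M h₁ h₂ => by
      obtain ⟨⟨⟨x, y, t⟩, z⟩, rfl⟩ := (mem_rep2 M).1 ⟨h₁, h₂⟩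
      exact ⟨x, y, z, t, rfl⟩)

theorem finrank_rep2 [CharP F 2] [Fintype F] : Module.finrank F (pencil (rep2Form₁ F) (rep2Form₂ F)) = 4 :=
  finrank_of_card (card_pencil _ rep2Param_injective mem_rep2)

theorem indep_rep2 : Indep (rep2Form₁ F) (rep2Form₂ F) := by
  intro a b h
  have h := TernaryForm.ext_iff.1 h
  simp [comb, zeroForm, rep2Form₁, rep2Form₂] at h
  grind

/-- The line X₂ = 0 is a common component of all members. -/
theorem zeros_rep2 [CharP F 2] :
    {v : Fin 3 → F | v ≠ 0 ∧ (rep2Form₁ F).eval v = 0 ∧ (rep2Form₂ F).eval v = 0}.ncard =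
      Nat.card {w : F × F // w ≠ 0} := by
  apply ncard_eq_card_of_param fun w => ![w.1.1, w.1.2, 0]
  · rintro ⟨⟨a, b⟩, h⟩ ⟨⟨c, d⟩, h'⟩ e
    simpa using e
  · intro v
    constructor
    · rintro ⟨hv, h₁, h₂⟩
      simp only [eval, rep2Form₁, rep2Form₂] at h₁ h₂
      have h2 : v 2 = 0 := by grind
      refine ⟨⟨(v 0, v 1), fun h => hv ?_⟩, ?_⟩
      · rw [Prod.mk_eq_zero] at h
        funext j
        fin_cases j <;> simp [h, h2]
      · funext j
        fin_cases j <;> simp [h2]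
    · rintro ⟨⟨w, h⟩, rfl⟩
      refine ⟨fun h' => h ?_, ?_, ?_⟩
      · exact Prod.ext (congrFun h' 0) (congrFun h' 1)
      · simp [eval, rep2Form₁]
      · simp [eval, rep2Form₂]

theorem pointOD_rep2 [CharP F 2] [Fintype F] (j : Fin 4) :
    (pointOD (pencil (rep2Form₁ F) (rep2Form₂ F)) j : ℚ) =
      (![Fintype.card F + 1, Fintype.card F + 1, 2 * Fintype.card F ^ 2 - Fintype.card F - 1, Fintype.card F ^ 3 - Fintype.card F ^ 2] : Fin 4 → ℚ) j := by
  have h2 : (2 : F) = 0 := CharTwo.two_eq_zero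
  -- The determinant is t z², with no constant term.
  refine pointOD_of_param (rep2Param) rep2Param_injective mem_rep2 (zeros_rep2)
    (Z := F × F) (fun yz => ((0, yz.1, 0), yz.2)) ?_ ?_ (fun x => x ^ 2) sq_bijective
    (fun w => w.2.2) (fun w => 0) ?_
    (fun v => (v.1, v.2, 0)) ?_ ?_ (B := F × F) (fun xy => (xy.1, xy.2, 0)) ?_ ?_ ?_ ?_ ?_ ?_ j
  · intro u v h
    simp at h ⊢
    grind
  · rintro ⟨⟨x, y, t⟩, z⟩
    simp only [rep2Param, zeroDiag_symMk, Matrix.cons_val, Prod.exists, Prod.mk.injEq]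
    grind
  · intro p
    simp only [rep2Param, det_symMk, Matrix.cons_val, id]
    grind
  · intro u v h
    simp at h ⊢
    grind
  · rintro ⟨x, y, t⟩
    simp only [Prod.exists, Prod.mk.injEq]
    grind
  · intro u v h
    simp at h ⊢
    try grind
  · rintro ⟨x, y, t⟩
    simp only [Sum.exists, Prod.exists, Sum.elim_inl, Sum.elim_inr, Prod.mk.injEq]
    grind [sqrtTwo_sq, sq_inj]
  · simp only [card_ne_zero_cast, Matrix.cons_val]
    ring
  · simp only [Nat.card_sum, Nat.card_prod, Nat.cast_add, Nat.cast_mul, card_units_cast, card_cast, Matrix.cons_val]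
    ring
  · simp only [Nat.card_sum, Nat.card_prod, Nat.cast_add, Nat.cast_mul, card_units_cast, card_cast, Matrix.cons_val]
    ring
  · simp only [Matrix.cons_val]
    ring


def rep3Form₁ (F : Type*) [Field F] : TernaryForm F := ⟨0, 0, 0, 1, 0, 0⟩

def rep3Form₂ (F : Type*) [Field F] : TernaryForm F := ⟨0, 0, 0, 0, 0, 1⟩

def rep3Param (p : (F × F × F) × F) : Sym F :=
  symMk ![p.1.1, p.1.2.1, p.1.2.2, 0, p.2, 0]

theorem rep3Param_injective : Function.Injective (rep3Param (F := F)) := by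
  rintro ⟨⟨x, y, z⟩, t⟩ ⟨⟨x', y', z'⟩, t'⟩ h
  have h := symMk_injective h
  simp at h ⊢
  grind

theorem mem_rep3 [CharP F 2] (M : Sym F) :
    M ∈ pencil (rep3Form₁ F) (rep3Form₂ F) ↔ ∃ p, rep3Param p = M := by
  have h2 : (2 : F) = 0 := CharTwo.two_eq_zero
  constructor
  · intro hM
    obtain ⟨h₁, h₂⟩ := mem_pencil.1 hM
    simp only [pair, rep3Form₁, rep3Form₂] at h₁ h₂
    refine ⟨((M.1 0 0, M.1 0 1, M.1 0 2), M.1 1 2), sym_ext ?_ ?_ ?_ ?_ ?_ ?_⟩ <;>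
      simp [rep3Param, symMk] <;> grind
  · rintro ⟨p, rfl⟩
    simp only [mem_pencil, rep3Param, pair_symMk, rep3Form₁, rep3Form₂, Matrix.cons_val]
    constructor <;> grind

theorem solid_rep3 [CharP F 2] : (solid fun x y z t : F =>
    !![x, y, z; y, 0, t; z, t, 0]) = pencil (rep3Form₁ F) (rep3Form₂ F) :=
  solid_eq_pencil (fun x y z t => ![x, y, z, 0, t, 0]) (fun _ _ _ _ => rfl)
    (fun x y z t => (mem_rep3 _).2 ⟨((x, y, z), t), rfl⟩)
    (fun M h₁ h₂ => by
      obtain ⟨⟨⟨x, y, z⟩, t⟩, rfl⟩ := (mem_rep3 M).1 ⟨h₁, h₂⟩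
      exact ⟨x, y, z, t, rfl⟩)

theorem finrank_rep3 [CharP F 2] [Fintype F] : Module.finrank F (pencil (rep3Form₁ F) (rep3Form₂ F)) = 4 :=
  finrank_of_card (card_pencil _ rep3Param_injective mem_rep3)

theorem indep_rep3 : Indep (rep3Form₁ F) (rep3Form₂ F) := by
  intro a b h
  have h := TernaryForm.ext_iff.1 h
  simp [comb, zeroForm, rep3Form₁, rep3Form₂] at h
  grind

theorem zeros_rep3 [CharP F 2] [Fintype F] :
    {v : Fin 3 → F | v ≠ 0 ∧ (rep3Form₁ F).eval v = 0 ∧ (rep3Form₂ F).eval v = 0}.ncard =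
      1 * (Fintype.card F - 1) := by
  have h2 : (2 : F) = 0 := CharTwo.two_eq_zero
  refine ncard_lines ![![1, 0, 0]] ?_ ?_ ?_ ?_
  · intro i h
    fin_cases i <;> simp at h
  · intro i j c h
    fin_cases i <;> fin_cases j <;> simp at h ⊢ <;> grind
  · intro i c
    fin_cases i <;> simp [eval, rep3Form₁, rep3Form₂] <;> grind
  · rintro v - ⟨h₁, h₂⟩
    simp only [eval, rep3Form₁, rep3Form₂] at h₁ h₂
    refine ⟨0, v 0, ?_⟩
    funext j
    fin_cases j <;> simp <;> grind

theorem pointOD_rep3 [CharP F 2] [Fintype F] (j : Fin 4) :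
    (pointOD (pencil (rep3Form₁ F) (rep3Form₂ F)) j : ℚ) =
      (![1, Fintype.card F ^ 2 + Fintype.card F + 1, Fintype.card F ^ 2 - 1, Fintype.card F ^ 3 - Fintype.card F ^ 2] : Fin 4 → ℚ) j := by
  have h2 : (2 : F) = 0 := CharTwo.two_eq_zero
  -- The determinant is x t². The solid contains the whole nucleus plane, cut out by x = 0, hence q³
  -- alternating matrices.
  refine pointOD_of_param (rep3Param) rep3Param_injective mem_rep3 (zeros_rep3)
    (Z := F × F × F) (fun yzt => ((0, yzt.1, yzt.2.1), yzt.2.2)) ?_ ?_ (fun x => x ^ 2) sq_bijective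
    (fun w => w.1) (fun w => 0) ?_
    (fun v => (0, v.1, v.2)) ?_ ?_ (B := F × F) (fun yz => (0, yz.1, yz.2)) ?_ ?_ ?_ ?_ ?_ ?_ j
  · intro u v h
    simp at h ⊢
    grind
  · rintro ⟨⟨x, y, z⟩, t⟩
    simp only [rep3Param, zeroDiag_symMk, Matrix.cons_val, Prod.exists, Prod.mk.injEq]
    grind
  · intro p
    simp only [rep3Param, det_symMk, Matrix.cons_val, id]
    grind
  · intro u v h
    simp at h ⊢
    grind
  · rintro ⟨x, y, z⟩
    simp only [Prod.exists, Prod.mk.injEq]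
    grind
  · intro u v h
    simp at h ⊢
    try grind
  · rintro ⟨x, y, z⟩
    simp only [Sum.exists, Prod.exists, Sum.elim_inl, Sum.elim_inr, Prod.mk.injEq]
    grind [sqrtTwo_sq, sq_inj]
  · simp only [card_sub_one_cast, Matrix.cons_val]
    norm_num
  · simp only [Nat.card_sum, Nat.card_prod, Nat.cast_add, Nat.cast_mul, card_units_cast, card_cast, Matrix.cons_val]
    ring
  · simp only [Nat.card_sum, Nat.card_prod, Nat.cast_add, Nat.cast_mul, card_units_cast, card_cast, Matrix.cons_val]
    ring
  · simp only [Matrix.cons_val]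
    ring


def rep4Form₁ (F : Type*) [Field F] : TernaryForm F := ⟨0, 1, 0, 0, 0, 0⟩

def rep4Form₂ (F : Type*) [Field F] : TernaryForm F := ⟨0, 0, 0, 0, 1, 0⟩

def rep4Param (p : (F × F × F) × F) : Sym F :=
  symMk ![p.1.1, 0, p.1.2.1, p.2, 0, p.1.2.2]

theorem rep4Param_injective : Function.Injective (rep4Param (F := F)) := by
  rintro ⟨⟨x, y, t⟩, z⟩ ⟨⟨x', y', t'⟩, z'⟩ h
  have h := symMk_injective h
  simp at h ⊢
  grind

theorem mem_rep4 [CharP F 2] (M : Sym F) :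
    M ∈ pencil (rep4Form₁ F) (rep4Form₂ F) ↔ ∃ p, rep4Param p = M := by
  have h2 : (2 : F) = 0 := CharTwo.two_eq_zero
  constructor
  · intro hM
    obtain ⟨h₁, h₂⟩ := mem_pencil.1 hM
    simp only [pair, rep4Form₁, rep4Form₂] at h₁ h₂
    refine ⟨((M.1 0 0, M.1 0 2, M.1 2 2), M.1 1 1), sym_ext ?_ ?_ ?_ ?_ ?_ ?_⟩ <;>
      simp [rep4Param, symMk] <;> grind
  · rintro ⟨p, rfl⟩
    simp only [mem_pencil, rep4Param, pair_symMk, rep4Form₁, rep4Form₂, Matrix.cons_val]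
    constructor <;> grind

theorem solid_rep4 [CharP F 2] : (solid fun x y z t : F =>
    !![x, 0, y; 0, z, 0; y, 0, t]) = pencil (rep4Form₁ F) (rep4Form₂ F) :=
  solid_eq_pencil (fun x y z t => ![x, 0, y, z, 0, t]) (fun _ _ _ _ => rfl)
    (fun x y z t => (mem_rep4 _).2 ⟨((x, y, t), z), rfl⟩)
    (fun M h₁ h₂ => by
      obtain ⟨⟨⟨x, y, t⟩, z⟩, rfl⟩ := (mem_rep4 M).1 ⟨h₁, h₂⟩
      exact ⟨x, y, z, t, rfl⟩)

theorem finrank_rep4 [CharP F 2] [Fintype F] : Module.finrank F (pencil (rep4Form₁ F) (rep4Form₂ F)) = 4 :=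
  finrank_of_card (card_pencil _ rep4Param_injective mem_rep4)

theorem indep_rep4 : Indep (rep4Form₁ F) (rep4Form₂ F) := by
  intro a b h
  have h := TernaryForm.ext_iff.1 h
  simp [comb, zeroForm, rep4Form₁, rep4Form₂] at h
  grind

/-- The base locus is the common line X₁ = 0 together with the point (0, 1, 0) off it. -/
theorem zeros_rep4 [CharP F 2] :
    {v : Fin 3 → F | v ≠ 0 ∧ (rep4Form₁ F).eval v = 0 ∧ (rep4Form₂ F).eval v = 0}.ncard =
      Nat.card ({w : F × F // w ≠ 0} ⊕ Fˣ) := by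
  apply ncard_eq_card_of_param
    (Sum.elim (fun w : {w : F × F // w ≠ 0} => ![w.1.1, 0, w.1.2]) (fun u : Fˣ => ![0, (u : F), 0]))
  · rintro (⟨⟨a, b⟩, h⟩ | u) (⟨⟨c, d⟩, h'⟩ | v) e
    · simpa using e
    · simp at e
      exact absurd e.2.1.symm v.ne_zero
    · simp at e
    · simpa [Units.ext_iff] using e
  · intro v
    constructor
    · rintro ⟨hv, h₁, h₂⟩
      simp only [eval, rep4Form₁, rep4Form₂] at h₁ h₂
      by_cases h1 : v 1 = 0
      · refine ⟨Sum.inl ⟨(v 0, v 2), fun h => hv ?_⟩, ?_⟩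
        · rw [Prod.mk_eq_zero] at h
          funext j
          fin_cases j <;> simp [h, h1]
        · funext j
          fin_cases j <;> simp [h1]
      · refine ⟨Sum.inr (Units.mk0 _ h1), ?_⟩
        funext j
        fin_cases j <;> simp <;> grind
    · rintro ⟨⟨w, h⟩ | u, rfl⟩
      · refine ⟨fun h' => h ?_, ?_, ?_⟩
        · exact Prod.ext (congrFun h' 0) (congrFun h' 2)
        · simp [eval, rep4Form₁]
        · simp [eval, rep4Form₂]
      · refine ⟨fun h' => u.ne_zero (congrFun h' 1), ?_, ?_⟩
        · simp [eval, rep4Form₁]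
        · simp [eval, rep4Form₂]

theorem pointOD_rep4 [CharP F 2] [Fintype F] (j : Fin 4) :
    (pointOD (pencil (rep4Form₁ F) (rep4Form₂ F)) j : ℚ) =
      (![Fintype.card F + 2, 1, 2 * Fintype.card F ^ 2 - 2, Fintype.card F ^ 3 - Fintype.card F ^ 2] : Fin 4 → ℚ) j := by
  have h2 : (2 : F) = 0 := CharTwo.two_eq_zero
  -- The determinant is z(xt + y²); the cone xt = y² is parametrised by x and t through a square
  -- root.
  refine pointOD_of_param (rep4Param) rep4Param_injective mem_rep4 (zeros_rep4)
    (Z := F) (fun y => ((0, y, 0), 0)) ?_ ?_ id Function.bijective_id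
    (fun w => w.1 * w.2.2 + w.2.1 ^ 2) (fun w => 0) ?_
    (fun v => (v.1, sqrtTwo (v.1 * v.2), v.2)) ?_ ?_ (B := F × F) (fun xt => (xt.1, sqrtTwo (xt.1 * xt.2), xt.2)) ?_ ?_ ?_ ?_ ?_ ?_ j
  · intro u v h
    simp at h ⊢
    grind
  · rintro ⟨⟨x, y, t⟩, z⟩
    simp only [rep4Param, zeroDiag_symMk, Matrix.cons_val, Prod.exists, Prod.mk.injEq]
    grind
  · intro p
    simp only [rep4Param, det_symMk, Matrix.cons_val, id]
    grind
  · intro u v h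
    simp at h ⊢
    grind
  · rintro ⟨x, y, t⟩
    simp only [Prod.exists, Prod.mk.injEq]
    grind [sqrtTwo_sq, sq_inj]
  · intro u v h
    simp at h ⊢
    try grind
  · rintro ⟨x, y, t⟩
    simp only [Sum.exists, Prod.exists, Sum.elim_inl, Sum.elim_inr, Prod.mk.injEq]
    grind [sqrtTwo_sq, sq_inj]
  · simp only [Nat.card_sum, Nat.cast_add, card_ne_zero_cast, card_units_cast, Matrix.cons_val]
    ring
  · simp only [Nat.card_sum, Nat.card_prod, Nat.cast_add, Nat.cast_mul, card_units_cast, card_cast, Matrix.cons_val]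
    ring
  · simp only [Nat.card_sum, Nat.card_prod, Nat.cast_add, Nat.cast_mul, card_units_cast, card_cast, Matrix.cons_val]
    ring
  · simp only [Matrix.cons_val]
    ring


def rep5Form₁ (F : Type*) [Field F] : TernaryForm F := ⟨0, 1, 0, 0, 0, 1⟩

def rep5Form₂ (F : Type*) [Field F] : TernaryForm F := ⟨1, 0, 0, 0, 0, 0⟩

def rep5Param (p : (F × F × F) × F) : Sym F :=
  symMk ![0, p.1.1, p.1.2.2, p.2, p.1.2.1, p.1.1]

theorem rep5Param_injective : Function.Injective (rep5Param (F := F)) := by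
  rintro ⟨⟨x, t, y⟩, z⟩ ⟨⟨x', t', y'⟩, z'⟩ h
  have h := symMk_injective h
  simp at h ⊢
  grind

theorem mem_rep5 [CharP F 2] (M : Sym F) :
    M ∈ pencil (rep5Form₁ F) (rep5Form₂ F) ↔ ∃ p, rep5Param p = M := by
  have h2 : (2 : F) = 0 := CharTwo.two_eq_zero
  constructor
  · intro hM
    obtain ⟨h₁, h₂⟩ := mem_pencil.1 hM
    simp only [pair, rep5Form₁, rep5Form₂] at h₁ h₂
    refine ⟨((M.1 0 1, M.1 1 2, M.1 0 2), M.1 1 1), sym_ext ?_ ?_ ?_ ?_ ?_ ?_⟩ <;>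
      simp [rep5Param, symMk] <;> grind
  · rintro ⟨p, rfl⟩
    simp only [mem_pencil, rep5Param, pair_symMk, rep5Form₁, rep5Form₂, Matrix.cons_val]
    constructor <;> grind

theorem solid_rep5 [CharP F 2] : (solid fun x y z t : F =>
    !![0, x, y; x, z, t; y, t, x]) = pencil (rep5Form₁ F) (rep5Form₂ F) :=
  solid_eq_pencil (fun x y z t => ![0, x, y, z, t, x]) (fun _ _ _ _ => rfl)
    (fun x y z t => (mem_rep5 _).2 ⟨((x, t, y), z), rfl⟩)
    (fun M h₁ h₂ => by
      obtain ⟨⟨⟨x, t, y⟩, z⟩, rfl⟩ := (mem_rep5 M).1 ⟨h₁, h₂⟩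
      exact ⟨x, y, z, t, rfl⟩)

theorem finrank_rep5 [CharP F 2] [Fintype F] : Module.finrank F (pencil (rep5Form₁ F) (rep5Form₂ F)) = 4 :=
  finrank_of_card (card_pencil _ rep5Param_injective mem_rep5)

theorem indep_rep5 : Indep (rep5Form₁ F) (rep5Form₂ F) := by
  intro a b h
  have h := TernaryForm.ext_iff.1 h
  simp [comb, zeroForm, rep5Form₁, rep5Form₂] at h
  grind

theorem zeros_rep5 [CharP F 2] [Fintype F] :
    {v : Fin 3 → F | v ≠ 0 ∧ (rep5Form₁ F).eval v = 0 ∧ (rep5Form₂ F).eval v = 0}.ncard =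
      1 * (Fintype.card F - 1) := by
  have h2 : (2 : F) = 0 := CharTwo.two_eq_zero
  refine ncard_lines ![![0, 1, 0]] ?_ ?_ ?_ ?_
  · intro i h
    fin_cases i <;> simp at h
  · intro i j c h
    fin_cases i <;> fin_cases j <;> simp at h ⊢ <;> grind
  · intro i c
    fin_cases i <;> simp [eval, rep5Form₁, rep5Form₂] <;> grind
  · rintro v - ⟨h₁, h₂⟩
    simp only [eval, rep5Form₁, rep5Form₂] at h₁ h₂
    refine ⟨0, v 1, ?_⟩
    funext j
    fin_cases j <;> simp <;> grind

theorem pointOD_rep5 [CharP F 2] [Fintype F] (j : Fin 4) :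
    (pointOD (pencil (rep5Form₁ F) (rep5Form₂ F)) j : ℚ) =
      (![1, Fintype.card F + 1, Fintype.card F ^ 2 - 1, Fintype.card F ^ 3] : Fin 4 → ℚ) j := by
  have h2 : (2 : F) = 0 := CharTwo.two_eq_zero
  -- The determinant is y²z + x³, so it degenerates on x = y = 0.
  refine pointOD_of_param (rep5Param) rep5Param_injective mem_rep5 (zeros_rep5)
    (Z := F × F) (fun yt => ((0, yt.2, yt.1), 0)) ?_ ?_ id Function.bijective_id
    (fun w => w.2.2 ^ 2) (fun w => w.1 ^ 3) ?_
    (fun v => (v.1, v.2, 0)) ?_ ?_ (B := F) (fun t => (0, t, 0)) ?_ ?_ ?_ ?_ ?_ ?_ j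
  · intro u v h
    simp at h ⊢
    grind
  · rintro ⟨⟨x, t, y⟩, z⟩
    simp only [rep5Param, zeroDiag_symMk, Matrix.cons_val, Prod.exists, Prod.mk.injEq]
    grind
  · intro p
    simp only [rep5Param, det_symMk, Matrix.cons_val, id]
    grind
  · intro u v h
    simp at h ⊢
    grind
  · rintro ⟨x, t, y⟩
    simp only [Prod.exists, Prod.mk.injEq]
    grind
  · intro u v h
    simp at h ⊢
    try grind
  · rintro ⟨x, t, y⟩
    simp only [Sum.exists, Prod.exists, Sum.elim_inl, Sum.elim_inr, Prod.mk.injEq]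
    grind [sqrtTwo_sq, sq_inj]
  · simp only [card_sub_one_cast, Matrix.cons_val]
    norm_num
  · simp only [Nat.card_sum, Nat.card_prod, Nat.cast_add, Nat.cast_mul, card_units_cast, card_cast, Matrix.cons_val]
    ring
  · simp only [Nat.card_sum, Nat.card_prod, Nat.cast_add, Nat.cast_mul, card_units_cast, card_cast, Matrix.cons_val]
    ring
  · simp only [Matrix.cons_val]
    ring


def rep6Form₁ (F : Type*) [Field F] : TernaryForm F := ⟨0, 1, 0, 0, 0, 0⟩

def rep6Form₂ (F : Type*) [Field F] : TernaryForm F := ⟨0, 0, 0, 0, 0, 1⟩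

def rep6Param (p : (F × F × F) × F) : Sym F :=
  symMk ![p.2, 0, p.1.2.1, p.1.1, p.1.2.2, 0]

theorem rep6Param_injective : Function.Injective (rep6Param (F := F)) := by
  rintro ⟨⟨z, y, t⟩, x⟩ ⟨⟨z', y', t'⟩, x'⟩ h
  have h := symMk_injective h
  simp at h ⊢
  grind

theorem mem_rep6 [CharP F 2] (M : Sym F) :
    M ∈ pencil (rep6Form₁ F) (rep6Form₂ F) ↔ ∃ p, rep6Param p = M := by
  have h2 : (2 : F) = 0 := CharTwo.two_eq_zero
  constructor
  · intro hM
    obtain ⟨h₁, h₂⟩ := mem_pencil.1 hM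
    simp only [pair, rep6Form₁, rep6Form₂] at h₁ h₂
    refine ⟨((M.1 1 1, M.1 0 2, M.1 1 2), M.1 0 0), sym_ext ?_ ?_ ?_ ?_ ?_ ?_⟩ <;>
      simp [rep6Param, symMk] <;> grind
  · rintro ⟨p, rfl⟩
    simp only [mem_pencil, rep6Param, pair_symMk, rep6Form₁, rep6Form₂, Matrix.cons_val]
    constructor <;> grind

theorem solid_rep6 [CharP F 2] : (solid fun x y z t : F =>
    !![x, 0, y; 0, z, t; y, t, 0]) = pencil (rep6Form₁ F) (rep6Form₂ F) :=
  solid_eq_pencil (fun x y z t => ![x, 0, y, z, t, 0]) (fun _ _ _ _ => rfl)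
    (fun x y z t => (mem_rep6 _).2 ⟨((z, y, t), x), rfl⟩)
    (fun M h₁ h₂ => by
      obtain ⟨⟨⟨z, y, t⟩, x⟩, rfl⟩ := (mem_rep6 M).1 ⟨h₁, h₂⟩
      exact ⟨x, y, z, t, rfl⟩)

theorem finrank_rep6 [CharP F 2] [Fintype F] : Module.finrank F (pencil (rep6Form₁ F) (rep6Form₂ F)) = 4 :=
  finrank_of_card (card_pencil _ rep6Param_injective mem_rep6)

theorem indep_rep6 : Indep (rep6Form₁ F) (rep6Form₂ F) := by
  intro a b h
  have h := TernaryForm.ext_iff.1 h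
  simp [comb, zeroForm, rep6Form₁, rep6Form₂] at h
  grind

theorem zeros_rep6 [CharP F 2] [Fintype F] :
    {v : Fin 3 → F | v ≠ 0 ∧ (rep6Form₁ F).eval v = 0 ∧ (rep6Form₂ F).eval v = 0}.ncard =
      2 * (Fintype.card F - 1) := by
  have h2 : (2 : F) = 0 := CharTwo.two_eq_zero
  refine ncard_lines ![![1, 0, 0], ![0, 1, 0]] ?_ ?_ ?_ ?_
  · intro i h
    fin_cases i <;> simp at h
  · intro i j c h
    fin_cases i <;> fin_cases j <;> simp at h ⊢ <;> grind
  · intro i c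
    fin_cases i <;> simp [eval, rep6Form₁, rep6Form₂] <;> grind
  · rintro v - ⟨h₁, h₂⟩
    simp only [eval, rep6Form₁, rep6Form₂] at h₁ h₂
    rcases (by grind : v 0 = 0 ∨ v 1 = 0) with h | h
    · refine ⟨1, v 1, ?_⟩
      funext j
      fin_cases j <;> simp <;> grind
    · refine ⟨0, v 0, ?_⟩
      funext j
      fin_cases j <;> simp <;> grind

theorem pointOD_rep6 [CharP F 2] [Fintype F] (j : Fin 4) :
    (pointOD (pencil (rep6Form₁ F) (rep6Form₂ F)) j : ℚ) =
      (![2, Fintype.card F + 1, Fintype.card F ^ 2 + Fintype.card F - 2, Fintype.card F ^ 3 - Fintype.card F] : Fin 4 → ℚ) j := by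
  have h2 : (2 : F) = 0 := CharTwo.two_eq_zero
  -- The determinant is t²x + z y². It degenerates on t = 0 with z y = 0: two lines through the
  -- origin, counted as one full line and the nonzero points of the other.
  refine pointOD_of_param (rep6Param) rep6Param_injective mem_rep6 (zeros_rep6)
    (Z := F × F) (fun yt => ((0, yt.1, yt.2), 0)) ?_ ?_ id Function.bijective_id
    (fun w => w.2.2 ^ 2) (fun w => w.1 * w.2.1 ^ 2) ?_
    (fun v => (v.1, v.2, 0)) ?_ ?_ (B := F ⊕ Fˣ) (Sum.elim (fun z => (z, 0, 0)) (fun y : Fˣ => (0, (y : F), 0))) ?_ ?_ ?_ ?_ ?_ ?_ j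
  · intro u v h
    simp at h ⊢
    grind
  · rintro ⟨⟨z, y, t⟩, x⟩
    simp only [rep6Param, zeroDiag_symMk, Matrix.cons_val, Prod.exists, Prod.mk.injEq]
    grind
  · intro p
    simp only [rep6Param, det_symMk, Matrix.cons_val, id]
    grind
  · intro u v h
    simp at h ⊢
    grind
  · rintro ⟨z, y, t⟩
    simp only [Prod.exists, Prod.mk.injEq]
    grind
  · rintro u v h
    rcases u with u | u <;> rcases v with v | v <;> simp at h ⊢ <;> grind [Units.ext, Units.ne_zero]
  · rintro ⟨z, y, t⟩
    constructor
    · rintro ⟨h, h'⟩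
      dsimp only at h h'
      by_cases hy : y = 0
      · exact ⟨Sum.inl z, by simp; grind⟩
      exact ⟨Sum.inr (Units.mk0 y hy), by simp; grind [sq_inj]⟩
    · rintro ⟨u | u, h⟩ <;> simp at h <;> grind
  · simp only [card_sub_one_cast, Matrix.cons_val]
    norm_num
  · simp only [Nat.card_sum, Nat.card_prod, Nat.cast_add, Nat.cast_mul, card_units_cast, card_cast, Matrix.cons_val]
    ring
  · simp only [Nat.card_sum, Nat.card_prod, Nat.cast_add, Nat.cast_mul, card_units_cast, card_cast, Matrix.cons_val]
    ring
  · simp only [Matrix.cons_val]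
    ring


def rep7Form₁ (γ : F) : TernaryForm F := ⟨1, γ, 0, 1, 0, 0⟩

def rep7Form₂ (γ : F) : TernaryForm F := ⟨0, 1, 0, 0, 0, 1⟩

def rep7Param (γ : F) (p : (F × F × F) × F) : Sym F :=
  symMk ![p.1.1, p.1.2.1, p.1.2.2, p.1.1 + γ * p.1.2.1, p.2, p.1.2.1]

theorem rep7Param_injective (γ : F) : Function.Injective (rep7Param γ) := by
  rintro ⟨⟨x, y, z⟩, t⟩ ⟨⟨x', y', z'⟩, t'⟩ h
  have h := symMk_injective h
  simp at h ⊢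
  grind

theorem mem_rep7 [CharP F 2] (γ : F) (M : Sym F) :
    M ∈ pencil (rep7Form₁ γ) (rep7Form₂ γ) ↔ ∃ p, rep7Param γ p = M := by
  have h2 : (2 : F) = 0 := CharTwo.two_eq_zero
  constructor
  · intro hM
    obtain ⟨h₁, h₂⟩ := mem_pencil.1 hM
    simp only [pair, rep7Form₁, rep7Form₂] at h₁ h₂
    refine ⟨((M.1 0 0, M.1 0 1, M.1 0 2), M.1 1 2), sym_ext ?_ ?_ ?_ ?_ ?_ ?_⟩ <;>
      simp [rep7Param, symMk] <;> grind
  · rintro ⟨p, rfl⟩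
    simp only [mem_pencil, rep7Param, pair_symMk, rep7Form₁, rep7Form₂, Matrix.cons_val]
    constructor <;> grind

theorem solid_rep7 [CharP F 2] (γ : F) : (solid fun x y z t : F =>
    !![x, y, z; y, x + γ * y, t; z, t, y]) = pencil (rep7Form₁ γ) (rep7Form₂ γ) :=
  solid_eq_pencil (fun x y z t => ![x, y, z, x + γ * y, t, y]) (fun _ _ _ _ => rfl)
    (fun x y z t => ((mem_rep7 γ) _).2 ⟨((x, y, z), t), rfl⟩)
    (fun M h₁ h₂ => by
      obtain ⟨⟨⟨x, y, z⟩, t⟩, rfl⟩ := ((mem_rep7 γ) M).1 ⟨h₁, h₂⟩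
      exact ⟨x, y, z, t, rfl⟩)

theorem finrank_rep7 [CharP F 2] [Fintype F] (γ : F) : Module.finrank F (pencil (rep7Form₁ γ) (rep7Form₂ γ)) = 4 :=
  finrank_of_card (card_pencil _ (rep7Param_injective γ) (mem_rep7 γ))

theorem indep_rep7 (γ : F) : Indep (rep7Form₁ γ) (rep7Form₂ γ) := by
  intro a b h
  have h := TernaryForm.ext_iff.1 h
  simp [comb, zeroForm, rep7Form₁, rep7Form₂] at h
  grind

/-- The first form is anisotropic in X₀, X₁, and then the second gives X₂ = 0. -/
theorem zeros_rep7 [CharP F 2] [Fintype F] {γ : F} (hγ : Tr γ⁻¹ = 1) :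
    {v : Fin 3 → F | v ≠ 0 ∧ (rep7Form₁ γ).eval v = 0 ∧ (rep7Form₂ γ).eval v = 0}.ncard = 0 * (Fintype.card F - 1) := by
  rw [zero_mul, Set.ncard_eq_zero (Set.toFinite _), Set.eq_empty_iff_forall_notMem]
  rintro v ⟨hv, h₁, h₂⟩
  apply hv
  simp only [eval, rep7Form₁, rep7Form₂] at h₁ h₂
  obtain ⟨h, h'⟩ := norm_form_eq_zero' hγ (x := v 0) (y := v 1) (by grind)
  funext j
  fin_cases j <;> simp <;> grind

theorem pointOD_rep7 [CharP F 2] [Fintype F] {γ : F} (hγ : Tr γ⁻¹ = 1) (j : Fin 4) :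
    (pointOD (pencil (rep7Form₁ γ) (rep7Form₂ γ)) j : ℚ) =
      (![0, Fintype.card F + 1, Fintype.card F ^ 2 + Fintype.card F, Fintype.card F ^ 3 - Fintype.card F] : Fin 4 → ℚ) j := by
  have h2 : (2 : F) = 0 := CharTwo.two_eq_zero
  have hs := sqrtTwo_sq γ
  have hγ0 := ne_zero_of_tr_inv hγ
  have hs0 : sqrtTwo γ ≠ 0 := by grind
  -- On x = 0 the constant term is y(y² + γz²), whose zeros are the two lines y = 0 and y = √γ z.
  refine pointOD_of_param (rep7Param γ) (rep7Param_injective γ) (mem_rep7 γ) (zeros_rep7 hγ)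
    (Z := F × F) (fun zt => ((0, 0, zt.1), zt.2)) ?_ ?_ (fun x => x ^ 2) sq_bijective
    (fun w => w.1) (fun w => (w.1 + γ * w.2.1) * w.2.2 ^ 2 + w.1 * w.2.1 * (w.1 + γ * w.2.1) + w.2.1 ^ 3) ?_
    (fun v => (0, v.1, v.2)) ?_ ?_ (B := F ⊕ Fˣ) (Sum.elim (fun z => (0, 0, z)) (fun y : Fˣ => (0, (y : F), y * (sqrtTwo γ)⁻¹))) ?_ ?_ ?_ ?_ ?_ ?_ j
  · intro u v h
    simp at h ⊢
    grind
  · rintro ⟨⟨x, y, z⟩, t⟩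
    simp only [rep7Param, zeroDiag_symMk, Matrix.cons_val, Prod.exists, Prod.mk.injEq]
    grind
  · intro p
    simp only [rep7Param, det_symMk, Matrix.cons_val, id]
    grind
  · intro u v h
    simp at h ⊢
    grind
  · rintro ⟨x, y, z⟩
    simp only [Prod.exists, Prod.mk.injEq]
    grind
  · rintro u v h
    rcases u with u | u <;> rcases v with v | v <;> simp at h ⊢ <;> grind [Units.ext, Units.ne_zero]
  · rintro ⟨x, y, z⟩
    constructor
    · rintro ⟨h, h'⟩
      dsimp only at h h'
      by_cases hy : y = 0
      · exact ⟨Sum.inl z, by simp; grind⟩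
      have : y = sqrtTwo γ * z := sq_inj (by grind)
      exact ⟨Sum.inr (Units.mk0 y hy), by simp; grind [sq_inj]⟩
    · rintro ⟨u | u, h⟩ <;> simp at h <;> grind
  · simp only [card_sub_one_cast, Matrix.cons_val]
    norm_num
  · simp only [Nat.card_sum, Nat.card_prod, Nat.cast_add, Nat.cast_mul, card_units_cast, card_cast, Matrix.cons_val]
    ring
  · simp only [Nat.card_sum, Nat.card_prod, Nat.cast_add, Nat.cast_mul, card_units_cast, card_cast, Matrix.cons_val]
    ring
  · simp only [Matrix.cons_val]
    ring


def rep8Form₁ (F : Type*) [Field F] : TernaryForm F := ⟨0, 1, 0, 0, 0, 1⟩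

def rep8Form₂ (F : Type*) [Field F] : TernaryForm F := ⟨0, 0, 1, 0, 1, 0⟩

def rep8Param (p : (F × F × F) × F) : Sym F :=
  symMk ![p.2, p.1.1, p.1.2.1, p.1.2.2, p.1.2.1, p.1.1]

theorem rep8Param_injective : Function.Injective (rep8Param (F := F)) := by
  rintro ⟨⟨y, z, t⟩, x⟩ ⟨⟨y', z', t'⟩, x'⟩ h
  have h := symMk_injective h
  simp at h ⊢
  grind

theorem mem_rep8 [CharP F 2] (M : Sym F) :
    M ∈ pencil (rep8Form₁ F) (rep8Form₂ F) ↔ ∃ p, rep8Param p = M := by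
  have h2 : (2 : F) = 0 := CharTwo.two_eq_zero
  constructor
  · intro hM
    obtain ⟨h₁, h₂⟩ := mem_pencil.1 hM
    simp only [pair, rep8Form₁, rep8Form₂] at h₁ h₂
    refine ⟨((M.1 0 1, M.1 0 2, M.1 1 1), M.1 0 0), sym_ext ?_ ?_ ?_ ?_ ?_ ?_⟩ <;>
      simp [rep8Param, symMk] <;> grind
  · rintro ⟨p, rfl⟩
    simp only [mem_pencil, rep8Param, pair_symMk, rep8Form₁, rep8Form₂, Matrix.cons_val]
    constructor <;> grind

theorem solid_rep8 [CharP F 2] : (solid fun x y z t : F =>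
    !![x, y, z; y, t, z; z, z, y]) = pencil (rep8Form₁ F) (rep8Form₂ F) :=
  solid_eq_pencil (fun x y z t => ![x, y, z, t, z, y]) (fun _ _ _ _ => rfl)
    (fun x y z t => (mem_rep8 _).2 ⟨((y, z, t), x), rfl⟩)
    (fun M h₁ h₂ => by
      obtain ⟨⟨⟨y, z, t⟩, x⟩, rfl⟩ := (mem_rep8 M).1 ⟨h₁, h₂⟩
      exact ⟨x, y, z, t, rfl⟩)

theorem finrank_rep8 [CharP F 2] [Fintype F] : Module.finrank F (pencil (rep8Form₁ F) (rep8Form₂ F)) = 4 :=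
  finrank_of_card (card_pencil _ rep8Param_injective mem_rep8)

theorem indep_rep8 : Indep (rep8Form₁ F) (rep8Form₂ F) := by
  intro a b h
  have h := TernaryForm.ext_iff.1 h
  simp [comb, zeroForm, rep8Form₁, rep8Form₂] at h
  grind

theorem zeros_rep8 [CharP F 2] [Fintype F] :
    {v : Fin 3 → F | v ≠ 0 ∧ (rep8Form₁ F).eval v = 0 ∧ (rep8Form₂ F).eval v = 0}.ncard =
      3 * (Fintype.card F - 1) := by
  have h2 : (2 : F) = 0 := CharTwo.two_eq_zero
  refine ncard_lines ![![1, 0, 0], ![0, 1, 0], ![1, 1, 1]] ?_ ?_ ?_ ?_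
  · intro i h
    fin_cases i <;> simp at h
  · intro i j c h
    fin_cases i <;> fin_cases j <;> simp at h ⊢ <;> grind
  · intro i c
    fin_cases i <;> simp [eval, rep8Form₁, rep8Form₂] <;> grind
  · rintro v - ⟨h₁, h₂⟩
    simp only [eval, rep8Form₁, rep8Form₂] at h₁ h₂
    -- The second form factors as X₂(X₀ + X₁); on each factor the first form leaves points or a
    -- square.
    rcases (by grind : v 2 = 0 ∧ v 0 = 0 ∨ v 2 = 0 ∧ v 1 = 0 ∨ v 0 = v 1 ∧ v 1 = v 2) with h | h | h
    · refine ⟨1, v 1, ?_⟩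
      funext j
      fin_cases j <;> simp <;> grind
    · refine ⟨0, v 0, ?_⟩
      funext j
      fin_cases j <;> simp <;> grind
    · refine ⟨2, v 0, ?_⟩
      funext j
      fin_cases j <;> simp <;> grind

theorem pointOD_rep8 [CharP F 2] [Fintype F] (j : Fin 4) :
    (pointOD (pencil (rep8Form₁ F) (rep8Form₂ F)) j : ℚ) =
      (![3, 1, Fintype.card F ^ 2 + 2 * Fintype.card F - 3, Fintype.card F ^ 3 - Fintype.card F] : Fin 4 → ℚ) j := by
  have h2 : (2 : F) = 0 := CharTwo.two_eq_zero
  refine pointOD_of_param (rep8Param) rep8Param_injective mem_rep8 (zeros_rep8)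
    (Z := F) (fun z => ((0, z, 0), 0)) ?_ ?_ id Function.bijective_id
    (fun w => w.2.2 * w.1 + w.2.1 ^ 2) (fun w => w.2.2 * w.2.1 ^ 2 + w.1 ^ 3) ?_
    (fun v => (v.1, sqrtTwo (v.2 * v.1), v.2)) ?_ ?_ (B := F ⊕ Fˣ) (Sum.elim (fun t => (0, 0, t)) (fun y : Fˣ => ((y : F), (y : F), (y : F)))) ?_ ?_ ?_ ?_ ?_ ?_ j
  · intro u v h
    simp at h ⊢
    grind
  · rintro ⟨⟨y, z, t⟩, x⟩
    simp only [rep8Param, zeroDiag_symMk, Matrix.cons_val, Prod.exists, Prod.mk.injEq]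
    grind
  · intro p
    simp only [rep8Param, det_symMk, Matrix.cons_val, id]
    grind
  · intro u v h
    simp at h ⊢
    grind
  · rintro ⟨y, z, t⟩
    simp only [Prod.exists, Prod.mk.injEq]
    grind [sqrtTwo_sq, sq_inj]
  · rintro u v h
    rcases u with u | u <;> rcases v with v | v <;> simp at h ⊢ <;> grind [Units.ext, Units.ne_zero]
  · rintro ⟨y, z, t⟩
    constructor
    · rintro ⟨h, h'⟩
      dsimp only at h h'
      by_cases hy : y = 0
      · exact ⟨Sum.inl t, by simp; grind⟩
      -- With z² = ty the constant term tz² + y³ becomes y(t + y)².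
      have : (t + y) ^ 2 = 0 := by grind
      have : t = y := by grind
      have : z = y := sq_inj (by grind)
      exact ⟨Sum.inr (Units.mk0 y hy), by simp; grind [sq_inj]⟩
    · rintro ⟨u | u, h⟩ <;> simp at h <;> grind
  · simp only [card_sub_one_cast, Matrix.cons_val]
    norm_num
  · simp only [Nat.card_sum, Nat.card_prod, Nat.cast_add, Nat.cast_mul, card_units_cast, card_cast, Matrix.cons_val]
    ring
  · simp only [Nat.card_sum, Nat.card_prod, Nat.cast_add, Nat.cast_mul, card_units_cast, card_cast, Matrix.cons_val]
    ring
  · simp only [Matrix.cons_val]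
    ring


def rep9Form₁ (F : Type*) [Field F] : TernaryForm F := ⟨1, 1, 0, 0, 0, 0⟩

def rep9Form₂ (F : Type*) [Field F] : TernaryForm F := ⟨0, 0, 0, 0, 1, 1⟩

def rep9Param (p : (F × F × F) × F) : Sym F :=
  symMk ![p.1.1, p.1.1, p.1.2.1, p.2, p.1.2.2, p.1.2.2]

theorem rep9Param_injective : Function.Injective (rep9Param (F := F)) := by
  rintro ⟨⟨x, y, t⟩, z⟩ ⟨⟨x', y', t'⟩, z'⟩ h
  have h := symMk_injective h
  simp at h ⊢
  grind

theorem mem_rep9 [CharP F 2] (M : Sym F) :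
    M ∈ pencil (rep9Form₁ F) (rep9Form₂ F) ↔ ∃ p, rep9Param p = M := by
  have h2 : (2 : F) = 0 := CharTwo.two_eq_zero
  constructor
  · intro hM
    obtain ⟨h₁, h₂⟩ := mem_pencil.1 hM
    simp only [pair, rep9Form₁, rep9Form₂] at h₁ h₂
    refine ⟨((M.1 0 0, M.1 0 2, M.1 1 2), M.1 1 1), sym_ext ?_ ?_ ?_ ?_ ?_ ?_⟩ <;>
      simp [rep9Param, symMk] <;> grind
  · rintro ⟨p, rfl⟩
    simp only [mem_pencil, rep9Param, pair_symMk, rep9Form₁, rep9Form₂, Matrix.cons_val]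
    constructor <;> grind

theorem solid_rep9 [CharP F 2] : (solid fun x y z t : F =>
    !![x, x, y; x, z, t; y, t, t]) = pencil (rep9Form₁ F) (rep9Form₂ F) :=
  solid_eq_pencil (fun x y z t => ![x, x, y, z, t, t]) (fun _ _ _ _ => rfl)
    (fun x y z t => (mem_rep9 _).2 ⟨((x, y, t), z), rfl⟩)
    (fun M h₁ h₂ => by
      obtain ⟨⟨⟨x, y, t⟩, z⟩, rfl⟩ := (mem_rep9 M).1 ⟨h₁, h₂⟩
      exact ⟨x, y, z, t, rfl⟩)

theorem finrank_rep9 [CharP F 2] [Fintype F] : Module.finrank F (pencil (rep9Form₁ F) (rep9Form₂ F)) = 4 :=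
  finrank_of_card (card_pencil _ rep9Param_injective mem_rep9)

theorem indep_rep9 : Indep (rep9Form₁ F) (rep9Form₂ F) := by
  intro a b h
  have h := TernaryForm.ext_iff.1 h
  simp [comb, zeroForm, rep9Form₁, rep9Form₂] at h
  grind

theorem zeros_rep9 [CharP F 2] [Fintype F] :
    {v : Fin 3 → F | v ≠ 0 ∧ (rep9Form₁ F).eval v = 0 ∧ (rep9Form₂ F).eval v = 0}.ncard =
      4 * (Fintype.card F - 1) := by
  have h2 : (2 : F) = 0 := CharTwo.two_eq_zero
  refine ncard_lines ![![0, 1, 0], ![0, 1, 1], ![1, 1, 0], ![1, 1, 1]] ?_ ?_ ?_ ?_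
  · intro i h
    fin_cases i <;> simp at h
  · intro i j c h
    fin_cases i <;> fin_cases j <;> simp at h ⊢ <;> grind
  · intro i c
    fin_cases i <;> simp [eval, rep9Form₁, rep9Form₂] <;> grind
  · rintro v - ⟨h₁, h₂⟩
    simp only [eval, rep9Form₁, rep9Form₂] at h₁ h₂
    rcases (by grind : v 0 = 0 ∧ v 2 = 0 ∨ v 0 = 0 ∧ v 1 = v 2 ∨ v 0 = v 1 ∧ v 2 = 0 ∨ v 0 = v 1 ∧ v 1 = v 2) with h | h | h | h
    · refine ⟨0, v 1, ?_⟩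
      funext j
      fin_cases j <;> simp <;> grind
    · refine ⟨1, v 1, ?_⟩
      funext j
      fin_cases j <;> simp <;> grind
    · refine ⟨2, v 0, ?_⟩
      funext j
      fin_cases j <;> simp <;> grind
    · refine ⟨3, v 0, ?_⟩
      funext j
      fin_cases j <;> simp <;> grind

theorem pointOD_rep9 [CharP F 2] [Fintype F] (j : Fin 4) :
    (pointOD (pencil (rep9Form₁ F) (rep9Form₂ F)) j : ℚ) =
      (![4, 1, Fintype.card F ^ 2 + 3 * Fintype.card F - 4, Fintype.card F ^ 3 - 2 * Fintype.card F] : Fin 4 → ℚ) j := by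
  have h2 : (2 : F) = 0 := CharTwo.two_eq_zero
  -- On xt = y² the constant term is xt(x + t). This gives three lines through the origin, hence 3q
  -- − 2 triples.
  refine pointOD_of_param (rep9Param) rep9Param_injective mem_rep9 (zeros_rep9)
    (Z := F) (fun y => ((0, y, 0), 0)) ?_ ?_ id Function.bijective_id
    (fun w => w.1 * w.2.2 + w.2.1 ^ 2) (fun w => w.1 * w.2.2 ^ 2 + w.2.2 * w.1 ^ 2) ?_
    (fun v => (v.1, sqrtTwo (v.1 * v.2), v.2)) ?_ ?_ (B := F ⊕ Fˣ ⊕ Fˣ) (Sum.elim (fun x => (x, 0, 0)) (Sum.elim (fun t : Fˣ => (0, 0, (t : F))) (fun u : Fˣ => ((u : F), (u : F), (u : F))))) ?_ ?_ ?_ ?_ ?_ ?_ j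
  · intro u v h
    simp at h ⊢
    grind
  · rintro ⟨⟨x, y, t⟩, z⟩
    simp only [rep9Param, zeroDiag_symMk, Matrix.cons_val, Prod.exists, Prod.mk.injEq]
    grind
  · intro p
    simp only [rep9Param, det_symMk, Matrix.cons_val, id]
    grind
  · intro u v h
    simp at h ⊢
    grind
  · rintro ⟨x, y, t⟩
    simp only [Prod.exists, Prod.mk.injEq]
    grind [sqrtTwo_sq, sq_inj]
  · rintro u v h
    rcases u with u | u <;> rcases v with v | v <;> simp at h ⊢ <;> grind [Units.ext, Units.ne_zero]
  · rintro ⟨x, y, t⟩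
    constructor
    · rintro ⟨h, h'⟩
      dsimp only at h h'
      by_cases ht : t = 0
      · exact ⟨Sum.inl x, by simp; grind⟩
      by_cases hx : x = 0
      · exact ⟨Sum.inr (Sum.inl (Units.mk0 t ht)), by simp; grind⟩
      have : x = t := by grind
      have : y = x := sq_inj (by grind)
      exact ⟨Sum.inr (Sum.inr (Units.mk0 x hx)), by simp; grind [sq_inj]⟩
    · rintro ⟨u | u | u, h⟩ <;> simp at h <;> grind
  · simp only [card_sub_one_cast, Matrix.cons_val]
    norm_num
  · simp only [Nat.card_sum, Nat.card_prod, Nat.cast_add, Nat.cast_mul, card_units_cast, card_cast, Matrix.cons_val]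
    ring
  · simp only [Nat.card_sum, Nat.card_prod, Nat.cast_add, Nat.cast_mul, card_units_cast, card_cast, Matrix.cons_val]
    ring
  · simp only [Matrix.cons_val]
    ring


def rep10Form₁ (γ : F) : TernaryForm F := ⟨0, 1, 0, 1, γ, 0⟩

def rep10Form₂ (γ : F) : TernaryForm F := ⟨0, 1, 0, 0, 0, 1⟩

def rep10Param (γ : F) (p : (F × F × F) × F) : Sym F :=
  symMk ![p.1.1, p.1.2.1, p.2, p.1.2.1 + γ * p.1.2.2, p.1.2.2, p.1.2.1]

theorem rep10Param_injective (γ : F) : Function.Injective (rep10Param γ) := by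
  rintro ⟨⟨x, y, t⟩, z⟩ ⟨⟨x', y', t'⟩, z'⟩ h
  have h := symMk_injective h
  simp at h ⊢
  grind

theorem mem_rep10 [CharP F 2] (γ : F) (M : Sym F) :
    M ∈ pencil (rep10Form₁ γ) (rep10Form₂ γ) ↔ ∃ p, rep10Param γ p = M := by
  have h2 : (2 : F) = 0 := CharTwo.two_eq_zero
  constructor
  · intro hM
    obtain ⟨h₁, h₂⟩ := mem_pencil.1 hM
    simp only [pair, rep10Form₁, rep10Form₂] at h₁ h₂
    refine ⟨((M.1 0 0, M.1 0 1, M.1 1 2), M.1 0 2), sym_ext ?_ ?_ ?_ ?_ ?_ ?_⟩ <;>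
      simp [rep10Param, symMk] <;> grind
  · rintro ⟨p, rfl⟩
    simp only [mem_pencil, rep10Param, pair_symMk, rep10Form₁, rep10Form₂, Matrix.cons_val]
    constructor <;> grind

theorem solid_rep10 [CharP F 2] (γ : F) : (solid fun x y z t : F =>
    !![x, y, z; y, y + γ * t, t; z, t, y]) = pencil (rep10Form₁ γ) (rep10Form₂ γ) :=
  solid_eq_pencil (fun x y z t => ![x, y, z, y + γ * t, t, y]) (fun _ _ _ _ => rfl)
    (fun x y z t => ((mem_rep10 γ) _).2 ⟨((x, y, t), z), rfl⟩)
    (fun M h₁ h₂ => by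
      obtain ⟨⟨⟨x, y, t⟩, z⟩, rfl⟩ := ((mem_rep10 γ) M).1 ⟨h₁, h₂⟩
      exact ⟨x, y, z, t, rfl⟩)

theorem finrank_rep10 [CharP F 2] [Fintype F] (γ : F) : Module.finrank F (pencil (rep10Form₁ γ) (rep10Form₂ γ)) = 4 :=
  finrank_of_card (card_pencil _ (rep10Param_injective γ) (mem_rep10 γ))

theorem indep_rep10 (γ : F) : Indep (rep10Form₁ γ) (rep10Form₂ γ) := by
  intro a b h
  have h := TernaryForm.ext_iff.1 h
  simp [comb, zeroForm, rep10Form₁, rep10Form₂] at h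
  grind

theorem zeros_rep10 [CharP F 2] [Fintype F] {γ : F} (hγ : Tr γ⁻¹ = 1) :
    {v : Fin 3 → F | v ≠ 0 ∧ (rep10Form₁ γ).eval v = 0 ∧ (rep10Form₂ γ).eval v = 0}.ncard =
      1 * (Fintype.card F - 1) := by
  have h2 : (2 : F) = 0 := CharTwo.two_eq_zero
  refine ncard_lines ![![1, 0, 0]] ?_ ?_ ?_ ?_
  · intro i h
    fin_cases i <;> simp at h
  · intro i j c h
    fin_cases i <;> fin_cases j <;> simp at h ⊢ <;> grind
  · intro i c
    fin_cases i <;> simp [eval, rep10Form₁, rep10Form₂] <;> grind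
  · rintro v - ⟨h₁, h₂⟩
    simp only [eval, rep10Form₁, rep10Form₂] at h₁ h₂
    -- Off the line X₁ = 0 the first form forces X₀ = X₁ + γX₂, and the second becomes X₁² + γX₁X₂ +
    -- X₂², which is anisotropic.
    have h : v 1 = 0 ∧ v 2 = 0 := by
      by_cases h : v 1 = 0
      · grind
      · exact norm_form_eq_zero' hγ (by grind)
    refine ⟨0, v 0, ?_⟩
    funext j
    fin_cases j <;> simp <;> grind

theorem pointOD_rep10 [CharP F 2] [Fintype F] {γ : F} (hγ : Tr γ⁻¹ = 1) (j : Fin 4) :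
    (pointOD (pencil (rep10Form₁ γ) (rep10Form₂ γ)) j : ℚ) =
      (![1, 1, Fintype.card F ^ 2 + 2 * Fintype.card F - 1, Fintype.card F ^ 3 - Fintype.card F] : Fin 4 → ℚ) j := by
  have h2 : (2 : F) = 0 := CharTwo.two_eq_zero
  have hγ0 := ne_zero_of_tr_inv hγ
  -- On y = γt the constant term is t²(x + γ³t), which gives the two lines in `eB`.
  refine pointOD_of_param (rep10Param γ) (rep10Param_injective γ) (mem_rep10 γ) (zeros_rep10 hγ)
    (Z := F) (fun z => ((0, 0, 0), z)) ?_ ?_ (fun x => x ^ 2) sq_bijective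
    (fun w => w.2.1 + γ * w.2.2) (fun w => w.1 * (w.2.1 * (w.2.1 + γ * w.2.2) + w.2.2 ^ 2) + w.2.1 ^ 3) ?_
    (fun v => (v.1, γ * v.2, v.2)) ?_ ?_ (B := F ⊕ Fˣ) (Sum.elim (fun x => (x, 0, 0)) (fun t : Fˣ => (γ ^ 3 * t, γ * t, (t : F)))) ?_ ?_ ?_ ?_ ?_ ?_ j
  · intro u v h
    simp at h ⊢
    grind
  · rintro ⟨⟨x, y, t⟩, z⟩
    simp only [rep10Param, zeroDiag_symMk, Matrix.cons_val, Prod.exists, Prod.mk.injEq]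
    grind
  · intro p
    simp only [rep10Param, det_symMk, Matrix.cons_val, id]
    grind
  · intro u v h
    simp at h ⊢
    grind
  · rintro ⟨x, y, t⟩
    simp only [Prod.exists, Prod.mk.injEq]
    grind
  · rintro u v h
    rcases u with u | u <;> rcases v with v | v <;> simp at h ⊢ <;> grind [Units.ext, Units.ne_zero]
  · rintro ⟨x, y, t⟩
    constructor
    · rintro ⟨h, h'⟩
      dsimp only at h h'
      by_cases ht : t = 0
      · exact ⟨Sum.inl x, by simp; grind⟩
      exact ⟨Sum.inr (Units.mk0 t ht), by simp; grind [sq_inj]⟩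
    · rintro ⟨u | u, h⟩ <;> simp at h <;> grind
  · simp only [card_sub_one_cast, Matrix.cons_val]
    norm_num
  · simp only [Nat.card_sum, Nat.card_prod, Nat.cast_add, Nat.cast_mul, card_units_cast, card_cast, Matrix.cons_val]
    ring
  · simp only [Nat.card_sum, Nat.card_prod, Nat.cast_add, Nat.cast_mul, card_units_cast, card_cast, Matrix.cons_val]
    ring
  · simp only [Matrix.cons_val]
    ring


def rep11Form₁ (F : Type*) [Field F] : TernaryForm F := ⟨0, 1, 0, 0, 0, 1⟩

def rep11Form₂ (F : Type*) [Field F] : TernaryForm F := ⟨0, 0, 0, 0, 1, 0⟩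

def rep11Param (p : (F × F × F) × F) : Sym F :=
  symMk ![p.1.1, p.1.2.1, p.1.2.2, p.2, 0, p.1.2.1]

theorem rep11Param_injective : Function.Injective (rep11Param (F := F)) := by
  rintro ⟨⟨x, y, z⟩, t⟩ ⟨⟨x', y', z'⟩, t'⟩ h
  have h := symMk_injective h
  simp at h ⊢
  grind

theorem mem_rep11 [CharP F 2] (M : Sym F) :
    M ∈ pencil (rep11Form₁ F) (rep11Form₂ F) ↔ ∃ p, rep11Param p = M := by
  have h2 : (2 : F) = 0 := CharTwo.two_eq_zero
  constructor
  · intro hM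
    obtain ⟨h₁, h₂⟩ := mem_pencil.1 hM
    simp only [pair, rep11Form₁, rep11Form₂] at h₁ h₂
    refine ⟨((M.1 0 0, M.1 0 1, M.1 0 2), M.1 1 1), sym_ext ?_ ?_ ?_ ?_ ?_ ?_⟩ <;>
      simp [rep11Param, symMk] <;> grind
  · rintro ⟨p, rfl⟩
    simp only [mem_pencil, rep11Param, pair_symMk, rep11Form₁, rep11Form₂, Matrix.cons_val]
    constructor <;> grind

theorem solid_rep11 [CharP F 2] : (solid fun x y z t : F =>
    !![x, y, z; y, t, 0; z, 0, y]) = pencil (rep11Form₁ F) (rep11Form₂ F) :=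
  solid_eq_pencil (fun x y z t => ![x, y, z, t, 0, y]) (fun _ _ _ _ => rfl)
    (fun x y z t => (mem_rep11 _).2 ⟨((x, y, z), t), rfl⟩)
    (fun M h₁ h₂ => by
      obtain ⟨⟨⟨x, y, z⟩, t⟩, rfl⟩ := (mem_rep11 M).1 ⟨h₁, h₂⟩
      exact ⟨x, y, z, t, rfl⟩)

theorem finrank_rep11 [CharP F 2] [Fintype F] : Module.finrank F (pencil (rep11Form₁ F) (rep11Form₂ F)) = 4 :=
  finrank_of_card (card_pencil _ rep11Param_injective mem_rep11)

theorem indep_rep11 : Indep (rep11Form₁ F) (rep11Form₂ F) := by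
  intro a b h
  have h := TernaryForm.ext_iff.1 h
  simp [comb, zeroForm, rep11Form₁, rep11Form₂] at h
  grind

theorem zeros_rep11 [CharP F 2] [Fintype F] :
    {v : Fin 3 → F | v ≠ 0 ∧ (rep11Form₁ F).eval v = 0 ∧ (rep11Form₂ F).eval v = 0}.ncard =
      2 * (Fintype.card F - 1) := by
  have h2 : (2 : F) = 0 := CharTwo.two_eq_zero
  refine ncard_lines ![![1, 0, 0], ![0, 1, 0]] ?_ ?_ ?_ ?_
  · intro i h
    fin_cases i <;> simp at h
  · intro i j c h
    fin_cases i <;> fin_cases j <;> simp at h ⊢ <;> grind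
  · intro i c
    fin_cases i <;> simp [eval, rep11Form₁, rep11Form₂] <;> grind
  · rintro v - ⟨h₁, h₂⟩
    simp only [eval, rep11Form₁, rep11Form₂] at h₁ h₂
    rcases (by grind : v 0 = 0 ∨ v 1 = 0) with h | h
    · refine ⟨1, v 1, ?_⟩
      funext j
      fin_cases j <;> simp <;> grind
    · refine ⟨0, v 0, ?_⟩
      funext j
      fin_cases j <;> simp <;> grind

theorem pointOD_rep11 [CharP F 2] [Fintype F] (j : Fin 4) :
    (pointOD (pencil (rep11Form₁ F) (rep11Form₂ F)) j : ℚ) =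
      (![2, 1, Fintype.card F ^ 2 + Fintype.card F - 2, Fintype.card F ^ 3] : Fin 4 → ℚ) j := by
  have h2 : (2 : F) = 0 := CharTwo.two_eq_zero
  -- The constant term is y³, so on xy = z² the degenerate locus is y = z = 0.
  refine pointOD_of_param (rep11Param) rep11Param_injective mem_rep11 (zeros_rep11)
    (Z := F) (fun z => ((0, 0, z), 0)) ?_ ?_ id Function.bijective_id
    (fun w => w.1 * w.2.1 + w.2.2 ^ 2) (fun w => w.2.1 ^ 3) ?_
    (fun v => (v.1, v.2, sqrtTwo (v.1 * v.2))) ?_ ?_ (B := F) (fun x => (x, 0, 0)) ?_ ?_ ?_ ?_ ?_ ?_ j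
  · intro u v h
    simp at h ⊢
    grind
  · rintro ⟨⟨x, y, z⟩, t⟩
    simp only [rep11Param, zeroDiag_symMk, Matrix.cons_val, Prod.exists, Prod.mk.injEq]
    grind
  · intro p
    simp only [rep11Param, det_symMk, Matrix.cons_val, id]
    grind
  · intro u v h
    simp at h ⊢
    grind
  · rintro ⟨x, y, z⟩
    simp only [Prod.exists, Prod.mk.injEq]
    grind [sqrtTwo_sq, sq_inj]
  · intro u v h
    simp at h ⊢
    try grind
  · rintro ⟨x, y, z⟩
    simp only [Sum.exists, Prod.exists, Sum.elim_inl, Sum.elim_inr, Prod.mk.injEq]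
    grind [sqrtTwo_sq, sq_inj]
  · simp only [card_sub_one_cast, Matrix.cons_val]
    norm_num
  · simp only [Nat.card_sum, Nat.card_prod, Nat.cast_add, Nat.cast_mul, card_units_cast, card_cast, Matrix.cons_val]
    ring
  · simp only [Nat.card_sum, Nat.card_prod, Nat.cast_add, Nat.cast_mul, card_units_cast, card_cast, Matrix.cons_val]
    ring
  · simp only [Matrix.cons_val]
    ring


def rep12Form₁ (γ : F) : TernaryForm F := ⟨0, 1, 0, 0, 0, 1⟩

def rep12Form₂ (γ : F) : TernaryForm F := ⟨0, γ, 1, 0, 1, 0⟩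

def rep12Param (γ : F) (p : (F × F × F) × F) : Sym F :=
  symMk ![p.1.1, p.1.2.1, p.1.2.2, p.2, γ * p.1.2.1 + p.1.2.2, p.1.2.1]

theorem rep12Param_injective (γ : F) : Function.Injective (rep12Param γ) := by
  rintro ⟨⟨x, y, z⟩, t⟩ ⟨⟨x', y', z'⟩, t'⟩ h
  have h := symMk_injective h
  simp at h ⊢
  grind

theorem mem_rep12 [CharP F 2] (γ : F) (M : Sym F) :
    M ∈ pencil (rep12Form₁ γ) (rep12Form₂ γ) ↔ ∃ p, rep12Param γ p = M := by
  have h2 : (2 : F) = 0 := CharTwo.two_eq_zero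
  constructor
  · intro hM
    obtain ⟨h₁, h₂⟩ := mem_pencil.1 hM
    simp only [pair, rep12Form₁, rep12Form₂] at h₁ h₂
    refine ⟨((M.1 0 0, M.1 0 1, M.1 0 2), M.1 1 1), sym_ext ?_ ?_ ?_ ?_ ?_ ?_⟩ <;>
      simp [rep12Param, symMk] <;> grind
  · rintro ⟨p, rfl⟩
    simp only [mem_pencil, rep12Param, pair_symMk, rep12Form₁, rep12Form₂, Matrix.cons_val]
    constructor <;> grind

theorem solid_rep12 [CharP F 2] (γ : F) : (solid fun x y z t : F =>
    !![x, y, z; y, t, γ * y + z; z, γ * y + z, y]) = pencil (rep12Form₁ γ) (rep12Form₂ γ) :=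
  solid_eq_pencil (fun x y z t => ![x, y, z, t, γ * y + z, y]) (fun _ _ _ _ => rfl)
    (fun x y z t => ((mem_rep12 γ) _).2 ⟨((x, y, z), t), rfl⟩)
    (fun M h₁ h₂ => by
      obtain ⟨⟨⟨x, y, z⟩, t⟩, rfl⟩ := ((mem_rep12 γ) M).1 ⟨h₁, h₂⟩
      exact ⟨x, y, z, t, rfl⟩)

theorem finrank_rep12 [CharP F 2] [Fintype F] (γ : F) : Module.finrank F (pencil (rep12Form₁ γ) (rep12Form₂ γ)) = 4 :=
  finrank_of_card (card_pencil _ (rep12Param_injective γ) (mem_rep12 γ))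

theorem indep_rep12 (γ : F) : Indep (rep12Form₁ γ) (rep12Form₂ γ) := by
  intro a b h
  have h := TernaryForm.ext_iff.1 h
  simp [comb, zeroForm, rep12Form₁, rep12Form₂] at h
  grind

theorem zeros_rep12 [CharP F 2] [Fintype F] {γ : F} (hγ : Tr γ⁻¹ = 1) :
    {v : Fin 3 → F | v ≠ 0 ∧ (rep12Form₁ γ).eval v = 0 ∧ (rep12Form₂ γ).eval v = 0}.ncard =
      2 * (Fintype.card F - 1) := by
  have h2 : (2 : F) = 0 := CharTwo.two_eq_zero
  refine ncard_lines ![![1, 0, 0], ![0, 1, 0]] ?_ ?_ ?_ ?_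
  · intro i h
    fin_cases i <;> simp at h
  · intro i j c h
    fin_cases i <;> fin_cases j <;> simp at h ⊢ <;> grind
  · intro i c
    fin_cases i <;> simp [eval, rep12Form₁, rep12Form₂] <;> grind
  · rintro v - ⟨h₁, h₂⟩
    simp only [eval, rep12Form₁, rep12Form₂] at h₁ h₂
    -- Modulo the first form the second is X₂(X₀ + X₁ + γX₂). On the second factor the first form
    -- becomes X₀² + γX₀X₂ + X₂², which is anisotropic.
    have h : v 2 = 0 := by
      by_cases h : v 2 = 0
      · exact h
      · exact (norm_form_eq_zero' hγ (x := v 0) (by grind)).2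
    rcases (by grind : v 0 = 0 ∨ v 1 = 0) with h | h
    · refine ⟨1, v 1, ?_⟩
      funext j
      fin_cases j <;> simp <;> grind
    · refine ⟨0, v 0, ?_⟩
      funext j
      fin_cases j <;> simp <;> grind

theorem pointOD_rep12 [CharP F 2] [Fintype F] {γ : F} (hγ : Tr γ⁻¹ = 1) (j : Fin 4) :
    (pointOD (pencil (rep12Form₁ γ) (rep12Form₂ γ)) j : ℚ) =
      (![2, 1, Fintype.card F ^ 2 + Fintype.card F - 2, Fintype.card F ^ 3] : Fin 4 → ℚ) j := by
  have h2 : (2 : F) = 0 := CharTwo.two_eq_zero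
  refine pointOD_of_param (rep12Param γ) (rep12Param_injective γ) (mem_rep12 γ) (zeros_rep12 hγ)
    (Z := F) (fun z => ((0, 0, z), 0)) ?_ ?_ id Function.bijective_id
    (fun w => w.1 * w.2.1 + w.2.2 ^ 2) (fun w => w.1 * (γ * w.2.1 + w.2.2) ^ 2 + w.2.1 ^ 3) ?_
    (fun v => (v.1, v.2, sqrtTwo (v.1 * v.2))) ?_ ?_ (B := F) (fun x => (x, 0, 0)) ?_ ?_ ?_ ?_ ?_ ?_ j
  · intro u v h
    simp at h ⊢
    grind
  · rintro ⟨⟨x, y, z⟩, t⟩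
    simp only [rep12Param, zeroDiag_symMk, Matrix.cons_val, Prod.exists, Prod.mk.injEq]
    grind
  · intro p
    simp only [rep12Param, det_symMk, Matrix.cons_val, id]
    grind
  · intro u v h
    simp at h ⊢
    grind
  · rintro ⟨x, y, z⟩
    simp only [Prod.exists, Prod.mk.injEq]
    grind [sqrtTwo_sq, sq_inj]
  · intro u v h
    simp at h ⊢
    try grind
  · rintro ⟨x, y, z⟩
    -- On xy = z², multiplying the constant term by y gives (z² + γzy + y²)², the square of an
    -- anisotropic form. Hence y = 0, and then z = 0.
    have := sq_inj (R := F) (a := z ^ 2 + γ * z * y + y ^ 2) (b := 0)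
    have := norm_form_eq_zero' hγ (x := z) (y := y)
    simp only [Sum.exists, Prod.exists, Sum.elim_inl, Sum.elim_inr, Prod.mk.injEq]
    grind [sqrtTwo_sq, sq_inj]
  · simp only [card_sub_one_cast, Matrix.cons_val]
    norm_num
  · simp only [Nat.card_sum, Nat.card_prod, Nat.cast_add, Nat.cast_mul, card_units_cast, card_cast, Matrix.cons_val]
    ring
  · simp only [Nat.card_sum, Nat.card_prod, Nat.cast_add, Nat.cast_mul, card_units_cast, card_cast, Matrix.cons_val]
    ring
  · simp only [Matrix.cons_val]
    ring


def rep13Form₁ (γ : F) : TernaryForm F := ⟨γ, 1, 0, 1, 0, 0⟩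

def rep13Form₂ (γ : F) : TernaryForm F := ⟨γ, 0, 1, 0, 0, 1⟩

def rep13Param (γ : F) (p : (F × F × F) × F) : Sym F :=
  symMk ![p.1.1, p.1.2.1, p.1.2.2, γ * p.1.1 + p.1.2.1, p.2, γ * p.1.1 + p.1.2.2]

theorem rep13Param_injective (γ : F) : Function.Injective (rep13Param γ) := by
  rintro ⟨⟨x, y, z⟩, t⟩ ⟨⟨x', y', z'⟩, t'⟩ h
  have h := symMk_injective h
  simp at h ⊢
  grind

theorem mem_rep13 [CharP F 2] (γ : F) (M : Sym F) :
    M ∈ pencil (rep13Form₁ γ) (rep13Form₂ γ) ↔ ∃ p, rep13Param γ p = M := by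
  have h2 : (2 : F) = 0 := CharTwo.two_eq_zero
  constructor
  · intro hM
    obtain ⟨h₁, h₂⟩ := mem_pencil.1 hM
    simp only [pair, rep13Form₁, rep13Form₂] at h₁ h₂
    refine ⟨((M.1 0 0, M.1 0 1, M.1 0 2), M.1 1 2), sym_ext ?_ ?_ ?_ ?_ ?_ ?_⟩ <;>
      simp [rep13Param, symMk] <;> grind
  · rintro ⟨p, rfl⟩
    simp only [mem_pencil, rep13Param, pair_symMk, rep13Form₁, rep13Form₂, Matrix.cons_val]
    constructor <;> grind

theorem solid_rep13 [CharP F 2] (γ : F) : (solid fun x y z t : F =>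
    !![x, y, z; y, γ * x + y, t; z, t, γ * x + z]) = pencil (rep13Form₁ γ) (rep13Form₂ γ) :=
  solid_eq_pencil (fun x y z t => ![x, y, z, γ * x + y, t, γ * x + z]) (fun _ _ _ _ => rfl)
    (fun x y z t => ((mem_rep13 γ) _).2 ⟨((x, y, z), t), rfl⟩)
    (fun M h₁ h₂ => by
      obtain ⟨⟨⟨x, y, z⟩, t⟩, rfl⟩ := ((mem_rep13 γ) M).1 ⟨h₁, h₂⟩
      exact ⟨x, y, z, t, rfl⟩)

theorem finrank_rep13 [CharP F 2] [Fintype F] (γ : F) : Module.finrank F (pencil (rep13Form₁ γ) (rep13Form₂ γ)) = 4 :=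
  finrank_of_card (card_pencil _ (rep13Param_injective γ) (mem_rep13 γ))

theorem indep_rep13 (γ : F) : Indep (rep13Form₁ γ) (rep13Form₂ γ) := by
  intro a b h
  have h := TernaryForm.ext_iff.1 h
  simp [comb, zeroForm, rep13Form₁, rep13Form₂] at h
  grind

theorem zeros_rep13 [CharP F 2] [Fintype F] {γ : F} (hγ : Tr γ = 1) :
    {v : Fin 3 → F | v ≠ 0 ∧ (rep13Form₁ γ).eval v = 0 ∧ (rep13Form₂ γ).eval v = 0}.ncard = 0 * (Fintype.card F - 1) := by
  rw [zero_mul, Set.ncard_eq_zero (Set.toFinite _), Set.eq_empty_iff_forall_notMem]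
  rintro v ⟨hv, h₁, h₂⟩
  apply hv
  simp only [eval, rep13Form₁, rep13Form₂] at h₁ h₂
  obtain ⟨h, h'⟩ := norm_form_eq_zero hγ (x := v 1) (y := v 0) (by grind)
  funext j
  fin_cases j <;> simp <;> grind

theorem pointOD_rep13 [CharP F 2] [Fintype F] {γ : F} (hγ : Tr γ = 1) (j : Fin 4) :
    (pointOD (pencil (rep13Form₁ γ) (rep13Form₂ γ)) j : ℚ) =
      (![0, 1, Fintype.card F ^ 2 + 3 * Fintype.card F, Fintype.card F ^ 3 - 2 * Fintype.card F] : Fin 4 → ℚ) j := by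
  have h2 : (2 : F) = 0 := CharTwo.two_eq_zero
  -- On x = 0 the constant term is yz(y + z), which gives three lines.
  refine pointOD_of_param (rep13Param γ) (rep13Param_injective γ) (mem_rep13 γ) (zeros_rep13 hγ)
    (Z := F) (fun t => ((0, 0, 0), t)) ?_ ?_ (fun x => x ^ 2) sq_bijective
    (fun w => w.1) (fun w => w.1 * (γ * w.1 + w.2.1) * (γ * w.1 + w.2.2) + (γ * w.1 + w.2.1) * w.2.2 ^ 2 + (γ * w.1 + w.2.2) * w.2.1 ^ 2) ?_
    (fun v => (0, v.1, v.2)) ?_ ?_ (B := F ⊕ Fˣ ⊕ Fˣ) (Sum.elim (fun y => (0, y, 0)) (Sum.elim (fun z : Fˣ => (0, 0, (z : F))) (fun u : Fˣ => (0, (u : F), (u : F))))) ?_ ?_ ?_ ?_ ?_ ?_ j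
  · intro u v h
    simp at h ⊢
    grind
  · rintro ⟨⟨x, y, z⟩, t⟩
    simp only [rep13Param, zeroDiag_symMk, Matrix.cons_val, Prod.exists, Prod.mk.injEq]
    grind
  · intro p
    simp only [rep13Param, det_symMk, Matrix.cons_val, id]
    grind
  · intro u v h
    simp at h ⊢
    grind
  · rintro ⟨x, y, z⟩
    simp only [Prod.exists, Prod.mk.injEq]
    grind
  · rintro u v h
    rcases u with u | u <;> rcases v with v | v <;> simp at h ⊢ <;> grind [Units.ext, Units.ne_zero]
  · rintro ⟨x, y, z⟩
    constructor
    · rintro ⟨h, h'⟩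
      dsimp only at h h'
      by_cases hz : z = 0
      · exact ⟨Sum.inl y, by simp; grind⟩
      by_cases hy : y = 0
      · exact ⟨Sum.inr (Sum.inl (Units.mk0 z hz)), by simp; grind⟩
      exact ⟨Sum.inr (Sum.inr (Units.mk0 y hy)), by simp; grind [sq_inj]⟩
    · rintro ⟨u | u | u, h⟩ <;> simp at h <;> grind
  · simp only [card_sub_one_cast, Matrix.cons_val]
    norm_num
  · simp only [Nat.card_sum, Nat.card_prod, Nat.cast_add, Nat.cast_mul, card_units_cast, card_cast, Matrix.cons_val]
    ring
  · simp only [Nat.card_sum, Nat.card_prod, Nat.cast_add, Nat.cast_mul, card_units_cast, card_cast, Matrix.cons_val]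
    ring
  · simp only [Matrix.cons_val]
    ring


def rep14Form₁ (γ : F) : TernaryForm F := ⟨γ, 1, 1, 0, 0, γ⟩

def rep14Form₂ (γ : F) : TernaryForm F := ⟨γ, 1, 0, 1, 0, 0⟩

def rep14Param (γ : F) (p : (F × F × F) × F) : Sym F :=
  symMk ![p.1.1, p.1.2.1, γ * p.1.1 + p.1.2.1 + γ * p.1.2.2, γ * p.1.1 + p.1.2.1, p.2, p.1.2.2]

theorem rep14Param_injective (γ : F) : Function.Injective (rep14Param γ) := by
  rintro ⟨⟨x, y, t⟩, z⟩ ⟨⟨x', y', t'⟩, z'⟩ h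
  have h := symMk_injective h
  simp at h ⊢
  grind

theorem mem_rep14 [CharP F 2] (γ : F) (M : Sym F) :
    M ∈ pencil (rep14Form₁ γ) (rep14Form₂ γ) ↔ ∃ p, rep14Param γ p = M := by
  have h2 : (2 : F) = 0 := CharTwo.two_eq_zero
  constructor
  · intro hM
    obtain ⟨h₁, h₂⟩ := mem_pencil.1 hM
    simp only [pair, rep14Form₁, rep14Form₂] at h₁ h₂
    refine ⟨((M.1 0 0, M.1 0 1, M.1 2 2), M.1 1 2), sym_ext ?_ ?_ ?_ ?_ ?_ ?_⟩ <;>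
      simp [rep14Param, symMk] <;> grind
  · rintro ⟨p, rfl⟩
    simp only [mem_pencil, rep14Param, pair_symMk, rep14Form₁, rep14Form₂, Matrix.cons_val]
    constructor <;> grind

theorem solid_rep14 [CharP F 2] (γ : F) : (solid fun x y z t : F =>
    !![x, y, γ * x + y + γ * t; y, γ * x + y, z; γ * x + y + γ * t, z, t]) = pencil (rep14Form₁ γ) (rep14Form₂ γ) :=
  solid_eq_pencil (fun x y z t => ![x, y, γ * x + y + γ * t, γ * x + y, z, t]) (fun _ _ _ _ => rfl)
    (fun x y z t => ((mem_rep14 γ) _).2 ⟨((x, y, t), z), rfl⟩)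
    (fun M h₁ h₂ => by
      obtain ⟨⟨⟨x, y, t⟩, z⟩, rfl⟩ := ((mem_rep14 γ) M).1 ⟨h₁, h₂⟩
      exact ⟨x, y, z, t, rfl⟩)

theorem finrank_rep14 [CharP F 2] [Fintype F] (γ : F) : Module.finrank F (pencil (rep14Form₁ γ) (rep14Form₂ γ)) = 4 :=
  finrank_of_card (card_pencil _ (rep14Param_injective γ) (mem_rep14 γ))

theorem indep_rep14 (γ : F) : Indep (rep14Form₁ γ) (rep14Form₂ γ) := by
  intro a b h
  have h := TernaryForm.ext_iff.1 h
  simp [comb, zeroForm, rep14Form₁, rep14Form₂] at h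
  grind

theorem zeros_rep14 [CharP F 2] [Fintype F] {γ : F} (hγ : Tr γ = 1) :
    {v : Fin 3 → F | v ≠ 0 ∧ (rep14Form₁ γ).eval v = 0 ∧ (rep14Form₂ γ).eval v = 0}.ncard = 0 * (Fintype.card F - 1) := by
  rw [zero_mul, Set.ncard_eq_zero (Set.toFinite _), Set.eq_empty_iff_forall_notMem]
  rintro v ⟨hv, h₁, h₂⟩
  apply hv
  simp only [eval, rep14Form₁, rep14Form₂] at h₁ h₂
  obtain ⟨h, h'⟩ := norm_form_eq_zero hγ (x := v 1) (y := v 0) (by grind)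
  have := ne_zero_of_tr hγ
  funext j
  fin_cases j <;> simp <;> grind

theorem pointOD_rep14 [CharP F 2] [Fintype F] {γ : F} (hγ : Tr γ = 1) (j : Fin 4) :
    (pointOD (pencil (rep14Form₁ γ) (rep14Form₂ γ)) j : ℚ) =
      (![0, 1, Fintype.card F ^ 2 + Fintype.card F, Fintype.card F ^ 3] : Fin 4 → ℚ) j := by
  have h2 : (2 : F) = 0 := CharTwo.two_eq_zero
  refine pointOD_of_param (rep14Param γ) (rep14Param_injective γ) (mem_rep14 γ) (zeros_rep14 hγ)
    (Z := F) (fun z => ((0, 0, 0), z)) ?_ ?_ (fun x => x ^ 2) sq_bijective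
    (fun w => w.1) (fun w => w.1 * (γ * w.1 + w.2.1) * w.2.2 + (γ * w.1 + w.2.1) * (γ * w.1 + w.2.1 + γ * w.2.2) ^ 2 + w.2.2 * w.2.1 ^ 2) ?_
    (fun v => (0, v.1, v.2)) ?_ ?_ (B := F) (fun t => (0, 0, t)) ?_ ?_ ?_ ?_ ?_ ?_ j
  · intro u v h
    simp at h ⊢
    grind
  · rintro ⟨⟨x, y, t⟩, z⟩
    simp only [rep14Param, zeroDiag_symMk, Matrix.cons_val, Prod.exists, Prod.mk.injEq]
    grind
  · intro p
    simp only [rep14Param, det_symMk, Matrix.cons_val, id]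
    grind
  · intro u v h
    simp at h ⊢
    grind
  · rintro ⟨x, y, t⟩
    simp only [Prod.exists, Prod.mk.injEq]
    grind
  · intro u v h
    simp at h ⊢
    try grind
  · rintro ⟨x, y, t⟩
    -- On x = 0 the constant term is y(y² + yt + γ²t²), and the quadratic factor is anisotropic
    -- because γ² has trace one.
    have := norm_form_eq_zero (tr_sq γ ▸ hγ) (x := y) (y := t)
    simp only [Sum.exists, Prod.exists, Sum.elim_inl, Sum.elim_inr, Prod.mk.injEq]
    grind [sqrtTwo_sq, sq_inj]
  · simp only [card_sub_one_cast, Matrix.cons_val]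
    norm_num
  · simp only [Nat.card_sum, Nat.card_prod, Nat.cast_add, Nat.cast_mul, card_units_cast, card_cast, Matrix.cons_val]
    ring
  · simp only [Nat.card_sum, Nat.card_prod, Nat.cast_add, Nat.cast_mul, card_units_cast, card_cast, Matrix.cons_val]
    ring
  · simp only [Matrix.cons_val]
    ring


def rep15Form₁ (b c : F) : TernaryForm F := ⟨0, c, 1, b, 0, 0⟩

def rep15Form₂ (b c : F) : TernaryForm F := ⟨0, 1, 0, 0, 0, 1⟩

def rep15Param (b c : F) (p : (F × F × F) × F) : Sym F :=
  symMk ![p.1.1, p.1.2.1, b * p.1.2.2 + c * p.1.2.1, p.1.2.2, p.2, p.1.2.1]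

theorem rep15Param_injective (b c : F) : Function.Injective (rep15Param b c) := by
  rintro ⟨⟨x, y, z⟩, t⟩ ⟨⟨x', y', z'⟩, t'⟩ h
  have h := symMk_injective h
  simp at h ⊢
  grind

theorem mem_rep15 [CharP F 2] (b c : F) (M : Sym F) :
    M ∈ pencil (rep15Form₁ b c) (rep15Form₂ b c) ↔ ∃ p, rep15Param b c p = M := by
  have h2 : (2 : F) = 0 := CharTwo.two_eq_zero
  constructor
  · intro hM
    obtain ⟨h₁, h₂⟩ := mem_pencil.1 hM
    simp only [pair, rep15Form₁, rep15Form₂] at h₁ h₂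
    refine ⟨((M.1 0 0, M.1 0 1, M.1 1 1), M.1 1 2), sym_ext ?_ ?_ ?_ ?_ ?_ ?_⟩ <;>
      simp [rep15Param, symMk] <;> grind
  · rintro ⟨p, rfl⟩
    simp only [mem_pencil, rep15Param, pair_symMk, rep15Form₁, rep15Form₂, Matrix.cons_val]
    constructor <;> grind

theorem solid_rep15 [CharP F 2] (b c : F) : (solid fun x y z t : F =>
    !![x, y, b * z + c * y; y, z, t; b * z + c * y, t, y]) = pencil (rep15Form₁ b c) (rep15Form₂ b c) :=
  solid_eq_pencil (fun x y z t => ![x, y, b * z + c * y, z, t, y]) (fun _ _ _ _ => rfl)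
    (fun x y z t => ((mem_rep15 b c) _).2 ⟨((x, y, z), t), rfl⟩)
    (fun M h₁ h₂ => by
      obtain ⟨⟨⟨x, y, z⟩, t⟩, rfl⟩ := ((mem_rep15 b c) M).1 ⟨h₁, h₂⟩
      exact ⟨x, y, z, t, rfl⟩)

theorem finrank_rep15 [CharP F 2] [Fintype F] (b c : F) : Module.finrank F (pencil (rep15Form₁ b c) (rep15Form₂ b c)) = 4 :=
  finrank_of_card (card_pencil _ (rep15Param_injective b c) (mem_rep15 b c))

theorem indep_rep15 (b c : F) : Indep (rep15Form₁ b c) (rep15Form₂ b c) := by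
  intro a b h
  have h := TernaryForm.ext_iff.1 h
  simp [comb, zeroForm, rep15Form₁, rep15Form₂] at h
  grind

/-- The condition on b and c says that bλ³ + cλ + 1 has no root in F, written for u = λ⁻¹. -/
theorem zeros_rep15 [CharP F 2] [Fintype F] {b c : F} (hbc : ∀ u : F, u ^ 2 * (u + c) ≠ b) :
    {v : Fin 3 → F | v ≠ 0 ∧ (rep15Form₁ b c).eval v = 0 ∧ (rep15Form₂ b c).eval v = 0}.ncard =
      1 * (Fintype.card F - 1) := by
  have h2 : (2 : F) = 0 := CharTwo.two_eq_zero
  refine ncard_lines ![![1, 0, 0]] ?_ ?_ ?_ ?_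
  · intro i h
    fin_cases i <;> simp at h
  · intro i j c h
    fin_cases i <;> fin_cases j <;> simp at h ⊢ <;> grind
  · intro i c
    fin_cases i <;> simp [eval, rep15Form₁, rep15Form₂] <;> grind
  · rintro v - ⟨h₁, h₂⟩
    simp only [eval, rep15Form₁, rep15Form₂] at h₁ h₂
    have h : v 1 = 0 := by
      by_contra h
      -- With X₁ ≠ 0, eliminating X₀ leaves a cubic equation for u = X₂/X₁.
      apply hbc (v 2 / v 1)
      field_simp
      grind
    refine ⟨0, v 0, ?_⟩
    funext j
    fin_cases j <;> simp <;> grind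

theorem pointOD_rep15 [CharP F 2] [Fintype F] {b c : F} (hbc : ∀ u : F, u ^ 2 * (u + c) ≠ b) (j : Fin 4) :
    (pointOD (pencil (rep15Form₁ b c) (rep15Form₂ b c)) j : ℚ) =
      (![1, 1, Fintype.card F ^ 2 - 1, Fintype.card F ^ 3 + Fintype.card F] : Fin 4 → ℚ) j := by
  have h2 : (2 : F) = 0 := CharTwo.two_eq_zero
  refine pointOD_of_param (rep15Param b c) (rep15Param_injective b c) (mem_rep15 b c) (zeros_rep15 hbc)
    (Z := F) (fun t => ((0, 0, 0), t)) ?_ ?_ (fun x => x ^ 2) sq_bijective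
    (fun w => w.1) (fun w => w.1 * w.2.2 * w.2.1 + w.2.2 * (b * w.2.2 + c * w.2.1) ^ 2 + w.2.1 ^ 3) ?_
    (fun v => (0, v.1, v.2)) ?_ ?_ (B := Unit) (fun _ => (0, 0, 0)) ?_ ?_ ?_ ?_ ?_ ?_ j
  · intro u v h
    simp at h ⊢
    grind
  · rintro ⟨⟨x, y, z⟩, t⟩
    simp only [rep15Param, zeroDiag_symMk, Matrix.cons_val, Prod.exists, Prod.mk.injEq]
    grind
  · intro p
    simp only [rep15Param, det_symMk, Matrix.cons_val, id]
    grind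
  · intro u v h
    simp at h ⊢
    grind
  · rintro ⟨x, y, z⟩
    simp only [Prod.exists, Prod.mk.injEq]
    grind
  · intro u v h
    simp at h ⊢
    try grind
  · rintro ⟨x, y, z⟩
    simp only [exists_const, Prod.mk.injEq]
    constructor
    · rintro ⟨rfl, h⟩
      have hz : z = 0 := by
        by_contra hz
        -- For u² = y/z the equation z(bz + cy)² + y³ = 0 is the square of u²(u + c) = b.
        apply hbc (sqrtTwo (y / z))
        apply sq_inj
        rw [mul_pow, add_pow_two, ← pow_mul, mul_comm 2 2, pow_mul, sqrtTwo_sq]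
        field_simp
        grind
      grind
    · grind
  · simp only [card_sub_one_cast, Matrix.cons_val]
    norm_num
  · simp only [Nat.card_sum, Nat.card_prod, Nat.cast_add, Nat.cast_mul, card_units_cast, card_cast, Matrix.cons_val]
    ring
  · simp only [Nat.card_sum, Nat.card_prod, Nat.cast_add, Nat.cast_mul, card_units_cast, card_cast, Matrix.cons_val, Nat.card_unique, Nat.cast_one]
    ring
  · simp only [Matrix.cons_val]
    ring


end RepresentativeData

end VeroneseSolids

namespace VeroneseSolids
open TernaryForm

/-! ### Hyperplane-orbit distributions of the fifteen representatives -/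

section HyperplaneData

variable {F : Type*} [Field F] [Fintype F] [CharP F 2]

theorem hyperplaneOD_rep1 (j : Fin 4) :
    (hyperplaneOD (pencil (rep1Form₁ F) (rep1Form₂ F)) j : ℚ) =
      (![1, Fintype.card F / 2, Fintype.card F / 2, 0] : Fin 4 → ℚ) j := by
  classical
  have h2 : (2 : F) = 0 := CharTwo.two_eq_zero
  -- The members are βX₁² + X₁X₂ + βX₂², so the relevant trace is that of β², which equals `Tr β`:
  -- half the values of β give each kind of line pair.
  have hf (β : F) : comb 1 β (rep1Form₁ F) (rep1Form₂ F) = binaryForm β β ![0, 1, 0] ![0, 0, 1] := by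
    ext <;> simp [comb, binaryForm, rep1Form₁, rep1Form₂]
  have hlm : LinearIndependent F ![(![0, 1, 0] : Fin 3 → F), ![0, 0, 1]] :=
    linearIndependent_iff_minors.2 (by simp)
  rw [hyperplaneOD_pencil indep_rep1 (fun β => if Tr β = 0 then 1 else 2) 0 ?_ ?_]
  · have h0 := congrArg (Nat.cast : ℕ → ℚ) (ncard_tr_eq_zero (F := F))
    have h1 := congrArg (Nat.cast : ℕ → ℚ) (ncard_tr_eq_one (F := F))
    have h : ∀ a : F, ¬ Tr a = 0 ↔ Tr a = 1 := fun a => by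
      rcases tr_eq_zero_or_one a with h | h <;> simp [h]
    push_cast at h0 h1
    fin_cases j
    · simp [ite_eq_iff]
    · simp [ite_eq_iff]
      linarith
    · simp [ite_eq_iff, h]
      linarith
    · simp [ite_eq_iff]
  · intro β
    have hs : Tr (β * β) = Tr β := by rw [← sq, tr_sq]
    rw [hf]
    rcases tr_eq_zero_or_one β with h | h
    · simp only [h, if_true]
      exact isRealLinePair_binaryForm hlm (hs.trans h)
    · simp only [h, one_ne_zero, if_false]
      exact isImaginaryLinePair_binaryForm hlm (hs.trans h)
  · refine hasType_double ?_ ?_ <;> simp [Unmixed, TernaryForm.ext_iff, zeroForm, rep1Form₂]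

theorem hyperplaneOD_rep2 (j : Fin 4) :
    (hyperplaneOD (pencil (rep2Form₁ F) (rep2Form₂ F)) j : ℚ) =
      (![1, Fintype.card F, 0, 0] : Fin 4 → ℚ) j := by
  have h2 : (2 : F) = 0 := CharTwo.two_eq_zero
  refine (hyperplaneOD_pencil_const indep_rep2 1 0 (fun β => ?_) ?_ j).trans ?_
  · refine hasType_real ![0, 0, 1] ![0, 1, β] (by simp) ?_
    ext <;> simp [comb, prodLin, rep2Form₁, rep2Form₂] <;> grind
  · refine hasType_double ?_ ?_ <;> simp [Unmixed, TernaryForm.ext_iff, zeroForm, rep2Form₁, rep2Form₂]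
  · fin_cases j <;> simp
    try ring

theorem hyperplaneOD_rep3 (j : Fin 4) :
    (hyperplaneOD (pencil (rep3Form₁ F) (rep3Form₂ F)) j : ℚ) =
      (![Fintype.card F + 1, 0, 0, 0] : Fin 4 → ℚ) j := by
  have h2 : (2 : F) = 0 := CharTwo.two_eq_zero
  refine (hyperplaneOD_pencil_const indep_rep3 0 0 (fun β => ?_) ?_ j).trans ?_
  · refine hasType_double ?_ ?_ <;> simp [comb, Unmixed, TernaryForm.ext_iff, zeroForm, rep3Form₁, rep3Form₂]
  · refine hasType_double ?_ ?_ <;> simp [Unmixed, TernaryForm.ext_iff, zeroForm, rep3Form₁, rep3Form₂]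
  · fin_cases j <;> simp
    try ring

theorem hyperplaneOD_rep4 (j : Fin 4) :
    (hyperplaneOD (pencil (rep4Form₁ F) (rep4Form₂ F)) j : ℚ) =
      (![0, Fintype.card F + 1, 0, 0] : Fin 4 → ℚ) j := by
  have h2 : (2 : F) = 0 := CharTwo.two_eq_zero
  refine (hyperplaneOD_pencil_const indep_rep4 1 1 (fun β => ?_) ?_ j).trans ?_
  · refine hasType_real ![0, 1, 0] ![1, 0, β] (by simp) ?_
    ext <;> simp [comb, prodLin, rep4Form₁, rep4Form₂] <;> grind
  · refine hasType_real ![0, 1, 0] ![0, 0, 1] (by simp) ?_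
    ext <;> simp [prodLin, rep4Form₁, rep4Form₂] <;> grind
  · fin_cases j <;> simp
    try ring

theorem hyperplaneOD_rep5 (j : Fin 4) :
    (hyperplaneOD (pencil (rep5Form₁ F) (rep5Form₂ F)) j : ℚ) =
      (![1, 0, 0, Fintype.card F] : Fin 4 → ℚ) j := by
  have h2 : (2 : F) = 0 := CharTwo.two_eq_zero
  refine (hyperplaneOD_pencil_const indep_rep5 3 0 (fun β => ?_) ?_ j).trans ?_
  -- Here `disc` is constantly 1.
  · apply hasType_nonsingular
    simp only [disc, comb, rep5Form₁, rep5Form₂]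
    grind
  · refine hasType_double ?_ ?_ <;> simp [Unmixed, TernaryForm.ext_iff, zeroForm, rep5Form₁, rep5Form₂]
  · fin_cases j <;> simp
    try ring

theorem hyperplaneOD_rep6 (j : Fin 4) :
    (hyperplaneOD (pencil (rep6Form₁ F) (rep6Form₂ F)) j : ℚ) =
      (![1, 1, 0, Fintype.card F - 1] : Fin 4 → ℚ) j := by
  have h2 : (2 : F) = 0 := CharTwo.two_eq_zero
  refine (hyperplaneOD_pencil_one indep_rep6 0 1 3 0 ?_ (fun β hβ => ?_) ?_ j).trans ?_
  · refine hasType_real ![1, 0, 0] ![0, 1, 0] (by simp) ?_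
    ext <;> simp [comb, prodLin, rep6Form₁, rep6Form₂] <;> grind
  · apply hasType_nonsingular
    simp only [disc, comb, rep6Form₁, rep6Form₂]
    grind
  · refine hasType_double ?_ ?_ <;> simp [Unmixed, TernaryForm.ext_iff, zeroForm, rep6Form₁, rep6Form₂]
  · fin_cases j <;> simp
    try ring

/-- Here `disc` is β(β + γ)². At β = 0 the member is an anisotropic binary form, and at β = γ it is
a sum of squares, hence a double line. -/
theorem hyperplaneOD_rep7 {γ : F} (hγ : Tr γ⁻¹ = 1) (j : Fin 4) :
    (hyperplaneOD (pencil (rep7Form₁ γ) (rep7Form₂ γ)) j : ℚ) =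
      (![1, 0, 1, Fintype.card F - 1] : Fin 4 → ℚ) j := by
  have h2 : (2 : F) = 0 := CharTwo.two_eq_zero
  have hγ0 := ne_zero_of_tr_inv hγ
  refine (hyperplaneOD_pencil_two (indep_rep7 γ) hγ0.symm 2 0 3 3 ?_ ?_ (fun β hβ hβ' => ?_) ?_ j).trans ?_
  · refine hasType_imaginary (1) (γ⁻¹ ^ 2) ![1, 0, 0] ![0, γ, 0] (by simp [hγ0]) (by rw [one_mul, tr_inv_sq hγ]) ?_
    ext <;> simp [comb, binaryForm, rep7Form₁, rep7Form₂] <;> grind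
  · refine hasType_double ?_ ?_ <;> simp [comb, Unmixed, TernaryForm.ext_iff, zeroForm, rep7Form₁, rep7Form₂]
    grind
  · apply hasType_nonsingular
    simp only [disc, comb, rep7Form₁, rep7Form₂]
    grind
  · apply hasType_nonsingular
    simp only [disc, rep7Form₁, rep7Form₂]
    grind
  · fin_cases j <;> simp
    try ring

/-- Here `disc` is 1 + β²; besides f₂ only β = 1 gives a line pair. -/
theorem hyperplaneOD_rep8 (j : Fin 4) :
    (hyperplaneOD (pencil (rep8Form₁ F) (rep8Form₂ F)) j : ℚ) =
      (![0, 2, 0, Fintype.card F - 1] : Fin 4 → ℚ) j := by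
  have h2 : (2 : F) = 0 := CharTwo.two_eq_zero
  refine (hyperplaneOD_pencil_one indep_rep8 1 1 3 1 ?_ (fun β hβ => ?_) ?_ j).trans ?_
  · refine hasType_real ![1, 0, 1] ![0, 1, 1] (by simp) ?_
    ext <;> simp [comb, prodLin, rep8Form₁, rep8Form₂] <;> grind
  · apply hasType_nonsingular
    simp only [disc, comb, rep8Form₁, rep8Form₂]
    grind
  · refine hasType_real ![0, 0, 1] ![1, 1, 0] (by simp) ?_
    ext <;> simp [prodLin, rep8Form₁, rep8Form₂] <;> grind
  · fin_cases j <;> simp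
    try ring

/-- Here `disc` is β² + β. The three line pairs are the three ways of joining the four base points
in two pairs. -/
theorem hyperplaneOD_rep9 (j : Fin 4) :
    (hyperplaneOD (pencil (rep9Form₁ F) (rep9Form₂ F)) j : ℚ) =
      (![0, 3, 0, Fintype.card F - 2] : Fin 4 → ℚ) j := by
  have h2 : (2 : F) = 0 := CharTwo.two_eq_zero
  refine (hyperplaneOD_pencil_two indep_rep9 (zero_ne_one (α := F)) 1 1 3 1 ?_ ?_ (fun β hβ hβ' => ?_) ?_ j).trans ?_
  · refine hasType_real ![1, 0, 0] ![1, 1, 0] (by simp) ?_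
    ext <;> simp [comb, prodLin, rep9Form₁, rep9Form₂] <;> grind
  · refine hasType_real ![1, 0, 1] ![1, 1, 1] (by simp) ?_
    ext <;> simp [comb, prodLin, rep9Form₁, rep9Form₂] <;> grind
  · apply hasType_nonsingular
    simp only [disc, comb, rep9Form₁, rep9Form₂]
    grind
  · refine hasType_real ![0, 0, 1] ![0, 1, 1] (by simp) ?_
    ext <;> simp [prodLin, rep9Form₁, rep9Form₂] <;> grind
  · fin_cases j <;> simp
    try ring

/-- Here `disc` is β(1 + β)². The member at β = 1 is X₁² + γX₁X₂ + X₂², which is anisotropic in X₁,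
X₂. -/
theorem hyperplaneOD_rep10 {γ : F} (hγ : Tr γ⁻¹ = 1) (j : Fin 4) :
    (hyperplaneOD (pencil (rep10Form₁ γ) (rep10Form₂ γ)) j : ℚ) =
      (![0, 1, 1, Fintype.card F - 1] : Fin 4 → ℚ) j := by
  have h2 : (2 : F) = 0 := CharTwo.two_eq_zero
  have hγ0 := ne_zero_of_tr_inv hγ
  refine (hyperplaneOD_pencil_two (indep_rep10 γ) (zero_ne_one (α := F)) 1 2 3 3 ?_ ?_ (fun β hβ hβ' => ?_) ?_ j).trans ?_
  · refine hasType_real ![0, 1, 0] ![1, 1, γ] (by simp) ?_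
    ext <;> simp [comb, prodLin, rep10Form₁, rep10Form₂] <;> grind
  · refine hasType_imaginary (1) (γ⁻¹ ^ 2) ![0, 1, 0] ![0, 0, γ] (by simpa using hγ0) (by rw [one_mul, tr_inv_sq hγ]) ?_
    ext <;> simp [comb, binaryForm, rep10Form₁, rep10Form₂] <;> grind
  · apply hasType_nonsingular
    simp only [disc, comb, rep10Form₁, rep10Form₂]
    grind
  · apply hasType_nonsingular
    simp only [disc, rep10Form₁, rep10Form₂]
    grind
  · fin_cases j <;> simp
    try ring

theorem hyperplaneOD_rep11 (j : Fin 4) :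
    (hyperplaneOD (pencil (rep11Form₁ F) (rep11Form₂ F)) j : ℚ) =
      (![0, 1, 0, Fintype.card F] : Fin 4 → ℚ) j := by
  have h2 : (2 : F) = 0 := CharTwo.two_eq_zero
  refine (hyperplaneOD_pencil_const indep_rep11 3 1 (fun β => ?_) ?_ j).trans ?_
  · apply hasType_nonsingular
    simp only [disc, comb, rep11Form₁, rep11Form₂]
    grind
  · refine hasType_real ![0, 1, 0] ![0, 0, 1] (by simp) ?_
    ext <;> simp [prodLin, rep11Form₁, rep11Form₂] <;> grind
  · fin_cases j <;> simp
    try ring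

theorem hyperplaneOD_rep12 {γ : F} (hγ : Tr γ⁻¹ = 1) (j : Fin 4) :
    (hyperplaneOD (pencil (rep12Form₁ γ) (rep12Form₂ γ)) j : ℚ) =
      (![0, 1, 0, Fintype.card F] : Fin 4 → ℚ) j := by
  have h2 : (2 : F) = 0 := CharTwo.two_eq_zero
  have hγ0 := ne_zero_of_tr_inv hγ
  refine (hyperplaneOD_pencil_one (indep_rep12 γ) γ⁻¹ 1 3 3 ?_ (fun β hβ => ?_) ?_ j).trans ?_
  · refine hasType_real ![0, 0, 1] ![γ⁻¹, γ⁻¹, 1] (by simp [hγ0]) ?_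
    ext <;> simp [comb, prodLin, rep12Form₁, rep12Form₂] <;> grind
  · apply hasType_nonsingular
    simp only [disc, comb, rep12Form₁, rep12Form₂]
    -- Here `disc` factors as (1 + βγ)(1 + βγ + β²). The second factor is a value of an anisotropic
    -- form, so γ⁻¹ is the only exceptional β.
    have := norm_form_eq_zero' hγ (x := 1) (y := β)
    grind
  · apply hasType_nonsingular
    simp only [disc, rep12Form₁, rep12Form₂]
    grind
  · fin_cases j <;> simp
    try ring

/-- Here `disc` is β² + β. The two generators are anisotropic binary forms, and their sum is (X₁ +
X₂)(X₀ + X₁ + X₂). -/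
theorem hyperplaneOD_rep13 {γ : F} (hγ : Tr γ = 1) (j : Fin 4) :
    (hyperplaneOD (pencil (rep13Form₁ γ) (rep13Form₂ γ)) j : ℚ) =
      (![0, 1, 2, Fintype.card F - 2] : Fin 4 → ℚ) j := by
  have h2 : (2 : F) = 0 := CharTwo.two_eq_zero
  have hγ0 := ne_zero_of_tr hγ
  refine (hyperplaneOD_pencil_two (indep_rep13 γ) (zero_ne_one (α := F)) 2 1 3 2 ?_ ?_ (fun β hβ hβ' => ?_) ?_ j).trans ?_
  · refine hasType_imaginary (1) (γ) ![0, 1, 0] ![1, 0, 0] (by simp) (by rw [one_mul, hγ]) ?_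
    ext <;> simp [comb, binaryForm, rep13Form₁, rep13Form₂] <;> grind
  · refine hasType_real ![0, 1, 1] ![1, 1, 1] (by simp) ?_
    ext <;> simp [comb, prodLin, rep13Form₁, rep13Form₂] <;> grind
  · apply hasType_nonsingular
    simp only [disc, comb, rep13Form₁, rep13Form₂]
    grind
  · refine hasType_imaginary (1) (γ) ![0, 0, 1] ![1, 0, 0] (by simp) (by rw [one_mul, hγ]) ?_
    ext <;> simp [binaryForm, rep13Form₁, rep13Form₂] <;> grind
  · fin_cases j <;> simp
    try ring

theorem hyperplaneOD_rep14 {γ : F} (hγ : Tr γ = 1) (j : Fin 4) :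
    (hyperplaneOD (pencil (rep14Form₁ γ) (rep14Form₂ γ)) j : ℚ) =
      (![0, 0, 1, Fintype.card F] : Fin 4 → ℚ) j := by
  have h2 : (2 : F) = 0 := CharTwo.two_eq_zero
  have hγ0 := ne_zero_of_tr hγ
  refine (hyperplaneOD_pencil_const (indep_rep14 γ) 3 2 (fun β => ?_) ?_ j).trans ?_
  · apply hasType_nonsingular
    simp only [disc, comb, rep14Form₁, rep14Form₂]
    -- Multiplied by γ, `disc` is (γβ)² + γβ + γ², which cannot vanish because γ² has trace one.
    have := sq_add_self_ne ((tr_sq γ).trans hγ) (γ * β)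
    grind
  · refine hasType_imaginary (1) (γ) ![0, 1, 0] ![1, 0, 0] (by simp) (by rw [one_mul, hγ]) ?_
    ext <;> simp [binaryForm, rep14Form₁, rep14Form₂] <;> grind
  · fin_cases j <;> simp
    try ring

theorem hyperplaneOD_rep15 {b c : F} (hbc : ∀ u : F, u ^ 2 * (u + c) ≠ b) (j : Fin 4) :
    (hyperplaneOD (pencil (rep15Form₁ b c) (rep15Form₂ b c)) j : ℚ) =
      (![0, 0, 0, Fintype.card F + 1] : Fin 4 → ℚ) j := by
  have h2 : (2 : F) = 0 := CharTwo.two_eq_zero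
  refine (hyperplaneOD_pencil_const (indep_rep15 b c) 3 3 (fun β => ?_) ?_ j).trans ?_
  · apply hasType_nonsingular
    simp only [disc, comb, rep15Form₁, rep15Form₂]
    -- Here `disc` is b + β(β + c)², which is u²(u + c) + b for u = β + c.
    have := hbc (c + β)
    grind
  · apply hasType_nonsingular
    simp only [disc, rep15Form₁, rep15Form₂]
    grind
  · fin_cases j <;> simp
    try ring

end HyperplaneData

end VeroneseSolids

namespace VeroneseSolids
open TernaryForm

/-! ### Stabilisers found by solving for the matrix entries -/

section Canonical

variable {F : Type*} [Field F]

theorem exists_entries (A : Matrix (Fin 3) (Fin 3) F) :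
    ∃ a b c d e f g h i, A = !![a, b, c; d, e, f; g, h, i] :=
  ⟨_, _, _, _, _, _, _, _, _, Matrix.eta_fin_three A⟩

theorem det_entries (a b c d e f g h i : F) : (!![a, b, c; d, e, f; g, h, i]).det =
    a * e * i - a * f * h - b * d * i + b * f * g + c * d * h - c * e * g := by
  simp [det_fin_three]

theorem subst_entries (φ : TernaryForm F) (a b c d e f g h i : F) :
    φ.subst !![a, b, c; d, e, f; g, h, i] =
      ⟨φ.eval ![a, d, g], φ.polar ![a, d, g] ![b, e, h], φ.polar ![a, d, g] ![c, f, i],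
        φ.eval ![b, e, h], φ.polar ![b, e, h] ![c, f, i], φ.eval ![c, f, i]⟩ := by
  ext <;> simp [subst, eval, polar]

theorem inSpan_iff {f₁ f₂ f : TernaryForm F} : InSpan f₁ f₂ f ↔ ∃ a b : F,
    f.a00 = a * f₁.a00 + b * f₂.a00 ∧ f.a01 = a * f₁.a01 + b * f₂.a01 ∧
    f.a02 = a * f₁.a02 + b * f₂.a02 ∧ f.a11 = a * f₁.a11 + b * f₂.a11 ∧
    f.a12 = a * f₁.a12 + b * f₂.a12 ∧ f.a22 = a * f₁.a22 + b * f₂.a22 := by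
  simp only [InSpan, comb, TernaryForm.ext_iff]

theorem cyc_two_cases (e : Cyc 2) : e = 1 ∨ e = Multiplicative.ofAdd 1 := by
  revert e
  decide

theorem unipotentScalarAction_apply (g : E F × Fˣ) (w : E2 F) :
    unipotentScalarAction F g w = Multiplicative.ofAdd
      ((g.2 : F) * (w.toAdd.1 + g.1.toAdd * w.toAdd.2), (g.2 : F) * w.toAdd.2) := rfl

theorem scalarAction_apply' (V : Type*) [AddCommGroup V] [Module F V] (a : Fˣ)
    (v : Multiplicative V) : scalarAction F V a v = Multiplicative.ofAdd ((a : F) • v.toAdd) := rfl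

theorem torusAction_apply (s : Fˣ × Fˣ) (g : Unitri F) :
    torusAction F s g = ⟨s.1 * g.x, s.2 * g.y, s.1 * s.2 * g.z⟩ := rfl

theorem swapAction_ofAdd (G : Type*) [Group G] (g : G × G) :
    swapAction G (Multiplicative.ofAdd 1) g = g.swap := rfl

theorem naturalAction_apply' (A : GL (Fin 2) F) (v : Multiplicative (Fin 2 → F)) :
    naturalAction F A v = Multiplicative.ofAdd (A.1 *ᵥ v.toAdd) := rfl

variable [CharP F 2]

/-- The product v c in the corner entry is what turns matrix multiplication into the action (u, v) ↦
(a(u + cv), av); in characteristic two the cross terms agree. -/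
def unipotentScalarRep :
    E2 F ⋊[unipotentScalarAction F] (E F × Fˣ) →* Matrix (Fin 3) (Fin 3) F where
  toFun g := !![(g.right.2 : F), g.left.toAdd.2,
      g.left.toAdd.2 * g.right.1.toAdd + g.left.toAdd.1; 0, 1, g.right.1.toAdd; 0, 0, 1]
  map_one' := by
    ext i j
    fin_cases i <;> fin_cases j <;> simp
  map_mul' g h := by
    have h2 : (2 : F) = 0 := CharTwo.two_eq_zero
    ext i j
    fin_cases i <;> fin_cases j <;>
      simp [Matrix.mul_apply, Fin.sum_univ_three, unipotentScalarAction_apply] <;> grind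

theorem stabilizer_rep1 : Nonempty (MulAction.stabilizer (K F)
    (pencil (⟨0, 0, 0, 1, 1, 0⟩ : TernaryForm F) ⟨0, 0, 0, 0, 0, 1⟩) ≃*
      E2 F ⋊[unipotentScalarAction F] (E F × Fˣ)) := by
  have h2 : (2 : F) = 0 := CharTwo.two_eq_zero
  refine stabilizer_pencil unipotentScalarRep (fun g => ?_) (fun g c hg => ?_)
    (fun A hA h₁ h₂ => ?_)
  · simp only [unipotentScalarRep, MonoidHom.coe_mk, OneHom.coe_mk, subst_entries, inSpan_iff]
    -- Replacing X₁ by X₁ + cX₂ changes X₁² + X₁X₂ by (c² + c)X₂².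
    refine ⟨⟨1, g.right.1.toAdd ^ 2 + g.right.1.toAdd, ?_⟩, ⟨0, 1, ?_⟩⟩ <;>
      simp [eval, polar] <;> grind
  · have e := fun i j => congrFun (congrFun hg i) j
    simp [unipotentScalarRep, Fin.forall_fin_succ] at e
    refine SemidirectProduct.ext (Multiplicative.toAdd.injective (Prod.ext ?_ ?_))
      (Prod.ext ?_ (Units.ext ?_)) <;> simp [-Units.val_eq_one] <;> grind
  · obtain ⟨a, b, c, d, e, f, g, h, i, rfl⟩ := exists_entries A
    rw [subst_entries, inSpan_iff] at h₁ h₂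
    simp [eval, polar] at h₁ h₂
    rw [det_entries] at hA
    have ha : a ≠ 0 := by grind
    have he : e ≠ 0 := by grind
    refine ⟨⟨Multiplicative.ofAdd (c / e - b / e * (f / e), b / e),
      Multiplicative.ofAdd (f / e), Units.mk0 (a / e) (div_ne_zero ha he)⟩, e, ?_⟩
    ext i j
    fin_cases i <;> fin_cases j <;> simp [unipotentScalarRep] <;>
      try field_simp
    all_goals grind

/-- The unitriangular matrix times diag(ab, b, 1), whose conjugation action multiplies the
superdiagonal entries by a and b. -/
def unitriTorusRep : Unitri F ⋊[torusAction F] (Fˣ × Fˣ) →* Matrix (Fin 3) (Fin 3) F where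
  toFun g := !![(g.right.1 * g.right.2 : F), g.left.x * g.right.2, g.left.z;
    0, (g.right.2 : F), g.left.y; 0, 0, 1]
  map_one' := by
    ext i j
    fin_cases i <;> fin_cases j <;> simp [Unitri.one_def]
  map_mul' g h := by
    ext i j
    fin_cases i <;> fin_cases j <;>
      simp [Matrix.mul_apply, Fin.sum_univ_three, torusAction_apply, Unitri.mul_def] <;> ring

/-- The pencil X₂⟨X₁, X₂⟩ is preserved exactly by the substitutions fixing the flag ⟨X₂⟩ ⊂ ⟨X₁, X₂⟩,
that is, by upper triangular matrices. -/
theorem stabilizer_rep2 : Nonempty (MulAction.stabilizer (K F)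
    (pencil (rep2Form₁ F) (rep2Form₂ F)) ≃* Unitri F ⋊[torusAction F] (Fˣ × Fˣ)) := by
  have h2 : (2 : F) = 0 := CharTwo.two_eq_zero
  refine stabilizer_pencil unitriTorusRep (fun g => ?_) (fun g c hg => ?_)
    (fun A hA h₁ h₂ => ?_)
  · simp only [unitriTorusRep, MonoidHom.coe_mk, OneHom.coe_mk, subst_entries, inSpan_iff]
    refine ⟨⟨g.right.2, g.left.y, ?_⟩, ⟨0, 1, ?_⟩⟩ <;>
      simp [eval, polar, rep2Form₁, rep2Form₂] <;> grind
  · have e := fun i j => congrFun (congrFun hg i) j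
    simp [unitriTorusRep, Fin.forall_fin_succ] at e
    refine SemidirectProduct.ext (Unitri.ext ?_ ?_ ?_)
      (Prod.ext (Units.ext ?_) (Units.ext ?_)) <;>
      simp [Unitri.one_def, -Units.val_eq_one] <;> grind
  · obtain ⟨a, b, c, d, e, f, g, h, i, rfl⟩ := exists_entries A
    rw [subst_entries, inSpan_iff] at h₁ h₂
    simp [eval, polar, rep2Form₁, rep2Form₂] at h₁ h₂
    rw [det_entries] at hA
    have hg : g = 0 := by grind
    have hh : h = 0 := by grind
    have hi : i ≠ 0 := by grind
    have hd : d = 0 := by grind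
    have ha : a ≠ 0 := by grind
    have he : e ≠ 0 := by grind
    refine ⟨⟨⟨b / e, f / i, c / i⟩, Units.mk0 (a / e) (div_ne_zero ha he),
      Units.mk0 (e / i) (div_ne_zero he hi)⟩, i, ?_⟩
    ext i j
    fin_cases i <;> fin_cases j <;> simp [unitriTorusRep] <;> try field_simp
    all_goals grind

/-- Substitution in forms is contragredient to the action on column vectors; the inverse transpose
block restores the order of multiplication, and the top row is transformed accordingly. -/
def affineRep : Multiplicative (Fin 2 → F) ⋊[naturalAction F] GL (Fin 2) F →*
    Matrix (Fin 3) (Fin 3) F where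
  toFun g := !![1, (g.right⁻¹.1 *ᵥ g.left.toAdd) 0, (g.right⁻¹.1 *ᵥ g.left.toAdd) 1;
    0, g.right⁻¹.1 0 0, g.right⁻¹.1 1 0; 0, g.right⁻¹.1 0 1, g.right⁻¹.1 1 1]
  map_one' := by
    ext i j
    fin_cases i <;> fin_cases j <;> simp
  map_mul' g h := by
    have e : (g * h).right⁻¹.1 = h.right⁻¹.1 * g.right⁻¹.1 := by
      rw [SemidirectProduct.mul_right, _root_.mul_inv_rev, Units.val_mul]
    have e' : (g * h).right⁻¹.1 *ᵥ (g * h).left.toAdd =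
        h.right⁻¹.1 *ᵥ (g.right⁻¹.1 *ᵥ g.left.toAdd) + h.right⁻¹.1 *ᵥ h.left.toAdd := by
      rw [e, SemidirectProduct.mul_left, naturalAction_apply', toAdd_mul, toAdd_ofAdd,
        Matrix.mulVec_add, ← Matrix.mulVec_mulVec, ← Matrix.mulVec_mulVec, Matrix.mulVec_mulVec _ g.right⁻¹.1,
        ← Units.val_mul, inv_mul_cancel, Units.val_one, Matrix.one_mulVec]
    rw [e', e]
    generalize g.right⁻¹.1 *ᵥ g.left.toAdd = v
    generalize h.right⁻¹.1 *ᵥ h.left.toAdd = w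
    ext i j
    fin_cases i <;> fin_cases j <;>
      simp [Matrix.mul_apply, Fin.sum_univ_three, Fin.sum_univ_two, Matrix.mulVec, dotProduct] <;> ring

/-- Preserving the span of X₁² and X₂² amounts to preserving the span of X₁ and X₂, or to fixing the
point (1, 0, 0). -/
theorem stabilizer_rep3 : Nonempty (MulAction.stabilizer (K F)
    (pencil (rep3Form₁ F) (rep3Form₂ F)) ≃*
      Multiplicative (Fin 2 → F) ⋊[naturalAction F] GL (Fin 2) F) := by
  have h2 : (2 : F) = 0 := CharTwo.two_eq_zero
  refine stabilizer_pencil affineRep (fun g => ?_) (fun g c hg => ?_)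
    (fun A hA h₁ h₂ => ?_)
  · simp only [affineRep, MonoidHom.coe_mk, OneHom.coe_mk, subst_entries, inSpan_iff]
    refine ⟨⟨g.right⁻¹.1 0 0 ^ 2, g.right⁻¹.1 1 0 ^ 2, ?_⟩,
      ⟨g.right⁻¹.1 0 1 ^ 2, g.right⁻¹.1 1 1 ^ 2, ?_⟩⟩ <;>
      simp only [eval, polar, rep3Form₁, rep3Form₂, Matrix.cons_val] <;> grind
  · have e := fun i j => congrFun (congrFun hg i) j
    simp only [affineRep, MonoidHom.coe_mk, OneHom.coe_mk, Matrix.smul_apply, smul_eq_mul,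
      Fin.forall_fin_succ] at e
    simp at e
    have e1 : g.right = 1 := by
      rw [← inv_eq_one]
      ext i j
      fin_cases i <;> fin_cases j <;> simp <;> grind
    refine SemidirectProduct.ext ?_ e1
    rw [e1] at e
    apply Multiplicative.toAdd.injective
    funext i
    fin_cases i <;> simp at e ⊢ <;> grind
  · obtain ⟨a, b, c, d, e, f, g, h, i, rfl⟩ := exists_entries A
    rw [subst_entries, inSpan_iff] at h₁ h₂
    simp [eval, polar, rep3Form₁, rep3Form₂] at h₁ h₂
    rw [det_entries] at hA
    have hg : g = 0 := by grind
    have hd : d = 0 := by grind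
    have ha : a ≠ 0 := by grind
    obtain ⟨D, hD⟩ : ∃ D : GL (Fin 2) F, D.1 = !![e / a, h / a; f / a, i / a] :=
      ⟨GeneralLinearGroup.mkOfDetNeZero !![e / a, h / a; f / a, i / a] (by
        rw [det_fin_two_of]
        intro h0
        field_simp at h0
        grind), rfl⟩
    refine ⟨⟨Multiplicative.ofAdd (D⁻¹.1 *ᵥ ![b / a, c / a]), D⁻¹⟩, a, ?_⟩
    have e' : D.1 *ᵥ (D⁻¹.1 *ᵥ ![b / a, c / a]) = ![b / a, c / a] := by
      rw [Matrix.mulVec_mulVec, ← Units.val_mul, mul_inv_cancel, Units.val_one, Matrix.one_mulVec]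
    simp only [affineRep, MonoidHom.coe_mk, OneHom.coe_mk, _root_.inv_inv, toAdd_ofAdd]
    rw [e', hD]
    ext i j
    fin_cases i <;> fin_cases j <;> simp <;> try field_simp
    all_goals grind

def gl2Rep : GL (Fin 2) F →* Matrix (Fin 3) (Fin 3) F where
  toFun B := !![B.1 0 0, 0, B.1 0 1; 0, 1, 0; B.1 1 0, 0, B.1 1 1]
  map_one' := by
    ext i j
    fin_cases i <;> fin_cases j <;> simp
  map_mul' g h := by
    ext i j
    fin_cases i <;> fin_cases j <;>
      simp [Matrix.mul_apply, Fin.sum_univ_three, Fin.sum_univ_two]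

/-- The base locus is the line X₁ = 0 and the point (0, 1, 0) off it. Matrices fixing both are block
diagonal, and the middle entry can be scaled to 1. -/
theorem stabilizer_rep4 : Nonempty (MulAction.stabilizer (K F)
    (pencil (rep4Form₁ F) (rep4Form₂ F)) ≃* GL (Fin 2) F) := by
  have h2 : (2 : F) = 0 := CharTwo.two_eq_zero
  refine stabilizer_pencil gl2Rep (fun g => ?_) (fun g c hg => ?_)
    (fun A hA h₁ h₂ => ?_)
  · simp only [gl2Rep, MonoidHom.coe_mk, OneHom.coe_mk, subst_entries, inSpan_iff]
    refine ⟨⟨g.1 0 0, g.1 0 1, ?_⟩, ⟨g.1 1 0, g.1 1 1, ?_⟩⟩ <;>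
      simp [eval, polar, rep4Form₁, rep4Form₂]
  · have e := fun i j => congrFun (congrFun hg i) j
    simp [gl2Rep, Fin.forall_fin_succ] at e
    ext i j
    fin_cases i <;> fin_cases j <;> simp <;> grind
  · obtain ⟨a, b, c, d, e, f, g, h, i, rfl⟩ := exists_entries A
    rw [subst_entries, inSpan_iff] at h₁ h₂
    simp [eval, polar, rep4Form₁, rep4Form₂] at h₁ h₂
    rw [det_entries] at hA
    have hd : d = 0 := by
      by_contra hd
      have : a = 0 := by grind
      have : g = 0 := by grind
      grind
    have hf : f = 0 := by
      by_contra hf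
      have : c = 0 := by grind
      have : i = 0 := by grind
      grind
    have he : e ≠ 0 := by grind
    have hb : b = 0 := by grind
    have hh : h = 0 := by grind
    obtain ⟨D, hD⟩ : ∃ D : GL (Fin 2) F, D.1 = !![a / e, c / e; g / e, i / e] :=
      ⟨GeneralLinearGroup.mkOfDetNeZero !![a / e, c / e; g / e, i / e] (by
        rw [det_fin_two_of]
        intro h0
        field_simp at h0
        grind), rfl⟩
    refine ⟨D, e, ?_⟩
    simp only [gl2Rep, MonoidHom.coe_mk, OneHom.coe_mk, hD]
    ext i j
    fin_cases i <;> fin_cases j <;> simp <;> try field_simp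
    all_goals grind

/-- Keeping X₀X₁ and X₂² in proportion forces the diagonal (1, r², r). Entering v through its square
makes r act on it by r and not by r². -/
def scalarPlaneRep : E2 F ⋊[scalarAction F (F × F)] Fˣ →* Matrix (Fin 3) (Fin 3) F where
  toFun g := !![1, 0, 0; g.left.toAdd.2 ^ 2, (g.right : F) ^ 2, 0; g.left.toAdd.1, 0, (g.right : F)]
  map_one' := by
    ext i j
    fin_cases i <;> fin_cases j <;> simp
  map_mul' g h := by
    have h2 : (2 : F) = 0 := CharTwo.two_eq_zero
    ext i j
    fin_cases i <;> fin_cases j <;>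
      simp [Matrix.mul_apply, Fin.sum_univ_three, scalarAction_apply'] <;> grind

theorem stabilizer_rep5 [Fintype F] : Nonempty (MulAction.stabilizer (K F)
    (pencil (rep5Form₁ F) (rep5Form₂ F)) ≃* E2 F ⋊[scalarAction F (F × F)] Fˣ) := by
  have h2 : (2 : F) = 0 := CharTwo.two_eq_zero
  refine stabilizer_pencil scalarPlaneRep (fun g => ?_) (fun g c hg => ?_)
    (fun A hA h₁ h₂ => ?_)
  · simp only [scalarPlaneRep, MonoidHom.coe_mk, OneHom.coe_mk, subst_entries, inSpan_iff]
    refine ⟨⟨(g.right : F) ^ 2, g.left.toAdd.2 ^ 2 + g.left.toAdd.1 ^ 2, ?_⟩, ⟨0, 1, ?_⟩⟩ <;>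
      simp [eval, polar, rep5Form₁, rep5Form₂] <;> grind
  · have e := fun i j => congrFun (congrFun hg i) j
    simp [scalarPlaneRep, Fin.forall_fin_succ] at e
    refine SemidirectProduct.ext (Multiplicative.toAdd.injective (Prod.ext ?_ ?_))
      (Units.ext ?_) <;> simp [-Units.val_eq_one] <;> grind
  · obtain ⟨a, b, c, d, e, f, g, h, i, rfl⟩ := exists_entries A
    rw [subst_entries, inSpan_iff] at h₁ h₂
    simp [eval, polar, rep5Form₁, rep5Form₂] at h₁ h₂
    rw [det_entries] at hA
    have hb : b = 0 := by grind
    have hc : c = 0 := by grind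
    have ha : a ≠ 0 := by grind
    have hi : i ≠ 0 := by grind
    -- Since F is finite every entry d/a is a square, so it is reached by the representation.
    refine ⟨⟨Multiplicative.ofAdd (g / a, sqrtTwo (d / a)), Units.mk0 (i / a) (div_ne_zero hi ha)⟩,
      a, ?_⟩
    ext i j
    fin_cases i <;> fin_cases j <;> simp [scalarPlaneRep, sqrtTwo_sq] <;> try field_simp
    all_goals grind

def swapTorusRep :
    (Fˣ × Fˣ) ⋊[swapAction Fˣ] Cyc 2 →* Matrix (Fin 3) (Fin 3) F where
  toFun g := !![if g.right = 1 then (g.left.1 : F) else 0, if g.right = 1 then 0 else (g.left.1 : F), 0;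
    if g.right = 1 then 0 else (g.left.2 : F), if g.right = 1 then (g.left.2 : F) else 0, 0;
    0, 0, 1]
  map_one' := by
    ext i j
    fin_cases i <;> fin_cases j <;> simp
  map_mul' g h := by
    have h11 : (Multiplicative.ofAdd 1 * Multiplicative.ofAdd 1 : Cyc 2) = 1 := rfl
    have h1 : (Multiplicative.ofAdd 1 : Cyc 2) ≠ 1 := by decide
    rcases cyc_two_cases g.right with e | e <;> rcases cyc_two_cases h.right with e' | e' <;>
    · ext i j
      fin_cases i <;> fin_cases j <;>
        simp [Matrix.mul_apply, Fin.sum_univ_three, swapAction_ofAdd, h11, -ofAdd_eq_one, h1, e, e']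

theorem stabilizer_rep6 : Nonempty (MulAction.stabilizer (K F)
    (pencil (rep6Form₁ F) (rep6Form₂ F)) ≃* (Fˣ × Fˣ) ⋊[swapAction Fˣ] Cyc 2) := by
  have h2 : (2 : F) = 0 := CharTwo.two_eq_zero
  have hc1 : (Multiplicative.ofAdd 1 : Cyc 2) ≠ 1 := by decide
  refine stabilizer_pencil swapTorusRep (fun g => ?_) (fun g c hg => ?_)
    (fun A hA h₁ h₂ => ?_)
  · simp only [swapTorusRep, MonoidHom.coe_mk, OneHom.coe_mk, subst_entries, inSpan_iff]
    refine ⟨⟨g.left.1 * g.left.2, 0, ?_⟩, ⟨0, 1, ?_⟩⟩ <;>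
      by_cases h : g.right = 1 <;> simp [eval, polar, rep6Form₁, rep6Form₂, h, mul_comm]
  · have e := fun i j => congrFun (congrFun hg i) j
    have h00 := e 0 0
    have h11 := e 1 1
    have h22 := e 2 2
    simp [swapTorusRep] at h00 h11 h22
    have hr : g.right = 1 := by
      by_contra hr
      simp [hr, ← h22] at h00
    simp [hr] at h00 h11
    refine SemidirectProduct.ext (Prod.ext (Units.ext ?_) (Units.ext ?_)) hr <;>
      simp [-Units.val_eq_one] <;> grind
  · obtain ⟨a, b, c, d, e, f, g, h, i, rfl⟩ := exists_entries A
    rw [subst_entries, inSpan_iff] at h₁ h₂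
    simp [eval, polar, rep6Form₁, rep6Form₂] at h₁ h₂
    rw [det_entries] at hA
    have hg : g = 0 := by grind
    have hh : h = 0 := by grind
    have hi : i ≠ 0 := by grind
    -- The lines X₀ = 0 and X₁ = 0 are either interchanged (a = 0) or each fixed.
    by_cases ha : a = 0
    · have hd : d ≠ 0 := by grind
      have hb : b ≠ 0 := by grind
      have he : e = 0 := by grind
      have hc : c = 0 := by grind
      have hf : f = 0 := by grind
      refine ⟨⟨(Units.mk0 (b / i) (div_ne_zero hb hi), Units.mk0 (d / i) (div_ne_zero hd hi)),
        Multiplicative.ofAdd 1⟩, i, ?_⟩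
      ext i j
      fin_cases i <;> fin_cases j <;> simp [swapTorusRep, hc1, -ofAdd_eq_one] <;> try field_simp
      all_goals grind
    · have hd : d = 0 := by grind
      have he : e ≠ 0 := by grind
      have hb : b = 0 := by grind
      have hf : f = 0 := by grind
      have hc : c = 0 := by grind
      refine ⟨⟨(Units.mk0 (a / i) (div_ne_zero ha hi), Units.mk0 (e / i) (div_ne_zero he hi)), 1⟩,
        i, ?_⟩
      ext i j
      fin_cases i <;> fin_cases j <;> simp [swapTorusRep] <;> try field_simp
      all_goals grind

def scalarLineRep : E F ⋊[scalarAction F F] Fˣ →* Matrix (Fin 3) (Fin 3) F where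
  toFun g := !![(g.right : F), 0, g.left.toAdd; 0, (g.right : F)⁻¹, 0; 0, 0, 1]
  map_one' := by
    ext i j
    fin_cases i <;> fin_cases j <;> simp
  map_mul' g h := by
    ext i j
    fin_cases i <;> fin_cases j <;>
      simp [Matrix.mul_apply, Fin.sum_univ_three, scalarAction_apply', mul_comm, add_comm]

/-- X₁X₂ is the only degenerate member. The line X₁ = 0 is tangent to the conic X₀X₁ + X₂² = 0 while
X₂ = 0 meets it twice, so the two lines are fixed; matching X₀X₁ with X₂² relates the diagonal
entries. -/
theorem stabilizer_rep11 : Nonempty (MulAction.stabilizer (K F)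
    (pencil (rep11Form₁ F) (rep11Form₂ F)) ≃* E F ⋊[scalarAction F F] Fˣ) := by
  have h2 : (2 : F) = 0 := CharTwo.two_eq_zero
  refine stabilizer_pencil scalarLineRep (fun g => ?_) (fun g c hg => ?_)
    (fun A hA h₁ h₂ => ?_)
  · simp only [scalarLineRep, MonoidHom.coe_mk, OneHom.coe_mk, subst_entries, inSpan_iff]
    refine ⟨⟨1, g.left.toAdd * (g.right : F)⁻¹, ?_⟩, ⟨0, (g.right : F)⁻¹, ?_⟩⟩ <;>
      simp [eval, polar, rep11Form₁, rep11Form₂, mul_comm]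
  · have e := fun i j => congrFun (congrFun hg i) j
    simp [scalarLineRep, Fin.forall_fin_succ] at e
    refine SemidirectProduct.ext (Multiplicative.toAdd.injective ?_)
      (Units.ext ?_) <;> simp [-Units.val_eq_one] <;> grind
  · obtain ⟨a, b, c, d, e, f, g, h, i, rfl⟩ := exists_entries A
    rw [subst_entries, inSpan_iff] at h₁ h₂
    simp [eval, polar, rep11Form₁, rep11Form₂] at h₁ h₂
    rw [det_entries] at hA
    have hd : d = 0 := by
      by_contra hd
      have : g = 0 := by grind
      have : i = 0 := by grind
      grind
    have hg : g = 0 := by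
      by_contra hg
      have : f = 0 := by grind
      grind
    have ha : a ≠ 0 := by grind
    have hf : f = 0 := by
      by_contra hf
      grind
    have he : e ≠ 0 := by grind
    have hh : h = 0 := by grind
    have hi : i ≠ 0 := by grind
    have hb : b = 0 := by grind
    have hae : a * e = i ^ 2 := by grind
    refine ⟨⟨Multiplicative.ofAdd (c / i), Units.mk0 (a / i) (div_ne_zero ha hi)⟩, i, ?_⟩
    ext i j
    fin_cases i <;> fin_cases j <;> simp [scalarLineRep] <;> try field_simp
    all_goals grind

def shearScalarRep : Fˣ × Cyc 2 →* Matrix (Fin 3) (Fin 3) F where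
  toFun g := !![1, if g.2 = 1 then 0 else 1, 0; 0, 1, 0; 0, 0, (g.1 : F)]
  map_one' := by
    ext i j
    fin_cases i <;> fin_cases j <;> simp
  map_mul' g h := by
    have h2 : (2 : F) = 0 := CharTwo.two_eq_zero
    obtain ⟨g, e⟩ := g
    obtain ⟨h, e'⟩ := h
    have h11 : (Multiplicative.ofAdd 1 * Multiplicative.ofAdd 1 : Cyc 2) = 1 := rfl
    have h1 : (Multiplicative.ofAdd 1 : Cyc 2) ≠ 1 := by decide
    rcases cyc_two_cases e with rfl | rfl <;> rcases cyc_two_cases e' with rfl | rfl <;>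
    · ext i j
      fin_cases i <;> fin_cases j <;>
        simp [Matrix.mul_apply, Fin.sum_univ_three, h11, -ofAdd_eq_one, h1] <;> grind

/-- The stabiliser of the pencil spanned by a pair of lines `X₀² + X₀X₁ + δX₁²` and the pair
`X₁X₂`. -/
theorem stabilizer_linePairs (δ : F) : Nonempty (MulAction.stabilizer (K F)
    (pencil (⟨1, 1, 0, δ, 0, 0⟩ : TernaryForm F) ⟨0, 0, 0, 0, 1, 0⟩) ≃* Fˣ × Cyc 2) := by
  have h2 : (2 : F) = 0 := CharTwo.two_eq_zero
  have hc1 : (Multiplicative.ofAdd 1 : Cyc 2) ≠ 1 := by decide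
  refine stabilizer_pencil shearScalarRep (fun g => ?_) (fun g c hg => ?_)
    (fun A hA h₁ h₂ => ?_)
  · simp only [shearScalarRep, MonoidHom.coe_mk, OneHom.coe_mk, subst_entries, inSpan_iff]
    refine ⟨⟨1, 0, ?_⟩, ⟨0, (g.1 : F), ?_⟩⟩ <;>
      by_cases h : g.2 = 1 <;> simp [eval, polar, h] <;> grind
  · have e := fun i j => congrFun (congrFun hg i) j
    have h00 := e 0 0
    have h01 := e 0 1
    have h22 := e 2 2
    simp [shearScalarRep] at h00 h01 h22
    refine Prod.ext (Units.ext ?_) h01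
    rw [h22, ← h00]
    rfl
  · obtain ⟨a, b, c, d, e, f, g, h, i, rfl⟩ := exists_entries A
    rw [subst_entries, inSpan_iff] at h₁ h₂
    simp [eval, polar] at h₁ h₂
    rw [det_entries] at hA
    have hf : f = 0 := by
      by_contra hf
      have : i = 0 := by grind
      have : g = 0 := by grind
      have : h ≠ 0 := by grind
      have : d = 0 := by grind
      have : e = 0 := by grind
      grind
    have hc : c = 0 := by grind
    have hi : i ≠ 0 := by grind
    have hd : d = 0 := by grind
    have he : e ≠ 0 := by grind
    have hg : g = 0 := by grind
    have hh : h = 0 := by grind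
    have ha : a ≠ 0 := by grind
    have hae : a = e := by grind
    -- The coefficient of X₁² gives b² + ab = 0: either X₀ is only scaled, or the two factors of the
    -- first form are interchanged by the shear.
    have hb : b = 0 ∨ b = a := by grind
    rcases hb with hb | hb
    · refine ⟨(Units.mk0 (i / a) (div_ne_zero hi ha), 1), a, ?_⟩
      ext i j
      fin_cases i <;> fin_cases j <;> simp [shearScalarRep] <;> try field_simp
      all_goals grind
    · refine ⟨(Units.mk0 (i / a) (div_ne_zero hi ha), Multiplicative.ofAdd 1), a, ?_⟩
      ext i j
      fin_cases i <;> fin_cases j <;> simp [shearScalarRep, hc1, -ofAdd_eq_one] <;> try field_simp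
      all_goals grind

end Canonical
end VeroneseSolids

namespace VeroneseSolids
open TernaryForm

/-! ### The dihedral stabiliser: similitudes of a norm form -/

section Dihedral

/-- A homomorphism from a dihedral group given by the images of the standard generators. -/
theorem exists_dihedral_hom {G : Type*} [Group G] {n : ℕ} {R S : G} (hR : R ^ n = 1)
    (hS : S * S = 1) (hRS : S * R * S = R⁻¹) :
    ∃ φ : DihedralGroup n →* G, ∀ k : ℤ, φ (.r k) = R ^ k ∧ φ (.sr k) = S * R ^ k := by
  have hS' : S⁻¹ = S := inv_eq_of_mul_eq_one_right hS
  -- Conjugation by S inverts R, so S passes a power of R at the cost of a sign in the exponent.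
  have hconj (k : ℤ) : R ^ k * S = S * R ^ (-k) := by
    have h := conj_zpow (i := k) (a := S) (b := R)
    rw [hS', hRS, _root_.inv_zpow'] at h
    rw [h, ← mul_assoc, ← mul_assoc, hS, one_mul]
  let z : ZMod n →+ Additive G := ZMod.lift n ⟨zmultiplesHom (Additive G) (Additive.ofMul R), by
    rw [zmultiplesHom_apply, natCast_zsmul, ← ofMul_pow, hR, ofMul_one]⟩
  have hz (k : ℤ) : (z k).toMul = R ^ k := by
    simp only [z, ZMod.lift_coe, zmultiplesHom_apply]
    rfl
  let f : DihedralGroup n → G := fun d => match d with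
    | .r i => (z i).toMul
    | .sr i => S * (z i).toMul
  have hf : ∀ k : ℤ, f (.r k) = R ^ k ∧ f (.sr k) = S * R ^ k := fun k => by
    simp only [f, hz, and_self]
  refine ⟨⟨⟨f, ?_⟩, ?_⟩, hf⟩
  · have := (hf 0).1
    simpa using this
  · rintro (i | i) (j | j) <;> obtain ⟨i, rfl⟩ := ZMod.intCast_surjective i <;>
      obtain ⟨j, rfl⟩ := ZMod.intCast_surjective j
    · simp only [DihedralGroup.r_mul_r, ← Int.cast_add, (hf _).1, _root_.zpow_add]
    · simp only [DihedralGroup.r_mul_sr, ← Int.cast_sub, (hf _).1, (hf _).2]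
      rw [← mul_assoc, hconj, mul_assoc, ← _root_.zpow_add, neg_add_eq_sub]
    · simp only [DihedralGroup.sr_mul_r, ← Int.cast_add, (hf _).1, (hf _).2, _root_.zpow_add, mul_assoc]
    · simp only [DihedralGroup.sr_mul_sr, ← Int.cast_sub, (hf _).1, (hf _).2]
      rw [mul_assoc, ← mul_assoc (R ^ i), hconj, mul_assoc S, ← mul_assoc, hS, one_mul,
        ← _root_.zpow_add, neg_add_eq_sub]

end Dihedral

section QuadraticExtension

variable {F : Type*} [Field F] [Fintype F] [CharP F 2] {k : Type*} [Field k] [Algebra F k]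

omit [Fintype F] [CharP F 2] in
theorem eq_zero_of_not_mem_range {θ : k} (hθ : ∀ s : F, algebraMap F k s ≠ θ) {u v : F}
    (h : algebraMap F k u + algebraMap F k v * θ = 0) : u = 0 ∧ v = 0 := by
  have hv : v = 0 := by
    by_contra hv
    have hv' : algebraMap F k v ≠ 0 := by simpa using hv
    apply hθ (-u / v)
    rw [map_div₀, map_neg]
    field_simp
    linear_combination -h
  subst hv
  simpa using h

omit [CharP F 2] in
theorem not_mem_range_of_pow_card {θ : k} (hθ : θ ^ Fintype.card F = θ + 1) (s : F) :
    algebraMap F k s ≠ θ := by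
  rintro rfl
  rw [algebraMap_pow_card] at hθ
  simp at hθ

/-- Elements fixed by the square of the Frobenius map in terms of a basis `1, θ`. -/
theorem exists_coords {θ : k} (hθ : θ ^ Fintype.card F = θ + 1) {x : k}
    (hx : (x ^ Fintype.card F) ^ Fintype.card F = x) :
    ∃ u v : F, algebraMap F k u + algebraMap F k v * θ = x := by
  have : CharP k 2 := charP_of_injective_algebraMap (algebraMap F k).injective 2
  have h2 : (2 : k) = 0 := CharTwo.two_eq_zero
  -- The coordinates are v = x + x^q and u = x + vθ; both are fixed by Frobenius.
  obtain ⟨v, hv⟩ := exists_algebraMap_eq_of_pow_card (F := F) (x := x + x ^ Fintype.card F) (by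
    rw [add_pow_card, hx, add_comm])
  obtain ⟨u, hu⟩ := exists_algebraMap_eq_of_pow_card (F := F) (x := x + algebraMap F k v * θ) (by
    rw [add_pow_card, mul_pow, algebraMap_pow_card, hθ, hv]
    linear_combination x ^ Fintype.card F * h2)
  exact ⟨u, v, by linear_combination hu + algebraMap F k v * θ * h2⟩

end QuadraticExtension

section ConjugateLines

variable {F : Type*} [Field F]

/-- Multiplication by `u + vθ` on the basis `1, θ`, where `θ² = θ + δ`. -/
def quadMatrix (δ u v : F) : Matrix (Fin 3) (Fin 3) F := !![u, δ * v, 0; v, u + v, 0; 0, 0, 1]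

/-- The conjugation 1 ↦ 1, θ ↦ θ + 1 on the same basis, with X₂ left fixed. -/
def quadConj (F : Type*) [Field F] : Matrix (Fin 3) (Fin 3) F := !![1, 1, 0; 0, 1, 0; 0, 0, 1]

theorem quadMatrix_mul (δ u v u' v' : F) : quadMatrix δ u v * quadMatrix δ u' v' =
    quadMatrix δ (u * u' + δ * v * v') (u * v' + v * u' + v * v') := by
  ext i j
  fin_cases i <;> fin_cases j <;>
    simp [quadMatrix, Matrix.mul_apply, Fin.sum_univ_three] <;> ring

theorem quadMatrix_one (δ : F) : quadMatrix δ 1 0 = 1 := by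
  ext i j
  fin_cases i <;> fin_cases j <;> simp [quadMatrix]

/-- The determinant of multiplication by u + vθ is its norm. -/
theorem det_quadMatrix [CharP F 2] (δ u v : F) :
    (quadMatrix δ u v).det = u ^ 2 + u * v + δ * v ^ 2 := by
  have h2 : (2 : F) = 0 := CharTwo.two_eq_zero
  rw [quadMatrix, det_entries]
  linear_combination -(δ * v ^ 2) * h2

theorem quadConj_mul_self [CharP F 2] : quadConj F * quadConj F = 1 := by
  have h2 : (2 : F) = 0 := CharTwo.two_eq_zero
  ext i j
  fin_cases i <;> fin_cases j <;>
    simp [quadConj, Matrix.mul_apply, Fin.sum_univ_three] <;> grind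

theorem quadConj_conj [CharP F 2] (δ u v : F) :
    quadConj F * quadMatrix δ u v * quadConj F = quadMatrix δ (u + v) v := by
  have h2 : (2 : F) = 0 := CharTwo.two_eq_zero
  ext i j
  fin_cases i <;> fin_cases j <;>
    simp [quadConj, quadMatrix, Matrix.mul_apply, Fin.sum_univ_three] <;> grind

/-- These matrices commute with the norm-one group and with conjugation, and provide the direct
factor Fˣ. -/
def planeScalar (c : F) : Matrix (Fin 3) (Fin 3) F := !![c, 0, 0; 0, c, 0; 0, 0, 1]

theorem quadMatrix_mul_planeScalar (δ u v c : F) :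
    quadMatrix δ u v * planeScalar c =
      !![c * u, c * (δ * v), 0; c * v, c * (u + v), 0; 0, 0, 1] := by
  ext i j
  fin_cases i <;> fin_cases j <;>
    simp [planeScalar, quadMatrix, Matrix.mul_apply, Fin.sum_univ_three] <;> ring

theorem quadConj_mul_planeScalar (δ u v c : F) :
    quadConj F * quadMatrix δ u v * planeScalar c =
      !![c * (u + v), c * (δ * v + (u + v)), 0; c * v, c * (u + v), 0; 0, 0, 1] := by
  ext i j
  fin_cases i <;> fin_cases j <;>
    simp [quadConj, planeScalar, quadMatrix, Matrix.mul_apply, Fin.sum_univ_three] <;> ring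

theorem smul_blockDiag {i : F} (hi : i ≠ 0) (s u v u' v' : F) :
    i • !![s / i * u, s / i * v, 0; s / i * u', s / i * v', 0; 0, 0, 1] =
      !![s * u, s * v, 0; s * u', s * v', 0; 0, 0, i] := by
  ext j l
  fin_cases j <;> fin_cases l <;> simp <;> field_simp

variable [CharP F 2]

/-- The upper block must be a similitude of the norm form, and such a map is multiplication by a +
dθ, possibly composed with conjugation. The alternative in the conclusion records the two cases. -/
theorem similitude_of_inSpan {δ a b c d e f g h i : F}
    (hA : (!![a, b, c; d, e, f; g, h, i]).det ≠ 0)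
    (h₁ : InSpan (⟨1, 1, 0, δ, 0, 0⟩ : TernaryForm F) ⟨0, 0, 0, 0, 0, 1⟩
      (subst ⟨1, 1, 0, δ, 0, 0⟩ !![a, b, c; d, e, f; g, h, i]))
    (h₂ : InSpan (⟨1, 1, 0, δ, 0, 0⟩ : TernaryForm F) ⟨0, 0, 0, 0, 0, 1⟩
      (subst ⟨0, 0, 0, 0, 0, 1⟩ !![a, b, c; d, e, f; g, h, i])) :
    g = 0 ∧ h = 0 ∧ i ≠ 0 ∧ c = 0 ∧ f = 0 ∧ a ^ 2 + a * d + δ * d ^ 2 ≠ 0 ∧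
      (b = δ * d ∧ e = a + d ∨ b = δ * d + a ∧ e = a) := by
  have h2 : (2 : F) = 0 := CharTwo.two_eq_zero
  rw [subst_entries, inSpan_iff] at h₁ h₂
  simp [eval, polar] at h₁ h₂
  rw [det_entries] at hA
  have hg : g = 0 := by grind
  have hh : h = 0 := by grind
  have hi : i ≠ 0 := by grind
  have hα : a * e + b * d ≠ 0 := by grind
  have hc : c = 0 := by grind
  have hf : f = 0 := by grind
  have e1 : a ^ 2 + a * d + δ * d ^ 2 = a * e + b * d := by grind
  have e2 : b ^ 2 + b * e + δ * e ^ 2 = δ * (a * e + b * d) := by grind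
  -- In terms of α = a + dθ, the second column is θα + κα: the relation `e1` makes the difference
  -- from θα proportional to α. Comparing norms then gives κ² + κ = 0.
  have hκ : ∃ κ, b + δ * d = κ * a ∧ e + a + d = κ * d := by
    by_cases ha : a = 0
    · have hd : d ≠ 0 := by grind
      refine ⟨(e + a + d) / d, ?_, ?_⟩ <;> field_simp
      grind
    · refine ⟨(b + δ * d) / a, ?_, ?_⟩ <;> field_simp
      grind
  obtain ⟨κ, k1, k2⟩ := hκ
  have hb : b = δ * d + κ * a := by grind
  have he : e = a + d + κ * d := by grind
  have k3 : κ = 0 ∨ κ = 1 := by grind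
  refine ⟨hg, hh, hi, hc, hf, by rwa [e1], ?_⟩
  rcases k3 with rfl | rfl <;> grind

variable [Fintype F]

/-- The dihedral group of order `2(q+1)` generated by the elements of norm one and the conjugation
in `GL(2,q)`. -/
theorem exists_dihedral_rep {δ : F} (hδ : Tr δ = 1) :
    ∃ φ : DihedralGroup (Fintype.card F + 1) →* GL (Fin 3) F,
      (∀ i, ∃ u v : F, (φ (.r i)).1 = quadMatrix δ u v ∧
        (φ (.sr i)).1 = quadConj F * quadMatrix δ u v ∧ (v = 0 → i = 0 ∧ u = 1)) ∧
      ∀ a d : F, a ^ 2 + a * d + δ * d ^ 2 ≠ 0 → ∃ s ≠ 0, ∃ (i : _) (u v : F),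
        (φ (.r i)).1 = quadMatrix δ u v ∧ (φ (.sr i)).1 = quadConj F * quadMatrix δ u v ∧
        a = s * u ∧ d = s * v := by
  have h2 : (2 : F) = 0 := CharTwo.two_eq_zero
  set q := Fintype.card F with hq
  let k := AlgebraicClosure F
  have : CharP k 2 := charP_of_injective_algebraMap (algebraMap F k).injective 2
  have h2k : (2 : k) = 0 := CharTwo.two_eq_zero
  obtain ⟨θ, hθ⟩ := exists_sq_add_self (algebraMap F k δ)
  have hθq : θ ^ q = θ + 1 := pow_card_of_tr_eq_one hδ hθ
  have hθF := not_mem_range_of_pow_card hθq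
  -- As q vanishes in k, the number q + 1 is prime to the characteristic, so a primitive (q + 1)-th
  -- root of unity ζ exists. Its powers are the elements of norm one in the quadratic extension.
  have hq0 : ((q + 1 : ℕ) : k) ≠ 0 := by
    have : (q : k) = 0 := by
      have := congrArg (algebraMap F k) (FiniteField.cast_card_eq_zero F)
      rwa [map_natCast, map_zero] at this
    simp [this]
  have : NeZero ((q + 1 : ℕ) : k) := ⟨hq0⟩
  obtain ⟨ζ, hζ⟩ := HasEnoughRootsOfUnity.prim (M := k) (n := q + 1)
  have hζq : ζ ^ q * ζ = 1 := by rw [← pow_succ, hζ.pow_eq_one]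
  have hζ0 : ζ ≠ 0 := right_ne_zero_of_mul_eq_one hζq
  -- Since ζ^q = ζ⁻¹, the square of Frobenius fixes ζ.
  obtain ⟨u₀, v₀, h₀⟩ := exists_coords hθq (x := ζ) (by
    apply mul_right_cancel₀ (pow_ne_zero q hζ0)
    rw [← mul_pow, hζq, one_pow, mul_comm, hζq])
  have hnorm (u v : F) : (algebraMap F k u + algebraMap F k v * θ) ^ q *
      (algebraMap F k u + algebraMap F k v * θ) = algebraMap F k (u ^ 2 + u * v + δ * v ^ 2) := by
    rw [add_pow_card, mul_pow, algebraMap_pow_card, algebraMap_pow_card, hθq]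
    simp only [map_add, map_mul, map_pow]
    linear_combination algebraMap F k v ^ 2 * hθ + algebraMap F k v * algebraMap F k u * θ * h2k
  have hcoord {u v u' v' : F} (h : algebraMap F k u + algebraMap F k v * θ =
      algebraMap F k u' + algebraMap F k v' * θ) : u = u' ∧ v = v' := by
    obtain ⟨e, e'⟩ := eq_zero_of_not_mem_range hθF (u := u - u') (v := v - v') (by
      rw [map_sub, map_sub]
      linear_combination h)
    exact ⟨sub_eq_zero.1 e, sub_eq_zero.1 e'⟩
  have hN : u₀ ^ 2 + u₀ * v₀ + δ * v₀ ^ 2 = 1 := by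
    apply (algebraMap F k).injective
    rw [← hnorm, h₀, hζq, map_one]
  let R : GL (Fin 3) F := GeneralLinearGroup.mkOfDetNeZero (quadMatrix δ u₀ v₀) (by
    rw [det_quadMatrix, hN]
    exact one_ne_zero)
  let S : GL (Fin 3) F := ⟨quadConj F, quadConj F, quadConj_mul_self, quadConj_mul_self⟩
  have hRpow (n : ℕ) : ∃ u v : F, algebraMap F k u + algebraMap F k v * θ = ζ ^ n ∧
      (R ^ n).1 = quadMatrix δ u v := by
    induction n with
    | zero => exact ⟨1, 0, by simp, by rw [pow_zero, Units.val_one, quadMatrix_one]⟩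
    | succ n ih =>
      obtain ⟨u, v, h, h'⟩ := ih
      refine ⟨u * u₀ + δ * v * v₀, u * v₀ + v * u₀ + v * v₀, ?_, ?_⟩
      rotate_left
      · rw [pow_succ, Units.val_mul, h']
        exact quadMatrix_mul ..
      · rw [pow_succ, ← h, ← h₀]
        simp only [map_add, map_mul]
        linear_combination -(algebraMap F k v * algebraMap F k v₀) * hθ +
          algebraMap F k v * algebraMap F k v₀ * θ * h2k
  have hR : R ^ (q + 1) = 1 := by
    obtain ⟨u, v, h, h'⟩ := hRpow (q + 1)
    obtain ⟨rfl, rfl⟩ := hcoord (u' := 1) (v' := 0) (h.trans (by simp [hζ.pow_eq_one]))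
    exact Units.ext (h'.trans (quadMatrix_one δ))
  -- Conjugation sends an element of norm one to its inverse.
  have hRS : S * R * S = R⁻¹ := by
    rw [eq_inv_iff_mul_eq_one]
    apply Units.ext
    change quadConj F * quadMatrix δ u₀ v₀ * quadConj F * quadMatrix δ u₀ v₀ = 1
    rw [quadConj_conj, quadMatrix_mul, ← quadMatrix_one δ]
    congr 1
    · linear_combination hN
    · linear_combination (u₀ * v₀ + v₀ ^ 2) * h2
  obtain ⟨φ, hφ⟩ := exists_dihedral_hom hR (Units.ext quadConj_mul_self) hRS
  have hform (n : ℕ) : (φ (.r n)).1 = (R ^ n).1 ∧ (φ (.sr n)).1 = quadConj F * (R ^ n).1 := by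
    have e := hφ n
    rw [Int.cast_natCast, zpow_natCast] at e
    rw [e.1, e.2, Units.val_mul]
    exact ⟨rfl, rfl⟩
  refine ⟨φ, fun i => ?_, fun a d hα => ?_⟩
  · obtain ⟨u, v, h, h'⟩ := hRpow i.val
    have hi : i = (i.val : ZMod (q + 1)) := by simp
    have e := hform i.val
    rw [← hi, h'] at e
    refine ⟨u, v, e.1, e.2, ?_⟩
    rintro rfl
    have hu : algebraMap F k (u ^ 2) = 1 := by
      have := hnorm u 0
      rw [h, ← pow_mul, mul_comm _ q, pow_mul, ← mul_pow, hζq, one_pow] at this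
      rw [this]
      simp
    have hu1 : u = 1 := sq_inj (by
      apply (algebraMap F k).injective
      rw [hu]
      simp)
    subst hu1
    refine ⟨?_, rfl⟩
    -- The corresponding power of ζ is 1, and ζ has exact order q + 1.
    rw [hi, ZMod.natCast_eq_zero_iff]
    apply hζ.dvd_of_pow_eq_one
    rw [← h]
    simp
  -- Polar decomposition: dividing a + dθ by the rational square root s of its norm leaves an
  -- element of norm one, which is a power of ζ.
  · obtain ⟨s, hs⟩ := exists_sq_eq (a ^ 2 + a * d + δ * d ^ 2)
    have hs0 : s ≠ 0 := by
      rintro rfl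
      exact hα (by simpa using hs.symm)
    have hs0' : algebraMap F k s ≠ 0 := by simpa using hs0
    obtain ⟨n, -, hn⟩ := hζ.eq_pow_of_pow_eq_one
      (ξ := (algebraMap F k a + algebraMap F k d * θ) / algebraMap F k s) (by
        have e : algebraMap F k s ^ (q + 1) = algebraMap F k (s ^ 2) := by
          rw [pow_succ, algebraMap_pow_card, ← map_mul, sq]
        rw [div_pow, e, hs, pow_succ, hnorm, div_self]
        exact (map_ne_zero _).2 hα)
    obtain ⟨u, v, h, h'⟩ := hRpow n
    obtain ⟨e, e'⟩ := hcoord (u := a) (v := d) (u' := s * u) (v' := s * v) (by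
      rw [eq_div_iff hs0'] at hn
      rw [← hn, ← h, map_mul, map_mul]
      ring)
    exact ⟨s, hs0, n, u, v, (hform n).1.trans h', by rw [(hform n).2, h'], e, e'⟩

theorem planeScalar_comm (δ u v c : F) :
    planeScalar c * quadMatrix δ u v = quadMatrix δ u v * planeScalar c := by
  ext i j
  fin_cases i <;> fin_cases j <;>
    simp [planeScalar, quadMatrix, Matrix.mul_apply, Fin.sum_univ_three] <;> ring

theorem planeScalar_comm_conj (c : F) :
    planeScalar c * quadConj F = quadConj F * planeScalar c := by
  ext i j
  fin_cases i <;> fin_cases j <;>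
    simp [planeScalar, quadConj, Matrix.mul_apply, Fin.sum_univ_three]

theorem planeScalar_mul (c d : F) : planeScalar (c * d) = planeScalar c * planeScalar d := by
  ext i j
  fin_cases i <;> fin_cases j <;> simp [planeScalar, Matrix.mul_apply, Fin.sum_univ_three]

theorem subst_quadMatrix (δ u v c : F) :
    subst (⟨1, 1, 0, δ, 0, 0⟩ : TernaryForm F) (quadMatrix δ u v * planeScalar c) =
      comb (c ^ 2 * (u ^ 2 + u * v + δ * v ^ 2)) 0 ⟨1, 1, 0, δ, 0, 0⟩ ⟨0, 0, 0, 0, 0, 1⟩ ∧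
    subst (⟨0, 0, 0, 0, 0, 1⟩ : TernaryForm F) (quadMatrix δ u v * planeScalar c) =
      comb 0 1 ⟨1, 1, 0, δ, 0, 0⟩ ⟨0, 0, 0, 0, 0, 1⟩ := by
  have h2 : (2 : F) = 0 := CharTwo.two_eq_zero
  rw [quadMatrix_mul_planeScalar, subst_entries, subst_entries]
  constructor <;> ext <;> simp [eval, polar, comb] <;> grind

theorem subst_quadConj (δ u v c : F) :
    subst (⟨1, 1, 0, δ, 0, 0⟩ : TernaryForm F) (quadConj F * quadMatrix δ u v * planeScalar c) =
      comb (c ^ 2 * (u ^ 2 + u * v + δ * v ^ 2)) 0 ⟨1, 1, 0, δ, 0, 0⟩ ⟨0, 0, 0, 0, 0, 1⟩ ∧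
    subst (⟨0, 0, 0, 0, 0, 1⟩ : TernaryForm F) (quadConj F * quadMatrix δ u v * planeScalar c) =
      comb 0 1 ⟨1, 1, 0, δ, 0, 0⟩ ⟨0, 0, 0, 0, 0, 1⟩ := by
  have h2 : (2 : F) = 0 := CharTwo.two_eq_zero
  rw [quadConj_mul_planeScalar, subst_entries, subst_entries]
  constructor <;> ext <;> simp [eval, polar, comb] <;> grind

theorem stabilizer_conjugateLines {δ : F} (hδ : Tr δ = 1) : Nonempty (MulAction.stabilizer (K F)
    (pencil (⟨1, 1, 0, δ, 0, 0⟩ : TernaryForm F) ⟨0, 0, 0, 0, 0, 1⟩) ≃*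
      DihedralGroup (Fintype.card F + 1) × Fˣ) := by
  obtain ⟨φ, hφ, hpolar⟩ := exists_dihedral_rep hδ
  let ψ : DihedralGroup (Fintype.card F + 1) × Fˣ →* Matrix (Fin 3) (Fin 3) F :=
    { toFun := fun g => (φ g.1).1 * planeScalar (g.2 : F)
      map_one' := by
        ext i j
        fin_cases i <;> fin_cases j <;> simp [planeScalar]
      map_mul' := fun g h => by
        have e : planeScalar (g.2 : F) * (φ h.1).1 = (φ h.1).1 * planeScalar (g.2 : F) := by
          rcases h.1 with n | n <;> obtain ⟨u, v, e, e', -⟩ := hφ n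
          · rw [e, planeScalar_comm]
          · rw [e', ← Matrix.mul_assoc, planeScalar_comm_conj, Matrix.mul_assoc, planeScalar_comm,
              Matrix.mul_assoc]
        have e' : planeScalar ((g * h).2 : F) = planeScalar (g.2 : F) * planeScalar (h.2 : F) :=
          planeScalar_mul ..
        rw [e', Prod.fst_mul, map_mul, Units.val_mul, Matrix.mul_assoc, ← Matrix.mul_assoc _ (planeScalar _),
          ← e]
        simp only [Matrix.mul_assoc] }
  have hψ : ∀ g, ψ g = (φ g.1).1 * planeScalar (g.2 : F) := fun g => rfl
  refine stabilizer_pencil ψ (fun g => ?_) (fun g c hg => ?_) (fun A hA h₁ h₂ => ?_)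
  · rw [hψ]
    obtain ⟨n | n, c⟩ := g <;> obtain ⟨u, v, e, e', -⟩ := hφ n
    · rw [e]
      exact ⟨⟨_, _, (subst_quadMatrix δ u v c).1⟩, ⟨_, _, (subst_quadMatrix δ u v c).2⟩⟩
    · rw [e']
      exact ⟨⟨_, _, (subst_quadConj δ u v c).1⟩, ⟨_, _, (subst_quadConj δ u v c).2⟩⟩
  · rw [hψ] at hg
    obtain ⟨n | n, d⟩ := g <;> obtain ⟨u, v, e, e', h⟩ := hφ n
    · rw [e, quadMatrix_mul_planeScalar] at hg
      have e00 := congrFun (congrFun hg 0) 0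
      have e10 := congrFun (congrFun hg 1) 0
      have e22 := congrFun (congrFun hg 2) 2
      simp at e00 e10 e22
      obtain ⟨rfl, rfl⟩ := h e10
      refine Prod.ext rfl (Units.ext ?_)
      simpa [← e22] using e00
    · exfalso
      rw [e', quadConj_mul_planeScalar] at hg
      have e00 := congrFun (congrFun hg 0) 0
      have e01 := congrFun (congrFun hg 0) 1
      have e10 := congrFun (congrFun hg 1) 0
      have e22 := congrFun (congrFun hg 2) 2
      simp at e00 e01 e10 e22
      grind
  · obtain ⟨a, b, c, d, e, f, g, h, i, rfl⟩ := exists_entries A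
    obtain ⟨rfl, rfl, hi, rfl, rfl, hα, ⟨rfl, rfl⟩ | ⟨rfl, he⟩⟩ := similitude_of_inSpan hA h₁ h₂
    · obtain ⟨s, hs, n, u, v, e, -, rfl, rfl⟩ := hpolar a d hα
      refine ⟨(.r n, Units.mk0 (s / i) (div_ne_zero hs hi)), i, ?_⟩
      rw [hψ]
      dsimp only
      rw [e, quadMatrix_mul_planeScalar, Units.val_mk0, smul_blockDiag hi]
      ring_nf
    -- Conjugation turns the first column (a, d) into (a + d, d), which is an element of the same
    -- norm.
    · obtain ⟨s, hs, n, u, v, -, e', e1, rfl⟩ := hpolar (a + d) d (by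
        convert hα using 1
        grind)
      refine ⟨(.sr n, Units.mk0 (s / i) (div_ne_zero hs hi)), i, ?_⟩
      rw [hψ]
      dsimp only
      rw [e', quadConj_mul_planeScalar, Units.val_mk0, smul_blockDiag hi, he]
      obtain rfl : a = s * u + s * v := by grind
      ring_nf

end ConjugateLines
end VeroneseSolids

namespace VeroneseSolids
open TernaryForm

/-! ### Independence of forms under field extension -/

section Coefficients

variable {R : Type*} [CommRing R]

/-- The coefficients of a form. -/
def TernaryForm.coeff (f : TernaryForm R) : Fin 6 → R :=
  ![f.a00, f.a01, f.a02, f.a11, f.a12, f.a22]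

theorem TernaryForm.ext_coeff {f g : TernaryForm R} (h : ∀ i, f.coeff i = g.coeff i) : f = g :=
  TernaryForm.ext (h 0) (h 1) (h 2) (h 3) (h 4) (h 5)

theorem TernaryForm.coeff_comb (a b : R) (f g : TernaryForm R) (i : Fin 6) :
    (comb a b f g).coeff i = a * f.coeff i + b * g.coeff i := by
  fin_cases i <;> rfl

theorem TernaryForm.coeff_zeroForm (i : Fin 6) : (zeroForm R).coeff i = 0 := by
  fin_cases i <;> rfl

theorem TernaryForm.coeff_map {S : Type*} [CommRing S] (φ : R →+* S) (f : TernaryForm R)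
    (i : Fin 6) : (f.map φ).coeff i = φ (f.coeff i) := by
  fin_cases i <;> rfl

theorem TernaryForm.eval_neg (f : TernaryForm R) (v : Fin 3 → R) : f.eval (-v) = f.eval v := by
  simp only [eval, Pi.neg_apply]
  ring

variable {F : Type*} [Field F]

/-- A nonvanishing 2 × 2 minor of coefficients is a witness of independence that survives field
extension and gives rational coordinates by Cramer's rule. -/
theorem TernaryForm.Indep.exists_minor {f₁ f₂ : TernaryForm F} (h : Indep f₁ f₂) :
    ∃ i j, f₁.coeff i * f₂.coeff j - f₁.coeff j * f₂.coeff i ≠ 0 := by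
  by_contra! hm
  have key : ∀ i, f₂.coeff i = 0 ∧ -f₁.coeff i = 0 := fun i =>
    h _ _ (TernaryForm.ext_coeff fun j => by
      rw [coeff_comb, coeff_zeroForm]
      linear_combination -hm i j)
  have := h 1 0 (TernaryForm.ext_coeff fun j => by
    rw [coeff_comb, coeff_zeroForm]
    linear_combination -(key j).2)
  exact one_ne_zero this.1

variable {k : Type*} [Field k] [Algebra F k]

theorem TernaryForm.Indep.map {f₁ f₂ : TernaryForm F} (h : Indep f₁ f₂) :
    Indep (f₁.map (algebraMap F k)) (f₂.map (algebraMap F k)) := by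
  obtain ⟨i, j, hm⟩ := h.exists_minor
  replace hm := (map_ne_zero (algebraMap F k)).2 hm
  rw [map_sub, map_mul, map_mul] at hm
  intro a b hab
  have hc : ∀ l, a * algebraMap F k (f₁.coeff l) + b * algebraMap F k (f₂.coeff l) = 0 := by
    intro l
    rw [← coeff_map, ← coeff_map, ← coeff_comb, hab, coeff_zeroForm]
  constructor
  · apply mul_right_cancel₀ hm
    linear_combination (algebraMap F k (f₂.coeff j)) * hc i - algebraMap F k (f₂.coeff i) * hc j
  · apply mul_right_cancel₀ hm
    linear_combination (algebraMap F k (f₁.coeff i)) * hc j - algebraMap F k (f₁.coeff j) * hc i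

/-- A form over `F` in the span of `f₁, f₂` over an extension field is in their span over `F`. -/
theorem TernaryForm.Indep.inSpan_of_map {f₁ f₂ f : TernaryForm F} (h : Indep f₁ f₂)
    (hf : InSpan (f₁.map (algebraMap F k)) (f₂.map (algebraMap F k)) (f.map (algebraMap F k))) :
    InSpan f₁ f₂ f := by
  obtain ⟨i, j, hm⟩ := h.exists_minor
  obtain ⟨a, b, hab⟩ := hf
  have hc : ∀ l, algebraMap F k (f.coeff l) =
      a * algebraMap F k (f₁.coeff l) + b * algebraMap F k (f₂.coeff l) := by
    intro l
    rw [← coeff_map, ← coeff_map, ← coeff_map, ← coeff_comb, hab]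
  have hm' := (map_ne_zero (algebraMap F k)).2 hm
  obtain ⟨a', ha⟩ : ∃ a', a = algebraMap F k a' := ⟨(f.coeff i * f₂.coeff j - f.coeff j * f₂.coeff i) /
      (f₁.coeff i * f₂.coeff j - f₁.coeff j * f₂.coeff i), by
    rw [map_div₀, eq_div_iff hm']
    simp only [map_sub, map_mul]
    linear_combination -(algebraMap F k (f₂.coeff j)) * hc i +
      algebraMap F k (f₂.coeff i) * hc j⟩
  obtain ⟨b', hb⟩ : ∃ b', b = algebraMap F k b' := ⟨(f₁.coeff i * f.coeff j - f₁.coeff j * f.coeff i) /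
      (f₁.coeff i * f₂.coeff j - f₁.coeff j * f₂.coeff i), by
    rw [map_div₀, eq_div_iff hm']
    simp only [map_sub, map_mul]
    linear_combination -(algebraMap F k (f₁.coeff i)) * hc j +
      algebraMap F k (f₁.coeff j) * hc i⟩
  refine ⟨a', b', TernaryForm.ext_coeff fun l => (algebraMap F k).injective ?_⟩
  rw [hc l, coeff_comb, map_add, map_mul, map_mul, ← ha, ← hb]

end Coefficients

/-! ### Pencils with four base points in general position -/

section Frames

variable {k : Type*} [Field k]

/-- Four points of the plane over `k`, no three collinear, in coordinates adding up to zero. -/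
structure IsFrame (w : Fin 4 → Fin 3 → k) : Prop where
  sum_eq_zero : ∑ i, w i = 0
  rel : ∀ c : Fin 4 → k, ∑ i, c i • w i = 0 → ∀ i j, c i = c j

/-- The matrix with columns `w 0, w 1, w 2`. -/
def frameMatrix (w : Fin 4 → Fin 3 → k) : Matrix (Fin 3) (Fin 3) k := (Matrix.of ![w 0, w 1, w 2])ᵀ

theorem frameMatrix_mulVec (w : Fin 4 → Fin 3 → k) (x : Fin 3 → k) :
    frameMatrix w *ᵥ x = x 0 • w 0 + x 1 • w 1 + x 2 • w 2 := by
  ext i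
  simp [mulVec_three, frameMatrix]
  ring

theorem isFrame_of_det {w : Fin 4 → Fin 3 → k} (h : w 3 = -(w 0 + w 1 + w 2))
    (hd : (Matrix.of ![w 0, w 1, w 2]).det ≠ 0) : IsFrame w := by
  refine ⟨by rw [Fin.sum_univ_four, h]; abel, fun c hc => ?_⟩
  have hG : (frameMatrix w).det ≠ 0 := by rwa [frameMatrix, det_transpose]
  have h0 := Matrix.eq_zero_of_mulVec_eq_zero hG (v := ![c 0 - c 3, c 1 - c 3, c 2 - c 3]) (by
    rw [frameMatrix_mulVec, ← hc, Fin.sum_univ_four, h]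
    simp only [cons_val]
    module)
  have h1 : c 0 = c 3 := sub_eq_zero.1 (congrFun h0 0)
  have h2 : c 1 = c 3 := sub_eq_zero.1 (congrFun h0 1)
  have h3 : c 2 = c 3 := sub_eq_zero.1 (congrFun h0 2)
  intro i j
  fin_cases i <;> fin_cases j <;> simp [h1, h2, h3]

namespace IsFrame

variable {w w' : Fin 4 → Fin 3 → k}

theorem comp (hw : IsFrame w) (π : Equiv.Perm (Fin 4)) : IsFrame (w ∘ π) := by
  refine ⟨?_, fun c hc => ?_⟩
  · rw [← hw.sum_eq_zero]
    exact Equiv.sum_comp π w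
  · have := hw.rel (c ∘ π.symm) (by
      rw [← hc, ← Equiv.sum_comp π]
      simp)
    intro i j
    simpa using this (π i) (π j)

theorem eq_of_smul_eq (hw : IsFrame w) {i j : Fin 4} {a b : k} (ha : a ≠ 0)
    (h : a • w i = b • w j) : i = j := by
  by_contra hij
  obtain ⟨l, hi, hj⟩ : ∃ l, l ≠ i ∧ l ≠ j := by
    clear h
    revert i j
    decide
  have := hw.rel (Pi.single i a - Pi.single j b) (by
    simp [sub_smul, Finset.sum_sub_distrib, Pi.single_apply, ite_smul, h]) i l
  simp [hij, hi, hj] at this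
  exact ha this

theorem ne_zero (hw : IsFrame w) (i : Fin 4) : w i ≠ 0 := by
  intro h
  obtain ⟨j, hj⟩ : ∃ j, i ≠ j := by
    clear h
    revert i
    decide
  exact hj (hw.eq_of_smul_eq (a := 1) (b := 0) one_ne_zero (by simp [h]))

theorem det_ne_zero (hw : IsFrame w) : (frameMatrix w).det ≠ 0 := by
  intro h
  obtain ⟨v, hv, hv0⟩ := Matrix.exists_mulVec_eq_zero_iff.2 h
  rw [frameMatrix_mulVec] at hv0
  have := hw.rel ![v 0, v 1, v 2, 0] (by simpa [Fin.sum_univ_four] using hv0)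
  apply hv
  ext i
  fin_cases i
  · exact this 0 3
  · exact this 1 3
  · exact this 2 3

theorem three (hw : IsFrame w) : w 3 = -(w 0 + w 1 + w 2) := by
  have := hw.sum_eq_zero
  rw [Fin.sum_univ_four] at this
  exact eq_neg_of_add_eq_zero_right this

/-- Three of the vectors already form a basis. -/
theorem matrix_ext (hw : IsFrame w) {A B : Matrix (Fin 3) (Fin 3) k}
    (h : ∀ i, A *ᵥ w i = B *ᵥ w i) : A = B := by
  have hG : A * frameMatrix w = B * frameMatrix w := by
    refine transpose_injective (funext fun j => ?_)
    rw [col_mul, col_mul]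
    fin_cases j
    · exact h 0
    · exact h 1
    · exact h 2
  have hu : IsUnit (frameMatrix w).det := hw.det_ne_zero.isUnit
  rw [← mul_nonsing_inv_cancel_right (frameMatrix w) A hu, hG,
    mul_nonsing_inv_cancel_right _ _ hu]

theorem exists_transport (hw : IsFrame w) (hw' : IsFrame w') :
    ∃ A : Matrix (Fin 3) (Fin 3) k, A.det ≠ 0 ∧ ∀ i, A *ᵥ w i = w' i := by
  have hu : IsUnit (frameMatrix w).det := hw.det_ne_zero.isUnit
  refine ⟨frameMatrix w' * (frameMatrix w)⁻¹, ?_, ?_⟩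
  · rw [det_mul]
    exact mul_ne_zero hw'.det_ne_zero ((isUnit_nonsing_inv_det _ hu).ne_zero)
  · have key : ∀ j : Fin 3, (frameMatrix w' * (frameMatrix w)⁻¹) *ᵥ ((frameMatrix w)ᵀ j) =
        (frameMatrix w')ᵀ j := by
      intro j
      rw [← col_mul, nonsing_inv_mul_cancel_right _ _ hu]
    have h0 := key 0
    have h1 := key 1
    have h2 := key 2
    simp only [frameMatrix, transpose_transpose] at h0 h1 h2
    intro i
    fin_cases i
    · exact h0
    · exact h1
    · exact h2
    · change _ *ᵥ w 3 = w' 3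
      rw [hw.three, hw'.three, mulVec_neg, mulVec_add, mulVec_add]
      exact congrArg Neg.neg (congrArg₂ _ (congrArg₂ _ h0 h1) h2)

/-- A form vanishing at the points of a frame, in the coordinates given by the frame. -/
theorem subst_frameMatrix (hw : IsFrame w) {f : TernaryForm k} (hf : ∀ i, f.eval (w i) = 0) :
    ∃ a b : k, f.subst (frameMatrix w) = ⟨0, a, b, 0, -(a + b), 0⟩ := by
  have h0 : (f.subst (frameMatrix w)).a00 = 0 := hf 0
  have h1 : (f.subst (frameMatrix w)).a11 = 0 := hf 1
  have h2 : (f.subst (frameMatrix w)).a22 = 0 := hf 2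
  have h3 : (f.subst (frameMatrix w)).eval ![1, 1, 1] = 0 := by
    rw [eval_subst, frameMatrix_mulVec, ← hf 3, hw.three, eval_neg]
    simp
  refine ⟨(f.subst (frameMatrix w)).a01, (f.subst (frameMatrix w)).a02, ?_⟩
  simp [eval, h0, h1, h2] at h3
  ext
  · exact h0
  · rfl
  · rfl
  · exact h1
  · linear_combination h3
  · exact h2

theorem subst_injective {A : Matrix (Fin 3) (Fin 3) k} (hA : A.det ≠ 0) {f g : TernaryForm k}
    (h : f.subst A = g.subst A) : f = g := by
  rw [← subst_one f, ← subst_one g, ← mul_nonsing_inv A hA.isUnit, subst_mul, subst_mul, h]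

theorem minor_ne_zero (hw : IsFrame w) {f₁ f₂ : TernaryForm k} (hI : Indep f₁ f₂) {a b c d : k}
    (h₁ : f₁.subst (frameMatrix w) = ⟨0, a, b, 0, -(a + b), 0⟩)
    (h₂ : f₂.subst (frameMatrix w) = ⟨0, c, d, 0, -(c + d), 0⟩) : a * d - b * c ≠ 0 := by
  intro h0
  have key : ∀ x y, x * a + y * c = 0 → x * b + y * d = 0 → x = 0 ∧ y = 0 := by
    intro x y hx hy
    apply hI
    apply subst_injective hw.det_ne_zero
    rw [subst_comb, h₁, h₂]
    have hz : (zeroForm k).subst (frameMatrix w) = zeroForm k := by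
      ext <;> simp [subst, eval, polar, zeroForm]
    rw [hz]
    ext
    · simp [comb, zeroForm]
    · simpa [comb, zeroForm] using hx
    · simpa [comb, zeroForm] using hy
    · simp [comb, zeroForm]
    · simp only [comb, zeroForm]
      linear_combination -hx - hy
    · simp [comb, zeroForm]
  have h1 := key d (-b) (by linear_combination h0) (by ring)
  have h2 := key c (-a) (by ring) (by linear_combination -h0)
  have ha : a = 0 := neg_eq_zero.1 h2.2
  have hb : b = 0 := neg_eq_zero.1 h1.2
  have := key 1 0 (by simp [ha]) (by simp [hb])
  exact one_ne_zero this.1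

/-- In frame coordinates the forms through the four points depend on two coefficients, so two
independent ones span them all. -/
theorem inSpan_of_eval_eq_zero (hw : IsFrame w) {f₁ f₂ f : TernaryForm k} (hI : Indep f₁ f₂)
    (h₁ : ∀ i, f₁.eval (w i) = 0) (h₂ : ∀ i, f₂.eval (w i) = 0) (hf : ∀ i, f.eval (w i) = 0) :
    InSpan f₁ f₂ f := by
  obtain ⟨a, b, hab⟩ := hw.subst_frameMatrix h₁
  obtain ⟨c, d, hcd⟩ := hw.subst_frameMatrix h₂
  obtain ⟨e, g, heg⟩ := hw.subst_frameMatrix hf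
  have hm := hw.minor_ne_zero hI hab hcd
  have hn := mul_inv_cancel₀ hm
  refine ⟨(e * d - g * c) * (a * d - b * c)⁻¹, (a * g - b * e) * (a * d - b * c)⁻¹, ?_⟩
  apply subst_injective hw.det_ne_zero
  rw [subst_comb, hab, hcd, heg]
  ext <;> simp only [comb]
  · ring
  · linear_combination -e * hn
  · linear_combination -g * hn
  · ring
  · linear_combination (e + g) * hn
  · ring

/-- In frame coordinates the pencil contains X₁(X₀ − X₂) and X₂(X₀ − X₁), whose common zeros are the
four points only. -/
theorem eq_smul_of_eval_eq_zero (hw : IsFrame w) {f₁ f₂ : TernaryForm k} (hI : Indep f₁ f₂)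
    (h₁ : ∀ i, f₁.eval (w i) = 0) (h₂ : ∀ i, f₂.eval (w i) = 0) {v : Fin 3 → k}
    (hv₁ : f₁.eval v = 0) (hv₂ : f₂.eval v = 0) : ∃ (c : k) (i : Fin 4), v = c • w i := by
  obtain ⟨a, b, hab⟩ := hw.subst_frameMatrix h₁
  obtain ⟨c, d, hcd⟩ := hw.subst_frameMatrix h₂
  have hm := hw.minor_ne_zero hI hab hcd
  obtain ⟨x, rfl⟩ : ∃ x, frameMatrix w *ᵥ x = v :=
    ⟨(frameMatrix w)⁻¹ *ᵥ v, by
      rw [mulVec_mulVec, mul_nonsing_inv _ hw.det_ne_zero.isUnit, one_mulVec]⟩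
  rw [← eval_subst, hab] at hv₁
  rw [← eval_subst, hcd] at hv₂
  simp only [eval] at hv₁ hv₂
  have e1 : x 1 * (x 0 - x 2) = 0 := by
    apply mul_left_cancel₀ hm
    linear_combination d * hv₁ - b * hv₂
  have e2 : x 2 * (x 0 - x 1) = 0 := by
    apply mul_left_cancel₀ hm
    linear_combination a * hv₂ - c * hv₁
  rw [frameMatrix_mulVec]
  rcases mul_eq_zero.1 e1 with h | h
  · rcases mul_eq_zero.1 e2 with h' | h'
    · exact ⟨x 0, 0, by simp [h, h']⟩
    · exact ⟨x 2, 2, by rw [sub_eq_zero.1 h', h]; simp⟩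
  · rcases mul_eq_zero.1 e2 with h' | h'
    · exact ⟨x 1, 1, by rw [sub_eq_zero.1 h, h']; simp⟩
    · refine ⟨-x 0, 3, ?_⟩
      rw [hw.three, ← sub_eq_zero.1 h, ← sub_eq_zero.1 h']
      module

end IsFrame

variable {F : Type*} [Field F] [Fintype F] [Algebra F k]

theorem map_frobenius_mulVec (A : Matrix (Fin 3) (Fin 3) k) (v : Fin 3 → k) :
    (fun j => (A *ᵥ v) j ^ Fintype.card F) =
      (A.map fun a => a ^ Fintype.card F) *ᵥ fun j => v j ^ Fintype.card F := by
  ext j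
  simp only [mulVec_three, add_pow_card, mul_pow, map_apply]

/-- `w` consists of the four base points of the pencil spanned by `f₁, f₂`, and is permuted by
the Frobenius map according to `σ`. -/
structure IsBaseFrame (σ : Equiv.Perm (Fin 4)) (f₁ f₂ : TernaryForm F)
    (w : Fin 4 → Fin 3 → k) : Prop where
  isFrame : IsFrame w
  frob : ∀ i, (fun j => w i j ^ Fintype.card F) = w (σ i)
  zero₁ : ∀ i, (f₁.map (algebraMap F k)).eval (w i) = 0
  zero₂ : ∀ i, (f₂.map (algebraMap F k)).eval (w i) = 0
  indep : Indep f₁ f₂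

/-- The matrix carrying one frame to the other is unique. Raising its entries to the power q gives
another such matrix, as both frames are permuted by the same σ; so its entries are fixed by
Frobenius. -/
theorem exists_rational_transport {w w' : Fin 4 → Fin 3 → k} (hw : IsFrame w) (hw' : IsFrame w')
    (σ : Equiv.Perm (Fin 4)) (h : ∀ i, (fun j => w i j ^ Fintype.card F) = w (σ i))
    (h' : ∀ i, (fun j => w' i j ^ Fintype.card F) = w' (σ i)) :
    ∃ A : Matrix (Fin 3) (Fin 3) F, A.det ≠ 0 ∧
      ∀ i, A.map (algebraMap F k) *ᵥ w i = w' i := by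
  obtain ⟨H, hH, hHw⟩ := hw.exists_transport hw'
  have hfix : (H.map fun a => a ^ Fintype.card F) = H := by
    apply (hw.comp σ).matrix_ext
    intro i
    rw [Function.comp_apply, ← h i, ← map_frobenius_mulVec, hHw, h' i, h i, hHw]
  have hmem : ∀ i j, ∃ a : F, algebraMap F k a = H i j := fun i j =>
    exists_algebraMap_eq_of_pow_card (congrFun (congrFun hfix i) j)
  choose A hA using hmem
  have hAH : (Matrix.of A).map (algebraMap F k) = H := by
    ext i j
    exact hA i j
  refine ⟨Matrix.of A, ?_, ?_⟩
  · intro h0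
    apply hH
    rw [← hAH]
    have := RingHom.map_det (algebraMap F k) (Matrix.of A)
    rw [h0, map_zero] at this
    exact this.symm
  · rw [hAH]
    exact hHw

namespace IsBaseFrame

variable {σ : Equiv.Perm (Fin 4)} {f₁ f₂ g₁ g₂ : TernaryForm F} {w w' : Fin 4 → Fin 3 → k}

theorem inSpan (h : IsBaseFrame σ f₁ f₂ w) {f : TernaryForm F}
    (hf : ∀ i, (f.map (algebraMap F k)).eval (w i) = 0) : InSpan f₁ f₂ f :=
  h.indep.inSpan_of_map (k := k)
    (h.isFrame.inSpan_of_eval_eq_zero h.indep.map h.zero₁ h.zero₂ hf)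

theorem eval_of_inSpan (h : IsBaseFrame σ f₁ f₂ w) {f : TernaryForm F} (hf : InSpan f₁ f₂ f)
    (i : Fin 4) : (f.map (algebraMap F k)).eval (w i) = 0 := by
  obtain ⟨a, b, rfl⟩ := hf
  rw [map_comb, eval_comb, h.zero₁, h.zero₂]
  simp

theorem indep_subst {A : Matrix (Fin 3) (Fin 3) F} (hA : A.det ≠ 0) (hI : Indep f₁ f₂) :
    Indep (f₁.subst A) (f₂.subst A) := by
  intro a b hab
  apply hI
  apply IsFrame.subst_injective hA
  rw [subst_comb, hab]
  ext <;> simp [subst, eval, polar, zeroForm]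

/-- Pencils whose base points are permuted in the same way by the Frobenius map define solids in
the same orbit. -/
theorem pencil_mem_orbit (h : IsBaseFrame σ f₁ f₂ w) (h' : IsBaseFrame σ g₁ g₂ w') :
    pencil g₁ g₂ ∈ MulAction.orbit (K F) (pencil f₁ f₂) := by
  obtain ⟨A, hA, hAw⟩ := exists_rational_transport h'.isFrame h.isFrame σ h'.frob h.frob
  have hsub : IsBaseFrame σ (f₁.subst A) (f₂.subst A) w' :=
    ⟨h'.isFrame, h'.frob, fun i => by rw [map_subst, eval_subst, hAw, h.zero₁],
      fun i => by rw [map_subst, eval_subst, hAw, h.zero₂], indep_subst hA h.indep⟩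
  exact VeroneseSolids.pencil_mem_orbit A hA (h'.inSpan hsub.zero₁) (h'.inSpan hsub.zero₂)
    (hsub.inSpan h'.zero₁) (hsub.inSpan h'.zero₂)

/-- A linear substitution preserving the pencil permutes the base points. -/
theorem exists_perm (h : IsBaseFrame σ f₁ f₂ w) {A : Matrix (Fin 3) (Fin 3) F} (hA : A.det ≠ 0)
    (h₁ : InSpan f₁ f₂ (f₁.subst A)) (h₂ : InSpan f₁ f₂ (f₂.subst A)) :
    ∃ (c : F) (π : Equiv.Perm (Fin 4)), π * σ = σ * π ∧
      ∀ i, A.map (algebraMap F k) *ᵥ w i = algebraMap F k c • w (π i) := by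
  set A' := A.map (algebraMap F k) with hA'
  have hdet : A'.det ≠ 0 := by
    have := RingHom.map_det (algebraMap F k) A
    intro h0
    apply (map_ne_zero (algebraMap F k)).2 hA
    rw [this]
    exact h0
  have hex : ∀ i, ∃ (c : k) (j : Fin 4), A' *ᵥ w i = c • w j := fun i =>
    h.isFrame.eq_smul_of_eval_eq_zero h.indep.map h.zero₁ h.zero₂
      (by rw [← eval_subst, ← map_subst]; exact h.eval_of_inSpan h₁ i)
      (by rw [← eval_subst, ← map_subst]; exact h.eval_of_inSpan h₂ i)
  choose c p hcp using hex
  have hc0 : ∀ i, c i ≠ 0 := by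
    intro i h0
    have := hcp i
    rw [h0, zero_smul] at this
    exact h.isFrame.ne_zero i (Matrix.eq_zero_of_mulVec_eq_zero hdet this)
  have hp : Function.Injective p := by
    intro i j hij
    refine h.isFrame.eq_of_smul_eq (hc0 j) (b := c i) ?_
    apply mulVec_injective_of_det_ne_zero hdet
    rw [mulVec_smul, mulVec_smul, hcp, hcp, hij, smul_comm]
  let π : Equiv.Perm (Fin 4) := Equiv.ofBijective p (Finite.injective_iff_bijective.1 hp)
  have hπ : ∀ i, A' *ᵥ w i = c i • w (π i) := hcp
  -- The normalisation that the four vectors sum to zero, with no other relation up to scalars,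
  -- forces the four multipliers to coincide.
  have hconst := (h.isFrame.comp π).rel c (by
    have : A' *ᵥ (∑ i, w i) = ∑ i, c i • w (π i) := by
      rw [Matrix.mulVec_sum]
      exact Finset.sum_congr rfl fun i _ => hπ i
    rw [← mulVec_zero A', ← h.isFrame.sum_eq_zero, this]
    rfl)
  have hfixA : (A'.map fun a => a ^ Fintype.card F) = A' := by
    ext i j
    exact algebraMap_pow_card (A i j)
  -- Applying Frobenius to the relation for wᵢ and comparing with the one for its image shows both
  -- that π commutes with σ and that the common multiplier is rational.
  have hfr : ∀ i, c 0 • w (π (σ i)) = c 0 ^ Fintype.card F • w (σ (π i)) := by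
    intro i
    have e1 := map_frobenius_mulVec (F := F) A' (w i)
    rw [hfixA, h.frob, hπ, hπ, hconst i 0, hconst (σ i) 0] at e1
    rw [← e1, ← h.frob (π i)]
    ext j
    simp [mul_pow]
  have hcomm : ∀ i, π (σ i) = σ (π i) := fun i => h.isFrame.eq_of_smul_eq (hc0 0) (hfr i)
  have hcq : c 0 ^ Fintype.card F = c 0 := by
    have e := hfr 0
    rw [hcomm] at e
    exact (smul_left_injective k (h.isFrame.ne_zero _) e).symm
  obtain ⟨a, ha⟩ := exists_algebraMap_eq_of_pow_card hcq
  refine ⟨a, π, Equiv.ext hcomm, fun i => ?_⟩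
  rw [hπ, hconst i 0, ha]

/-- The stabiliser of a pencil with four base points is the centraliser of the Frobenius
permutation of the base points. -/
theorem stabilizer {G : Type*} [Group G] (h : IsBaseFrame σ f₁ f₂ w)
    (ρ : G →* Equiv.Perm (Fin 4)) (hρ : Function.Injective ρ)
    (hσ : ∀ π : Equiv.Perm (Fin 4), π * σ = σ * π ↔ ∃ g, ρ g = π) :
    Nonempty (MulAction.stabilizer (K F) (pencil f₁ f₂) ≃* G) := by
  -- A permutation commuting with σ yields a frame with the same Frobenius action, so it is realised
  -- by a rational matrix.
  have hex : ∀ g : G, ∃ A : Matrix (Fin 3) (Fin 3) F, A.det ≠ 0 ∧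
      ∀ i, A.map (algebraMap F k) *ᵥ w i = w (ρ g i) := by
    intro g
    refine exists_rational_transport h.isFrame (h.isFrame.comp (ρ g)) σ h.frob fun i => ?_
    change (fun j => w (ρ g i) j ^ Fintype.card F) = w (ρ g (σ i))
    rw [h.frob, ← Equiv.Perm.mul_apply, ← Equiv.Perm.mul_apply, (hσ _).2 ⟨g, rfl⟩]
  choose T hT hTw using hex
  have hmapinj : ∀ A B : Matrix (Fin 3) (Fin 3) F,
      (∀ i, A.map (algebraMap F k) *ᵥ w i = B.map (algebraMap F k) *ᵥ w i) → A = B :=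
    fun A B hAB => Matrix.map_injective (algebraMap F k).injective (h.isFrame.matrix_ext hAB)
  let ψ : G →* Matrix (Fin 3) (Fin 3) F :=
    { toFun := T
      map_one' := by
        apply hmapinj
        intro i
        rw [hTw, Matrix.map_one _ (map_zero _) (map_one _)]
        simp
      map_mul' := by
        intro a b
        apply hmapinj
        intro i
        rw [hTw, Matrix.map_mul, ← mulVec_mulVec, hTw, hTw]
        simp }
  refine stabilizer_pencil ψ (fun g => ⟨h.inSpan fun i => ?_, h.inSpan fun i => ?_⟩)
    (fun g c hg => ?_) (fun A hA h₁ h₂ => ?_)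
  · rw [map_subst, eval_subst]
    change (f₁.map _).eval ((T g).map _ *ᵥ w i) = 0
    rw [hTw, h.zero₁]
  · rw [map_subst, eval_subst]
    change (f₂.map _).eval ((T g).map _ *ᵥ w i) = 0
    rw [hTw, h.zero₂]
  · apply hρ
    ext i : 1
    have e := hTw g i
    change T g = _ at hg
    have e2 : (c • (1 : Matrix (Fin 3) (Fin 3) F)).map (algebraMap F k) =
        algebraMap F k c • (1 : Matrix (Fin 3) (Fin 3) k) := by
      ext a b
      by_cases hab : a = b <;> simp [hab, Matrix.one_apply]
    rw [hg, e2, smul_mulVec, one_mulVec] at e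
    rw [map_one, Equiv.Perm.one_apply]
    exact h.isFrame.eq_of_smul_eq (a := 1) (b := algebraMap F k c) one_ne_zero
      (by rw [one_smul, ← e])
  · obtain ⟨c, π, hπ, hAw⟩ := h.exists_perm hA h₁ h₂
    obtain ⟨g, rfl⟩ := (hσ π).1 hπ
    refine ⟨g, c, hmapinj _ _ fun i => ?_⟩
    have e2 : (c • T g).map (algebraMap F k) = algebraMap F k c • (T g).map (algebraMap F k) := by
      ext a b
      simp
    change _ = (c • T g).map (algebraMap F k) *ᵥ w i
    rw [e2, smul_mulVec, hTw, hAw]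

end IsBaseFrame

end Frames
end VeroneseSolids

namespace VeroneseSolids
open TernaryForm

/-! ### Base points of the pencils in rows 9, 12, 13, 14 and 15 -/

section BasePoints

variable {F : Type*} [Field F] [Fintype F] [CharP F 2]

local notation "k" => AlgebraicClosure F

theorem exists_baseFrame_rep9 :
    ∃ w : Fin 4 → Fin 3 → k, IsBaseFrame 1 (rep9Form₁ F) (rep9Form₂ F) w := by
  have : CharP k 2 := charP_of_injective_algebraMap (algebraMap F k).injective 2
  have h2 : (2 : k) = 0 := CharTwo.two_eq_zero
  have hq : Fintype.card F ≠ 0 := Fintype.card_ne_zero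
  refine ⟨![![0, 1, 0], ![0, 1, 1], ![1, 1, 0], ![1, 1, 1]], isFrame_of_det ?_ ?_, ?_, ?_, ?_,
    indep_rep9⟩
  · ext i
    fin_cases i <;> simp <;> grind
  · simp [det_fin_three]
  · intro i
    ext j
    fin_cases i <;> fin_cases j <;> simp [hq]
  · intro i
    fin_cases i <;> simp [rep9Form₁, TernaryForm.map, eval] <;> grind
  · intro i
    fin_cases i <;> simp [rep9Form₂, TernaryForm.map, eval] <;> grind

/-- Two base points are rational. The others are (ω, ω + γ, 1) and its conjugate, with ω² + γω = 1;
scaling the rational ones by γ makes the four vectors sum to zero. -/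
theorem exists_baseFrame_rep12 {γ : F} (hγ : Tr γ⁻¹ = 1) : ∃ w : Fin 4 → Fin 3 → k,
    IsBaseFrame (Equiv.swap 2 3) (rep12Form₁ γ) (rep12Form₂ γ) w := by
  have : CharP k 2 := charP_of_injective_algebraMap (algebraMap F k).injective 2
  have h2 : (2 : k) = 0 := CharTwo.two_eq_zero
  have hq : Fintype.card F ≠ 0 := Fintype.card_ne_zero
  obtain ⟨θ, hθ⟩ := exists_sq_add_self (algebraMap F k (γ⁻¹ ^ 2))
  have hθq := pow_card_of_tr_eq_one (tr_inv_sq hγ) hθ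
  have hγ0 : algebraMap F k γ ≠ 0 := (map_ne_zero _).2 (ne_zero_of_tr_inv hγ)
  have hgq : algebraMap F k γ ^ Fintype.card F = algebraMap F k γ := algebraMap_pow_card γ
  rw [map_pow, map_inv₀] at hθ
  set g := algebraMap F k γ with hg
  -- With θ² + θ = γ⁻², the element γθ solves the required equation, and Frobenius adds γ to it.
  obtain ⟨ω, hω⟩ : ∃ ω, ω = g * θ := ⟨_, rfl⟩
  have hωq : ω ^ Fintype.card F = ω + g := by rw [hω, mul_pow, hgq, hθq, mul_add, mul_one]
  have hωe : ω ^ 2 + g * ω = 1 := by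
    have e := mul_inv_cancel₀ hγ0
    rw [hω]
    linear_combination g ^ 2 * hθ + (g * g⁻¹ + 1) * e
  refine ⟨![![g, 0, 0], ![0, g, 0], ![ω, ω + g, 1], ![ω + g, ω, 1]], isFrame_of_det ?_ ?_, ?_, ?_,
    ?_, indep_rep12 γ⟩
  · ext i
    fin_cases i <;> simp <;> grind
  · simp [det_fin_three, hγ0]
  · intro i
    ext j
    fin_cases i <;> fin_cases j <;>
      simp [hq, hgq, hωq, add_pow_card, Equiv.swap_apply_def, add_assoc, CharTwo.add_self_eq_zero]
  · intro i
    fin_cases i <;> simp [rep12Form₁, TernaryForm.map, eval] <;> grind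
  · intro i
    fin_cases i <;> simp [rep12Form₂, TernaryForm.map, eval, ← hg] <;> grind

/-- For X₀ = 1 both X₁ and X₂ are roots of X² + X = γ. Frobenius adds 1 to each, which gives a
double transposition. -/
theorem exists_baseFrame_rep13 {γ : F} (hγ : Tr γ = 1) : ∃ w : Fin 4 → Fin 3 → k,
    IsBaseFrame (Equiv.swap 0 1 * Equiv.swap 2 3) (rep13Form₁ γ) (rep13Form₂ γ) w := by
  have : CharP k 2 := charP_of_injective_algebraMap (algebraMap F k).injective 2
  have h2 : (2 : k) = 0 := CharTwo.two_eq_zero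
  have hq : Fintype.card F ≠ 0 := Fintype.card_ne_zero
  obtain ⟨θ, hθ⟩ := exists_sq_add_self (algebraMap F k γ)
  have hθq := pow_card_of_tr_eq_one hγ hθ
  refine ⟨![![1, θ, θ], ![1, θ + 1, θ + 1], ![1, θ, θ + 1], ![1, θ + 1, θ]],
    isFrame_of_det ?_ ?_, ?_, ?_, ?_, indep_rep13 γ⟩
  · ext i
    fin_cases i <;> simp <;> grind
  · simp [det_fin_three]
    grind
  · intro i
    ext j
    fin_cases i <;> fin_cases j <;>
      simp [hθq, add_pow_card, Equiv.swap_apply_def, add_assoc, CharTwo.add_self_eq_zero]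
  · intro i
    fin_cases i <;> simp [rep13Form₁, TernaryForm.map, eval] <;> grind
  · intro i
    fin_cases i <;> simp [rep13Form₂, TernaryForm.map, eval] <;> grind

theorem exists_baseFrame_rep14 {γ : F} (hγ : Tr γ = 1) : ∃ w : Fin 4 → Fin 3 → k,
    IsBaseFrame (finRotate 4) (rep14Form₁ γ) (rep14Form₂ γ) w := by
  have : CharP k 2 := charP_of_injective_algebraMap (algebraMap F k).injective 2
  have h2 : (2 : k) = 0 := CharTwo.two_eq_zero
  have hq : Fintype.card F ≠ 0 := Fintype.card_ne_zero
  obtain ⟨θ, hθ⟩ := exists_sq_add_self (algebraMap F k γ)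
  have hθq := pow_card_of_tr_eq_one hγ hθ
  have hγ0 : algebraMap F k γ ≠ 0 := (map_ne_zero _).2 (ne_zero_of_tr hγ)
  have hgq : algebraMap F k γ ^ Fintype.card F = algebraMap F k γ := algebraMap_pow_card γ
  -- At a base point (1, θ, η) the first form reads γη² + η = θ², so ξ = γη solves ξ² + ξ = γθ².
  obtain ⟨ξ, hξ⟩ := exists_sq_add_self (algebraMap F k γ * θ ^ 2)
  obtain ⟨ν, hν⟩ : ∃ ν, ν = ξ ^ Fintype.card F + ξ := ⟨_, rfl⟩
  have hξq : ξ ^ Fintype.card F = ξ + ν := by rw [hν]; grind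
  -- Applying Frobenius to the equation for ξ replaces θ by θ + 1 and changes the right-hand side by
  -- γ. As `Tr γ` is 1, Frobenius adds 1 to ν, so its square adds 1 to ξ and it acts as a 4-cycle.
  have hνe : ν ^ 2 + ν = algebraMap F k γ := by
    have e : (ξ ^ 2 + ξ) ^ Fintype.card F = (algebraMap F k γ * θ ^ 2) ^ Fintype.card F := by
      rw [hξ]
    rw [add_pow_card, mul_pow, hgq, ← pow_mul, ← pow_mul, mul_comm 2, pow_mul, pow_mul, hξq,
      hθq] at e
    grind
  have hνq := pow_card_of_tr_eq_one hγ hνe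
  set g := algebraMap F k γ with hg
  obtain ⟨η, rfl⟩ : ∃ η, ξ = g * η := ⟨ξ / g, (mul_div_cancel₀ _ hγ0).symm⟩
  obtain ⟨μ, rfl⟩ : ∃ μ, ν = g * μ := ⟨ν / g, (mul_div_cancel₀ _ hγ0).symm⟩
  obtain ⟨i, hi⟩ : ∃ i, g * i = 1 := ⟨g⁻¹, mul_inv_cancel₀ hγ0⟩
  have hηq : η ^ Fintype.card F = η + μ := by
    apply mul_left_cancel₀ hγ0
    rw [mul_add, ← hξq, mul_pow, hgq]
  have hμq : μ ^ Fintype.card F = μ + i := by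
    apply mul_left_cancel₀ hγ0
    rw [mul_add, hi, ← hνq, mul_pow, hgq]
  have hiq : i ^ Fintype.card F = i := by
    apply mul_left_cancel₀ hγ0
    rw [hi]
    nth_rw 1 [← hgq]
    rw [← mul_pow, hi, one_pow]
  have hi0 : i ≠ 0 := right_ne_zero_of_mul_eq_one hi
  refine ⟨![![1, θ, η], ![1, θ + 1, η + μ], ![1, θ, η + i], ![1, θ + 1, η + μ + i]],
    isFrame_of_det ?_ ?_, ?_, ?_, ?_, indep_rep14 γ⟩
  · ext i
    fin_cases i <;> simp <;> grind
  · simp [det_fin_three]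
    grind
  · have e1 : η + μ + (μ + i) = η + i := by grind
    have e2 : η + μ + (μ + i) + i = η := by grind
    have e3 : θ + 1 + 1 = θ := by grind
    have e4 : η + i + i = η := by grind
    intro i
    ext j
    fin_cases i <;> fin_cases j <;> simp [hθq, hηq, hμq, hiq, e1, e2, e3, e4, add_pow_card]
  · intro i
    fin_cases i <;> simp [rep14Form₁, TernaryForm.map, eval, ← hg] <;> grind
  · intro i
    fin_cases i <;> simp [rep14Form₂, TernaryForm.map, eval, ← hg] <;> grind

omit [Fintype F] in
-- A root x is nonzero, and u = x⁻¹ would satisfy the excluded equation.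
theorem cubic_ne_zero {b c : F} (hbc : ∀ u : F, u ^ 2 * (u + c) ≠ b) (x : F) :
    b * x ^ 3 + c * x + 1 ≠ 0 := by
  have h2 : (2 : F) = 0 := CharTwo.two_eq_zero
  intro h
  have hx : x ≠ 0 := by
    rintro rfl
    simp at h
  apply hbc x⁻¹
  have e := mul_inv_cancel₀ hx
  apply mul_right_cancel₀ (pow_ne_zero 3 hx)
  have e1 : x⁻¹ ^ 2 * (x⁻¹ + c) * x ^ 3 = 1 + c * x := by
    field_simp
  rw [e1]
  linear_combination -h + (1 + c * x) * h2

/-- The base points are (1, 0, 0) and (1, x², x) for the three roots x of bλ³ + cλ + 1. That cubic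
has no quadratic term, so its roots add up to zero, which makes the four vectors sum to zero;
Frobenius cycles the roots. -/
theorem exists_baseFrame_rep15 {b c : F} (hbc : ∀ u : F, u ^ 2 * (u + c) ≠ b) :
    ∃ w : Fin 4 → Fin 3 → k,
    IsBaseFrame (Equiv.swap 0 1 * Equiv.swap 1 2) (rep15Form₁ b c) (rep15Form₂ b c) w := by
  have : CharP k 2 := charP_of_injective_algebraMap (algebraMap F k).injective 2
  have h2 : (2 : k) = 0 := CharTwo.two_eq_zero
  have hq : Fintype.card F ≠ 0 := Fintype.card_ne_zero
  have hb : b ≠ 0 := by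
    rintro rfl
    exact hbc 0 (by simp)
  have hb' : algebraMap F k b ≠ 0 := (map_ne_zero _).2 hb
  have hbq : algebraMap F k b ^ Fintype.card F = algebraMap F k b := algebraMap_pow_card b
  have hcq : algebraMap F k c ^ Fintype.card F = algebraMap F k c := algebraMap_pow_card c
  have hno : ∀ x : k, x ^ Fintype.card F = x →
      algebraMap F k b * x ^ 3 + algebraMap F k c * x + 1 ≠ 0 := by
    intro x hx h
    obtain ⟨a, rfl⟩ := exists_algebraMap_eq_of_pow_card hx
    apply cubic_ne_zero hbc a
    apply (algebraMap F k).injective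
    simpa using h
  obtain ⟨x, hx⟩ : ∃ x : k, algebraMap F k b * x ^ 3 + algebraMap F k c * x + 1 = 0 := by
    open Polynomial in
    obtain ⟨x, hx⟩ := IsAlgClosed.exists_root
      (C (algebraMap F k b) * X ^ 3 + C (algebraMap F k c) * X + 1 : k[X]) (by
        have : (C (algebraMap F k b) * X ^ 3 + C (algebraMap F k c) * X + 1 : k[X]).degree = 3 := by
          compute_degree!
        rw [this]
        norm_num)
    exact ⟨x, by simpa [IsRoot] using hx⟩
  have hroot : ∀ y : k, algebraMap F k b * y ^ 3 + algebraMap F k c * y + 1 = 0 →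
      algebraMap F k b * (y ^ Fintype.card F) ^ 3 + algebraMap F k c * y ^ Fintype.card F + 1
        = 0 := by
    intro y hy
    have e := congrArg (· ^ Fintype.card F) hy
    simp only [add_pow_card, mul_pow, hbq, hcq, one_pow, zero_pow hq] at e
    rw [← e]
    ring
  obtain ⟨y, hy⟩ : ∃ y, y = x ^ Fintype.card F := ⟨_, rfl⟩
  have hyr := hroot x hx
  rw [← hy] at hyr
  set b' := algebraMap F k b with hb₀
  set c' := algebraMap F k c with hc₀
  have hxy : y ≠ x := fun h => hno x (hy.symm.trans h) hx
  -- The difference of the two root equations, divided by y − x.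
  have hquad : b' * (x ^ 2 + x * y + y ^ 2) + c' = 0 := by
    apply mul_left_cancel₀ (sub_ne_zero.2 hxy)
    linear_combination hyr - hx
  have hs : b' * (x + y) ^ 3 + c' * (x + y) + 1 = 0 := by
    linear_combination hyr + x * hquad + (b' * x ^ 2 * y + b' * x * y ^ 2) * h2
  -- The conjugate of y is again a root. It is not y, which would then be rational, nor x, since
  -- then the third root x + y would be rational; hence it is x + y.
  have hyq : y ^ Fintype.card F = x + y := by
    have hz := hroot y hyr
    set z := y ^ Fintype.card F
    have hzy : z ≠ y := by
      intro h
      exact hno y h hyr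
    have hzx : z ≠ x := by
      intro h
      refine hno (x + y) ?_ hs
      rw [add_pow_card, ← hy]
      change y + z = x + y
      rw [h, add_comm]
    have h1 : b' * (x ^ 2 + x * z + z ^ 2) + c' = 0 := by
      apply mul_left_cancel₀ (sub_ne_zero.2 hzx)
      linear_combination hz - hx
    have h3 : z + x + y = 0 := by
      apply mul_left_cancel₀ (mul_ne_zero hb' (sub_ne_zero.2 hzy))
      linear_combination h1 - hquad
    linear_combination h3 - (x + y) * h2
  have hx0 : x ≠ 0 := by
    rintro rfl
    simp at hx
  have hy0 : y ≠ 0 := by rw [hy]; exact pow_ne_zero _ hx0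
  have hxy0 : x + y ≠ 0 := by
    intro h
    apply hxy
    linear_combination h - x * h2
  refine ⟨![![1, x ^ 2, x], ![1, y ^ 2, y], ![1, (x + y) ^ 2, x + y], ![1, 0, 0]],
    isFrame_of_det ?_ ?_, ?_, ?_, ?_, indep_rep15 b c⟩
  · ext i
    fin_cases i <;> simp <;> grind
  · simp [det_fin_three]
    intro h
    apply mul_ne_zero (mul_ne_zero hx0 hy0) hxy0
    grind
  · have e1 : ∀ z : k, (z ^ 2) ^ Fintype.card F = (z ^ Fintype.card F) ^ 2 := fun z => by
      rw [← pow_mul, ← pow_mul, mul_comm]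
    have e2 : y + (x + y) = x := by grind
    intro i
    ext j
    fin_cases i <;> fin_cases j <;>
      simp [e1, ← hy, hyq, hq, e2, add_pow_card, Equiv.swap_apply_def]
  · intro i
    fin_cases i <;> simp [rep15Form₁, TernaryForm.map, eval, ← hb₀, ← hc₀] <;> grind
  · intro i
    fin_cases i <;> simp [rep15Form₂, TernaryForm.map, eval] <;> grind

end BasePoints

end VeroneseSolids

namespace VeroneseSolids
open TernaryForm

/-! ### Centralisers in the symmetric group on four letters -/

section Centralizers

/-- The homomorphism from the group of order two given by an involution. -/
def involutionHom {G : Type*} [Group G] (s : G) (hs : s * s = 1) : Cyc 2 →* G where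
  toFun e := if e = 1 then 1 else s
  map_one' := by simp
  map_mul' a b := by
    rcases cyc_two_cases a with rfl | rfl <;> rcases cyc_two_cases b with rfl | rfl
    · simp
    · simp
    · simp
    · rw [if_pos (by decide), if_neg (by decide), hs]

/-- The centraliser of a transposition. -/
def transpositionCentralizer : Cyc 2 × Cyc 2 →* Equiv.Perm (Fin 4) where
  toFun g := involutionHom (Equiv.swap 0 1) (by decide) g.1 *
    involutionHom (Equiv.swap 2 3) (by decide) g.2
  map_one' := by decide
  map_mul' := by decide

theorem transpositionCentralizer_injective : Function.Injective transpositionCentralizer := by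
  decide

theorem mem_transpositionCentralizer (π : Equiv.Perm (Fin 4)) :
    π * Equiv.swap 2 3 = Equiv.swap 2 3 * π ↔ ∃ g, transpositionCentralizer g = π := by
  revert π
  decide

/-- The centraliser of a double transposition. -/
def doubleTranspositionCentralizer :
    (Cyc 2 × Cyc 2) ⋊[swapAction (Cyc 2)] Cyc 2 →* Equiv.Perm (Fin 4) :=
  SemidirectProduct.lift transpositionCentralizer
    (involutionHom (Equiv.swap 0 2 * Equiv.swap 1 3) (by decide)) (by
      intro g
      rcases cyc_two_cases g with rfl | rfl
      · simp
        rfl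
      · ext1 x
        simp only [MonoidHom.comp_apply, MulEquiv.coe_toMonoidHom, swapAction_ofAdd,
          MulAut.conj_apply]
        revert x
        decide)

theorem doubleTranspositionCentralizer_apply (a : Cyc 2 × Cyc 2) (b : Cyc 2) :
    doubleTranspositionCentralizer ⟨a, b⟩ = transpositionCentralizer a *
      involutionHom (Equiv.swap 0 2 * Equiv.swap 1 3) (by decide) b := rfl

theorem doubleTranspositionCentralizer_injective :
    Function.Injective doubleTranspositionCentralizer := by
  rintro ⟨a, b⟩ ⟨c, d⟩ h
  rw [doubleTranspositionCentralizer_apply, doubleTranspositionCentralizer_apply] at h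
  have : a = c ∧ b = d := by
    revert a b c d
    decide
  rw [this.1, this.2]

theorem mem_doubleTranspositionCentralizer (π : Equiv.Perm (Fin 4)) :
    π * (Equiv.swap 0 1 * Equiv.swap 2 3) = (Equiv.swap 0 1 * Equiv.swap 2 3) * π ↔
      ∃ g, doubleTranspositionCentralizer g = π := by
  have h : (∃ g, doubleTranspositionCentralizer g = π) ↔ ∃ a b, transpositionCentralizer a *
      involutionHom (Equiv.swap 0 2 * Equiv.swap 1 3) (by decide) b = π :=
    ⟨fun ⟨g, hg⟩ => ⟨g.left, g.right, hg⟩, fun ⟨a, b, hg⟩ => ⟨⟨a, b⟩, hg⟩⟩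
  rw [h]
  clear h
  revert π
  decide

/-- The centraliser of a cycle of length four. -/
def fourCycleCentralizer : Cyc 4 →* Equiv.Perm (Fin 4) where
  toFun g := finRotate 4 ^ g.toAdd.val
  map_one' := by decide
  map_mul' := by decide

theorem fourCycleCentralizer_injective : Function.Injective fourCycleCentralizer := by
  decide

theorem mem_fourCycleCentralizer (π : Equiv.Perm (Fin 4)) :
    π * finRotate 4 = finRotate 4 * π ↔ ∃ g, fourCycleCentralizer g = π := by
  revert π
  decide

/-- The centraliser of a cycle of length three. -/
def threeCycleCentralizer : Cyc 3 →* Equiv.Perm (Fin 4) where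
  toFun g := (Equiv.swap 0 1 * Equiv.swap 1 2) ^ g.toAdd.val
  map_one' := by decide
  map_mul' := by decide

theorem threeCycleCentralizer_injective : Function.Injective threeCycleCentralizer := by
  decide

theorem mem_threeCycleCentralizer (π : Equiv.Perm (Fin 4)) :
    π * (Equiv.swap 0 1 * Equiv.swap 1 2) = (Equiv.swap 0 1 * Equiv.swap 1 2) * π ↔
      ∃ g, threeCycleCentralizer g = π := by
  revert π
  decide

end Centralizers

section BasePointStabilizers

variable {F : Type*} [Field F] [Fintype F] [CharP F 2]

theorem stabilizer_rep9 : Nonempty (MulAction.stabilizer (K F)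
    (pencil (rep9Form₁ F) (rep9Form₂ F)) ≃* Equiv.Perm (Fin 4)) := by
  obtain ⟨w, hw⟩ := exists_baseFrame_rep9 (F := F)
  exact hw.stabilizer (MonoidHom.id _) Function.injective_id (by simp)

theorem stabilizer_rep12 {γ : F} (hγ : Tr γ⁻¹ = 1) : Nonempty (MulAction.stabilizer (K F)
    (pencil (rep12Form₁ γ) (rep12Form₂ γ)) ≃* Cyc 2 × Cyc 2) := by
  obtain ⟨w, hw⟩ := exists_baseFrame_rep12 hγ
  exact hw.stabilizer _ transpositionCentralizer_injective mem_transpositionCentralizer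

theorem stabilizer_rep13 {γ : F} (hγ : Tr γ = 1) : Nonempty (MulAction.stabilizer (K F)
    (pencil (rep13Form₁ γ) (rep13Form₂ γ)) ≃*
      (Cyc 2 × Cyc 2) ⋊[swapAction (Cyc 2)] Cyc 2) := by
  obtain ⟨w, hw⟩ := exists_baseFrame_rep13 hγ
  exact hw.stabilizer _ doubleTranspositionCentralizer_injective
    mem_doubleTranspositionCentralizer

theorem stabilizer_rep14 {γ : F} (hγ : Tr γ = 1) : Nonempty (MulAction.stabilizer (K F)
    (pencil (rep14Form₁ γ) (rep14Form₂ γ)) ≃* Cyc 4) := by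
  obtain ⟨w, hw⟩ := exists_baseFrame_rep14 hγ
  exact hw.stabilizer _ fourCycleCentralizer_injective mem_fourCycleCentralizer

theorem stabilizer_rep15 {b c : F} (hbc : ∀ u : F, u ^ 2 * (u + c) ≠ b) :
    Nonempty (MulAction.stabilizer (K F)
      (pencil (rep15Form₁ b c) (rep15Form₂ b c)) ≃* Cyc 3) := by
  obtain ⟨w, hw⟩ := exists_baseFrame_rep15 hbc
  exact hw.stabilizer _ threeCycleCentralizer_injective mem_threeCycleCentralizer

/-- The Frobenius permutation of the base points does not depend on the parameter. The same reason
serves rows 13, 14 and 15. -/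
theorem rep12_mem_orbit {γ δ : F} (hγ : Tr γ⁻¹ = 1) (hδ : Tr δ⁻¹ = 1) :
    pencil (rep12Form₁ δ) (rep12Form₂ δ) ∈
      MulAction.orbit (K F) (pencil (rep12Form₁ γ) (rep12Form₂ γ)) := by
  obtain ⟨w, hw⟩ := exists_baseFrame_rep12 hγ
  obtain ⟨w', hw'⟩ := exists_baseFrame_rep12 hδ
  exact hw.pencil_mem_orbit hw'

theorem rep13_mem_orbit {γ δ : F} (hγ : Tr γ = 1) (hδ : Tr δ = 1) :
    pencil (rep13Form₁ δ) (rep13Form₂ δ) ∈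
      MulAction.orbit (K F) (pencil (rep13Form₁ γ) (rep13Form₂ γ)) := by
  obtain ⟨w, hw⟩ := exists_baseFrame_rep13 hγ
  obtain ⟨w', hw'⟩ := exists_baseFrame_rep13 hδ
  exact hw.pencil_mem_orbit hw'

theorem rep14_mem_orbit {γ δ : F} (hγ : Tr γ = 1) (hδ : Tr δ = 1) :
    pencil (rep14Form₁ δ) (rep14Form₂ δ) ∈
      MulAction.orbit (K F) (pencil (rep14Form₁ γ) (rep14Form₂ γ)) := by
  obtain ⟨w, hw⟩ := exists_baseFrame_rep14 hγ
  obtain ⟨w', hw'⟩ := exists_baseFrame_rep14 hδ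
  exact hw.pencil_mem_orbit hw'

theorem rep15_mem_orbit {b c b' c' : F} (hbc : ∀ u : F, u ^ 2 * (u + c) ≠ b)
    (hbc' : ∀ u : F, u ^ 2 * (u + c') ≠ b') :
    pencil (rep15Form₁ b' c') (rep15Form₂ b' c') ∈
      MulAction.orbit (K F) (pencil (rep15Form₁ b c) (rep15Form₂ b c)) := by
  obtain ⟨w, hw⟩ := exists_baseFrame_rep15 hbc
  obtain ⟨w', hw'⟩ := exists_baseFrame_rep15 hbc'
  exact hw.pencil_mem_orbit hw'

end BasePointStabilizers

/-! ### Coordinate changes to simpler generators -/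

section Conjugates

variable {F : Type*} [Field F]

/-- The shear replacing X₀ by X₀ + sX₁ adds s² + s to δ, so among forms X₀² + X₀X₁ + δX₁² only the
trace of δ matters. -/
theorem linePair_mem_orbit [CharP F 2] (δ s : F) (f : TernaryForm F)
    (hf : f.subst !![1, s, 0; 0, 1, 0; 0, 0, 1] = f) :
    pencil ⟨1, 1, 0, δ + (s ^ 2 + s), 0, 0⟩ f ∈
      MulAction.orbit (K F) (pencil ⟨1, 1, 0, δ, 0, 0⟩ f) := by
  have h2 : (2 : F) = 0 := CharTwo.two_eq_zero
  have h := pencil_subst_mem_orbit (⟨1, 1, 0, δ, 0, 0⟩ : TernaryForm F) f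
    (A := !![1, s, 0; 0, 1, 0; 0, 0, 1]) (by simp [det_entries])
  rw [hf] at h
  convert h using 2
  rw [subst_entries]
  ext <;> simp [eval, polar] <;> grind

variable [Fintype F] [CharP F 2]

/-- Replacing X₂ by X₁ + X₂ turns the double line (X₁ + X₂)² into X₂². -/
theorem rep1_canonical_mem_orbit :
    pencil (⟨0, 0, 0, 1, 1, 0⟩ : TernaryForm F) ⟨0, 0, 0, 0, 0, 1⟩ ∈
      MulAction.orbit (K F) (pencil (rep1Form₁ F) (rep1Form₂ F)) := by
  have h2 : (2 : F) = 0 := CharTwo.two_eq_zero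
  refine pencil_mem_orbit !![1, 0, 0; 0, 1, 0; 0, 1, 1] (by simp [det_entries]) ?_ ?_ ?_ ?_ <;>
    rw [inSpan_iff]
  · exact ⟨1, 0, by simp [subst_entries, rep1Form₁, eval, polar]⟩
  · exact ⟨0, 1, by simp [subst_entries, rep1Form₂, eval, polar]; grind⟩
  · exact ⟨1, 0, by simp [subst_entries, rep1Form₁, rep1Form₂, eval, polar]⟩
  · exact ⟨0, 1, by simp [subst_entries, rep1Form₁, rep1Form₂, eval, polar]; grind⟩

/-- Scaling X₁ by γ⁻¹ normalises the first form. The row for X₂ is chosen so that the double line f₁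
+ γf₂ = (X₀ + X₁ + √γ X₂)² becomes X₂². -/
theorem rep7_canonical_mem_orbit {γ : F} (hγ : γ ≠ 0) :
    pencil (⟨1, 1, 0, γ⁻¹ ^ 2, 0, 0⟩ : TernaryForm F) ⟨0, 0, 0, 0, 0, 1⟩ ∈
      MulAction.orbit (K F) (pencil (rep7Form₁ γ) (rep7Form₂ γ)) := by
  have h2 : (2 : F) = 0 := CharTwo.two_eq_zero
  obtain ⟨s, hs⟩ := exists_sq_eq γ⁻¹
  have hs' : s ^ 2 * γ = 1 := by rw [hs, inv_mul_cancel₀ hγ]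
  have hs0 : s ≠ 0 := by
    rintro rfl
    simp at hs'
  rw [← hs]
  refine pencil_mem_orbit !![1, 0, 0; 0, s ^ 2, 0; s, s ^ 3, s] ?_ ?_ ?_ ?_ ?_
  · simp [det_entries, hs0]
  all_goals rw [inSpan_iff]
  · exact ⟨1, 0, by simp [subst_entries, rep7Form₁, eval, polar]; grind⟩
  · exact ⟨s ^ 2, s ^ 2, by simp [subst_entries, rep7Form₂, eval, polar]; grind⟩
  · exact ⟨1, 0, by simp [subst_entries, rep7Form₁, rep7Form₂, eval, polar]; grind⟩
  · exact ⟨1, γ, by simp [subst_entries, rep7Form₁, rep7Form₂, eval, polar]; grind⟩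

/-- The matrix matches degenerate members: X₀(X₀ + X₁) goes to (X₀ + X₂)(X₁ + X₂) and X₁X₂ to X₂(X₀
+ X₁). -/
theorem rep8_canonical_mem_orbit :
    pencil (rep8Form₁ F) (rep8Form₂ F) ∈ MulAction.orbit (K F)
      (pencil (⟨1, 1, 0, 0, 0, 0⟩ : TernaryForm F) ⟨0, 0, 0, 0, 1, 0⟩) := by
  have h2 : (2 : F) = 0 := CharTwo.two_eq_zero
  refine pencil_mem_orbit !![1, 0, 1; 1, 1, 0; 0, 0, 1] ?_ ?_ ?_ ?_ ?_
  · simp [det_entries]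
  all_goals rw [inSpan_iff]
  · exact ⟨1, 1, by simp [subst_entries, rep8Form₁, rep8Form₂, eval, polar]; grind⟩
  · exact ⟨0, 1, by simp [subst_entries, rep8Form₁, rep8Form₂, eval, polar]⟩
  · exact ⟨1, 1, by simp [subst_entries, rep8Form₁, eval, polar]; grind⟩
  · exact ⟨0, 1, by simp [subst_entries, rep8Form₂, eval, polar]⟩

/-- The matrix matches degenerate members: the conjugate lines go to X₁² + γX₁X₂ + X₂² and X₁X₂ to
γX₁(X₀ + X₁ + γX₂). -/
theorem rep10_canonical_mem_orbit {γ : F} (hγ : γ ≠ 0) :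
    pencil (rep10Form₁ γ) (rep10Form₂ γ) ∈ MulAction.orbit (K F)
      (pencil (⟨1, 1, 0, γ⁻¹ ^ 2, 0, 0⟩ : TernaryForm F) ⟨0, 0, 0, 0, 1, 0⟩) := by
  have h2 : (2 : F) = 0 := CharTwo.two_eq_zero
  have e := inv_mul_cancel₀ hγ
  refine pencil_mem_orbit !![0, 0, 1; 0, γ, 0; 1, 1, γ] ?_ ?_ ?_ ?_ ?_
  · simp [det_entries, hγ]
  all_goals rw [inSpan_iff]
  · exact ⟨1, 1, by simp [subst_entries, rep10Form₁, rep10Form₂, eval, polar]; grind⟩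
  · exact ⟨γ, 0, by simp [subst_entries, rep10Form₁, rep10Form₂, eval, polar]⟩
  · exact ⟨0, γ⁻¹, by simp [subst_entries, rep10Form₁, eval, polar, hγ]⟩
  · exact ⟨1, γ⁻¹, by simp [subst_entries, rep10Form₂, eval, polar]; grind⟩

end Conjugates
end VeroneseSolids

namespace VeroneseSolids
open TernaryForm

/-! ### Orders and structure of the groups in the table -/

section GroupOrders

variable (F : Type*) [Field F] [Fintype F]

theorem card_GL_two_cast : (Nat.card (GL (Fin 2) F) : ℚ) =
    ((Fintype.card F : ℚ) ^ 2 - 1) * ((Fintype.card F : ℚ) ^ 2 - Fintype.card F) := by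
  have hq : 1 ≤ Fintype.card F := Fintype.one_lt_card.le
  have h1 : 1 ≤ Fintype.card F ^ 2 := Nat.one_le_pow _ _ hq
  have h2 : Fintype.card F ≤ Fintype.card F ^ 2 := Nat.le_self_pow (by norm_num) _
  rw [Matrix.card_GL_field, Fin.prod_univ_two]
  push_cast [Nat.cast_sub h1, Nat.cast_sub h2]
  simp [Nat.cast_sub h1, Nat.cast_sub h2]

theorem card_unitri_cast : (Nat.card (Unitri F) : ℚ) = (Fintype.card F : ℚ) ^ 3 := by
  have e : Unitri F ≃ F × F × F :=
    { toFun := fun g => (g.x, g.y, g.z)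
      invFun := fun p => ⟨p.1, p.2.1, p.2.2⟩
      left_inv := fun _ => rfl
      right_inv := fun _ => rfl }
  rw [Nat.card_congr e, Nat.card_prod, Nat.card_prod]
  push_cast
  rw [card_cast]
  ring

theorem card_E_cast : (Nat.card (E F) : ℚ) = Fintype.card F := card_cast (F := F)

theorem card_E2_cast : (Nat.card (E2 F) : ℚ) = (Fintype.card F : ℚ) ^ 2 := by
  have : Nat.card (E2 F) = Nat.card (F × F) := rfl
  rw [this, Nat.card_prod]
  push_cast
  rw [card_cast]
  ring

theorem card_vector_cast : (Nat.card (Multiplicative (Fin 2 → F)) : ℚ) =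
    (Fintype.card F : ℚ) ^ 2 := by
  have : Nat.card (Multiplicative (Fin 2 → F)) = Nat.card (Fin 2 → F) := rfl
  rw [this, Nat.card_fun]
  simp

theorem card_cyc (n : ℕ) : Nat.card (Cyc n) = n := Nat.card_zmod n

theorem nonempty_cyc_mulEquiv : Nonempty (Cyc (Fintype.card F - 1) ≃* Fˣ) := by
  classical
  have h : Nat.card Fˣ = Fintype.card F - 1 := by
    rw [Nat.card_eq_fintype_card, Fintype.card_units]
  rw [← h]
  exact ⟨zmodCyclicMulEquiv inferInstance⟩

theorem card_cyc_cast : (Nat.card (Cyc (Fintype.card F - 1)) : ℚ) = Fintype.card F - 1 := by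
  obtain ⟨e⟩ := nonempty_cyc_mulEquiv F
  rw [Nat.card_congr e.toEquiv, card_units_cast]

end GroupOrders

namespace Unitri

variable (F : Type*) [Field F]

theorem mem_center_iff {g : Unitri F} : g ∈ Subgroup.center (Unitri F) ↔ g.x = 0 ∧ g.y = 0 := by
  rw [Subgroup.mem_center_iff]
  constructor
  · intro h
    -- Commuting with the two elementary generators kills one superdiagonal entry each.
    have h1 := congrArg Unitri.z (h ⟨1, 0, 0⟩)
    have h2 := congrArg Unitri.z (h ⟨0, 1, 0⟩)
    simp [mul_def] at h1 h2
    exact ⟨h2, h1⟩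
  · rintro ⟨hx, hy⟩ h
    ext <;> simp [mul_def, hx, hy, add_comm]

theorem center_mulEquiv : Nonempty (Subgroup.center (Unitri F) ≃* E F) :=
  ⟨{  toFun := fun g => Multiplicative.ofAdd g.1.z
      invFun := fun z => ⟨⟨0, 0, z.toAdd⟩, (mem_center_iff F).2 ⟨rfl, rfl⟩⟩
      left_inv := fun g => by
        have h := (mem_center_iff F).1 g.2
        apply Subtype.ext
        ext
        · exact h.1.symm
        · exact h.2.symm
        · rfl
      right_inv := fun _ => rfl
      map_mul' := fun g h => by
        have hg := (mem_center_iff F).1 g.2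
        simp [mul_def, hg.1] }⟩

/-- The quotient map from the unitriangular group to the elementary abelian group of order
`q²`. -/
def toPlane : Unitri F →* E2 F where
  toFun g := Multiplicative.ofAdd (g.x, g.y)
  map_one' := rfl
  map_mul' _ _ := rfl

theorem quotient_center_mulEquiv :
    Nonempty (Unitri F ⧸ Subgroup.center (Unitri F) ≃* E2 F) := by
  have hk : (toPlane F).ker = Subgroup.center (Unitri F) := by
    ext g
    rw [mem_center_iff, MonoidHom.mem_ker]
    exact Prod.ext_iff
  have hs : Function.Surjective (toPlane F) := fun w => ⟨⟨w.toAdd.1, w.toAdd.2, 0⟩, rfl⟩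
  exact ⟨(QuotientGroup.quotientMulEquivOfEq hk.symm).trans
    (QuotientGroup.quotientKerEquivOfSurjective _ hs)⟩

end Unitri

/-! ### Existence of admissible parameters -/

section Parameters

variable {F : Type*} [Field F] [Fintype F] [CharP F 2]

variable (F) in
theorem exists_tr_eq_one : ∃ γ : F, Tr γ = 1 := tr_surjective 1

variable (F) in
theorem exists_tr_inv_eq_one : ∃ γ : F, Tr γ⁻¹ = 1 := by
  obtain ⟨γ, hγ⟩ := exists_tr_eq_one F
  exact ⟨γ⁻¹, by rwa [_root_.inv_inv]⟩

open Polynomial in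
omit [Fintype F] in
-- A cubic is irreducible exactly when it has no root, and roots are nonzero here, so passing to
-- inverses gives the condition used throughout.
theorem irreducible_cubic_iff {b c : F} (hb : b ≠ 0) :
    Irreducible (C b * X ^ 3 + C c * X + 1 : F[X]) ↔ ∀ u : F, u ^ 2 * (u + c) ≠ b := by
  have h2 : (2 : F) = 0 := CharTwo.two_eq_zero
  have hdeg : (C b * X ^ 3 + C c * X + 1 : F[X]).natDegree = 3 := by compute_degree!
  have hne : (C b * X ^ 3 + C c * X + 1 : F[X]) ≠ 0 := by
    intro h
    rw [h] at hdeg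
    simp at hdeg
  rw [irreducible_iff_roots_eq_zero_of_degree_le_three (by omega) (by omega),
    Multiset.eq_zero_iff_forall_notMem]
  constructor
  · intro h u hu
    have hu0 : u ≠ 0 := by
      rintro rfl
      simp at hu
      exact hb hu.symm
    apply h u⁻¹
    rw [mem_roots hne]
    simp only [IsRoot, eval_add, eval_mul, eval_C, eval_pow, eval_X, eval_one]
    have e := mul_inv_cancel₀ hu0
    rw [← hu]
    field_simp
    linear_combination (u + c) * h2
  · intro h x hx
    rw [mem_roots hne] at hx
    simp only [IsRoot, eval_add, eval_mul, eval_C, eval_pow, eval_X, eval_one] at hx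
    exact cubic_ne_zero h x hx

variable (F) in
-- The map u ↦ u²(u + 1) takes the value 0 at both 0 and 1; not being injective on a finite set, it
-- misses some b, and b ≠ 0 because 0 is attained.
theorem exists_irreducible_cubic : ∃ b : F, b ≠ 0 ∧ ∀ u : F, u ^ 2 * (u + 1) ≠ b := by
  have hns : ¬ Function.Surjective fun u : F => u ^ 2 * (u + 1) := by
    intro hs
    have hi := Finite.injective_iff_surjective.2 hs
    have := @hi 0 1 (by simp [CharTwo.add_self_eq_zero])
    exact zero_ne_one this
  obtain ⟨b, hb⟩ := not_forall.1 hns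
  refine ⟨b, ?_, fun u hu => hb ⟨u, hu⟩⟩
  rintro rfl
  exact hb ⟨0, by simp⟩

end Parameters

/-! ### Each row is a single orbit, independent of parameters -/

section Orbits

variable {F : Type*} [Field F] [Fintype F] [CharP F 2]

omit [Fintype F] in
theorem Omega_eq_of_unique {i : ℕ} {U : Submodule F (Sym F)} (h₁ : IsRepresentative i U)
    (h₂ : ∀ R, IsRepresentative i R → R = U) : Omega F i = MulAction.orbit (K F) U :=
  Omega_eq_orbit ⟨U, h₁, MulAction.mem_orbit_self U⟩ fun R hR => by
    rw [h₂ R hR]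
    exact MulAction.mem_orbit_self U

omit [Fintype F] in
theorem mem_orbit_trans {U V W : Submodule F (Sym F)} (h₁ : V ∈ MulAction.orbit (K F) U)
    (h₂ : W ∈ MulAction.orbit (K F) V) : W ∈ MulAction.orbit (K F) U := by
  rwa [← MulAction.orbit_eq_iff.2 h₁]

omit [Fintype F] in
theorem mem_orbit_symm {U V : Submodule F (Sym F)} (h : V ∈ MulAction.orbit (K F) U) :
    U ∈ MulAction.orbit (K F) V := by
  rw [MulAction.orbit_eq_iff.2 h]
  exact MulAction.mem_orbit_self U

variable (F)

omit [Fintype F] in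
theorem Omega_one : Omega F 1 = MulAction.orbit (K F) (pencil (rep1Form₁ F) (rep1Form₂ F)) := by
  rw [← solid_rep1]
  exact Omega_eq_of_unique .rep1 fun R hR => by cases hR; rfl

omit [Fintype F] in
theorem Omega_two : Omega F 2 = MulAction.orbit (K F) (pencil (rep2Form₁ F) (rep2Form₂ F)) := by
  rw [← solid_rep2]
  exact Omega_eq_of_unique .rep2 fun R hR => by cases hR; rfl

omit [Fintype F] in
theorem Omega_three : Omega F 3 = MulAction.orbit (K F) (pencil (rep3Form₁ F) (rep3Form₂ F)) := by
  rw [← solid_rep3]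
  exact Omega_eq_of_unique .rep3 fun R hR => by cases hR; rfl

omit [Fintype F] in
theorem Omega_four : Omega F 4 = MulAction.orbit (K F) (pencil (rep4Form₁ F) (rep4Form₂ F)) := by
  rw [← solid_rep4]
  exact Omega_eq_of_unique .rep4 fun R hR => by cases hR; rfl

omit [Fintype F] in
theorem Omega_five : Omega F 5 = MulAction.orbit (K F) (pencil (rep5Form₁ F) (rep5Form₂ F)) := by
  rw [← solid_rep5]
  exact Omega_eq_of_unique .rep5 fun R hR => by cases hR; rfl

omit [Fintype F] in
theorem Omega_six : Omega F 6 = MulAction.orbit (K F) (pencil (rep6Form₁ F) (rep6Form₂ F)) := by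
  rw [← solid_rep6]
  exact Omega_eq_of_unique .rep6 fun R hR => by cases hR; rfl

omit [Fintype F] in
theorem Omega_eight :
    Omega F 8 = MulAction.orbit (K F) (pencil (rep8Form₁ F) (rep8Form₂ F)) := by
  rw [← solid_rep8]
  exact Omega_eq_of_unique .rep8 fun R hR => by cases hR; rfl

omit [Fintype F] in
theorem Omega_nine : Omega F 9 = MulAction.orbit (K F) (pencil (rep9Form₁ F) (rep9Form₂ F)) := by
  rw [← solid_rep9]
  exact Omega_eq_of_unique .rep9 fun R hR => by cases hR; rfl

omit [Fintype F] in
theorem Omega_eleven :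
    Omega F 11 = MulAction.orbit (K F) (pencil (rep11Form₁ F) (rep11Form₂ F)) := by
  rw [← solid_rep11]
  exact Omega_eq_of_unique .rep11 fun R hR => by cases hR; rfl

variable {F}

theorem exists_sq_add_self_of_tr_eq {γ δ : F} (h : Tr γ = Tr δ) : ∃ s, γ + (s ^ 2 + s) = δ := by
  obtain ⟨s, hs⟩ := (tr_eq_zero_iff (a := γ + δ)).1 (by
    rw [tr_add, h]
    generalize Tr δ = t
    revert t
    decide)
  refine ⟨s, ?_⟩
  rw [hs, ← add_assoc, CharTwo.add_self_eq_zero, zero_add]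

/-- Both pencils reduce to the simpler one with δ the inverse square of the parameter. The two
values have equal trace, so they differ by some s² + s and a shear relates them. -/
theorem rep7_mem_orbit {γ δ : F} (hγ : Tr γ⁻¹ = 1) (hδ : Tr δ⁻¹ = 1) :
    pencil (rep7Form₁ δ) (rep7Form₂ δ) ∈
      MulAction.orbit (K F) (pencil (rep7Form₁ γ) (rep7Form₂ γ)) := by
  refine mem_orbit_trans (rep7_canonical_mem_orbit (ne_zero_of_tr_inv hγ))
    (mem_orbit_trans ?_ (mem_orbit_symm (rep7_canonical_mem_orbit (ne_zero_of_tr_inv hδ))))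
  obtain ⟨s, hs⟩ := exists_sq_add_self_of_tr_eq ((tr_inv_sq hγ).trans (tr_inv_sq hδ).symm)
  rw [← hs]
  refine linePair_mem_orbit _ _ _ ?_
  ext <;> simp [subst_entries, eval, polar]

theorem rep10_mem_orbit {γ δ : F} (hγ : Tr γ⁻¹ = 1) (hδ : Tr δ⁻¹ = 1) :
    pencil (rep10Form₁ δ) (rep10Form₂ δ) ∈
      MulAction.orbit (K F) (pencil (rep10Form₁ γ) (rep10Form₂ γ)) := by
  refine mem_orbit_trans (mem_orbit_symm (rep10_canonical_mem_orbit (ne_zero_of_tr_inv hγ)))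
    (mem_orbit_trans ?_ (rep10_canonical_mem_orbit (ne_zero_of_tr_inv hδ)))
  obtain ⟨s, hs⟩ := exists_sq_add_self_of_tr_eq ((tr_inv_sq hγ).trans (tr_inv_sq hδ).symm)
  rw [← hs]
  refine linePair_mem_orbit _ _ _ ?_
  ext <;> simp [subst_entries, eval, polar]

theorem Omega_seven {γ : F} (hγ : Tr γ⁻¹ = 1) :
    Omega F 7 = MulAction.orbit (K F) (pencil (rep7Form₁ γ) (rep7Form₂ γ)) := by
  refine Omega_eq_orbit ⟨_, .rep7 γ hγ, ?_⟩ fun R hR => ?_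
  · rw [solid_rep7]
    exact MulAction.mem_orbit_self _
  · cases hR with
    | rep7 δ hδ =>
      rw [solid_rep7]
      exact rep7_mem_orbit hγ hδ

theorem Omega_ten {γ : F} (hγ : Tr γ⁻¹ = 1) :
    Omega F 10 = MulAction.orbit (K F) (pencil (rep10Form₁ γ) (rep10Form₂ γ)) := by
  refine Omega_eq_orbit ⟨_, .rep10 γ hγ, ?_⟩ fun R hR => ?_
  · rw [solid_rep10]
    exact MulAction.mem_orbit_self _
  · cases hR with
    | rep10 δ hδ =>
      rw [solid_rep10]
      exact rep10_mem_orbit hγ hδ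

theorem Omega_twelve {γ : F} (hγ : Tr γ⁻¹ = 1) :
    Omega F 12 = MulAction.orbit (K F) (pencil (rep12Form₁ γ) (rep12Form₂ γ)) := by
  refine Omega_eq_orbit ⟨_, .rep12 γ hγ, ?_⟩ fun R hR => ?_
  · rw [solid_rep12]
    exact MulAction.mem_orbit_self _
  · cases hR with
    | rep12 δ hδ =>
      rw [solid_rep12]
      exact rep12_mem_orbit hγ hδ

theorem Omega_thirteen {γ : F} (hγ : Tr γ = 1) :
    Omega F 13 = MulAction.orbit (K F) (pencil (rep13Form₁ γ) (rep13Form₂ γ)) := by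
  refine Omega_eq_orbit ⟨_, .rep13 γ hγ, ?_⟩ fun R hR => ?_
  · rw [solid_rep13]
    exact MulAction.mem_orbit_self _
  · cases hR with
    | rep13 δ hδ =>
      rw [solid_rep13]
      exact rep13_mem_orbit hγ hδ

theorem Omega_fourteen {γ : F} (hγ : Tr γ = 1) :
    Omega F 14 = MulAction.orbit (K F) (pencil (rep14Form₁ γ) (rep14Form₂ γ)) := by
  refine Omega_eq_orbit ⟨_, .rep14 γ hγ, ?_⟩ fun R hR => ?_
  · rw [solid_rep14]
    exact MulAction.mem_orbit_self _
  · cases hR with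
    | rep14 δ hδ =>
      rw [solid_rep14]
      exact rep14_mem_orbit hγ hδ

theorem Omega_fifteen {b c : F} (hb : b ≠ 0) (hbc : ∀ u : F, u ^ 2 * (u + c) ≠ b) :
    Omega F 15 = MulAction.orbit (K F) (pencil (rep15Form₁ b c) (rep15Form₂ b c)) := by
  refine Omega_eq_orbit ⟨_, .rep15 b c hb ((irreducible_cubic_iff hb).2 hbc), ?_⟩ fun R hR => ?_
  · rw [solid_rep15]
    exact MulAction.mem_orbit_self _
  · cases hR with
    | rep15 b' c' hb' h' =>
      rw [solid_rep15]
      exact rep15_mem_orbit hbc ((irreducible_cubic_iff hb').1 h')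

theorem Omega_nonempty {i : ℕ} (hi : i ∈ Finset.Icc 1 15) :
    ∃ U : Submodule F (Sym F), Module.finrank F U = 4 ∧ Omega F i = MulAction.orbit (K F) U := by
  obtain ⟨γ, hγ⟩ := exists_tr_eq_one F
  obtain ⟨δ, hδ⟩ := exists_tr_inv_eq_one F
  obtain ⟨b, hb, hbc⟩ := exists_irreducible_cubic F
  rw [Finset.mem_Icc] at hi
  obtain ⟨h1, h2⟩ := hi
  interval_cases i
  · exact ⟨_, finrank_rep1, Omega_one F⟩
  · exact ⟨_, finrank_rep2, Omega_two F⟩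
  · exact ⟨_, finrank_rep3, Omega_three F⟩
  · exact ⟨_, finrank_rep4, Omega_four F⟩
  · exact ⟨_, finrank_rep5, Omega_five F⟩
  · exact ⟨_, finrank_rep6, Omega_six F⟩
  · exact ⟨_, finrank_rep7 δ, Omega_seven hδ⟩
  · exact ⟨_, finrank_rep8, Omega_eight F⟩
  · exact ⟨_, finrank_rep9, Omega_nine F⟩
  · exact ⟨_, finrank_rep10 δ, Omega_ten hδ⟩
  · exact ⟨_, finrank_rep11, Omega_eleven F⟩
  · exact ⟨_, finrank_rep12 δ, Omega_twelve hδ⟩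
  · exact ⟨_, finrank_rep13 γ, Omega_thirteen hγ⟩
  · exact ⟨_, finrank_rep14 γ, Omega_fourteen hγ⟩
  · exact ⟨_, finrank_rep15 b 1, Omega_fifteen hb hbc⟩

/-- Every representative generates the orbit. -/
theorem representative_spec {i : ℕ} (hi : i ∈ Finset.Icc 1 15) :
    (∃ R : Submodule F (Sym F), IsRepresentative i R) ∧
      ∀ R : Submodule F (Sym F), IsRepresentative i R →
        Module.finrank F R = 4 ∧ Omega F i = MulAction.orbit (K F) R := by
  obtain ⟨U, hU, hΩ⟩ := Omega_nonempty (F := F) hi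
  constructor
  · have h : U ∈ Omega F i := hΩ ▸ MulAction.mem_orbit_self U
    obtain ⟨R, hR, -⟩ := h
    exact ⟨R, hR⟩
  · intro R hR
    have h : R ∈ MulAction.orbit (K F) U := hΩ ▸ ⟨R, hR, MulAction.mem_orbit_self R⟩
    refine ⟨?_, hΩ.trans (MulAction.orbit_eq_iff.2 h).symm⟩
    obtain ⟨A, rfl⟩ := mem_orbit_iff.1 h
    rw [finrank_alpha, hU]

end Orbits

end VeroneseSolids

namespace VeroneseSolids
open TernaryForm

/-! ### The table and the distinctness of the orbits -/

section Rows

variable (F : Type*) [Field F] [Fintype F]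

theorem nonempty_mulEquiv_cyc_prod {G : Type*} [Group G] {L : Type*} [Group L]
    (h : Nonempty (G ≃* Fˣ × L)) : Nonempty (G ≃* Cyc (Fintype.card F - 1) × L) := by
  obtain ⟨e⟩ := h
  obtain ⟨c⟩ := nonempty_cyc_mulEquiv F
  exact ⟨e.trans (c.symm.prodCongr (MulEquiv.refl L))⟩

theorem nonempty_mulEquiv_prod_cyc {G : Type*} [Group G] {L : Type*} [Group L]
    (h : Nonempty (G ≃* L × Fˣ)) : Nonempty (G ≃* L × Cyc (Fintype.card F - 1)) := by
  obtain ⟨e⟩ := h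
  obtain ⟨c⟩ := nonempty_cyc_mulEquiv F
  exact ⟨e.trans ((MulEquiv.refl L).prodCongr c.symm)⟩

variable [CharP F 2]

theorem orbitRow_one (q : ℕ) (hq : Fintype.card F = q) : OrbitRow F 1
    ![1, q + 1, 2 * q ^ 2 - 1, q ^ 3 - q ^ 2] ![1, q / 2, q / 2, 0]
    (E2 F ⋊[unipotentScalarAction F] (E F × Fˣ)) ((q ^ 3 - 1) * (q + 1)) := by
  subst hq
  refine orbitRow_of _ _ (Omega_one F) rep1_canonical_mem_orbit
    pointOD_rep1 hyperplaneOD_rep1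
    stabilizer_rep1 ?_
  rw [SemidirectProduct.card, Nat.card_prod, Nat.cast_mul, Nat.cast_mul, card_E2_cast,
    card_E_cast, card_units_cast]
  ring

theorem orbitRow_two (q : ℕ) (hq : Fintype.card F = q) : OrbitRow F 2
    ![q + 1, q + 1, 2 * q ^ 2 - q - 1, q ^ 3 - q ^ 2] ![1, q, 0, 0]
    (Unitri F ⋊[torusAction F] (Fˣ × Fˣ)) ((q ^ 2 + q + 1) * (q + 1)) := by
  subst hq
  refine orbitRow_of _ _ (Omega_two F) (MulAction.mem_orbit_self _)
    pointOD_rep2 hyperplaneOD_rep2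
    stabilizer_rep2 ?_
  rw [SemidirectProduct.card, Nat.card_prod, Nat.cast_mul, Nat.cast_mul, card_unitri_cast,
    card_units_cast]
  ring

theorem orbitRow_three (q : ℕ) (hq : Fintype.card F = q) : OrbitRow F 3
    ![1, q ^ 2 + q + 1, q ^ 2 - 1, q ^ 3 - q ^ 2] ![q + 1, 0, 0, 0]
    (Multiplicative (Fin 2 → F) ⋊[naturalAction F] GL (Fin 2) F) (q ^ 2 + q + 1) := by
  subst hq
  refine orbitRow_of _ _ (Omega_three F) (MulAction.mem_orbit_self _)
    pointOD_rep3 hyperplaneOD_rep3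
    stabilizer_rep3 ?_
  rw [SemidirectProduct.card, Nat.cast_mul, card_vector_cast, card_GL_two_cast]
  ring

theorem orbitRow_four (q : ℕ) (hq : Fintype.card F = q) : OrbitRow F 4
    ![q + 2, 1, 2 * q ^ 2 - 2, q ^ 3 - q ^ 2] ![0, q + 1, 0, 0]
    (GL (Fin 2) F) (q ^ 2 * (q ^ 2 + q + 1)) := by
  subst hq
  refine orbitRow_of _ _ (Omega_four F) (MulAction.mem_orbit_self _)
    pointOD_rep4 hyperplaneOD_rep4
    stabilizer_rep4 ?_
  rw [card_GL_two_cast]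
  ring

theorem orbitRow_five (q : ℕ) (hq : Fintype.card F = q) : OrbitRow F 5
    ![1, q + 1, q ^ 2 - 1, q ^ 3] ![1, 0, 0, q]
    (E2 F ⋊[scalarAction F (F × F)] Fˣ) (q * (q ^ 3 - 1) * (q + 1)) := by
  subst hq
  refine orbitRow_of _ _ (Omega_five F) (MulAction.mem_orbit_self _)
    pointOD_rep5 hyperplaneOD_rep5
    stabilizer_rep5 ?_
  rw [SemidirectProduct.card, Nat.cast_mul, card_E2_cast, card_units_cast]
  ring

theorem orbitRow_six (q : ℕ) (hq : Fintype.card F = q) : OrbitRow F 6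
    ![2, q + 1, q ^ 2 + q - 2, q ^ 3 - q] ![1, 1, 0, q - 1]
    ((Fˣ × Fˣ) ⋊[swapAction Fˣ] Cyc 2) (1 / 2 * q ^ 3 * (q ^ 2 + q + 1) * (q + 1)) := by
  subst hq
  refine orbitRow_of _ _ (Omega_six F) (MulAction.mem_orbit_self _)
    pointOD_rep6 hyperplaneOD_rep6
    stabilizer_rep6 ?_
  rw [SemidirectProduct.card, Nat.card_prod, card_cyc, Nat.cast_mul, Nat.cast_mul, card_units_cast]
  ring

theorem orbitRow_seven (q : ℕ) (hq : Fintype.card F = q) : OrbitRow F 7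
    ![0, q + 1, q ^ 2 + q, q ^ 3 - q] ![1, 0, 1, q - 1]
    (DihedralGroup (q + 1) × Cyc (q - 1)) (1 / 2 * q ^ 3 * (q ^ 3 - 1)) := by
  subst hq
  obtain ⟨δ, hδ⟩ := exists_tr_inv_eq_one F
  refine orbitRow_of _ _ (Omega_seven hδ) (rep7_canonical_mem_orbit (ne_zero_of_tr_inv hδ))
    (pointOD_rep7 hδ) (hyperplaneOD_rep7 hδ)
    (nonempty_mulEquiv_prod_cyc F (stabilizer_conjugateLines (tr_inv_sq hδ))) ?_
  rw [Nat.card_prod, DihedralGroup.nat_card, Nat.cast_mul, Nat.cast_mul, card_cyc_cast]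
  push_cast
  ring

theorem orbitRow_eight (q : ℕ) (hq : Fintype.card F = q) : OrbitRow F 8
    ![3, 1, q ^ 2 + 2 * q - 3, q ^ 3 - q] ![0, 2, 0, q - 1]
    (Cyc (q - 1) × Cyc 2) (1 / 2 * q ^ 3 * (q ^ 3 - 1) * (q + 1)) := by
  subst hq
  refine orbitRow_of _ _ (Omega_eight F) (mem_orbit_symm rep8_canonical_mem_orbit)
    pointOD_rep8 hyperplaneOD_rep8
    (nonempty_mulEquiv_cyc_prod F (stabilizer_linePairs 0)) ?_
  rw [Nat.card_prod, card_cyc 2, Nat.cast_mul, card_cyc_cast]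
  ring

theorem orbitRow_nine (q : ℕ) (hq : Fintype.card F = q) : OrbitRow F 9
    ![4, 1, q ^ 2 + 3 * q - 4, q ^ 3 - 2 * q] ![0, 3, 0, q - 2]
    (Equiv.Perm (Fin 4)) (1 / 24 * q ^ 3 * (q ^ 3 - 1) * (q ^ 2 - 1)) := by
  subst hq
  refine orbitRow_of _ _ (Omega_nine F) (MulAction.mem_orbit_self _)
    pointOD_rep9 hyperplaneOD_rep9
    stabilizer_rep9 ?_
  rw [Nat.card_perm, Nat.card_fin, show Nat.factorial 4 = 24 from rfl]
  ring

theorem orbitRow_ten (q : ℕ) (hq : Fintype.card F = q) : OrbitRow F 10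
    ![1, 1, q ^ 2 + 2 * q - 1, q ^ 3 - q] ![0, 1, 1, q - 1]
    (Cyc (q - 1) × Cyc 2) (1 / 2 * q ^ 3 * (q ^ 3 - 1) * (q + 1)) := by
  subst hq
  obtain ⟨δ, hδ⟩ := exists_tr_inv_eq_one F
  refine orbitRow_of _ _ (Omega_ten hδ) (mem_orbit_symm (rep10_canonical_mem_orbit (ne_zero_of_tr_inv hδ)))
    (pointOD_rep10 hδ) (hyperplaneOD_rep10 hδ)
    (nonempty_mulEquiv_cyc_prod F (stabilizer_linePairs _)) ?_
  rw [Nat.card_prod, card_cyc 2, Nat.cast_mul, card_cyc_cast]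
  ring

theorem orbitRow_eleven (q : ℕ) (hq : Fintype.card F = q) : OrbitRow F 11
    ![2, 1, q ^ 2 + q - 2, q ^ 3] ![0, 1, 0, q]
    (E F ⋊[scalarAction F F] Fˣ) (q ^ 2 * (q ^ 3 - 1) * (q + 1)) := by
  subst hq
  refine orbitRow_of _ _ (Omega_eleven F) (MulAction.mem_orbit_self _)
    pointOD_rep11 hyperplaneOD_rep11
    stabilizer_rep11 ?_
  rw [SemidirectProduct.card, Nat.cast_mul, card_E_cast, card_units_cast]
  ring

theorem orbitRow_twelve (q : ℕ) (hq : Fintype.card F = q) : OrbitRow F 12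
    ![2, 1, q ^ 2 + q - 2, q ^ 3] ![0, 1, 0, q]
    (Cyc 2 × Cyc 2) (1 / 4 * q ^ 3 * (q ^ 3 - 1) * (q ^ 2 - 1)) := by
  subst hq
  obtain ⟨δ, hδ⟩ := exists_tr_inv_eq_one F
  refine orbitRow_of _ _ (Omega_twelve hδ) (MulAction.mem_orbit_self _)
    (pointOD_rep12 hδ) (hyperplaneOD_rep12 hδ)
    (stabilizer_rep12 hδ) ?_
  rw [Nat.card_prod, card_cyc]
  ring

theorem orbitRow_thirteen (q : ℕ) (hq : Fintype.card F = q) : OrbitRow F 13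
    ![0, 1, q ^ 2 + 3 * q, q ^ 3 - 2 * q] ![0, 1, 2, q - 2]
    ((Cyc 2 × Cyc 2) ⋊[swapAction (Cyc 2)] Cyc 2) (1 / 8 * q ^ 3 * (q ^ 3 - 1) * (q ^ 2 - 1)) := by
  subst hq
  obtain ⟨γ, hγ⟩ := exists_tr_eq_one F
  refine orbitRow_of _ _ (Omega_thirteen hγ) (MulAction.mem_orbit_self _)
    (pointOD_rep13 hγ) (hyperplaneOD_rep13 hγ)
    (stabilizer_rep13 hγ) ?_
  rw [SemidirectProduct.card, Nat.card_prod, card_cyc]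
  ring

theorem orbitRow_fourteen (q : ℕ) (hq : Fintype.card F = q) : OrbitRow F 14
    ![0, 1, q ^ 2 + q, q ^ 3] ![0, 0, 1, q]
    (Cyc 4) (1 / 4 * q ^ 3 * (q ^ 3 - 1) * (q ^ 2 - 1)) := by
  subst hq
  obtain ⟨γ, hγ⟩ := exists_tr_eq_one F
  refine orbitRow_of _ _ (Omega_fourteen hγ) (MulAction.mem_orbit_self _)
    (pointOD_rep14 hγ) (hyperplaneOD_rep14 hγ)
    (stabilizer_rep14 hγ) ?_
  rw [card_cyc]
  ring

theorem orbitRow_fifteen (q : ℕ) (hq : Fintype.card F = q) : OrbitRow F 15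
    ![1, 1, q ^ 2 - 1, q ^ 3 + q] ![0, 0, 0, q + 1]
    (Cyc 3) (1 / 3 * q ^ 3 * (q ^ 3 - 1) * (q ^ 2 - 1)) := by
  subst hq
  obtain ⟨b, hb, hbc⟩ := exists_irreducible_cubic F
  refine orbitRow_of _ _ (Omega_fifteen hb hbc) (MulAction.mem_orbit_self _)
    (pointOD_rep15 hbc) (hyperplaneOD_rep15 hbc)
    (stabilizer_rep15 hbc) ?_
  rw [card_cyc]
  ring

/-- The hyperplane-orbit distributions of the fifteen orbits. -/
def hyperplaneTable (q : ℚ) : ℕ → Fin 4 → ℚ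
  | 1 => ![1, q / 2, q / 2, 0]
  | 2 => ![1, q, 0, 0]
  | 3 => ![q + 1, 0, 0, 0]
  | 4 => ![0, q + 1, 0, 0]
  | 5 => ![1, 0, 0, q]
  | 6 => ![1, 1, 0, q - 1]
  | 7 => ![1, 0, 1, q - 1]
  | 8 => ![0, 2, 0, q - 1]
  | 9 => ![0, 3, 0, q - 2]
  | 10 => ![0, 1, 1, q - 1]
  | 11 => ![0, 1, 0, q]
  | 12 => ![0, 1, 0, q]
  | 13 => ![0, 1, 2, q - 2]
  | 14 => ![0, 0, 1, q]
  | _ => ![0, 0, 0, q + 1]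

theorem hyperplaneOD_of_mem_Omega {i : ℕ} (hi : i ∈ Finset.Icc 1 15) {S : Submodule F (Sym F)}
    (hS : S ∈ Omega F i) (j : Fin 4) :
    (hyperplaneOD S j : ℚ) = hyperplaneTable (Fintype.card F) i j := by
  obtain ⟨h1, h2⟩ := Finset.mem_Icc.1 hi
  interval_cases i
  · exact ((orbitRow_one F _ rfl).1 S hS).2.1 j
  · exact ((orbitRow_two F _ rfl).1 S hS).2.1 j
  · exact ((orbitRow_three F _ rfl).1 S hS).2.1 j
  · exact ((orbitRow_four F _ rfl).1 S hS).2.1 j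
  · exact ((orbitRow_five F _ rfl).1 S hS).2.1 j
  · exact ((orbitRow_six F _ rfl).1 S hS).2.1 j
  · exact ((orbitRow_seven F _ rfl).1 S hS).2.1 j
  · exact ((orbitRow_eight F _ rfl).1 S hS).2.1 j
  · exact ((orbitRow_nine F _ rfl).1 S hS).2.1 j
  · exact ((orbitRow_ten F _ rfl).1 S hS).2.1 j
  · exact ((orbitRow_eleven F _ rfl).1 S hS).2.1 j
  · exact ((orbitRow_twelve F _ rfl).1 S hS).2.1 j
  · exact ((orbitRow_thirteen F _ rfl).1 S hS).2.1 j
  · exact ((orbitRow_fourteen F _ rfl).1 S hS).2.1 j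
  · exact ((orbitRow_fifteen F _ rfl).1 S hS).2.1 j

set_option maxHeartbeats 2000000 in
omit [Fintype F] [CharP F 2] in
-- Rows 4 and 9 share [0, 3, 0, 0] when q = 2, and rows 11 and 12 agree for every q. Other pairs
-- already differ in one column when q ≥ 2.
theorem hyperplaneTable_eq {q : ℚ} (hq : 2 ≤ q) {i j : ℕ} (hi : i ∈ Finset.Icc 1 15)
    (hj : j ∈ Finset.Icc 1 15) (hij : i < j)
    (h : ∀ l, hyperplaneTable q i l = hyperplaneTable q j l) :
    (i = 4 ∧ j = 9 ∧ q = 2) ∨ (i = 11 ∧ j = 12) := by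
  obtain ⟨hi1, hi2⟩ := Finset.mem_Icc.1 hi
  obtain ⟨hj1, hj2⟩ := Finset.mem_Icc.1 hj
  have h0 := h 0
  have h1 := h 1
  have h2 := h 2
  have h3 := h 3
  clear h hi hj hj1
  interval_cases i <;> interval_cases j <;>
    simp only [hyperplaneTable, cons_val] at h0 h1 h2 h3 <;>
    first
      | (exfalso; linarith)
      | exact Or.inl ⟨rfl, rfl, by linarith⟩
      | exact Or.inr ⟨rfl, rfl⟩

theorem Omega_ne_of_lt {i j : ℕ} (hi : i ∈ Finset.Icc 1 15) (hj : j ∈ Finset.Icc 1 15)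
    (hij : i < j) : Omega F i ≠ Omega F j := by
  intro h
  obtain ⟨S, -, hS⟩ := Omega_nonempty (F := F) hi
  have hSi : S ∈ Omega F i := hS ▸ MulAction.mem_orbit_self S
  have hq : (2 : ℚ) ≤ Fintype.card F := by exact_mod_cast (Fintype.one_lt_card (α := F))
  rcases hyperplaneTable_eq hq hi hj hij fun l =>
    (hyperplaneOD_of_mem_Omega F hi hSi l).symm.trans
      (hyperplaneOD_of_mem_Omega F hj (h ▸ hSi) l) with ⟨rfl, rfl, h2⟩ | ⟨rfl, rfl⟩
  -- For q = 2 the two orbits have 28 and 7 elements.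
  · have e1 := (orbitRow_four F _ rfl).2
    have e2 := (orbitRow_nine F _ rfl).2
    rw [h, e2, h2] at e1
    norm_num at e1
  · have e1 := (orbitRow_eleven F _ rfl).2
    have e2 := (orbitRow_twelve F _ rfl).2
    rw [h, e2] at e1
    generalize hc : Fintype.card F = q at *
    have hq3 : (0 : ℚ) < (q : ℚ) ^ 3 - 1 := by
      have : (1 : ℚ) < (q : ℚ) ^ 3 := one_lt_pow₀ (by linarith) (by norm_num)
      linarith
    -- Equality of the two sizes reduces to q(q − 1) = 4, which has no solution in integers.
    have e3 : (q : ℚ) * (q - 1) = 4 := by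
      have hne : (q : ℚ) ^ 2 * (q ^ 3 - 1) * (q + 1) ≠ 0 := by positivity
      apply mul_left_cancel₀ hne
      linear_combination 4 * e1
    have e4 : q * q = 4 + q := by
      have : (q : ℚ) * q = 4 + q := by linear_combination e3
      exact_mod_cast this
    have h5 : q ≤ 4 := by nlinarith
    interval_cases q <;> omega

end Rows
end VeroneseSolids

theorem mainTheorem2 {F : Type*} [Field F] [Fintype F] [CharP F 2] (q : ℕ)
    (hq : Fintype.card F = q) :
    -- each `Ω_i` is a single orbit of solids, whatever admissible parameters are chosen
    (∀ i ∈ Finset.Icc 1 15,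
      (∃ R : Submodule F (VeroneseSolids.Sym F), VeroneseSolids.IsRepresentative i R) ∧
      ∀ R : Submodule F (VeroneseSolids.Sym F), VeroneseSolids.IsRepresentative i R →
        Module.finrank F R = 4 ∧
        VeroneseSolids.Omega F i = MulAction.orbit (VeroneseSolids.K F) R) ∧
    -- the orbits are pairwise distinct
    (∀ i ∈ Finset.Icc 1 15, ∀ j ∈ Finset.Icc 1 15, i ≠ j →
      VeroneseSolids.Omega F i ≠ VeroneseSolids.Omega F j) ∧
    -- the group denoted `E_q^{1+2}` has centre `E_q` and central quotient `E_q^2`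
    (Nonempty (Subgroup.center (VeroneseSolids.Unitri F) ≃* VeroneseSolids.E F) ∧
      Nonempty (VeroneseSolids.Unitri F ⧸ Subgroup.center (VeroneseSolids.Unitri F) ≃*
        VeroneseSolids.E2 F)) ∧
    VeroneseSolids.OrbitRow F 1
      ![1, q + 1, 2 * q ^ 2 - 1, q ^ 3 - q ^ 2] ![1, q / 2, q / 2, 0]
      (VeroneseSolids.E2 F ⋊[VeroneseSolids.unipotentScalarAction F]
        (VeroneseSolids.E F × Fˣ))
      ((q ^ 3 - 1) * (q + 1)) ∧
    VeroneseSolids.OrbitRow F 2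
      ![q + 1, q + 1, 2 * q ^ 2 - q - 1, q ^ 3 - q ^ 2] ![1, q, 0, 0]
      (VeroneseSolids.Unitri F ⋊[VeroneseSolids.torusAction F] (Fˣ × Fˣ))
      ((q ^ 2 + q + 1) * (q + 1)) ∧
    VeroneseSolids.OrbitRow F 3
      ![1, q ^ 2 + q + 1, q ^ 2 - 1, q ^ 3 - q ^ 2] ![q + 1, 0, 0, 0]
      (Multiplicative (Fin 2 → F) ⋊[VeroneseSolids.naturalAction F] Matrix.GeneralLinearGroup (Fin 2) F)
      (q ^ 2 + q + 1) ∧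
    VeroneseSolids.OrbitRow F 4
      ![q + 2, 1, 2 * q ^ 2 - 2, q ^ 3 - q ^ 2] ![0, q + 1, 0, 0]
      (Matrix.GeneralLinearGroup (Fin 2) F)
      (q ^ 2 * (q ^ 2 + q + 1)) ∧
    VeroneseSolids.OrbitRow F 5
      ![1, q + 1, q ^ 2 - 1, q ^ 3] ![1, 0, 0, q]
      (VeroneseSolids.E2 F ⋊[VeroneseSolids.scalarAction F (F × F)] Fˣ)
      (q * (q ^ 3 - 1) * (q + 1)) ∧
    VeroneseSolids.OrbitRow F 6
      ![2, q + 1, q ^ 2 + q - 2, q ^ 3 - q] ![1, 1, 0, q - 1]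
      ((Fˣ × Fˣ) ⋊[VeroneseSolids.swapAction Fˣ] VeroneseSolids.Cyc 2)
      (1 / 2 * q ^ 3 * (q ^ 2 + q + 1) * (q + 1)) ∧
    VeroneseSolids.OrbitRow F 7
      ![0, q + 1, q ^ 2 + q, q ^ 3 - q] ![1, 0, 1, q - 1]
      (DihedralGroup (q + 1) × VeroneseSolids.Cyc (q - 1))
      (1 / 2 * q ^ 3 * (q ^ 3 - 1)) ∧
    VeroneseSolids.OrbitRow F 8
      ![3, 1, q ^ 2 + 2 * q - 3, q ^ 3 - q] ![0, 2, 0, q - 1]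
      (VeroneseSolids.Cyc (q - 1) × VeroneseSolids.Cyc 2)
      (1 / 2 * q ^ 3 * (q ^ 3 - 1) * (q + 1)) ∧
    VeroneseSolids.OrbitRow F 9
      ![4, 1, q ^ 2 + 3 * q - 4, q ^ 3 - 2 * q] ![0, 3, 0, q - 2]
      (Equiv.Perm (Fin 4))
      (1 / 24 * q ^ 3 * (q ^ 3 - 1) * (q ^ 2 - 1)) ∧
    VeroneseSolids.OrbitRow F 10
      ![1, 1, q ^ 2 + 2 * q - 1, q ^ 3 - q] ![0, 1, 1, q - 1]
      (VeroneseSolids.Cyc (q - 1) × VeroneseSolids.Cyc 2)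
      (1 / 2 * q ^ 3 * (q ^ 3 - 1) * (q + 1)) ∧
    VeroneseSolids.OrbitRow F 11
      ![2, 1, q ^ 2 + q - 2, q ^ 3] ![0, 1, 0, q]
      (VeroneseSolids.E F ⋊[VeroneseSolids.scalarAction F F] Fˣ)
      (q ^ 2 * (q ^ 3 - 1) * (q + 1)) ∧
    VeroneseSolids.OrbitRow F 12
      ![2, 1, q ^ 2 + q - 2, q ^ 3] ![0, 1, 0, q]
      (VeroneseSolids.Cyc 2 × VeroneseSolids.Cyc 2)
      (1 / 4 * q ^ 3 * (q ^ 3 - 1) * (q ^ 2 - 1)) ∧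
    VeroneseSolids.OrbitRow F 13
      ![0, 1, q ^ 2 + 3 * q, q ^ 3 - 2 * q] ![0, 1, 2, q - 2]
      ((VeroneseSolids.Cyc 2 × VeroneseSolids.Cyc 2)
        ⋊[VeroneseSolids.swapAction (VeroneseSolids.Cyc 2)] VeroneseSolids.Cyc 2)
      (1 / 8 * q ^ 3 * (q ^ 3 - 1) * (q ^ 2 - 1)) ∧
    VeroneseSolids.OrbitRow F 14
      ![0, 1, q ^ 2 + q, q ^ 3] ![0, 0, 1, q]
      (VeroneseSolids.Cyc 4)
      (1 / 4 * q ^ 3 * (q ^ 3 - 1) * (q ^ 2 - 1)) ∧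
    VeroneseSolids.OrbitRow F 15
      ![1, 1, q ^ 2 - 1, q ^ 3 + q] ![0, 0, 0, q + 1]
      (VeroneseSolids.Cyc 3)
      (1 / 3 * q ^ 3 * (q ^ 3 - 1) * (q ^ 2 - 1)) := by
  refine ⟨fun i hi => VeroneseSolids.representative_spec hi, ?_,
    ⟨VeroneseSolids.Unitri.center_mulEquiv F, VeroneseSolids.Unitri.quotient_center_mulEquiv F⟩,
    VeroneseSolids.orbitRow_one F q hq, VeroneseSolids.orbitRow_two F q hq,
    VeroneseSolids.orbitRow_three F q hq, VeroneseSolids.orbitRow_four F q hq,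
    VeroneseSolids.orbitRow_five F q hq, VeroneseSolids.orbitRow_six F q hq,
    VeroneseSolids.orbitRow_seven F q hq, VeroneseSolids.orbitRow_eight F q hq,
    VeroneseSolids.orbitRow_nine F q hq, VeroneseSolids.orbitRow_ten F q hq,
    VeroneseSolids.orbitRow_eleven F q hq, VeroneseSolids.orbitRow_twelve F q hq,
    VeroneseSolids.orbitRow_thirteen F q hq, VeroneseSolids.orbitRow_fourteen F q hq,
    VeroneseSolids.orbitRow_fifteen F q hq⟩
  intro i hi j hj hij
  rcases lt_or_gt_of_ne hij with h | h
  · exact VeroneseSolids.Omega_ne_of_lt F hi hj h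
  · exact (VeroneseSolids.Omega_ne_of_lt F hj hi h).symm
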